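/- **Setting.** Let $\mathbb T=\mathbb R/L\mathbb Z$ with $L>0$, let $\|f\|_{H^r(\mathbb T)}^2=\sum_{k\in\mathbb Z}(1+(2\pi k/L)^2)^r|\hat f(k)|^2$ and $\|f\|_{W^{1,\infty}(\mathbb T)}=\max\{\|f\|_{L^\infty},\|f'\|_{L^\infty}\}$. Let $s\ge 3$ be real and let $\psi_{\mathrm{in}}\in H^s(\mathbb T)$ (complex-valued), $v_0\in H^s(\mathbb T)$ and $v_j\in H^s(\mathbb T)\cap W^{1,\infty}(\mathbb T)$, $j\ge1$ (real-valued), $\lambda_1\ge\lambda_2\ge\dots>0$, and $G\in (H^1(\mathbb T))'$. Let $\boldsymbol\mu_\infty=\bigotimes_{j\ge1}\mathcal N(0,1)$ on $U=\mathbb R^{\mathbb N}$, let $\mathbb E$ be the expectation over $\boldsymbol\mu_\infty$, and put $$V(\boldsymbol\xi,x)=v_0(x)+\sum_{j=1}^\infty\lambda_j\xi_jv_j(x),\qquad V_m(\boldsymbol\xi,x)=v_0(x)+\sum_{j=1}^m\lambda_j\xi_jv_j(x).$$ With $a_j=\lambda_j\|v_j\|_{H^s}$ and $b_j=\lambda_j\|v_j\|_{W^{1,\infty}}$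 assume $\sum_ja_j<\infty$ and $\sum_jb_j^p<\infty$ for some $p\in(0,1]$. Assume that for some constants $K,\varepsilon,\chi>0$ and all $m\ge1$, $\|V_m-V\|_{L^{2+\varepsilon}_{\boldsymbol\mu_\infty}(U,H^1(\mathbb T))}\le Km^{-\chi}$. For $\boldsymbol\mu_\infty$-a.e. $\boldsymbol\xi$ let $\psi(\cdot,\boldsymbol\xi)\in C([0,\infty),H^1(\mathbb T))$ be the solution of $\mathrm i\partial_t\psi=-\frac12\partial_x^2\psi+V\psi$, $\psi(0)=\psi_{\mathrm{in}}$, in the sense of Duhamel's formula $\psi(t)=e^{\mathrm it\partial_x^2/2}\psi_{\mathrm{in}}-\mathrm i\int_0^te^{\mathrm i(t-\rho)\partial_x^2/2}V\psi(\rho)\,d\rho$. For $\tau>0$ let $\psi_m^0=\psi_{\mathrm{in}}$ and $\psi_m^{n+1}=e^{\mathrm i\tau\partial_x^2/2}e^{-\mathrm i\tau V_m}\psi_m^n$ (Lie–Trotter splitting), and $t_n=n\tau$. **Lattice rule.** Let $\Phi$ be the standard normal distribution function. For a generating vector $\boldsymbol z\in\mathbb N^m$, a shift $\boldsymbol\Delta\in[0,1]^m$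 and $F$ on $\mathbb R^m$ let $$Q_{m,N}(F;\boldsymbol\Delta)=\frac1N\sum_{k=1}^NF\Big(\Phi^{-1}\big(\mathrm{frac}(k\boldsymbol z/N+\boldsymbol\Delta)\big)\Big)$$ with $\mathrm{frac}$ and $\Phi^{-1}$ applied componentwise; $\mathbb E^{\boldsymbol\Delta}$ is the expectation for $\boldsymbol\Delta$ uniform on $[0,1]^m$. **Parameters and CBC algorithm.** Fix $T>0$ and $\delta\in(0,\frac12]$, and let $C_T=\max\{1,T\}$. Put $\lambda^*=\frac1{2-2\delta}$, $\kappa=1-\delta$ if $p\le\frac23$, and $\lambda^*=\frac p{2-p}$, $\kappa=\frac1p-\frac12$ if $\frac23<p\le1$. Let $$\varrho(\theta,\lambda)=2\Big(\frac{\sqrt{2\pi}\,e^{\theta^2/\eta}}{\pi^{2-2\eta}(1-\eta)\eta}\Big)^{\lambda}\zeta(\lambda+\tfrac12),\ \ \eta=\frac{2\lambda-1}{4\lambda},\qquad \theta_j=\tfrac12\Big(b_j+\sqrt{b_j^2+1-\tfrac1{2\lambda^*}}\Big),$$ and for finite $u\subset\{1,2,\dots\}$ $$\gamma_u=\Big(((|u|+1)!)^2(4C_T)^{2|u|}\prod_{j\in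 u}\frac{b_j^2}{(\theta_j-b_j)\,\varrho(\theta_j,\lambda^*)}\Big)^{1/(1+\lambda^*)}.$$ The shift-averaged worst-case error of the lattice rule in the weighted unanchored Sobolev space over $\mathbb R^d$ with Gaussian density, weight functions $w_j(t)=e^{-\theta_j|t|}$ and weights $\gamma_u$ is $e^{\mathrm{sh}}_{d,N}(\boldsymbol z)$, where $$e^{\mathrm{sh}}_{d,N}(\boldsymbol z)^2=\frac1N\sum_{k=0}^{N-1}\sum_{\emptyset\ne u\subseteq\{1,\dots,d\}}\gamma_u\prod_{j\in u}\omega_j\big(\mathrm{frac}(kz_j/N)\big),\quad \omega_j(f)=\int_{\mathbb R}\frac{(\Phi(t)-f)_++(\Phi(t)-1+f)_+-\Phi(t)^2}{w_j(t)^2}\,dt.$$ The component-by-component (CBC) algorithm sets $z_1=1$ and, for $d=2,\dots,m$ in turn, chooses $z_d$ as a minimizer of $e^{\mathrm{sh}}_{d,N}(z_1,\dots,z_{d-1},z_d)$ over $\{1\le z\le N:\gcd(z,N)=1\}$. If $p=1$ (so that $\lambda^*=1$), assume in addition that for some $\theta_{\max}$ with $\theta_j<\theta_{\max}$ for all $j$,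 $$\sum_{j=1}^\infty b_j<\frac{\big(\inf_j(\theta_j-b_j)\big)^{1/2}}{4C_T\,\varrho(\theta_{\max},1)^{1/2}}.$$ **Theorem.** Under these assumptions $G(|\psi(t)|^2)$ is $\boldsymbol\mu_\infty$-integrable for every $t\in[0,T]$, and there is a constant $C>0$, independent of $m$, $\tau$, $n$ and $N$, such that for all integers $m\ge1$ and $1\le N\le10^{30}$ there is a generating vector $\boldsymbol z$ constructed by the CBC algorithm with the above weights for which $$\sqrt{\mathbb E^{\boldsymbol\Delta}\Big[\big|\mathbb E[G(|\psi(t_n)|^2)]-Q_{m,N}(G(|\psi_m^n|^2);\boldsymbol\Delta)\big|^2\Big]}\le C\big(m^{-\chi}+\tau+N^{-\kappa}\big)$$ for all $\tau>0$ and all integers $n\ge0$ with $t_n=n\tau\le T$; in particular the random variable inside the expectation is square integrable in $\boldsymbol\Delta$. -/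

import Mathlib

open MeasureTheory ProbabilityTheory Filter Topology Finset
open scoped ENNReal NNReal BigOperators

namespace QMCTS

noncomputable section

/-! ### Sobolev spaces on the torus `AddCircle L = ℝ / L ℤ`

Functions on the torus are honest functions `AddCircle L → ℂ`; everything below depends on
them only up to equality almost everywhere. -/

/-- The Fourier weight `(1 + (2πn/L)²)^s` of the Sobolev space `H^s`. -/
def sobolevWeight (L s : ℝ) (n : ℤ) : ℝ := (1 + (2 * Real.pi * n / L) ^ 2) ^ s

/-- `f ∈ H^s` (for `s ≥ 0`): `f` is square integrable and `∑ₙ (1 + (2πn/L)²)^s |f̂(n)|² < ∞`. -/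
def MemSobolev {L : ℝ} [Fact (0 < L)] (s : ℝ) (f : AddCircle L → ℂ) : Prop :=
  MemLp f 2 (AddCircle.haarAddCircle (T := L)) ∧
    Summable fun n : ℤ => sobolevWeight L s n * ‖fourierCoeff f n‖ ^ 2

/-- The norm `‖f‖_{H^s} = (∑ₙ (1 + (2πn/L)²)^s |f̂(n)|²)^{1/2}`. -/
def sobolevNorm {L : ℝ} [Fact (0 < L)] (s : ℝ) (f : AddCircle L → ℂ) : ℝ :=
  Real.sqrt (∑' n : ℤ, sobolevWeight L s n * ‖fourierCoeff f n‖ ^ 2)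

theorem sobolevWeight_nonneg (L s : ℝ) (n : ℤ) : 0 ≤ sobolevWeight L s n :=
  Real.rpow_nonneg (by positivity) s

theorem MemSobolev.integrable {L : ℝ} [Fact (0 < L)] {s : ℝ} {f : AddCircle L → ℂ}
    (hf : MemSobolev s f) : Integrable f (AddCircle.haarAddCircle (T := L)) :=
  hf.1.integrable (by norm_num)

/-- `H^s` as a space of functions. -/
def sobolevSubmodule (L : ℝ) [Fact (0 < L)] (s : ℝ) : Submodule ℂ (AddCircle L → ℂ) where
  carrier := {f | MemSobolev s f}
  zero_mem' := by
    refine ⟨MemLp.zero, ?_⟩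
    have h : ∀ n : ℤ, fourierCoeff (0 : AddCircle L → ℂ) n = 0 := fun n => by
      simp [fourierCoeff]
    simp only [h]
    simp
  add_mem' := by
    intro f g hf hg
    refine ⟨hf.1.add hg.1, ?_⟩
    refine Summable.of_nonneg_of_le
      (fun n => mul_nonneg (sobolevWeight_nonneg L s n) (by positivity)) (fun n => ?_)
      ((hf.2.mul_left 2).add (hg.2.mul_left 2))
    have h : fourierCoeff (f + g) n = fourierCoeff f n + fourierCoeff g n :=
      congrFun (fourierCoeff.add hf.integrable hg.integrable) n
    rw [h]
    have h1 := norm_add_le (fourierCoeff f n) (fourierCoeff g n)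
    have h2 : ‖fourierCoeff f n + fourierCoeff g n‖ ^ 2
        ≤ 2 * ‖fourierCoeff f n‖ ^ 2 + 2 * ‖fourierCoeff g n‖ ^ 2 := by
      nlinarith [norm_nonneg (fourierCoeff f n + fourierCoeff g n),
        sq_nonneg (‖fourierCoeff f n‖ - ‖fourierCoeff g n‖)]
    nlinarith [mul_le_mul_of_nonneg_left h2 (sobolevWeight_nonneg L s n)]
  smul_mem' := by
    intro c f hf
    refine ⟨hf.1.const_smul c, ?_⟩
    have h : ∀ n : ℤ, sobolevWeight L s n * ‖fourierCoeff (c • f) n‖ ^ 2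
        = ‖c‖ ^ 2 * (sobolevWeight L s n * ‖fourierCoeff f n‖ ^ 2) := fun n => by
      rw [fourierCoeff.const_smul, norm_smul]; ring
    simp only [h]
    exact hf.2.mul_left _

/-- The Sobolev space `H^s` of the torus, with its own norm. -/
def SobolevSpace (L : ℝ) [Fact (0 < L)] (s : ℝ) : Type := ↥(sobolevSubmodule L s)

instance (L : ℝ) [Fact (0 < L)] (s : ℝ) : AddCommGroup (SobolevSpace L s) :=
  inferInstanceAs (AddCommGroup ↥(sobolevSubmodule L s))

instance (L : ℝ) [Fact (0 < L)] (s : ℝ) : Module ℂ (SobolevSpace L s) :=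
  inferInstanceAs (Module ℂ ↥(sobolevSubmodule L s))

/-- The function underlying an element of `H^s`. -/
def SobolevSpace.toFun {L : ℝ} [Fact (0 < L)] {s : ℝ} (f : SobolevSpace L s) :
    AddCircle L → ℂ := f.1

/-- The weighted Fourier coefficients of an element of `H^s`, as an element of `ℓ²(ℤ)`. -/
def SobolevSpace.coeffs (L : ℝ) [Fact (0 < L)] (s : ℝ) :
    SobolevSpace L s →ₗ[ℂ] lp (fun _ : ℤ => ℂ) 2 where
  toFun f := ⟨fun n => ((Real.sqrt (sobolevWeight L s n) : ℝ) : ℂ) * fourierCoeff f.1 n, by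
    refine memℓp_gen ?_
    have h : ∀ n : ℤ, ‖((Real.sqrt (sobolevWeight L s n) : ℝ) : ℂ) * fourierCoeff f.1 n‖
        ^ (2 : ℝ≥0∞).toReal = sobolevWeight L s n * ‖fourierCoeff f.1 n‖ ^ 2 := fun n => by
      rw [norm_mul, Complex.norm_real, Real.norm_eq_abs, abs_of_nonneg (Real.sqrt_nonneg _)]
      simp only [ENNReal.toReal_ofNat, Real.rpow_two]
      rw [mul_pow, Real.sq_sqrt (sobolevWeight_nonneg L s n)]
    simp only [h]
    exact f.2.2⟩
  map_add' f g := by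
    ext n
    have h : fourierCoeff (f.1 + g.1) n = fourierCoeff f.1 n + fourierCoeff g.1 n :=
      congrFun (fourierCoeff.add (MemSobolev.integrable f.2) (MemSobolev.integrable g.2)) n
    change _ * fourierCoeff (f.1 + g.1) n = _ * fourierCoeff f.1 n + _ * fourierCoeff g.1 n
    rw [h, mul_add]
  map_smul' c f := by
    ext n
    change _ * fourierCoeff (c • f.1) n = c * (_ * fourierCoeff f.1 n)
    rw [fourierCoeff.const_smul, smul_eq_mul]
    ring

instance (L : ℝ) [Fact (0 < L)] (s : ℝ) : SeminormedAddCommGroup (SobolevSpace L s) :=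
  SeminormedAddCommGroup.induced _ _ (SobolevSpace.coeffs L s)

instance (L : ℝ) [Fact (0 < L)] (s : ℝ) : NormedSpace ℂ (SobolevSpace L s) :=
  NormedSpace.induced ℂ _ _ (SobolevSpace.coeffs L s)

/-- The norm of `SobolevSpace L s` is the `H^s` norm; it vanishes exactly on the functions that
are zero almost everywhere, so continuous linear functionals on this space are the same as
continuous linear functionals on the usual space of equivalence classes. -/
theorem SobolevSpace.norm_eq {L : ℝ} [Fact (0 < L)] {s : ℝ} (f : SobolevSpace L s) :
    ‖f‖ = sobolevNorm s f.toFun := by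
  change ‖SobolevSpace.coeffs L s f‖ = _
  rw [lp.norm_eq_tsum_rpow (by norm_num), sobolevNorm, Real.sqrt_eq_rpow]
  simp only [ENNReal.toReal_ofNat, Real.rpow_two]
  congr 1
  refine tsum_congr fun n => ?_
  change ‖((Real.sqrt (sobolevWeight L s n) : ℝ) : ℂ) * fourierCoeff f.1 n‖ ^ 2 = _
  rw [norm_mul, Complex.norm_real, Real.norm_eq_abs, abs_of_nonneg (Real.sqrt_nonneg _),
    mul_pow, Real.sq_sqrt (sobolevWeight_nonneg L s n)]
  rfl

open Classical in
/-- `G(f)` for a functional `G ∈ (H^1)'` and a function `f` on the torus that lies in `H^1`. -/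
def dualApply {L : ℝ} [Fact (0 < L)] (G : StrongDual ℂ (SobolevSpace L 1))
    (f : AddCircle L → ℂ) : ℂ :=
  if h : MemSobolev 1 f then G (⟨f, h⟩ : ↥(sobolevSubmodule L 1)) else 0

/-- The physical observable `G(|f|²)`. -/
def observable {L : ℝ} [Fact (0 < L)] (G : StrongDual ℂ (SobolevSpace L 1))
    (f : AddCircle L → ℂ) : ℂ :=
  dualApply G fun x => ((‖f x‖ ^ 2 : ℝ) : ℂ)

/-! ### The space `W^{1,∞}` -/

/-- `g` is the weak derivative of `f`: `∫ f φ' = - ∫ g φ` for all smooth periodic `φ`. -/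
def IsWeakDeriv {L : ℝ} [Fact (0 < L)] (f g : AddCircle L → ℂ) : Prop :=
  Integrable f (AddCircle.haarAddCircle (T := L)) ∧
  Integrable g (AddCircle.haarAddCircle (T := L)) ∧
  ∀ φ : ℝ → ℂ, ContDiff ℝ (⊤ : ℕ∞) φ → Function.Periodic φ L →
    ∫ x in (0 : ℝ)..L, f (x : AddCircle L) * deriv φ x
      = - ∫ x in (0 : ℝ)..L, g (x : AddCircle L) * φ x

open Classical in
/-- The weak derivative (unique up to equality almost everywhere when it exists). -/
def weakDeriv {L : ℝ} [Fact (0 < L)] (f : AddCircle L → ℂ) : AddCircle L → ℂ :=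
  if h : ∃ g, IsWeakDeriv f g then h.choose else 0

/-- `f ∈ W^{1,∞}`: `f` and its weak derivative are essentially bounded. -/
def MemW1Inf {L : ℝ} [Fact (0 < L)] (f : AddCircle L → ℂ) : Prop :=
  (∃ g, IsWeakDeriv f g) ∧ MemLp f ∞ (AddCircle.haarAddCircle (T := L)) ∧
    MemLp (weakDeriv f) ∞ (AddCircle.haarAddCircle (T := L))

/-- `‖f‖_{W^{1,∞}} = max (‖f‖_{L^∞}) (‖f'‖_{L^∞})`. -/
def w1InfNorm {L : ℝ} [Fact (0 < L)] (f : AddCircle L → ℂ) : ℝ :=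
  max (eLpNorm f ∞ (AddCircle.haarAddCircle (T := L))).toReal
    (eLpNorm (weakDeriv f) ∞ (AddCircle.haarAddCircle (T := L))).toReal

/-! ### The random potential

The sequences `λ₁, λ₂, …`, `v₁, v₂, …`, `ξ₁, ξ₂, …` are indexed by `ℕ` starting at `0`. -/

/-- A real-valued function, regarded as complex-valued. -/
def cplx {X : Type*} (f : X → ℝ) : X → ℂ := fun x => (f x : ℂ)

/-- The product Gaussian measure `⨂ⱼ N(0,1)` on `ℝ^ℕ`. -/
def gaussProd : Measure (ℕ → ℝ) := Measure.infinitePi fun _ : ℕ => gaussianReal 0 1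

/-- `V(ξ, x) = v₀(x) + ∑_{j} λⱼ ξⱼ vⱼ(x)`. -/
def potential {L : ℝ} (v₀ : AddCircle L → ℝ) (lam : ℕ → ℝ) (v : ℕ → AddCircle L → ℝ)
    (ξ : ℕ → ℝ) (x : AddCircle L) : ℝ :=
  v₀ x + ∑' j, lam j * ξ j * v j x

/-- `V_m(ξ, x) = v₀(x) + ∑_{j ≤ m} λⱼ ξⱼ vⱼ(x)`, a function of `ξ ∈ ℝ^m`. -/
def truncPotential {L : ℝ} (v₀ : AddCircle L → ℝ) (lam : ℕ → ℝ) (v : ℕ → AddCircle L → ℝ)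
    (m : ℕ) (ξ : Fin m → ℝ) (x : AddCircle L) : ℝ :=
  v₀ x + ∑ j : Fin m, lam j * ξ j * v j x

/-- `aⱼ = λⱼ ‖vⱼ‖_{H^s}`. -/
def aSeq {L : ℝ} [Fact (0 < L)] (s : ℝ) (lam : ℕ → ℝ) (v : ℕ → AddCircle L → ℝ) (j : ℕ) : ℝ :=
  lam j * sobolevNorm s (cplx (v j))

/-- `bⱼ = λⱼ ‖vⱼ‖_{W^{1,∞}}`. -/
def bSeq {L : ℝ} [Fact (0 < L)] (lam : ℕ → ℝ) (v : ℕ → AddCircle L → ℝ) (j : ℕ) : ℝ :=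
  lam j * w1InfNorm (cplx (v j))

/-- `V_m - V`, as a function of `ξ ∈ ℝ^ℕ` with values in the functions on the torus. -/
def truncDiff {L : ℝ} (v₀ : AddCircle L → ℝ) (lam : ℕ → ℝ) (v : ℕ → AddCircle L → ℝ)
    (m : ℕ) (ξ : ℕ → ℝ) : AddCircle L → ℂ :=
  cplx fun x => truncPotential v₀ lam v m (fun j => ξ j) x - potential v₀ lam v ξ x

/-- `‖V_m - V‖_{L^q(ℝ^ℕ, H^1)} ≤ K m^{-χ}` for all `m ≥ 1` and some constant `K`. -/
def TruncationRate {L : ℝ} [Fact (0 < L)] (v₀ : AddCircle L → ℝ) (lam : ℕ → ℝ)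
    (v : ℕ → AddCircle L → ℝ) (q χ : ℝ) : Prop :=
  ∃ K : ℝ, ∀ m : ℕ, 1 ≤ m →
    (∀ᵐ ξ ∂gaussProd, MemSobolev 1 (truncDiff v₀ lam v m ξ)) ∧
    eLpNorm (fun ξ => sobolevNorm 1 (truncDiff v₀ lam v m ξ)) (ENNReal.ofReal q) gaussProd
      ≤ ENNReal.ofReal (K * (m : ℝ) ^ (-χ))

/-! ### The Schrödinger equation and the Lie–Trotter splitting -/

/-- The free flow `exp(i t ∂ₓ² / 2)`: the Fourier multiplier `exp(-i t (2πn/L)² / 2)`, given by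
its Fourier series (absolutely convergent for `f ∈ H^1`). -/
def freeFlow {L : ℝ} [Fact (0 < L)] (t : ℝ) (f : AddCircle L → ℂ) (x : AddCircle L) : ℂ :=
  ∑' n : ℤ, Complex.exp (-Complex.I * ((t * (2 * Real.pi * n / L) ^ 2 / 2 : ℝ) : ℂ))
    * fourierCoeff f n * fourier n x

/-- `u ∈ C([0,∞), H^1)` is the mild solution of `i ∂ₜ u = -½ ∂ₓ² u + W u`, `u(0) = ψ₀`, i.e. it
satisfies Duhamel's formula
`u(t) = exp(i t ∂ₓ²/2) ψ₀ - i ∫₀ᵗ exp(i (t-ρ) ∂ₓ²/2) (W u(ρ)) dρ` for all `t ≥ 0`. -/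
def IsMildSolution {L : ℝ} [Fact (0 < L)] (W : AddCircle L → ℝ) (ψ₀ : AddCircle L → ℂ)
    (u : ℝ → SobolevSpace L 1) : Prop :=
  ContinuousOn u (Set.Ici 0) ∧
  ∀ t : ℝ, 0 ≤ t → ∀ᵐ x ∂(AddCircle.haarAddCircle (T := L)),
    (u t).toFun x = freeFlow t ψ₀ x
      - Complex.I * ∫ ρ in (0 : ℝ)..t, freeFlow (t - ρ) (fun y => (W y : ℂ) * (u ρ).toFun y) x

/-- One Lie–Trotter step `f ↦ exp(i τ ∂ₓ²/2) (exp(-i τ W) f)`. -/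
def lieStep {L : ℝ} [Fact (0 < L)] (τ : ℝ) (W : AddCircle L → ℝ) (f : AddCircle L → ℂ) :
    AddCircle L → ℂ :=
  freeFlow τ fun x => Complex.exp (-Complex.I * ((τ * W x : ℝ) : ℂ)) * f x

/-- The semi-discrete solution `ψ_m^n(ξ)`, `ξ ∈ ℝ^m`, obtained by `n` Lie–Trotter steps of
size `τ` from `ψ_in`. -/
def semiDiscrete {L : ℝ} [Fact (0 < L)] (v₀ : AddCircle L → ℝ) (lam : ℕ → ℝ)
    (v : ℕ → AddCircle L → ℝ) (ψin : AddCircle L → ℂ) (m : ℕ) (τ : ℝ) (n : ℕ)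
    (ξ : Fin m → ℝ) : AddCircle L → ℂ :=
  (lieStep τ (truncPotential v₀ lam v m ξ))^[n] ψin

/-! ### Randomly shifted lattice rules -/

/-- The standard normal distribution function `Φ`. -/
def stdNormalCDF (t : ℝ) : ℝ := cdf (gaussianReal 0 1) t

/-- The inverse `Φ⁻¹` on `(0,1)`. -/
def stdNormalQuantile (y : ℝ) : ℝ := sInf {t : ℝ | y ≤ stdNormalCDF t}

/-- The randomly shifted rank-1 lattice rule
`Q_{m,N}(F; Δ) = N⁻¹ ∑_{k=1}^N F(Φ⁻¹(frac(k z / N + Δ)))` with generating vector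
`(z 0, …, z (m-1))`. -/
def latticeRule (m N : ℕ) (z : ℕ → ℕ) (F : (Fin m → ℝ) → ℂ) (Δ : Fin m → ℝ) : ℂ :=
  (N : ℂ)⁻¹ * ∑ k ∈ Finset.Icc 1 N,
    F fun j => stdNormalQuantile (Int.fract ((k : ℝ) * (z j : ℝ) / N + Δ j))

/-- The weight function `w(t) = exp(-θ |t|)` of the weighted Sobolev space of integrands. -/
def weightFun (θ t : ℝ) : ℝ := Real.exp (-θ * |t|)

/-- The shift-averaged one-dimensional kernel (with weight parameter `1` and the constant `1`
removed) of the weighted unanchored Sobolev space with Gaussian density and weight function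
`w = weightFun θ`. The kernel of that space is
`1 + ∫ (1_{t<x} - (1-Φ(t))) (1_{t<y} - (1-Φ(t))) / w(t)² dt`; putting `x = Φ⁻¹(U)`,
`y = Φ⁻¹(frac(U + f))` and averaging over `U` uniform in `[0,1]` gives
`1 + ∫ ((Φ(t) - f)₊ + (Φ(t) - 1 + f)₊ - Φ(t)²) / w(t)² dt`. -/
def shiftKernel (θ f : ℝ) : ℝ :=
  ∫ t : ℝ, (max (stdNormalCDF t - f) 0 + max (stdNormalCDF t - 1 + f) 0
    - stdNormalCDF t ^ 2) / weightFun θ t ^ 2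

/-- The shift-averaged worst-case error `e^sh_{d,N}(z)` of the lattice rule with generating vector
`(z 0, …, z (d-1))` over the unit ball of the `d`-variate weighted unanchored Sobolev space, whose
squared norm is
`∑_u γ_u⁻¹ ∫ (∫ ∂^u F ∏_{j ∉ u} φ(ξⱼ) dξ_{-u})² ∏_{j ∈ u} w_j(ξⱼ)² dξ_u`, `w_j = weightFun (θ j)`,
by its explicit expression
`e^sh_{d,N}(z)² = N⁻¹ ∑_{k=0}^{N-1} ∑_{∅ ≠ u ⊆ {1,…,d}} γ_u ∏_{j ∈ u} shiftKernel θ_j (frac(k z_j/N))`. -/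
def shiftAvgError (γ : Finset ℕ → ℝ) (θ : ℕ → ℝ) (N d : ℕ) (z : ℕ → ℕ) : ℝ :=
  Real.sqrt ((N : ℝ)⁻¹ * ∑ k ∈ Finset.range N,
    ∑ u ∈ (Finset.range d).powerset.erase ∅,
      γ u * ∏ j ∈ u, shiftKernel (θ j) (Int.fract ((k : ℝ) * (z j : ℝ) / N)))

/-- `(z 0, …, z (m-1))` is an output of the component-by-component algorithm: the first component
is `1`, and each further component minimizes the shift-averaged worst-case error, the preceding
ones being kept, over the residues coprime to `N`. (For `N ≥ 2` the condition
`1 ≤ y ≤ N`, `gcd(y, N) = 1` is the same as `1 ≤ y ≤ N - 1`, `gcd(y, N) = 1`.) -/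
def IsCBC (γ : Finset ℕ → ℝ) (θ : ℕ → ℝ) (N m : ℕ) (z : ℕ → ℕ) : Prop :=
  z 0 = 1 ∧ ∀ d, 1 ≤ d → d < m →
    (1 ≤ z d ∧ z d ≤ N ∧ Nat.Coprime (z d) N) ∧
    ∀ y : ℕ, 1 ≤ y → y ≤ N → Nat.Coprime y N →
      shiftAvgError γ θ N (d + 1) z ≤ shiftAvgError γ θ N (d + 1) (Function.update z d y)

/-! ### Parameters of the lattice rule -/

/-- The parameter `λ* = 1/(2-2δ)` if `p ≤ 2/3`, and `λ* = p/(2-p)` if `p > 2/3`. -/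
def lamStar (p δ : ℝ) : ℝ := if p ≤ 2 / 3 then 1 / (2 - 2 * δ) else p / (2 - p)

/-- The rate `κ = 1 - δ` if `p ≤ 2/3`, and `κ = 1/p - 1/2` if `p > 2/3`. -/
def kappa (p δ : ℝ) : ℝ := if p ≤ 2 / 3 then 1 - δ else 1 / p - 1 / 2

/-- `ϱ(λ)` for the weight function with parameter `θ`:
`2 (√(2π) exp(θ²/η) / (π^{2-2η} (1-η) η))^λ ζ(λ+1/2)`, `η = (2λ-1)/(4λ)`. -/
def rhoConst (θ l : ℝ) : ℝ :=
  let η : ℝ := (2 * l - 1) / (4 * l)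
  2 * (Real.sqrt (2 * Real.pi) * Real.exp (θ ^ 2 / η)
      / (Real.pi ^ (2 - 2 * η) * (1 - η) * η)) ^ l
    * (riemannZeta ((l + 1 / 2 : ℝ) : ℂ)).re

/-- `θⱼ = ½ (bⱼ + √(bⱼ² + 1 - 1/(2λ*)))`. -/
def thetaSeq (b : ℕ → ℝ) (l : ℝ) (j : ℕ) : ℝ :=
  (b j + Real.sqrt (b j ^ 2 + 1 - 1 / (2 * l))) / 2

/-- The product and order dependent weights
`γ_u = ( ((|u|+1)!)² (4 max{1,T})^{2|u|} ∏_{j∈u} bⱼ² / ((θⱼ - bⱼ) ϱⱼ(λ*)) )^{1/(1+λ*)}`. -/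
def podWeight (b : ℕ → ℝ) (l T : ℝ) (u : Finset ℕ) : ℝ :=
  ((((u.card + 1).factorial : ℝ)) ^ 2 * (4 * max 1 T) ^ (2 * u.card)
    * ∏ j ∈ u, b j ^ 2 / ((thetaSeq b l j - b j) * rhoConst (thetaSeq b l j) l))
      ^ (1 / (1 + l))

/-- The smallness condition imposed when `p = 1` (so that `λ* = 1`):
`∑ⱼ bⱼ < D^{1/2} / (4 max{1,T} ϱ_max(1)^{1/2})`, where `D = infⱼ (θⱼ - bⱼ)` and `ϱ_max(1)` is
formed with an upper bound `θ_max` of the `θⱼ`. -/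
def SmallnessCondition (b : ℕ → ℝ) (T : ℝ) : Prop :=
  ∃ θmax : ℝ, (∀ j, thetaSeq b 1 j < θmax) ∧
    ∑' j, b j < Real.sqrt (⨅ j, (thetaSeq b 1 j - b j))
      / (4 * max 1 T * Real.sqrt (rhoConst θmax 1))

end

end QMCTS

/-!
The error is the sum of the error of the expectation, caused by truncating the potential and by the
time discretization, and of the error of the quadrature, and the two are bounded separately.

**Encoding.** A function in `H^{r+1}(𝕋)` is encoded by the square-summable sequence `SeqL2` of its
Fourier coefficients multiplied with `⟨2πn/L⟩^{r+1}`; `ev` recovers the function. Since `H^{r+1}` is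
an algebra (`mulS`, by Young's inequality), multiplication by a potential is a bounded operator, its
exponential `kickS` is a power series, and the free flow `flowS` is diagonal and unitary. So the
equation, the splitting and the observable become statements about bounded operators on one Hilbert
space. Regularity `H³` of the data is all that is used of `s ≥ 3`.

**Error of the expectation.** In the interaction picture a mild solution solves an ordinary
differential equation with bounded right-hand side (`IsMildSolution.interaction`), and the splitting
is an approximate solution of it. The residual consists of the truncation error of the potential and
of the commutator of the potential with the free flow, which is `O(τ)` from `H³` to `H¹`
(`norm_commutator_le`). Grönwall's inequality gives a pathwise error bound (`splitting_error`) whose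
constant is exponential in `∑ λⱼ ‖vⱼ‖ |ξⱼ|`. All exponential moments of this sum are finite
(`exists_exp_dominating`), so that the Cauchy–Schwarz inequality in `ξ` leads to the bound
`m^{-χ} + τ` (`expectation_error`).

**Error of the quadrature.** The kicks are unitary in `L²`, so the mixed first derivatives in the
parameters `ξⱼ`, `j ∈ u`, of the semi-discrete observable are bounded by `∏ bⱼ` with constants that
depend on `|u|` only, up to an exponential in `∑ bⱼ |ξⱼ|` (`norm_obsFam_le`). The ANOVA representation
(`anova`) writes the quadrature error as a sum over `u` of integrals of these derivatives against
averaged kernels. After the Cauchy–Schwarz inequality with the weight functions, the average over the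
shift turns the kernels into the worst-case error `e^{sh}` (`lattice_error`).

**Component-by-component construction.** The shift-averaged kernels have nonnegative Fourier
coefficients with algebraic decay (`hasSum_shiftKernel`, `kerCoeff_le`). Each minimum is at most an
average over the units of `ℤ/N`, and by the inequality `(∑ aᵢ)^λ ≤ ∑ aᵢ^λ` for `λ ≤ 1` this average is
controlled by sums of powers of coefficients along residue classes (`sum_foldCoeff_rpow_le`). This gives
`e^{sh}² ≤ (φ(N)⁻¹ ∑ γᵤ^λ ∏ ϱ(θⱼ, λ))^{1/λ}` (`IsCBC.bound`). With the given weights the sums over `u`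
are bounded independently of the dimension (`exists_sum_podWeight_le`), `1/(2λ*) = κ`, and
`N ≤ 100 φ(N)` in the range `N ≤ 10^30` (`le_hundred_mul_totient`). Together this is the rate `N^{-κ}`
(`lattice_cbc_error`).
-/

open MeasureTheory ProbabilityTheory Filter Topology Finset
open scoped ENNReal NNReal BigOperators

namespace QMCTS

noncomputable section

section

/-! ### Square-summable sequences and Young's inequality -/

/-- `ℓ²(ℤ)`; for an exponent `r`, an element `a` encodes the function with Fourier coefficients
`a n / wt L n ^ r`, so that its norm is the `H^r` norm of that function. -/
abbrev SeqL2 : Type := ↥(lp (fun _ : ℤ => ℂ) 2)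

theorem SeqL2.summable_sq (a : SeqL2) : Summable fun n => ‖a n‖ ^ 2 := by
  have := (lp.memℓp a).summable (by norm_num)
  simpa using this

theorem SeqL2.norm_sq (a : SeqL2) : ‖a‖ ^ 2 = ∑' n, ‖a n‖ ^ 2 := by
  have := lp.norm_rpow_eq_tsum (p := 2) (by norm_num) a
  simpa using this

/-- The element of `ℓ²(ℤ)` with given entries. -/
def SeqL2.mk (f : ℤ → ℂ) (h : Summable fun n => ‖f n‖ ^ 2) : SeqL2 :=
  ⟨f, memℓp_gen (by simpa using h)⟩

@[simp] theorem SeqL2.mk_apply (f : ℤ → ℂ) (h) (n : ℤ) : SeqL2.mk f h n = f n := rfl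

theorem SeqL2.norm_mk_le (f : ℤ → ℂ) (h) (C : ℝ) (hC : 0 ≤ C) (hf : ∑' n, ‖f n‖ ^ 2 ≤ C ^ 2) :
    ‖SeqL2.mk f h‖ ≤ C := by
  refine le_of_sq_le_sq ?_ hC
  rw [SeqL2.norm_sq]; simpa using hf

theorem SeqL2.norm_le_of_le (a : SeqL2) {g : ℤ → ℝ} (hg : Summable fun n => g n ^ 2) {C : ℝ}
    (hC : 0 ≤ C) (hgC : ∑' n, g n ^ 2 ≤ C ^ 2) (h : ∀ n, ‖a n‖ ≤ g n) : ‖a‖ ≤ C := by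
  refine le_of_sq_le_sq ?_ hC
  rw [SeqL2.norm_sq]
  refine (Summable.tsum_le_tsum (fun n => ?_) a.summable_sq hg).trans hgC
  gcongr; exact h n

/-- Cauchy–Schwarz with respect to the weights `β`. -/
theorem tsum_mul_sq_le {β A : ℤ → ℝ} (hβ : ∀ k, 0 ≤ β k)
    (h1 : Summable β) (h2 : Summable fun k => β k * A k) (h3 : Summable fun k => β k * A k ^ 2) :
    (∑' k, β k * A k) ^ 2 ≤ (∑' k, β k) * ∑' k, β k * A k ^ 2 := by
  have t1 : Tendsto (fun s : Finset ℤ => ∑ k ∈ s, β k * A k) atTop _ := h2.hasSum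
  have t2 : Tendsto (fun s : Finset ℤ => ∑ k ∈ s, β k) atTop _ := h1.hasSum
  have t3 : Tendsto (fun s : Finset ℤ => ∑ k ∈ s, β k * A k ^ 2) atTop _ := h3.hasSum
  refine le_of_tendsto_of_tendsto' (t1.pow 2) (t2.mul t3) fun s => ?_
  exact Finset.sum_sq_le_sum_mul_sum_of_sq_le_mul s (fun i _ => hβ i)
    (fun i _ => mul_nonneg (hβ i) (sq_nonneg _)) (fun i _ => le_of_eq (by ring))

theorem summable_conv {β A : ℤ → ℝ} (hβ : ∀ k, 0 ≤ β k) (hA : ∀ k, 0 ≤ A k)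
    (h1 : Summable β) (h2 : Summable fun k => A k ^ 2) (n : ℤ) :
    Summable fun k => β k * A (n - k) := by
  have hb : ∀ k, A k ≤ Real.sqrt (∑' k, A k ^ 2) := fun k => by
    refine Real.le_sqrt_of_sq_le ?_
    exact h2.le_tsum k (fun j _ => sq_nonneg _)
  exact Summable.of_nonneg_of_le (fun k => mul_nonneg (hβ k) (hA _))
    (fun k => mul_le_mul_of_nonneg_left (hb _) (hβ k)) (h1.mul_right _)

/-- Young's inequality `ℓ¹ * ℓ² ⊆ ℓ²`. -/
theorem young {β A : ℤ → ℝ} (hβ : ∀ k, 0 ≤ β k) (hA : ∀ k, 0 ≤ A k)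
    (h1 : Summable β) (h2 : Summable fun k => A k ^ 2) :
    (Summable fun n => (∑' k, β k * A (n - k)) ^ 2) ∧
      ∑' n, (∑' k, β k * A (n - k)) ^ 2 ≤ (∑' k, β k) ^ 2 * ∑' k, A k ^ 2 := by
  have hp : Summable fun p : ℤ × ℤ => β p.1 * A p.2 ^ 2 :=
    h1.mul_of_nonneg h2 hβ (fun _ => sq_nonneg _)
  let e : ℤ × ℤ ≃ ℤ × ℤ :=
    { toFun := fun p => (p.2, p.1 - p.2)
      invFun := fun p => (p.1 + p.2, p.1)
      left_inv := fun p => by ext <;> simp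
      right_inv := fun p => by ext <;> simp }
  have hq : Summable fun p : ℤ × ℤ => β p.2 * A (p.1 - p.2) ^ 2 := (e.summable_iff).2 hp
  have hq1 : ∀ n, Summable fun k => β k * A (n - k) ^ 2 := fun n => hq.prod_factor n
  have hle : ∀ n, (∑' k, β k * A (n - k)) ^ 2 ≤ (∑' k, β k) * ∑' k, β k * A (n - k) ^ 2 :=
    fun n => tsum_mul_sq_le hβ h1 (summable_conv hβ hA h1 h2 n) (hq1 n)
  have hs : Summable fun n => (∑' k, β k) * ∑' k, β k * A (n - k) ^ 2 := hq.prod.mul_left _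
  have hs' := Summable.of_nonneg_of_le (fun n => sq_nonneg _) hle hs
  refine ⟨hs', (hs'.tsum_le_tsum hle hs).trans ?_⟩
  rw [tsum_mul_left, ← hq.tsum_prod, sq, mul_assoc]
  refine mul_le_mul_of_nonneg_left (le_of_eq ?_) (tsum_nonneg hβ)
  rw [h1.tsum_mul_tsum h2 hp]
  exact e.tsum_eq (fun p : ℤ × ℤ => β p.1 * A p.2 ^ 2)

theorem SeqL2.norm_le_of_conv {β A : ℤ → ℝ} (hβ : ∀ k, 0 ≤ β k) (hA : ∀ k, 0 ≤ A k)
    (h1 : Summable β) (h2 : Summable fun k => A k ^ 2) {B C : ℝ} (hB : ∑' k, β k ≤ B)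
    (hC0 : 0 ≤ C) (hC : ∑' k, A k ^ 2 ≤ C ^ 2) (a : SeqL2)
    (h : ∀ n, ‖a n‖ ≤ ∑' k, β k * A (n - k)) : ‖a‖ ≤ B * C := by
  have hB0 : 0 ≤ B := (tsum_nonneg hβ).trans hB
  refine a.norm_le_of_le (young hβ hA h1 h2).1 (by positivity) ?_ h
  refine (young hβ hA h1 h2).2.trans ?_
  rw [mul_pow]
  gcongr
  exact tsum_nonneg hβ

/-! ### The Fourier weight -/

variable {L : ℝ}

/-- The weight `⟨2πn/L⟩ = (1 + (2πn/L)²)^{1/2}`. -/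
def wt (L : ℝ) (n : ℤ) : ℝ := Real.sqrt (1 + (2 * Real.pi * n / L) ^ 2)

theorem one_le_wt (n : ℤ) : 1 ≤ wt L n := by
  rw [wt]; exact Real.one_le_sqrt.2 (by nlinarith [sq_nonneg (2 * Real.pi * n / L)])

theorem wt_pos (n : ℤ) : 0 < wt L n := lt_of_lt_of_le one_pos (one_le_wt n)

theorem wt_ne (n : ℤ) : (wt L n : ℂ) ≠ 0 := by exact_mod_cast (wt_pos n).ne'

theorem abs_le_wt (n : ℤ) : |2 * Real.pi * n / L| ≤ wt L n := by
  rw [wt]; refine Real.abs_le_sqrt (by linarith)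

theorem wt_sq (n : ℤ) : wt L n ^ 2 = 1 + (2 * Real.pi * n / L) ^ 2 := by
  rw [wt, Real.sq_sqrt (by positivity)]

theorem wt_add_le (k l : ℤ) : wt L (k + l) ≤ wt L k + wt L l := by
  have h1 := abs_le_wt (L := L) k
  have h2 := abs_le_wt (L := L) l
  refine abs_le_of_sq_le_sq' ?_ (by have := wt_pos (L := L) k; have := wt_pos (L := L) l; linarith) |>.2
  have e : 2 * Real.pi * ((k + l : ℤ) : ℝ) / L = 2 * Real.pi * k / L + 2 * Real.pi * l / L := by
    push_cast; ring
  have h3 : (2 * Real.pi * k / L) * (2 * Real.pi * l / L) ≤ wt L k * wt L l := by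
    refine (le_abs_self _).trans ?_
    rw [abs_mul]; gcongr; exact (wt_pos k).le
  rw [wt_sq, e, add_sq (wt L k), wt_sq, wt_sq]
  nlinarith

theorem wt_neg (n : ℤ) : wt L (-n) = wt L n := by
  rw [wt, wt]; congr 2; push_cast; ring

theorem sobolevWeight_nat (r : ℕ) (n : ℤ) : sobolevWeight L r n = (wt L n ^ r) ^ 2 := by
  rw [sobolevWeight, Real.rpow_natCast, ← pow_mul, Nat.mul_comm, pow_mul, wt_sq]

variable [hL : Fact (0 < L)]

theorem summable_wt : Summable fun n : ℤ => (wt L n ^ 2)⁻¹ := by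
  have hL0 : 0 < L := hL.out
  have h : Summable fun n : ℤ => (L ^ 2 / (2 * Real.pi) ^ 2) * (1 / (n : ℝ) ^ 2) :=
    (Real.summable_one_div_int_pow.2 (by norm_num)).mul_left _
  refine Summable.of_norm_bounded_eventually h ?_
  refine (Set.finite_singleton (0 : ℤ)).subset ?_
  intro n hn
  by_contra h0
  have h0' : (n : ℝ) ≠ 0 := by exact_mod_cast h0
  apply hn
  change ‖(wt L n ^ 2)⁻¹‖ ≤ _
  rw [Real.norm_of_nonneg (by positivity), wt_sq]
  have hpi := Real.pi_pos
  have e : L ^ 2 / (2 * Real.pi) ^ 2 * (1 / (n : ℝ) ^ 2) = ((2 * Real.pi * n / L) ^ 2)⁻¹ := by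
    field_simp
  rw [e]
  apply inv_anti₀ (by positivity)
  linarith

/-- `(∑ₙ ⟨2πn/L⟩⁻²)^{1/2}`, the constant of the embedding of `H¹` into the Wiener algebra. -/
def wtConst (L : ℝ) : ℝ := Real.sqrt (∑' n : ℤ, (wt L n ^ 2)⁻¹)

omit hL in
theorem wtConst_nonneg : 0 ≤ wtConst L := Real.sqrt_nonneg _

/-- Cauchy-Schwarz: `∑ |aₙ| ⟨n⟩⁻¹ ≤ wtConst ‖a‖`. -/
theorem summable_div_wt (a : SeqL2) :
    Summable (fun n => ‖a n‖ / wt L n) ∧ ∑' n, ‖a n‖ / wt L n ≤ wtConst L * ‖a‖ := by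
  have hs1 : Summable fun n => ‖a n‖ ^ (2:ℝ) := by simpa using a.summable_sq
  have hs2 : Summable fun n => ((wt L n)⁻¹) ^ (2:ℝ) := by
    simpa using (summable_wt (L := L))
  have h := Real.summable_and_inner_le_Lp_mul_Lq_tsum_of_nonneg (p := 2) (q := 2)
    (by constructor <;> norm_num) (fun n => norm_nonneg (a n))
    (fun n => inv_nonneg.2 (wt_pos (L := L) n).le) hs1 hs2
  refine ⟨by simpa [div_eq_mul_inv] using h.1, ?_⟩
  have h2 := h.2
  simp only [Real.rpow_two] at h2
  rw [← Real.sqrt_eq_rpow, ← Real.sqrt_eq_rpow, ← a.norm_sq, Real.sqrt_sq (norm_nonneg _)] at h2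
  simpa [div_eq_mul_inv, wtConst, mul_comm] using h2

end

section
variable {L : ℝ}

/-! ### Functions with square-summable weighted Fourier coefficients -/

/-- The `n`-th Fourier coefficient of the function in `H^{r+1}` encoded by `a`. -/
def cf (L : ℝ) (r : ℕ) (a : SeqL2) (n : ℤ) : ℂ := a n / (wt L n : ℂ) ^ (r + 1)

theorem norm_cf (r : ℕ) (a : SeqL2) (n : ℤ) : ‖cf L r a n‖ = ‖a n‖ / wt L n ^ (r + 1) := by
  rw [cf, norm_div, norm_pow, Complex.norm_real, Real.norm_of_nonneg (wt_pos n).le]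

theorem norm_cf_mul (r : ℕ) (a : SeqL2) (n : ℤ) :
    wt L n ^ (r + 1) * ‖cf L r a n‖ = ‖a n‖ := by
  rw [norm_cf, mul_div_cancel₀]
  exact (pow_pos (wt_pos n) _).ne'

theorem wt_pow_mul_norm_cf (r : ℕ) (a : SeqL2) (n : ℤ) :
    wt L n ^ r * ‖cf L r a n‖ = ‖a n‖ / wt L n := by
  rw [← norm_cf_mul (L := L) r a n, pow_succ]
  field_simp [(wt_pos (L := L) n).ne']

theorem norm_cf_le (r : ℕ) (a : SeqL2) (n : ℤ) : ‖cf L r a n‖ ≤ ‖a n‖ / wt L n := by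
  rw [← wt_pow_mul_norm_cf]
  exact le_mul_of_one_le_left (norm_nonneg _) (one_le_pow₀ (one_le_wt n))

theorem cf_add (r : ℕ) (a b : SeqL2) (n : ℤ) : cf L r (a + b) n = cf L r a n + cf L r b n := by
  simp [cf, add_div]

theorem cf_smul (r : ℕ) (c : ℂ) (a : SeqL2) (n : ℤ) : cf L r (c • a) n = c * cf L r a n := by
  simp [cf, mul_div_assoc]

theorem SeqL2.ext_cf (r : ℕ) {a b : SeqL2} (h : ∀ n, cf L r a n = cf L r b n) : a = b := by
  ext n
  have := h n
  rwa [cf, cf, div_left_inj' (pow_ne_zero _ (wt_ne n))] at this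

variable [hL : Fact (0 < L)]

theorem summable_cf (r : ℕ) (a : SeqL2) : Summable fun n => ‖cf L r a n‖ :=
  Summable.of_nonneg_of_le (fun _ => norm_nonneg _) (norm_cf_le r a) (summable_div_wt a).1

theorem tsum_cf_le (r : ℕ) (a : SeqL2) : ∑' n, ‖cf L r a n‖ ≤ wtConst L * ‖a‖ :=
  ((summable_cf r a).tsum_le_tsum (norm_cf_le r a) (summable_div_wt a).1).trans
    (summable_div_wt a).2

theorem norm_cf_smul_fourier (r : ℕ) (a : SeqL2) (n : ℤ) :
    ‖cf L r a n • (fourier n : C(AddCircle L, ℂ))‖ = ‖cf L r a n‖ := by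
  rw [norm_smul, fourier_norm, mul_one]

theorem summable_cf_fourier (r : ℕ) (a : SeqL2) :
    Summable fun n => cf L r a n • (fourier n : C(AddCircle L, ℂ)) :=
  Summable.of_norm (by simpa only [norm_cf_smul_fourier] using summable_cf r a)

/-- The continuous function encoded by `a`, as an element of `H^{r+1}`. -/
def ev (L : ℝ) [Fact (0 < L)] (r : ℕ) : SeqL2 →L[ℂ] C(AddCircle L, ℂ) :=
  LinearMap.mkContinuous
    { toFun := fun a => ∑' n, cf L r a n • (fourier n : C(AddCircle L, ℂ))
      map_add' := fun a b => by
        rw [← (summable_cf_fourier r a).tsum_add (summable_cf_fourier r b)]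
        exact tsum_congr fun n => by rw [cf_add, add_smul]
      map_smul' := fun c a => by
        rw [RingHom.id_apply, ← (summable_cf_fourier r a).tsum_const_smul]
        exact tsum_congr fun n => by rw [cf_smul, mul_smul] }
    (wtConst L) (fun a => by
      refine (norm_tsum_le_tsum_norm ?_).trans ?_
      · simpa only [norm_cf_smul_fourier] using summable_cf r a
      · simpa only [norm_cf_smul_fourier] using tsum_cf_le r a)

theorem hasSum_ev (r : ℕ) (a : SeqL2) :
    HasSum (fun n => cf L r a n • (fourier n : C(AddCircle L, ℂ))) (ev L r a) :=
  (summable_cf_fourier r a).hasSum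

theorem integrable_continuousMap (f : C(AddCircle L, ℂ)) :
    Integrable f (AddCircle.haarAddCircle (T := L)) :=
  f.continuous.integrable_of_hasCompactSupport (HasCompactSupport.of_compactSpace _)

theorem memLp_continuousMap (f : C(AddCircle L, ℂ)) :
    MemLp f 2 (AddCircle.haarAddCircle (T := L)) :=
  (MemLp.of_bound (p := 2) f.continuous.aestronglyMeasurable ‖f‖
    (ae_of_all _ fun x => f.norm_coe_le_norm x))

/-- The `n`-th Fourier coefficient as a functional on continuous functions. -/
def fcoeff (L : ℝ) [Fact (0 < L)] (n : ℤ) : C(AddCircle L, ℂ) →L[ℂ] ℂ :=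
  LinearMap.mkContinuous
    { toFun := fun f => fourierCoeff f n
      map_add' := fun f g => by
        have := congrFun (fourierCoeff.add (integrable_continuousMap f)
          (integrable_continuousMap g)) n
        simpa using this
      map_smul' := fun c f => by
        have := fourierCoeff.const_smul (⇑f) c n
        simpa using this }
    1 (fun f => by
      rw [one_mul]
      change ‖fourierCoeff f n‖ ≤ _
      rw [fourierCoeff]
      refine (norm_integral_le_of_norm_le_const (C := ‖f‖) (ae_of_all _ fun x => ?_)).trans ?_
      · rw [norm_smul]
        have : ‖(fourier (-n) : C(AddCircle L, ℂ)) x‖ ≤ 1 := by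
          rw [← fourier_norm (T := L) (-n)]
          exact ContinuousMap.norm_coe_le_norm _ x
        calc _ ≤ 1 * ‖f‖ := by
              gcongr
              exact f.norm_coe_le_norm x
          _ = _ := one_mul _
      · simp)

theorem fcoeff_apply (n : ℤ) (f : C(AddCircle L, ℂ)) : fcoeff L n f = fourierCoeff f n := rfl

theorem fcoeff_fourier_mul (k n : ℤ) (g : C(AddCircle L, ℂ)) :
    fcoeff L n (fourier k * g) = fcoeff L (n - k) g := by
  rw [fcoeff_apply, fcoeff_apply, fourierCoeff, fourierCoeff]
  refine integral_congr_ae (ae_of_all _ fun x => ?_)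
  simp only [ContinuousMap.mul_apply, smul_eq_mul, ← mul_assoc]
  rw [← fourier_add]
  congr 3; ring

theorem hasSum_fcoeff_ev_mul (r : ℕ) (a : SeqL2) (g : C(AddCircle L, ℂ)) (n : ℤ) :
    HasSum (fun k => cf L r a k * fcoeff L (n - k) g) (fcoeff L n (ev L r a * g)) := by
  have h1 : HasSum (fun k => (cf L r a k • (fourier k : C(AddCircle L, ℂ))) * g)
    (ev L r a * g) := (hasSum_ev r a).mul_right g
  have := h1.mapL (fcoeff L n)
  refine this.congr_fun ?_ |> fun h => h
  intro k
  rw [smul_mul_assoc, map_smul, fcoeff_fourier_mul, smul_eq_mul]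

theorem fcoeff_one (n : ℤ) : fcoeff L n 1 = if n = 0 then 1 else 0 := by
  have h := fourierCoeff_fourier (T := L) 0
  have e : (1 : C(AddCircle L, ℂ)) = fourier 0 := by ext x; simp
  rw [e, fcoeff_apply, h, Pi.single_apply]

theorem fcoeff_ev (r : ℕ) (a : SeqL2) (n : ℤ) : fcoeff L n (ev L r a) = cf L r a n := by
  have h := hasSum_fcoeff_ev_mul (L := L) r a 1 n
  rw [mul_one] at h
  refine h.unique ?_
  have := hasSum_single (f := fun k => cf L r a k * fcoeff L (n - k) 1) n (fun k hk => by
    rw [fcoeff_one, if_neg (by omega), mul_zero])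
  simpa [fcoeff_one] using this

theorem fourierCoeff_ev (r : ℕ) (a : SeqL2) (n : ℤ) : fourierCoeff (ev L r a) n = cf L r a n :=
  fcoeff_ev r a n

/-- A square integrable function is determined by its Fourier coefficients. -/
theorem ae_eq_of_fourierCoeff {f g : AddCircle L → ℂ}
    (hf : MemLp f 2 (AddCircle.haarAddCircle (T := L)))
    (hg : MemLp g 2 (AddCircle.haarAddCircle (T := L)))
    (h : ∀ n, fourierCoeff f n = fourierCoeff g n) :
    f =ᵐ[AddCircle.haarAddCircle (T := L)] g := by
  have e : hf.toLp f = hg.toLp g := by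
    apply (fourierBasis (T := L)).repr.injective
    ext n
    rw [fourierBasis_repr, fourierBasis_repr, fourierCoeff_congr_ae hf.coeFn_toLp,
      fourierCoeff_congr_ae hg.coeFn_toLp, h]
  exact hf.coeFn_toLp.symm.trans ((Lp.ext_iff.1 e).trans hg.coeFn_toLp)

theorem continuousMap_ext_fcoeff {f g : C(AddCircle L, ℂ)}
    (h : ∀ n, fcoeff L n f = fcoeff L n g) : f = g := by
  have hz : ∀ n, fcoeff L n (f - g) = 0 := fun n => by rw [map_sub, h, sub_self]
  have hs : Summable (fourierCoeff ⇑(f - g)) := by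
    have : fourierCoeff ⇑(f - g) = 0 := funext hz
    rw [this]; exact summable_zero
  have := hasSum_fourier_series_of_summable hs
  have e0 : (fun i => fourierCoeff ⇑(f - g) i • (fourier i : C(AddCircle L, ℂ))) = 0 := by
    funext i
    have := hz i
    rw [fcoeff_apply] at this
    simp only [this, zero_smul, Pi.zero_apply]
  rw [e0] at this
  exact sub_eq_zero.1 (this.unique hasSum_zero)

theorem parseval (f : C(AddCircle L, ℂ)) :
    HasSum (fun n => ‖fcoeff L n f‖ ^ 2) (∫ x, ‖f x‖ ^ 2 ∂(AddCircle.haarAddCircle (T := L))) := by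
  have hf := memLp_continuousMap f
  have h := hasSum_sq_fourierCoeff (hf.toLp _)
  have e1 : ∀ n, fourierCoeff (hf.toLp ⇑f) n = fcoeff L n f := fun n =>
    congrFun (fourierCoeff_congr_ae hf.coeFn_toLp) n
  simp only [e1] at h
  convert h using 1
  refine integral_congr_ae ?_
  filter_upwards [hf.coeFn_toLp] with x hx
  rw [hx]

end

section
variable {L : ℝ} [hL : Fact (0 < L)]

/-! ### The Sobolev algebras -/

/-- `⟨n⟩^{r+1}` is at most `2^r` times the sum of `⟨k⟩^{r+1}` and `⟨n-k⟩^{r+1}`, so that the weighted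
coefficients of a product are dominated by two convolutions `ℓ¹ * ℓ²`. -/
theorem norm_fcoeff_mul_le (r : ℕ) (a b : SeqL2) (n : ℤ) :
    wt L n ^ (r + 1) * ‖fcoeff L n (ev L r a * ev L r b)‖ ≤
      2 ^ r * ((∑' k, ‖cf L r b k‖ * ‖a (n - k)‖) + ∑' k, ‖cf L r a k‖ * ‖b (n - k)‖) := by
  have h := hasSum_fcoeff_ev_mul r a (ev L r b) n
  simp only [fcoeff_ev] at h
  have s1 := summable_conv (fun k => norm_nonneg (cf L r b k)) (fun k => norm_nonneg (a k))
    (summable_cf r b) a.summable_sq n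
  have s2 := summable_conv (fun k => norm_nonneg (cf L r a k)) (fun k => norm_nonneg (b k))
    (summable_cf r a) b.summable_sq n
  have e1 : ∑' k, ‖cf L r b k‖ * ‖a (n - k)‖ = ∑' k, ‖a k‖ * ‖cf L r b (n - k)‖ := by
    rw [← (Equiv.subLeft n).tsum_eq]
    refine tsum_congr fun k => ?_
    simp [mul_comm]
  have s1' : Summable fun k => ‖a k‖ * ‖cf L r b (n - k)‖ := by
    rw [← (Equiv.subLeft n).summable_iff] at s1
    refine s1.congr fun k => ?_
    simp [mul_comm]
  rw [e1]
  have hk : ∀ k, wt L n ^ (r + 1) * ‖cf L r a k * cf L r b (n - k)‖ ≤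
      2 ^ r * (‖a k‖ * ‖cf L r b (n - k)‖ + ‖cf L r a k‖ * ‖b (n - k)‖) := fun k => by
    have hw : wt L n ^ (r + 1) ≤ 2 ^ r * (wt L k ^ (r + 1) + wt L (n - k) ^ (r + 1)) := by
      have h1 := wt_add_le (L := L) k (n - k)
      rw [add_sub_cancel] at h1
      exact (pow_le_pow_left₀ (wt_pos n).le h1 _).trans
        (add_pow_le (wt_pos k).le (wt_pos _).le (r + 1))
    rw [norm_mul]
    calc _ ≤ 2 ^ r * (wt L k ^ (r + 1) + wt L (n - k) ^ (r + 1)) *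
          (‖cf L r a k‖ * ‖cf L r b (n - k)‖) := by gcongr
      _ = _ := by
        rw [← norm_cf_mul (L := L) r a k, ← norm_cf_mul (L := L) r b (n - k)]; ring
  have hs := (s1'.add s2).mul_left ((2 : ℝ) ^ r)
  have hs0 := Summable.of_nonneg_of_le
    (fun k => mul_nonneg (pow_nonneg (wt_pos n).le _) (norm_nonneg _)) hk hs
  have hs1 : Summable fun k => ‖cf L r a k * cf L r b (n - k)‖ := by
    refine (summable_mul_left_iff (pow_pos (wt_pos n) (r + 1)).ne').1 hs0
  rw [← h.tsum_eq]
  calc _ ≤ wt L n ^ (r + 1) * ∑' k, ‖cf L r a k * cf L r b (n - k)‖ := by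
        have := wt_pos (L := L) n
        gcongr
        exact norm_tsum_le_tsum_norm hs1
    _ = ∑' k, wt L n ^ (r + 1) * ‖cf L r a k * cf L r b (n - k)‖ := by rw [tsum_mul_left]
    _ ≤ _ := by
      refine (hs0.tsum_le_tsum hk hs).trans (le_of_eq ?_)
      rw [tsum_mul_left, s1'.tsum_add s2]

/-- The sequence encoding the product of two functions of `H^{r+1}`. -/
def prodSeq (L : ℝ) [Fact (0 < L)] (r : ℕ) (a b : SeqL2) (n : ℤ) : ℂ :=
  (wt L n : ℂ) ^ (r + 1) * fcoeff L n (ev L r a * ev L r b)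

theorem norm_prodSeq_le (r : ℕ) (a b : SeqL2) (n : ℤ) : ‖prodSeq L r a b n‖ ≤
      2 ^ r * ((∑' k, ‖cf L r b k‖ * ‖a (n - k)‖) + ∑' k, ‖cf L r a k‖ * ‖b (n - k)‖) := by
  refine le_trans (le_of_eq ?_) (norm_fcoeff_mul_le r a b n)
  rw [prodSeq, norm_mul, norm_pow, Complex.norm_real, Real.norm_of_nonneg (wt_pos n).le]

theorem prodSeq_bound (r : ℕ) (a b : SeqL2) :
    (Summable fun n => (2 ^ r * ((∑' k, ‖cf L r b k‖ * ‖a (n - k)‖)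
      + ∑' k, ‖cf L r a k‖ * ‖b (n - k)‖)) ^ 2) ∧
    ∑' n, (2 ^ r * ((∑' k, ‖cf L r b k‖ * ‖a (n - k)‖)
      + ∑' k, ‖cf L r a k‖ * ‖b (n - k)‖)) ^ 2 ≤ (2 ^ (r + 1) * wtConst L * ‖a‖ * ‖b‖) ^ 2 := by
  obtain ⟨y1, z1⟩ := young (fun k => norm_nonneg (cf L r b k)) (fun k => norm_nonneg (a k))
    (summable_cf r b) a.summable_sq
  obtain ⟨y2, z2⟩ := young (fun k => norm_nonneg (cf L r a k)) (fun k => norm_nonneg (b k))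
    (summable_cf r a) b.summable_sq
  have hle : ∀ n, (2 ^ r * ((∑' k, ‖cf L r b k‖ * ‖a (n - k)‖)
      + ∑' k, ‖cf L r a k‖ * ‖b (n - k)‖)) ^ 2 ≤ (2 ^ r) ^ 2 * (2 * ((∑' k, ‖cf L r b k‖ * ‖a (n - k)‖) ^ 2
      + (∑' k, ‖cf L r a k‖ * ‖b (n - k)‖) ^ 2)) := fun n => by
    rw [mul_pow]
    gcongr
    exact add_sq_le
  have hs := (((y1.add y2).mul_left 2).mul_left (((2 : ℝ) ^ r) ^ 2))
  have hs0 := Summable.of_nonneg_of_le (fun _ => sq_nonneg _) hle hs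
  refine ⟨hs0, (hs0.tsum_le_tsum hle hs).trans ?_⟩
  rw [tsum_mul_left, tsum_mul_left, y1.tsum_add y2]
  have t1 := pow_le_pow_left₀ (tsum_nonneg fun k => norm_nonneg (cf L r b k)) (tsum_cf_le r b) 2
  have t2 := pow_le_pow_left₀ (tsum_nonneg fun k => norm_nonneg (cf L r a k)) (tsum_cf_le r a) 2
  rw [← SeqL2.norm_sq] at z1 z2
  calc _ ≤ (2 ^ r) ^ 2 * (2 * ((wtConst L * ‖b‖) ^ 2 * ‖a‖ ^ 2 + (wtConst L * ‖a‖) ^ 2 * ‖b‖ ^ 2)) := by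
        gcongr
        · exact z1.trans (by gcongr)
        · exact z2.trans (by gcongr)
    _ = _ := by ring

theorem prodSeq_summable (r : ℕ) (a b : SeqL2) : Summable fun n => ‖prodSeq L r a b n‖ ^ 2 :=
  Summable.of_nonneg_of_le (fun _ => sq_nonneg _)
    (fun n => pow_le_pow_left₀ (norm_nonneg _) (norm_prodSeq_le r a b n) 2) (prodSeq_bound r a b).1

/-- The constant in `‖f g‖_{H^{r+1}} ≤ C ‖f‖_{H^{r+1}} ‖g‖_{H^{r+1}}`. -/
def algConst (L : ℝ) (r : ℕ) : ℝ := 2 ^ (r + 1) * wtConst L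

omit hL in
theorem algConst_nonneg (r : ℕ) : 0 ≤ algConst L r := mul_nonneg (by positivity) wtConst_nonneg

theorem norm_prodSeq (r : ℕ) (a b : SeqL2) :
    ‖SeqL2.mk (prodSeq L r a b) (prodSeq_summable r a b)‖ ≤ algConst L r * ‖a‖ * ‖b‖ :=
  SeqL2.norm_le_of_le _ (prodSeq_bound r a b).1
    (mul_nonneg (mul_nonneg (algConst_nonneg r) (norm_nonneg _)) (norm_nonneg _))
    (prodSeq_bound r a b).2 (norm_prodSeq_le r a b)

/-- Multiplication of functions, as a bounded bilinear map on `H^{r+1}`. -/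
def mulS (L : ℝ) [Fact (0 < L)] (r : ℕ) : SeqL2 →L[ℂ] SeqL2 →L[ℂ] SeqL2 :=
  LinearMap.mkContinuous₂
    (LinearMap.mk₂ ℂ (fun a b => SeqL2.mk (prodSeq L r a b) (prodSeq_summable r a b))
      (fun a a' b => by
        ext n
        simp only [SeqL2.mk_apply, prodSeq, lp.coeFn_add, Pi.add_apply, map_add, add_mul, mul_add])
      (fun c a b => by
        ext n
        simp only [SeqL2.mk_apply, prodSeq, lp.coeFn_smul, Pi.smul_apply, map_smul,
          smul_mul_assoc, smul_eq_mul]; ring)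
      (fun a b b' => by
        ext n
        simp only [SeqL2.mk_apply, prodSeq, lp.coeFn_add, Pi.add_apply, map_add, mul_add])
      (fun c a b => by
        ext n
        simp only [SeqL2.mk_apply, prodSeq, lp.coeFn_smul, Pi.smul_apply, map_smul,
          mul_smul_comm, smul_eq_mul]; ring))
    (algConst L r) (norm_prodSeq r)

theorem mulS_apply (r : ℕ) (a b : SeqL2) (n : ℤ) : mulS L r a b n = prodSeq L r a b n := rfl

theorem norm_mulS_le (r : ℕ) (a b : SeqL2) : ‖mulS L r a b‖ ≤ algConst L r * ‖a‖ * ‖b‖ :=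
  norm_prodSeq r a b

theorem norm_mulS_op_le (r : ℕ) (a : SeqL2) : ‖mulS L r a‖ ≤ algConst L r * ‖a‖ :=
  ContinuousLinearMap.opNorm_le_bound _ (mul_nonneg (algConst_nonneg r) (norm_nonneg _))
    (norm_mulS_le r a)

theorem cf_mulS (r : ℕ) (a b : SeqL2) (n : ℤ) :
    cf L r (mulS L r a b) n = fcoeff L n (ev L r a * ev L r b) := by
  rw [cf, mulS_apply, prodSeq, mul_div_cancel_left₀ _ (pow_ne_zero _ (wt_ne n))]

theorem ev_mulS (r : ℕ) (a b : SeqL2) : ev L r (mulS L r a b) = ev L r a * ev L r b :=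
  continuousMap_ext_fcoeff fun n => by rw [fcoeff_ev, cf_mulS]

theorem ev_injective (r : ℕ) : Function.Injective (ev L r) := fun a b h => by
  refine SeqL2.ext_cf (L := L) r fun n => ?_
  rw [← fcoeff_ev, ← fcoeff_ev, h]

theorem mulS_comm (r : ℕ) (a b : SeqL2) : mulS L r a b = mulS L r b a :=
  ev_injective (L := L) r (by rw [ev_mulS, ev_mulS, mul_comm])

theorem mulS_assoc (r : ℕ) (a b c : SeqL2) :
    mulS L r (mulS L r a b) c = mulS L r a (mulS L r b c) :=
  ev_injective (L := L) r (by simp only [ev_mulS, mul_assoc])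

theorem commute_mulS (r : ℕ) (a b : SeqL2) : Commute (mulS L r a) (mulS L r b) := by
  ext1 c
  change mulS L r a (mulS L r b c) = mulS L r b (mulS L r a c)
  rw [← mulS_assoc, mulS_comm r a b, mulS_assoc]

/-! ### Diagonal operators: inclusions, the free flow, complex conjugation -/

omit hL in
theorem summable_diag {m : ℤ → ℂ} (hm : ∀ n, ‖m n‖ ≤ 1) (a : SeqL2) :
    Summable fun n => ‖m n * a n‖ ^ 2 := by
  refine Summable.of_nonneg_of_le (fun _ => sq_nonneg _) (fun n => ?_) a.summable_sq
  rw [norm_mul]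
  gcongr
  exact mul_le_of_le_one_left (norm_nonneg _) (hm n)

omit hL in
theorem norm_diag_le {m : ℤ → ℂ} (hm : ∀ n, ‖m n‖ ≤ 1) (a : SeqL2) :
    ‖SeqL2.mk (fun n => m n * a n) (summable_diag hm a)‖ ≤ ‖a‖ := by
  refine SeqL2.norm_le_of_le _ a.summable_sq (norm_nonneg _) (SeqL2.norm_sq a).ge fun n => ?_
  rw [SeqL2.mk_apply, norm_mul]
  exact mul_le_of_le_one_left (norm_nonneg _) (hm n)

/-- Multiplication of a square-summable sequence by a sequence bounded by `1`. -/
def diagS (m : ℤ → ℂ) (hm : ∀ n, ‖m n‖ ≤ 1) : SeqL2 →L[ℂ] SeqL2 :=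
  LinearMap.mkContinuous
    { toFun := fun a => SeqL2.mk (fun n => m n * a n) (summable_diag hm a)
      map_add' := fun a b => by
        ext n; simp [mul_add]
      map_smul' := fun c a => by
        ext n; simp; ring }
    1 (fun a => by rw [one_mul]; exact norm_diag_le hm a)

omit hL in
@[simp] theorem diagS_apply (m : ℤ → ℂ) (hm : ∀ n, ‖m n‖ ≤ 1) (a : SeqL2) (n : ℤ) :
    diagS m hm a n = m n * a n := rfl

omit hL in
theorem norm_diagS_le (m : ℤ → ℂ) (hm : ∀ n, ‖m n‖ ≤ 1) (a : SeqL2) : ‖diagS m hm a‖ ≤ ‖a‖ :=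
  norm_diag_le hm a

/-- The frequency `(2πn/L)²/2` of the free Schrödinger flow. -/
def freq (L : ℝ) (n : ℤ) : ℝ := (2 * Real.pi * n / L) ^ 2 / 2

omit hL in
theorem norm_exp_neg_I_mul (x : ℝ) : ‖Complex.exp (-Complex.I * (x : ℂ))‖ = 1 := by
  rw [neg_mul, mul_comm, ← neg_mul, ← Complex.ofReal_neg, Complex.norm_exp_ofReal_mul_I]

/-- The free flow `exp(i t ∂ₓ²/2)` on sequences. -/
def flowS (L t : ℝ) : SeqL2 →L[ℂ] SeqL2 :=
  diagS (fun n => Complex.exp (-Complex.I * ((t * freq L n : ℝ) : ℂ))) (fun _ =>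
    (norm_exp_neg_I_mul _).le)

omit hL in
theorem flowS_apply (t : ℝ) (a : SeqL2) (n : ℤ) :
    flowS L t a n = Complex.exp (-Complex.I * ((t * freq L n : ℝ) : ℂ)) * a n := rfl

omit hL in
theorem flowS_add (s t : ℝ) (a : SeqL2) : flowS L s (flowS L t a) = flowS L (s + t) a := by
  ext n
  simp only [flowS_apply]
  rw [← mul_assoc, ← Complex.exp_add]
  congr 2; push_cast; ring

omit hL in
theorem flowS_zero (a : SeqL2) : flowS L 0 a = a := by
  ext n; simp [flowS_apply]

omit hL in
theorem norm_flowS (t : ℝ) (a : SeqL2) : ‖flowS L t a‖ = ‖a‖ := by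
  refine le_antisymm (norm_diagS_le _ _ _) ?_
  conv_lhs => rw [← flowS_zero (L := L) a, ← neg_add_cancel t, ← flowS_add]
  exact norm_diagS_le _ _ _

/-- The inclusion `H³ ⊆ H¹`. -/
def inclS (L : ℝ) : SeqL2 →L[ℂ] SeqL2 :=
  diagS (fun n => ((wt L n : ℂ) ^ 2)⁻¹) (fun n => by
    rw [norm_inv, norm_pow, Complex.norm_real, Real.norm_of_nonneg (wt_pos n).le]
    exact inv_le_one_of_one_le₀ (one_le_pow₀ (one_le_wt n)))

omit hL in
theorem cf_inclS (a : SeqL2) (n : ℤ) : cf L 0 (inclS L a) n = cf L 2 a n := by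
  rw [cf, cf, inclS, diagS_apply]
  have := wt_ne (L := L) n
  field_simp
  ring

omit hL in
theorem norm_inclS_le (a : SeqL2) : ‖inclS L a‖ ≤ ‖a‖ := norm_diagS_le _ _ _

theorem ev_inclS (a : SeqL2) : ev L 0 (inclS L a) = ev L 2 a :=
  continuousMap_ext_fcoeff fun n => by rw [fcoeff_ev, fcoeff_ev, cf_inclS]

theorem inclS_mulS (a b : SeqL2) : inclS L (mulS L 2 a b) = mulS L 0 (inclS L a) (inclS L b) :=
  ev_injective (L := L) 0 (by rw [ev_inclS, ev_mulS, ev_mulS, ev_inclS, ev_inclS])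

omit hL in
theorem inclS_flowS (t : ℝ) (a : SeqL2) : inclS L (flowS L t a) = flowS L t (inclS L a) := by
  ext n
  rw [flowS_apply, inclS, diagS_apply, diagS_apply, flowS_apply]
  ring

omit hL in
theorem summable_conj (a : SeqL2) : Summable fun n => ‖(starRingEnd ℂ) (a (-n))‖ ^ 2 := by
  simp only [RCLike.norm_conj]
  exact ((Equiv.neg ℤ).summable_iff (f := fun n => ‖a n‖ ^ 2)).2 a.summable_sq

omit hL in
theorem norm_conj_seq_le (a : SeqL2) :
    ‖SeqL2.mk (fun n => (starRingEnd ℂ) (a (-n))) (summable_conj a)‖ ≤ ‖a‖ := by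
  refine SeqL2.norm_mk_le _ _ _ (norm_nonneg _) ?_
  rw [SeqL2.norm_sq]
  simp only [RCLike.norm_conj]
  exact le_of_eq ((Equiv.neg ℤ).tsum_eq (fun n => ‖a n‖ ^ 2))

/-- The sequence encoding the complex conjugate of a function. -/
def conjS : SeqL2 →L[ℝ] SeqL2 :=
  LinearMap.mkContinuous
    { toFun := fun a => SeqL2.mk (fun n => (starRingEnd ℂ) (a (-n))) (summable_conj a)
      map_add' := fun a b => by ext n; simp
      map_smul' := fun c a => by ext n; simp }
    1 (fun a => by rw [one_mul]; exact norm_conj_seq_le a)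

omit hL in
@[simp] theorem conjS_apply (a : SeqL2) (n : ℤ) : conjS a n = (starRingEnd ℂ) (a (-n)) := rfl

omit hL in
theorem norm_conjS (a : SeqL2) : ‖conjS a‖ = ‖a‖ := by
  have h : ∀ a, ‖conjS a‖ ≤ ‖a‖ := norm_conj_seq_le
  refine le_antisymm (h a) ?_
  have e : conjS (conjS a) = a := by ext n; simp
  conv_lhs => rw [← e]
  exact h _

omit hL in
theorem cf_conjS (r : ℕ) (a : SeqL2) (n : ℤ) :
    cf L r (conjS a) n = (starRingEnd ℂ) (cf L r a (-n)) := by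
  rw [cf, cf, conjS_apply, map_div₀, map_pow, Complex.conj_ofReal, wt_neg]

theorem ev_conjS (r : ℕ) (a : SeqL2) : ev L r (conjS a) = star (ev L r a) := by
  refine continuousMap_ext_fcoeff fun n => ?_
  rw [fcoeff_ev, cf_conjS, ← fcoeff_ev, fcoeff_apply, fcoeff_apply, fourierCoeff, fourierCoeff,
    ← integral_conj]
  refine integral_congr_ae (ae_of_all _ fun x => ?_)
  simp only [neg_neg, smul_eq_mul, map_mul, ContinuousMap.star_apply, RCLike.star_def]
  rw [fourier_neg]

theorem ev_apply_norm_sq (r : ℕ) (a : SeqL2) (x : AddCircle L) :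
    ev L r (mulS L r a (conjS a)) x = ((‖ev L r a x‖ ^ 2 : ℝ) : ℂ) := by
  rw [ev_mulS, ev_conjS, ContinuousMap.mul_apply, ContinuousMap.star_apply, RCLike.star_def,
    Complex.mul_conj, Complex.normSq_eq_norm_sq]

/-! ### Exponentials -/

/-- Bounded operators intertwined by a bounded map have intertwined exponentials. -/
theorem exp_intertwine {X Y : Type*} [NormedAddCommGroup X] [NormedSpace ℂ X] [CompleteSpace X]
    [NormedAddCommGroup Y] [NormedSpace ℂ Y] [CompleteSpace Y] (l : X →L[ℂ] Y)
    (A : X →L[ℂ] X) (B : Y →L[ℂ] Y) (h : ∀ x, l (A x) = B (l x)) (x : X) :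
    l (NormedSpace.exp A x) = NormedSpace.exp B (l x) := by
  have hp : ∀ n : ℕ, ∀ x, l ((A ^ n) x) = (B ^ n) (l x) := fun n => by
    induction n with
    | zero => intro x; simp
    | succ n ih =>
      intro x
      rw [pow_succ, pow_succ]
      change l ((A ^ n) (A x)) = (B ^ n) (B (l x))
      rw [ih, h]
  have hA := (NormedSpace.exp_series_hasSum_exp' (𝕂 := ℂ) A).mapL
    (l.comp (ContinuousLinearMap.apply ℂ X x) : (X →L[ℂ] X) →L[ℂ] Y)
  have hB := (NormedSpace.exp_series_hasSum_exp' (𝕂 := ℂ) B).mapL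
    (ContinuousLinearMap.apply ℂ Y (l x))
  refine hA.unique ((hB.congr_fun ?_ :))
  intro n
  change l ((n.factorial : ℂ)⁻¹ • (A ^ n) x) = (n.factorial : ℂ)⁻¹ • (B ^ n) (l x)
  rw [map_smul, hp]

/-- A functional that is an eigenvector of the adjoint of `A` is one of the adjoint of `exp A`. -/
theorem exp_eigen {X : Type*} [NormedAddCommGroup X] [NormedSpace ℂ X] [CompleteSpace X]
    (l : X →L[ℂ] ℂ) (A : X →L[ℂ] X) (z : ℂ) (h : ∀ x, l (A x) = z * l x) (x : X) :
    l (NormedSpace.exp A x) = Complex.exp z * l x := by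
  have hp : ∀ n : ℕ, ∀ x, l ((A ^ n) x) = z ^ n * l x := fun n => by
    induction n with
    | zero => intro x; simp
    | succ n ih =>
      intro x
      rw [pow_succ, pow_succ]
      change l ((A ^ n) (A x)) = _
      rw [ih, h, mul_assoc]
  have hA := (NormedSpace.exp_series_hasSum_exp' (𝕂 := ℂ) A).mapL
    (l.comp (ContinuousLinearMap.apply ℂ X x) : (X →L[ℂ] X) →L[ℂ] ℂ)
  have hB := (NormedSpace.exp_series_hasSum_exp' (𝕂 := ℂ) z).mul_right (l x)
  rw [← Complex.exp_eq_exp_ℂ] at hB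
  refine hA.unique ((hB.congr_fun ?_ :))
  intro n
  change l ((n.factorial : ℂ)⁻¹ • (A ^ n) x) = ((n.factorial : ℂ)⁻¹ • z ^ n) * l x
  rw [map_smul, hp, smul_mul_assoc]

theorem norm_exp_le {X : Type*} [NormedAddCommGroup X] [NormedSpace ℂ X] [CompleteSpace X]
    (A : X →L[ℂ] X) (x : X) : ‖NormedSpace.exp A x‖ ≤ Real.exp ‖A‖ * ‖x‖ := by
  have hA := NormedSpace.exp_series_hasSum_exp' (𝕂 := ℂ) A
  have hx := hA.mapL (ContinuousLinearMap.apply ℂ X x)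
  have hR : HasSum (fun n : ℕ => ((n.factorial : ℝ)⁻¹ • ‖A‖ ^ n) * ‖x‖) (Real.exp ‖A‖ * ‖x‖) := by
    rw [Real.exp_eq_exp_ℝ]
    exact (NormedSpace.exp_series_hasSum_exp' (𝕂 := ℝ) ‖A‖).mul_right _
  have hn : ∀ n : ℕ, ‖(ContinuousLinearMap.apply ℂ X x) ((n.factorial : ℂ)⁻¹ • A ^ n)‖ ≤
      ((n.factorial : ℝ)⁻¹ • ‖A‖ ^ n) * ‖x‖ := fun n => by
    have e : (ContinuousLinearMap.apply ℂ X x) ((n.factorial : ℂ)⁻¹ • A ^ n) =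
      (n.factorial : ℂ)⁻¹ • (A ^ n) x := rfl
    rw [e, norm_smul, norm_inv, Complex.norm_natCast, smul_eq_mul, mul_assoc]
    gcongr
    have : ∀ n : ℕ, ‖(A ^ n) x‖ ≤ ‖A‖ ^ n * ‖x‖ := fun n => by
      induction n with
      | zero => simp
      | succ n ih =>
        rw [pow_succ', pow_succ']
        change ‖A ((A ^ n) x)‖ ≤ _
        refine (A.le_opNorm _).trans ?_
        rw [mul_assoc]
        gcongr
    exact this n
  exact hx.norm_le_of_bounded hR hn

/-- `exp(-i τ V)` as an operator on `H^{r+1}`, `V` being encoded by the sequence `a`. -/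
def kickS (L : ℝ) [Fact (0 < L)] (r : ℕ) (τ : ℝ) (a : SeqL2) : SeqL2 →L[ℂ] SeqL2 :=
  NormedSpace.exp ((-Complex.I * (τ : ℂ)) • mulS L r a)

theorem ev_kickS (r : ℕ) (τ : ℝ) (a b : SeqL2) (x : AddCircle L) :
    ev L r (kickS L r τ a b) x = Complex.exp (-Complex.I * τ * ev L r a x) * ev L r b x := by
  refine exp_eigen (((ContinuousMap.evalCLM ℂ x).comp (ev L r)) : SeqL2 →L[ℂ] ℂ)
    ((-Complex.I * (τ : ℂ)) • mulS L r a) (-Complex.I * τ * ev L r a x) (fun b => ?_) b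
  change ev L r ((-Complex.I * (τ : ℂ)) • mulS L r a b) x = (-Complex.I * τ * ev L r a x) *
    ev L r b x
  rw [map_smul, ev_mulS]
  simp only [ContinuousMap.smul_apply, ContinuousMap.mul_apply, smul_eq_mul]; ring

theorem norm_kickS_le (r : ℕ) (τ : ℝ) (a b : SeqL2) :
    ‖kickS L r τ a b‖ ≤ Real.exp (|τ| * (algConst L r * ‖a‖)) * ‖b‖ := by
  refine (norm_exp_le _ _).trans ?_
  gcongr
  rw [norm_smul, norm_mul, norm_neg, Complex.norm_I, one_mul, Complex.norm_real, Real.norm_eq_abs]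
  gcongr
  exact norm_mulS_op_le r a

theorem inclS_kickS (τ : ℝ) (a b : SeqL2) :
    inclS L (kickS L 2 τ a b) = kickS L 0 τ (inclS L a) (inclS L b) :=
  exp_intertwine _ _ _ (fun b => by
    simp only [_root_.smul_apply, map_smul, inclS_mulS]) b

end

section
variable {L : ℝ} [hL : Fact (0 < L)]

/-! ### Sequences of Fourier coefficients of Sobolev functions -/

local notation "haar" => (AddCircle.haarAddCircle (T := L))

omit hL in
theorem sobolevWeight_mono {s s' : ℝ} (h : s ≤ s') (n : ℤ) :
    sobolevWeight L s n ≤ sobolevWeight L s' n :=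
  Real.rpow_le_rpow_of_exponent_le (by nlinarith [sq_nonneg (2 * Real.pi * n / L)]) h

theorem MemSobolev.mono {s s' : ℝ} (h : s ≤ s') {f : AddCircle L → ℂ} (hf : MemSobolev s' f) :
    MemSobolev s f :=
  ⟨hf.1, Summable.of_nonneg_of_le
    (fun n => mul_nonneg (sobolevWeight_nonneg L s n) (by positivity))
    (fun n => mul_le_mul_of_nonneg_right (sobolevWeight_mono h n) (by positivity)) hf.2⟩

theorem sobolevNorm_mono {s s' : ℝ} (h : s ≤ s') {f : AddCircle L → ℂ} (hf : MemSobolev s' f) :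
    sobolevNorm s f ≤ sobolevNorm s' f := by
  refine Real.sqrt_le_sqrt ((hf.mono h).2.tsum_le_tsum (fun n => ?_) hf.2)
  exact mul_le_mul_of_nonneg_right (sobolevWeight_mono h n) (by positivity)

theorem summable_toS {r : ℕ} {f : AddCircle L → ℂ} (hf : MemSobolev ((r + 1 : ℕ) : ℝ) f) :
    Summable fun n => ‖(wt L n : ℂ) ^ (r + 1) * fourierCoeff f n‖ ^ 2 := by
  refine hf.2.congr fun n => ?_
  rw [sobolevWeight_nat, norm_mul, norm_pow, Complex.norm_real, Real.norm_of_nonneg (wt_pos n).le,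
    mul_pow]

open Classical in
/-- The sequence encoding a function of `H^{r+1}` (zero for all other functions). -/
def toS (r : ℕ) (f : AddCircle L → ℂ) : SeqL2 :=
  if h : MemSobolev ((r + 1 : ℕ) : ℝ) f then SeqL2.mk _ (summable_toS h) else 0

theorem cf_toS {r : ℕ} {f : AddCircle L → ℂ} (hf : MemSobolev ((r + 1 : ℕ) : ℝ) f) (n : ℤ) :
    cf L r (toS r f) n = fourierCoeff f n := by
  rw [toS, dif_pos hf, cf, SeqL2.mk_apply, mul_div_cancel_left₀ _ (pow_ne_zero _ (wt_ne n))]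

theorem norm_toS {r : ℕ} {f : AddCircle L → ℂ} (hf : MemSobolev ((r + 1 : ℕ) : ℝ) f) :
    ‖toS r f‖ = sobolevNorm ((r + 1 : ℕ) : ℝ) f := by
  rw [sobolevNorm, ← Real.sqrt_sq (norm_nonneg (toS r f)), SeqL2.norm_sq]
  congr 1
  refine tsum_congr fun n => ?_
  rw [toS, dif_pos hf, SeqL2.mk_apply, sobolevWeight_nat, norm_mul, norm_pow, Complex.norm_real,
    Real.norm_of_nonneg (wt_pos n).le, mul_pow]

theorem ev_toS_ae {r : ℕ} {f : AddCircle L → ℂ} (hf : MemSobolev ((r + 1 : ℕ) : ℝ) f) :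
    f =ᵐ[haar] ev L r (toS r f) :=
  ae_eq_of_fourierCoeff hf.1 (memLp_continuousMap _) fun n => by rw [fourierCoeff_ev, cf_toS hf]

theorem memSobolev_of_ae {r : ℕ} {f : AddCircle L → ℂ} {a : SeqL2} (h : f =ᵐ[haar] ev L r a) :
    MemSobolev ((r + 1 : ℕ) : ℝ) f := by
  refine ⟨(memLp_congr_ae h).2 (memLp_continuousMap _), a.summable_sq.congr fun n => ?_⟩
  rw [fourierCoeff_congr_ae h, fourierCoeff_ev, sobolevWeight_nat, ← mul_pow, norm_cf_mul]

theorem toS_eq_of_ae {r : ℕ} {f : AddCircle L → ℂ} {a : SeqL2} (h : f =ᵐ[haar] ev L r a) :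
    toS r f = a :=
  SeqL2.ext_cf (L := L) r fun n => by
    rw [cf_toS (memSobolev_of_ae h), fourierCoeff_congr_ae h, fourierCoeff_ev]

theorem memSobolev_one_of_ae {f : AddCircle L → ℂ} {a : SeqL2} (h : f =ᵐ[haar] ev L 0 a) :
    MemSobolev 1 f := by
  have := memSobolev_of_ae h
  simpa using this

/-! ### The splitting scheme on sequences -/

/-- On `H¹` and above the Fourier series defining `freeFlow` converges absolutely, so that it
depends only on the almost everywhere class of its argument. -/
theorem freeFlow_eq_ev {r : ℕ} {f : AddCircle L → ℂ} {a : SeqL2} (h : f =ᵐ[haar] ev L r a)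
    (t : ℝ) : freeFlow t f = ev L r (flowS L t a) := by
  funext x
  have hs := (hasSum_ev r (flowS L t a)).mapL (ContinuousMap.evalCLM ℂ x)
  rw [freeFlow]
  refine Eq.trans (tsum_congr fun n => ?_) hs.tsum_eq
  rw [fourierCoeff_congr_ae h, fourierCoeff_ev]
  change _ = cf L r (flowS L t a) n * fourier n x
  rw [cf, cf, flowS_apply, freq, mul_div_assoc t, mul_div_assoc (Complex.exp _) (a n)]

theorem lieStep_eq_ev {r : ℕ} {f : AddCircle L → ℂ} {a w : SeqL2} {W : AddCircle L → ℝ}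
    (h : f =ᵐ[haar] ev L r a) (hW : cplx W =ᵐ[haar] ev L r w) (τ : ℝ) :
    lieStep τ W f = ev L r (flowS L τ (kickS L r τ w a)) := by
  refine freeFlow_eq_ev ?_ τ
  filter_upwards [h, hW] with x hx hWx
  rw [ev_kickS, ← hx, ← hWx, cplx]
  congr 2; push_cast; ring

/-- One step of the Lie–Trotter splitting on sequences. -/
def stepS (L : ℝ) [Fact (0 < L)] (r : ℕ) (τ : ℝ) (w a : SeqL2) : SeqL2 :=
  flowS L τ (kickS L r τ w a)

theorem iterate_lieStep {r : ℕ} {f : AddCircle L → ℂ} {a w : SeqL2} {W : AddCircle L → ℝ}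
    (h : f =ᵐ[haar] ev L r a) (hW : cplx W =ᵐ[haar] ev L r w) (τ : ℝ) (n : ℕ) :
    (lieStep τ W)^[n] f =ᵐ[haar] ev L r ((stepS L r τ w)^[n] a) := by
  induction n with
  | zero => exact h
  | succ n ih =>
    rw [Function.iterate_succ_apply', Function.iterate_succ_apply', lieStep_eq_ev ih hW τ]
    rfl

/-- The truncated potential as a sequence in `H^{r+1}`. -/
def truncS (V0 : SeqL2) (lam : ℕ → ℝ) (V : ℕ → SeqL2) (m : ℕ) (ξ : Fin m → ℝ) : SeqL2 :=
  V0 + ∑ j : Fin m, ((lam j * ξ j : ℝ) : ℂ) • V j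

theorem truncPotential_ae {r : ℕ} {v₀ : AddCircle L → ℝ} {lam : ℕ → ℝ} {v : ℕ → AddCircle L → ℝ}
    {V0 : SeqL2} {V : ℕ → SeqL2} (h0 : cplx v₀ =ᵐ[haar] ev L r V0)
    (hV : ∀ j, cplx (v j) =ᵐ[haar] ev L r (V j)) (m : ℕ) (ξ : Fin m → ℝ) :
    cplx (truncPotential v₀ lam v m ξ) =ᵐ[haar] ev L r (truncS V0 lam V m ξ) := by
  filter_upwards [h0, ae_all_iff.2 hV] with x hx hVx
  simp only [cplx] at hx hVx
  simp only [cplx, truncPotential, truncS, map_add, map_sum, map_smul, ContinuousMap.add_apply,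
    ContinuousMap.sum_apply, ContinuousMap.smul_apply, smul_eq_mul, ← hx, ← hVx]
  push_cast
  rfl

theorem potential_ae {r : ℕ} {v₀ : AddCircle L → ℝ} {lam : ℕ → ℝ} {v : ℕ → AddCircle L → ℝ}
    {V0 : SeqL2} {V : ℕ → SeqL2} (h0 : cplx v₀ =ᵐ[haar] ev L r V0)
    (hV : ∀ j, cplx (v j) =ᵐ[haar] ev L r (V j)) (ξ : ℕ → ℝ)
    (hs : Summable fun j => ((lam j * ξ j : ℝ) : ℂ) • V j) :
    cplx (potential v₀ lam v ξ) =ᵐ[haar]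
      ev L r (V0 + ∑' j, ((lam j * ξ j : ℝ) : ℂ) • V j) := by
  filter_upwards [h0, ae_all_iff.2 hV] with x hx hVx
  simp only [cplx] at hx hVx
  have h1 := (hs.hasSum.mapL (ev L r)).mapL (ContinuousMap.evalCLM ℂ x)
  simp only [map_smul] at h1
  change HasSum (fun j => ((lam j * ξ j : ℝ) : ℂ) * ev L r (V j) x) _ at h1
  simp only [← hVx] at h1
  simp only [cplx, potential]
  rw [Complex.ofReal_add, Complex.ofReal_tsum, map_add, ContinuousMap.add_apply, ← hx]
  congr 1
  rw [← show _ = ev L r (∑' j, ((lam j * ξ j : ℝ) : ℂ) • V j) x from h1.tsum_eq]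
  refine tsum_congr fun j => ?_
  push_cast; ring

/-! ### The observable on sequences -/

/-- The element of `H¹` encoded by a sequence. -/
def sobOf (a : SeqL2) : ↥(sobolevSubmodule L 1) :=
  ⟨ev L 0 a, memSobolev_one_of_ae (EventuallyEq.refl _ _)⟩

omit hL in
theorem sqrt_sobolevWeight_one (n : ℤ) : Real.sqrt (sobolevWeight L 1 n) = wt L n := by
  have := sobolevWeight_nat (L := L) 1 n
  rw [Nat.cast_one] at this
  rw [this, pow_one, Real.sqrt_sq (wt_pos n).le]

theorem coeffs_apply (f : SobolevSpace L 1) (n : ℤ) :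
    (SobolevSpace.coeffs L 1 f : SeqL2) n = (wt L n : ℂ) * fourierCoeff f.toFun n := by
  rw [← sqrt_sobolevWeight_one]; rfl

theorem coeffs_of_ae {f : SobolevSpace L 1} {a : SeqL2} (h : f.toFun =ᵐ[haar] ev L 0 a) :
    (SobolevSpace.coeffs L 1 f : SeqL2) = a := by
  ext n
  rw [coeffs_apply, fourierCoeff_congr_ae h, fourierCoeff_ev, cf, zero_add, pow_one,
    mul_div_cancel₀ _ (wt_ne n)]

theorem toFun_ae_coeffs (f : SobolevSpace L 1) :
    f.toFun =ᵐ[haar] ev L 0 (SobolevSpace.coeffs L 1 f : SeqL2) := by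
  refine ae_eq_of_fourierCoeff f.2.1 (memLp_continuousMap _) fun n => ?_
  rw [fourierCoeff_ev, cf, coeffs_apply, zero_add, pow_one, mul_div_cancel_left₀ _ (wt_ne n)]

/-- A functional on `H¹`, transported to sequences. -/
def dualS (G : StrongDual ℂ (SobolevSpace L 1)) : SeqL2 →L[ℂ] ℂ :=
  LinearMap.mkContinuous
    { toFun := fun a => G (sobOf a : ↥(sobolevSubmodule L 1))
      map_add' := fun a b => by
        have : (sobOf (L := L) (a + b)) = sobOf a + sobOf b := by
          apply Subtype.ext
          change ⇑(ev L 0 (a + b)) = ⇑(ev L 0 a) + ⇑(ev L 0 b)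
          rw [map_add]; rfl
        rw [this]
        exact map_add G (sobOf a : SobolevSpace L 1) (sobOf b : SobolevSpace L 1)
      map_smul' := fun c a => by
        have : (sobOf (L := L) (c • a)) = c • sobOf a := by
          apply Subtype.ext
          change ⇑(ev L 0 (c • a)) = c • ⇑(ev L 0 a)
          rw [map_smul]; rfl
        rw [this]
        exact map_smul G c (sobOf a : SobolevSpace L 1) }
    ‖G‖ (fun a => by
      refine (G.le_opNorm (sobOf a : SobolevSpace L 1)).trans ?_
      refine mul_le_mul_of_nonneg_left (le_of_eq ?_) (norm_nonneg _)
      change ‖(SobolevSpace.coeffs L 1 (sobOf a : SobolevSpace L 1) : SeqL2)‖ = _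
      exact congrArg norm (coeffs_of_ae (f := (sobOf a : ↥(sobolevSubmodule L 1))) (a := a)
        (EventuallyEq.refl _ _)))

theorem dualApply_eq (G : StrongDual ℂ (SobolevSpace L 1)) {f : AddCircle L → ℂ} {a : SeqL2}
    (h : f =ᵐ[haar] ev L 0 a) : dualApply G f = dualS G a := by
  have hf := memSobolev_one_of_ae h
  rw [dualApply, dif_pos hf]
  change G (⟨f, hf⟩ : ↥(sobolevSubmodule L 1)) = G (sobOf a : ↥(sobolevSubmodule L 1))
  let F : SobolevSpace L 1 := (⟨f, hf⟩ : ↥(sobolevSubmodule L 1))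
  let A : SobolevSpace L 1 := (sobOf a : ↥(sobolevSubmodule L 1))
  change G F = G A
  rw [← sub_eq_zero, ← map_sub, ← norm_le_zero_iff]
  refine (G.le_opNorm _).trans (le_of_eq ?_)
  have : ‖F - A‖ = 0 := by
    change ‖(SobolevSpace.coeffs L 1 (F - A) : SeqL2)‖ = 0
    rw [map_sub, coeffs_of_ae (f := F) h, coeffs_of_ae (f := A) (a := a) (EventuallyEq.refl _ _),
      sub_self, norm_zero]
  rw [this, mul_zero]

/-- The observable `G(|f|²)` for the function `f ∈ H¹` encoded by `a`. -/
def obsS (G : StrongDual ℂ (SobolevSpace L 1)) (a : SeqL2) : ℂ :=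
  dualS G (mulS L 0 a (conjS a))

theorem observable_eq (G : StrongDual ℂ (SobolevSpace L 1)) {f : AddCircle L → ℂ} {a : SeqL2}
    (h : f =ᵐ[haar] ev L 0 a) : observable G f = obsS G a := by
  refine dualApply_eq G ?_
  filter_upwards [h] with x hx
  rw [ev_apply_norm_sq, hx]

theorem norm_obsS_sub_le (G : StrongDual ℂ (SobolevSpace L 1)) (a b : SeqL2) :
    ‖obsS G a - obsS G b‖ ≤ ‖dualS G‖ * algConst L 0 * (‖a‖ + ‖b‖) * ‖a - b‖ := by
  have e : mulS L 0 a (conjS a) - mulS L 0 b (conjS b)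
      = mulS L 0 a (conjS (a - b)) + mulS L 0 (a - b) (conjS b) := by
    simp only [map_sub, _root_.sub_apply]
    abel
  rw [obsS, obsS, ← map_sub, e]
  refine ((dualS G).le_opNorm _).trans ?_
  have h1 := norm_mulS_le (L := L) 0 a (conjS (a - b))
  have h2 := norm_mulS_le (L := L) 0 (a - b) (conjS b)
  rw [norm_conjS] at h1 h2
  calc _ ≤ ‖dualS G‖ * (algConst L 0 * ‖a‖ * ‖a - b‖ + algConst L 0 * ‖a - b‖ * ‖b‖) := by
        gcongr
        exact (norm_add_le _ _).trans (add_le_add h1 h2)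
    _ = _ := by ring

theorem norm_obsS_le (G : StrongDual ℂ (SobolevSpace L 1)) (a : SeqL2) :
    ‖obsS G a‖ ≤ ‖dualS G‖ * algConst L 0 * ‖a‖ ^ 2 := by
  have h := norm_obsS_sub_le G a 0
  have h0 : obsS G (0 : SeqL2) = 0 := by simp [obsS]
  rw [h0, sub_zero, sub_zero, norm_zero, add_zero] at h
  rw [sq, ← mul_assoc]; exact h

end

section
variable {L : ℝ} [hL : Fact (0 < L)]

local notation "haar" => (AddCircle.haarAddCircle (T := L))

/-! ### The interaction picture -/

omit hL in
theorem continuous_flowS_const (a : SeqL2) : Continuous fun t => flowS L t a := by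
  rw [continuous_iff_continuousAt]
  intro s
  rw [ContinuousAt, tendsto_iff_norm_sub_tendsto_zero]
  have h : Tendsto (fun t => ∑' n, ‖(flowS L t a - flowS L s a) n‖ ^ 2) (𝓝 s) (𝓝 (∑' _ : ℤ, 0)) := by
    refine tendsto_tsum_of_dominated_convergence (bound := fun n => 4 * ‖a n‖ ^ 2)
      (a.summable_sq.mul_left 4) (fun n => ?_) (Eventually.of_forall fun t n => ?_)
    · have : Continuous fun t => ‖(flowS L t a - flowS L s a) n‖ ^ 2 := by
        simp only [lp.coeFn_sub, Pi.sub_apply, flowS_apply]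
        fun_prop
      have h2 := this.tendsto s
      simpa using h2
    · rw [norm_pow, norm_norm, lp.coeFn_sub, Pi.sub_apply]
      have h1 : ∀ t, ‖flowS L t a n‖ = ‖a n‖ := fun t => by
        rw [flowS_apply, norm_mul, norm_exp_neg_I_mul, one_mul]
      have h2 := norm_sub_le (flowS L t a n) (flowS L s a n)
      rw [h1, h1] at h2
      calc _ ≤ (‖a n‖ + ‖a n‖) ^ 2 := by gcongr
        _ = _ := by ring
  rw [tsum_zero] at h
  have h2 := (Real.continuous_sqrt.tendsto 0).comp h
  rw [Real.sqrt_zero] at h2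
  refine h2.congr fun t => ?_
  simp only [Function.comp]
  rw [← SeqL2.norm_sq, Real.sqrt_sq (norm_nonneg _)]

omit hL in
theorem Continuous.flowS {X : Type*} [TopologicalSpace X] {f : X → ℝ} {g : X → SeqL2}
    (hf : Continuous f) (hg : Continuous g) : Continuous fun x => flowS L (f x) (g x) := by
  rw [continuous_iff_continuousAt]
  intro x
  have h1 : Tendsto (fun y => QMCTS.flowS L (f y) (g x)) (𝓝 x) (𝓝 (QMCTS.flowS L (f x) (g x))) :=
    ((continuous_flowS_const (g x)).comp hf).tendsto x
  have h2 : Tendsto (fun y => QMCTS.flowS L (f y) (g y - g x)) (𝓝 x) (𝓝 0) := by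
    rw [tendsto_zero_iff_norm_tendsto_zero]
    simp only [norm_flowS]
    rw [← tendsto_iff_norm_sub_tendsto_zero]
    exact hg.tendsto x
  have := h1.add h2
  rw [add_zero] at this
  refine this.congr fun y => ?_
  rw [map_sub]; abel

/-- A mild solution in `H¹`, written in the interaction picture `z(t) = exp(-i t ∂ₓ²/2) u(t)`,
solves an ordinary differential equation with a bounded, time-dependent right-hand side. -/
theorem IsMildSolution.interaction {W : AddCircle L → ℝ} {ψ₀ : AddCircle L → ℂ}
    {u : ℝ → SobolevSpace L 1} (hu : IsMildSolution W ψ₀ u) {w a : SeqL2}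
    (hW : cplx W =ᵐ[haar] ev L 0 w) (hψ : ψ₀ =ᵐ[haar] ev L 0 a) :
    ∃ z : ℝ → SeqL2, z 0 = a ∧ (∀ t, 0 ≤ t → (u t).toFun =ᵐ[haar] ev L 0 (flowS L t (z t))) ∧
      ∀ t, 0 ≤ t → HasDerivAt z
        (-Complex.I • flowS L (-t) (mulS L 0 w (flowS L t (z t)))) t := by
  set φ : ℝ → SeqL2 := fun t => (SobolevSpace.coeffs L 1 (u (max t 0)) : SeqL2) with hφ
  have hφc : Continuous φ := by
    have h1 : Continuous fun t => u (max t 0) :=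
      hu.1.comp_continuous (by fun_prop) (fun t => Set.mem_Ici.2 (le_max_right _ _))
    have h2 : Isometry fun f : SobolevSpace L 1 => (SobolevSpace.coeffs L 1 f : SeqL2) := by
      refine Isometry.of_dist_eq fun f g => ?_
      rw [dist_eq_norm, dist_eq_norm, ← map_sub]; rfl
    exact h2.continuous.comp h1
  have hφ0 : ∀ t, 0 ≤ t → φ t = (SobolevSpace.coeffs L 1 (u t) : SeqL2) := fun t ht => by
    rw [hφ]; simp only [max_eq_left ht]
  set F : ℝ → SeqL2 := fun ρ => flowS L (-ρ) (mulS L 0 w (φ ρ)) with hF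
  have hFc : Continuous F := Continuous.flowS continuous_neg ((mulS L 0 w).continuous.comp hφc)
  set z : ℝ → SeqL2 := fun t => a - Complex.I • ∫ ρ in (0:ℝ)..t, F ρ with hz
  have hduh : ∀ t, 0 ≤ t → (u t).toFun =ᵐ[haar] ev L 0 (flowS L t (z t)) := fun t ht => by
    filter_upwards [hu.2 t ht] with x hx
    rw [hx, hz]
    simp only [map_sub, map_smul, ContinuousMap.sub_apply, ContinuousMap.smul_apply, smul_eq_mul]
    rw [freeFlow_eq_ev hψ t]
    congr 2
    have e := ((ContinuousMap.evalCLM ℂ x).comp ((ev L 0).comp (flowS L t))).intervalIntegral_comp_comm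
      (hFc.intervalIntegrable (μ := volume) 0 t)
    refine Eq.trans ?_ e
    refine intervalIntegral.integral_congr fun ρ hρ => ?_
    rw [Set.uIcc_of_le ht] at hρ
    have hWu : (fun y => (W y : ℂ) * (u ρ).toFun y) =ᵐ[haar] ev L 0 (mulS L 0 w (φ ρ)) := by
      filter_upwards [hW, toFun_ae_coeffs (u ρ)] with y hy hy2
      rw [ev_mulS, ContinuousMap.mul_apply, ← hy, hφ0 ρ hρ.1, ← hy2, cplx]
    rw [freeFlow_eq_ev hWu]
    change _ = ev L 0 (flowS L t (F ρ)) x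
    rw [hF]
    simp only [flowS_add]
    rw [sub_eq_add_neg]
  -- `F` was written with the coefficients of `u`; by Duhamel's formula these are the ones of `z`
  refine ⟨z, by simp [hz], hduh, fun t ht => ?_⟩
  have h1 : HasDerivAt (fun t => ∫ ρ in (0:ℝ)..t, F ρ) (F t) t :=
    intervalIntegral.integral_hasDerivAt_right (hFc.intervalIntegrable _ _)
      hFc.stronglyMeasurable.stronglyMeasurableAtFilter hFc.continuousAt
  have h2 := (h1.const_smul Complex.I).const_sub a
  have e : F t = flowS L (-t) (mulS L 0 w (flowS L t (z t))) := by
    rw [hF]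
    beta_reduce
    rw [hφ0 t ht, coeffs_of_ae (hduh t ht)]
  rw [e, ← neg_smul] at h2
  exact h2

/-! ### The local error of the Lie–Trotter splitting -/

omit hL in
theorem abs_freq_sub_le (k l : ℤ) :
    |freq L (k + l) - freq L l| ≤ 2 * wt L k ^ 2 * wt L l := by
  have hk := abs_le_wt (L := L) k
  have hl := abs_le_wt (L := L) l
  set x := 2 * Real.pi * k / L with hx
  set y := 2 * Real.pi * l / L with hy
  have e : freq L (k + l) - freq L l = x * (x + 2 * y) / 2 := by
    rw [freq, freq]; push_cast; rw [← hy]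
    rw [show 2 * Real.pi * (k + l : ℝ) / L = x + y by rw [hx, hy]; ring]; ring
  have h1 := one_le_wt (L := L) k
  have h2 := one_le_wt (L := L) l
  have h3 : |x + 2 * y| ≤ wt L k + 2 * wt L l := by
    refine (abs_add_le _ _).trans ?_
    rw [abs_mul, abs_two]; gcongr
  rw [e, abs_div, abs_mul, abs_two]
  calc _ ≤ wt L k * (wt L k + 2 * wt L l) / 2 := by gcongr
    _ ≤ _ := by nlinarith [mul_nonneg (sub_nonneg.2 h1) (sub_nonneg.2 h2),
        mul_le_mul_of_nonneg_left h2 (sq_nonneg (wt L k)),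
        mul_le_mul_of_nonneg_left h1 (by positivity : 0 ≤ wt L k * wt L l)]

omit hL in
theorem wt_add_le_mul (k l : ℤ) : wt L (k + l) ≤ 2 * wt L k * wt L l := by
  have h1 := one_le_wt (L := L) k
  have h2 := one_le_wt (L := L) l
  have := wt_add_le (L := L) k l
  nlinarith

/-- The commutator of a potential in `H³` with the free flow, applied to a function in `H³`, is
of first order in time in the `H¹` norm. In Fourier space, the mode `k` of the function and the mode
`n - k` of the potential contribute with the phase `σ (freq n - freq k)`, whose size is at most
`|σ| ⟨n-k⟩² ⟨k⟩` up to a constant (`abs_freq_sub_le`); the weights are absorbed by the `H³` norms. -/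
theorem norm_commutator_le (A B : SeqL2) (σ : ℝ) :
    ‖mulS L 0 (inclS L A) (inclS L B)
      - flowS L (-σ) (mulS L 0 (inclS L A) (flowS L σ (inclS L B)))‖
      ≤ 4 * |σ| * wtConst L * ‖B‖ * ‖A‖ := by
  have hβ : Summable fun k => 4 * |σ| * (‖B k‖ / wt L k) := (summable_div_wt B).1.mul_left _
  refine SeqL2.norm_le_of_conv (β := fun k => 4 * |σ| * (‖B k‖ / wt L k)) (A := fun k => ‖A k‖)
    (fun k => by have := wt_pos (L := L) k; positivity) (fun k => norm_nonneg _)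
    hβ A.summable_sq (B := 4 * |σ| * wtConst L * ‖B‖) (C := ‖A‖) ?_ (norm_nonneg _)
    (SeqL2.norm_sq A).ge _ fun n => ?_
  · rw [tsum_mul_left]
    calc _ ≤ 4 * |σ| * (wtConst L * ‖B‖) := by
          gcongr
          exact (summable_div_wt (L := L) B).2
      _ = _ := by ring
  rw [mulS_comm (L := L) 0 (inclS L A), mulS_comm (L := L) 0 (inclS L A), lp.coeFn_sub, Pi.sub_apply, flowS_apply,
    mulS_apply, mulS_apply, prodSeq, prodSeq, mul_left_comm, ← mul_sub]
  have h1 := hasSum_fcoeff_ev_mul (L := L) 0 (inclS L B) (ev L 0 (inclS L A)) n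
  have h2 := (hasSum_fcoeff_ev_mul (L := L) 0 (flowS L σ (inclS L B)) (ev L 0 (inclS L A)) n).mul_left
    (Complex.exp (-Complex.I * ((-σ * freq L n : ℝ) : ℂ)))
  have h3 := h1.sub h2
  simp only [fcoeff_ev, cf_inclS] at h3
  rw [← h3.tsum_eq]
  have hk : ∀ k, wt L n * ‖cf L 2 B k * cf L 2 A (n - k)
      - Complex.exp (-Complex.I * ((-σ * freq L n : ℝ) : ℂ)) *
        (cf L 0 (flowS L σ (inclS L B)) k * cf L 2 A (n - k))‖
      ≤ 4 * |σ| * (‖B k‖ / wt L k) * ‖A (n - k)‖ := fun k => by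
    have e0 : cf L 0 (flowS L σ (inclS L B)) k =
        Complex.exp (-Complex.I * ((σ * freq L k : ℝ) : ℂ)) * cf L 2 B k := by
      rw [cf, flowS_apply, mul_div_assoc]
      congr 1
      exact cf_inclS B k
    have e1 : cf L 2 B k * cf L 2 A (n - k)
      - Complex.exp (-Complex.I * ((-σ * freq L n : ℝ) : ℂ)) *
        (cf L 0 (flowS L σ (inclS L B)) k * cf L 2 A (n - k)) =
        -(Complex.exp (Complex.I * ((σ * (freq L n - freq L k) : ℝ) : ℂ)) - 1) *
          (cf L 2 B k * cf L 2 A (n - k)) := by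
      rw [e0]
      have : Complex.exp (Complex.I * ((σ * (freq L n - freq L k) : ℝ) : ℂ)) =
        Complex.exp (-Complex.I * ((-σ * freq L n : ℝ) : ℂ)) *
          Complex.exp (-Complex.I * ((σ * freq L k : ℝ) : ℂ)) := by
        rw [← Complex.exp_add]; congr 1; push_cast; ring
      rw [this]; ring
    rw [e1, norm_mul, norm_neg, norm_mul]
    have b1 : ‖Complex.exp (Complex.I * ((σ * (freq L n - freq L k) : ℝ) : ℂ)) - 1‖ ≤
        |σ| * (2 * wt L (n - k) ^ 2 * wt L k) := by
      refine (Real.norm_exp_I_mul_ofReal_sub_one_le).trans ?_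
      rw [Real.norm_eq_abs, abs_mul]
      have := abs_freq_sub_le (L := L) (n - k) k
      rw [sub_add_cancel] at this
      gcongr
    have b2 : wt L n ≤ 2 * wt L (n - k) * wt L k := by
      have := wt_add_le_mul (L := L) (n - k) k
      rwa [sub_add_cancel] at this
    have p1 := wt_pos (L := L) n
    have p2 := wt_pos (L := L) k
    have p3 := wt_pos (L := L) (n - k)
    calc _ ≤ (2 * wt L (n - k) * wt L k) * (|σ| * (2 * wt L (n - k) ^ 2 * wt L k) *
          (‖cf L 2 B k‖ * ‖cf L 2 A (n - k)‖)) := by gcongr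
      _ = 4 * |σ| * (wt L k ^ 2 * ‖cf L 2 B k‖) * (wt L (n - k) ^ (2 + 1) * ‖cf L 2 A (n - k)‖) := by
        ring
      _ = _ := by rw [norm_cf_mul, wt_pow_mul_norm_cf]
  have hsum := summable_conv (fun k => by have := wt_pos (L := L) k; positivity)
    (fun k => norm_nonneg (A k)) hβ A.summable_sq n
  have hs0 := Summable.of_nonneg_of_le
    (fun k => mul_nonneg (wt_pos (L := L) n).le (norm_nonneg _)) hk hsum
  have hs1 := (summable_mul_left_iff (wt_pos (L := L) n).ne').1 hs0
  rw [norm_mul, norm_pow, Complex.norm_real, Real.norm_of_nonneg (wt_pos n).le, zero_add, pow_one]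
  calc _ ≤ wt L n * ∑' k, _ := by
        have := wt_pos (L := L) n
        gcongr
        exact norm_tsum_le_tsum_norm hs1
    _ = ∑' k, wt L n * _ := by rw [tsum_mul_left]
    _ ≤ _ := hs0.tsum_le_tsum hk hsum

theorem hasDerivAt_kickS (r : ℕ) (w a : SeqL2) (t : ℝ) :
    HasDerivAt (fun t => kickS L r t w a) (-Complex.I • mulS L r w (kickS L r t w a)) t := by
  have h := hasDerivAt_exp_smul_const' (𝕂 := ℝ) (-Complex.I • mulS L r w) t
  have h2 := ((ContinuousLinearMap.apply ℂ SeqL2 a).restrictScalars ℝ).hasFDerivAt.comp_hasDerivAt t h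
  have e : ∀ t : ℝ, (-Complex.I * (t : ℂ)) • mulS L r w = t • (-Complex.I • mulS L r w) :=
    fun t => by
      rw [mul_comm, mul_smul, Complex.coe_smul]
      rfl
  simp only [kickS, e]
  exact h2

/-! ### Convergence of the splitting -/

theorem gronwallBound_le {δ K ε x : ℝ} (hK : 0 ≤ K) (hε : 0 ≤ ε) :
    gronwallBound δ K ε x ≤ (δ + ε * x) * Real.exp (K * x) := by
  rcases eq_or_lt_of_le hK with rfl | hK
  · simp [gronwallBound_K0]
  · rw [gronwallBound_of_K_ne_0 hK.ne', add_mul]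
    refine add_le_add le_rfl ?_
    have h := Real.add_one_le_exp (-(K * x))
    have h2 : Real.exp (K * x) - 1 ≤ K * x * Real.exp (K * x) := by
      have e : Real.exp (-(K * x)) * Real.exp (K * x) = 1 := by rw [← Real.exp_add]; simp
      nlinarith [Real.exp_pos (K * x)]
    calc ε / K * (Real.exp (K * x) - 1) ≤ ε / K * (K * x * Real.exp (K * x)) := by gcongr
      _ = _ := by field_simp

omit hL in
theorem inclS_stepS [Fact (0 < L)] (τ : ℝ) (w a : SeqL2) :
    inclS L (stepS L 2 τ w a) = stepS L 0 τ (inclS L w) (inclS L a) := by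
  rw [stepS, stepS, inclS_flowS, inclS_kickS]

theorem norm_iterate_step_le (τ : ℝ) (hτ : 0 ≤ τ) (r : ℕ) (w a : SeqL2) (n : ℕ) :
    ‖(stepS L r τ w)^[n] a‖ ≤ Real.exp (n * τ * (algConst L r * ‖w‖)) * ‖a‖ := by
  induction n with
  | zero => simp
  | succ n ih =>
    rw [Function.iterate_succ_apply', stepS, norm_flowS]
    refine (norm_kickS_le _ _ _ _).trans ?_
    rw [abs_of_nonneg hτ]
    calc _ ≤ Real.exp (τ * (algConst L r * ‖w‖)) * (Real.exp (n * τ * (algConst L r * ‖w‖)) * ‖a‖) := by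
          gcongr
      _ = _ := by
        rw [← mul_assoc, ← Real.exp_add]; congr 2; push_cast; ring

/-- Error of the splitting with potential `W` (in `H³`) for the equation with potential `w`
(in `H¹`): Grönwall's inequality in the interaction picture, in which the splitting is an
approximate solution. -/
theorem splitting_error {z : ℝ → SeqL2} {w W a : SeqL2} (hz0 : z 0 = inclS L a)
    (hz : ∀ t, 0 ≤ t → HasDerivAt z
        (-Complex.I • flowS L (-t) (mulS L 0 w (flowS L t (z t)))) t)
    {τ T M : ℝ} (hτ : 0 ≤ τ) (hM : Real.exp (T * (algConst L 2 * ‖W‖)) * ‖a‖ ≤ M) (n : ℕ)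
    (hn : n * τ ≤ T) :
    ‖flowS L (n * τ) (z (n * τ)) - inclS L ((stepS L 2 τ W)^[n] a)‖ ≤
      (n * τ) * (algConst L 0 * ‖inclS L W - w‖ * M + 4 * τ * wtConst L * M * ‖W‖) *
        Real.exp (algConst L 0 * ‖w‖ * (n * τ)) := by
  have hM0 : 0 ≤ M := le_trans (by positivity) hM
  have hc0 := algConst_nonneg (L := L) 0
  have hc2 := algConst_nonneg (L := L) 2
  have hwc := wtConst_nonneg (L := L)
  set ε := algConst L 0 * ‖inclS L W - w‖ * M + 4 * τ * wtConst L * M * ‖W‖ with hε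
  have hε0 : 0 ≤ ε := by positivity
  set K := algConst L 0 * ‖w‖ with hK
  have hK0 : 0 ≤ K := by positivity
  induction n with
  | zero => simp [hz0, flowS_zero]
  | succ n ih =>
    have hn' : n * τ ≤ T := le_trans (by push_cast; nlinarith) hn
    specialize ih hn'
    set c := (stepS L 2 τ W)^[n] a with hc
    set s : ℝ := n * τ with hs
    have hs0 : 0 ≤ s := by positivity
    -- the splitting within one step, in the interaction picture: the kick acts for the time `t - s`,
    -- while the free flow is undone
    set y : ℝ → SeqL2 := fun t => flowS L (-s) (kickS L 0 (t - s) (inclS L W) (inclS L c)) with hy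
    have hy' : ∀ t, HasDerivAt y (flowS L (-s) (-Complex.I • mulS L 0 (inclS L W)
        (kickS L 0 (t - s) (inclS L W) (inclS L c)))) t := fun t => by
      have h1 := (hasDerivAt_kickS (L := L) 0 (inclS L W) (inclS L c) (t - s)).comp_sub_const t s
      exact ((flowS L (-s)).restrictScalars ℝ).hasFDerivAt.comp_hasDerivAt t h1
    have hgr := dist_le_of_approx_trajectories_ODE (E := SeqL2)
      (v := fun t y => -Complex.I • flowS L (-t) (mulS L 0 w (flowS L t y)))
      (K := K.toNNReal) (f := z) (g := y)
      (f' := fun t => -Complex.I • flowS L (-t) (mulS L 0 w (flowS L t (z t))))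
      (g' := fun t => flowS L (-s) (-Complex.I • mulS L 0 (inclS L W)
        (kickS L 0 (t - s) (inclS L W) (inclS L c))))
      (a := s) (b := s + τ) (εf := 0) (εg := ε) (δ := s * ε * Real.exp (K * s))
      (fun t => by
        refine LipschitzWith.of_dist_le_mul fun y1 y2 => ?_
        rw [dist_eq_norm, dist_eq_norm, ← smul_sub, ← map_sub, ← map_sub, ← map_sub, norm_smul,
          norm_neg, Complex.norm_I, one_mul, norm_flowS, Real.coe_toNNReal _ hK0]
        refine (norm_mulS_le _ _ _).trans ?_
        rw [norm_flowS])
      (fun t ht => (hz t (hs0.trans ht.1)).continuousAt.continuousWithinAt)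
      (fun t ht => (hz t (hs0.trans ht.1)).hasDerivWithinAt)
      (fun t _ => by rw [dist_self])
      (fun t _ => (hy' t).continuousAt.continuousWithinAt)
      (fun t _ => (hy' t).hasDerivWithinAt)
      (fun t ht => by
        set σ := t - s with hσ
        have hσ0 : 0 ≤ σ := sub_nonneg.2 ht.1
        have hσ1 : σ ≤ τ := by have := ht.2; rw [hσ]; linarith
        set X := kickS L 2 σ W c with hX
        have hXM : ‖X‖ ≤ M := by
          refine (norm_kickS_le _ _ _ _).trans (le_trans ?_ hM)
          have := norm_iterate_step_le (L := L) τ hτ 2 W a n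
          rw [abs_of_nonneg hσ0]
          calc _ ≤ Real.exp (σ * (algConst L 2 * ‖W‖)) *
                (Real.exp (n * τ * (algConst L 2 * ‖W‖)) * ‖a‖) := by gcongr
            _ = Real.exp ((σ + n * τ) * (algConst L 2 * ‖W‖)) * ‖a‖ := by
              rw [← mul_assoc, ← Real.exp_add, add_mul]
            _ ≤ _ := by
              gcongr
              push_cast at hn; linarith
        have eX : kickS L 0 σ (inclS L W) (inclS L c) = inclS L X := by rw [hX, inclS_kickS]
        have ey : flowS L t (y t) = flowS L σ (inclS L X) := by
          simp only [hy]
          rw [flowS_add, ← sub_eq_add_neg, ← hσ, eX]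
        rw [dist_eq_norm, ey, eX, map_smul, ← smul_sub, norm_smul, norm_neg, Complex.norm_I, one_mul,
          show -t = -s + -σ by rw [hσ]; ring, ← flowS_add, ← map_sub, norm_flowS]
        -- the residual splits into the error of the potential and the commutator with the free flow
        have e2 : mulS L 0 (inclS L W) (inclS L X)
            - flowS L (-σ) (mulS L 0 w (flowS L σ (inclS L X)))
            = flowS L (-σ) (mulS L 0 (inclS L W - w) (flowS L σ (inclS L X))) +
              (mulS L 0 (inclS L W) (inclS L X)
                - flowS L (-σ) (mulS L 0 (inclS L W) (flowS L σ (inclS L X)))) := by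
          simp only [map_sub, _root_.sub_apply]; abel
        rw [e2, hε]
        refine (norm_add_le _ _).trans (add_le_add ?_ ?_)
        · rw [norm_flowS]
          refine (norm_mulS_le _ _ _).trans ?_
          rw [norm_flowS]
          gcongr
          exact (norm_inclS_le X).trans hXM
        · refine (norm_commutator_le W X σ).trans ?_
          rw [abs_of_nonneg hσ0]
          gcongr)
      (by
        rw [dist_eq_norm]
        have : y s = flowS L (-s) (inclS L c) := by
          simp only [hy, sub_self]
          congr 1
          rw [kickS]; simp
        rw [this]
        calc ‖z s - flowS L (-s) (inclS L c)‖ = ‖flowS L s (z s) - inclS L c‖ := by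
              rw [← norm_flowS (L := L) s, map_sub, flowS_add, add_neg_cancel, flowS_zero]
          _ ≤ _ := ih)
      (s + τ) ⟨by linarith, le_refl _⟩
    have e1 : ((n + 1 : ℕ) : ℝ) * τ = s + τ := by rw [hs]; push_cast; ring
    -- at the end of the step, `y` is the next iterate in the interaction picture
    have e2 : y (s + τ) = flowS L (-(s + τ)) (inclS L ((stepS L 2 τ W)^[n + 1] a)) := by
      rw [Function.iterate_succ_apply', inclS_stepS, stepS, flowS_add]
      simp only [hy]
      rw [add_sub_cancel_left, neg_add, add_assoc, neg_add_cancel, add_zero]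
    rw [e1]
    rw [e2, dist_eq_norm, Real.coe_toNNReal _ hK0, zero_add, add_sub_cancel_left] at hgr
    have e3 : ‖flowS L (s + τ) (z (s + τ)) - inclS L ((stepS L 2 τ W)^[n + 1] a)‖ =
        ‖z (s + τ) - flowS L (-(s + τ)) (inclS L ((stepS L 2 τ W)^[n + 1] a))‖ := by
      rw [← norm_flowS (L := L) (s + τ) (z (s + τ) - _), map_sub, flowS_add, add_neg_cancel,
        flowS_zero]
    rw [e3]
    refine hgr.trans ((gronwallBound_le hK0 hε0).trans ?_)
    have h5 : 1 ≤ Real.exp (K * s) := Real.one_le_exp (by positivity)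
    calc (s * ε * Real.exp (K * s) + ε * τ) * Real.exp (K * τ)
        ≤ (s * ε * Real.exp (K * s) + ε * τ * Real.exp (K * s)) * Real.exp (K * τ) := by
          refine mul_le_mul_of_nonneg_right (add_le_add le_rfl ?_) (Real.exp_pos _).le
          exact le_mul_of_one_le_right (by positivity) h5
      _ = (s + τ) * ε * Real.exp (K * (s + τ)) := by
        rw [mul_add K, Real.exp_add]; ring

end

section

/-! ### Gaussian exponential moments -/

instance : IsProbabilityMeasure gaussProd := by unfold gaussProd; infer_instance

theorem integrable_exp_mul_abs (c : ℝ) :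
    Integrable (fun x => Real.exp (c * |x|)) (gaussianReal 0 1) := by
  refine Integrable.mono' ((integrable_exp_mul_gaussianReal (μ := 0) (v := 1) c).add
    (integrable_exp_mul_gaussianReal (μ := 0) (v := 1) (-c))) (by fun_prop)
    (ae_of_all _ fun x => ?_)
  rw [Real.norm_of_nonneg (Real.exp_pos _).le]
  rcases abs_cases x with ⟨h, -⟩ | ⟨h, -⟩ <;> rw [h]
  · exact le_add_of_nonneg_right (Real.exp_pos _).le
  · rw [mul_neg, ← neg_mul]
    exact le_add_of_nonneg_left (Real.exp_pos _).le

/-- All exponential moments of `∑ αⱼ |ξⱼ|` are finite. By convexity of the exponential, with the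
weights `αⱼ / A` for `A = 1 + ∑ αⱼ`, the exponential of the sum is at most
`1 + ∑ (αⱼ / A) exp (c A |ξⱼ|)`, which is integrable. The bound is stated through such a majorant,
so that it also yields the almost sure convergence of the series. -/
theorem exists_exp_dominating {α : ℕ → ℝ} (hα : ∀ j, 0 ≤ α j) (hs : Summable α) {c : ℝ}
    (hc : 1 ≤ c) : ∃ H : (ℕ → ℝ) → ℝ, Integrable H gaussProd ∧
      ∀ᵐ ξ ∂gaussProd, (Summable fun j => α j * |ξ j|) ∧
        Real.exp (c * ∑' j, α j * |ξ j|) ≤ H ξ := by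
  set A : ℝ := 1 + ∑' j, α j with hA
  have hA0 : 0 < A := by
    have : 0 ≤ ∑' j, α j := tsum_nonneg hα
    positivity
  set h : ℕ → (ℕ → ℝ) → ℝ := fun j ξ => α j / A * Real.exp (c * A * |ξ j|) with hh
  have hhm : ∀ j, Measurable (h j) := fun j => by
    simp only [hh]; fun_prop
  have hh0 : ∀ j ξ, 0 ≤ h j ξ := fun j ξ =>
    mul_nonneg (div_nonneg (hα j) hA0.le) (Real.exp_pos _).le
  set I := ∫ x, Real.exp (c * A * |x|) ∂(gaussianReal 0 1) with hI
  have hint : ∀ j, ∫⁻ ξ, ENNReal.ofReal (h j ξ) ∂gaussProd = ENNReal.ofReal (α j / A * I) := by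
    intro j
    have hmp := measurePreserving_eval_infinitePi (fun _ : ℕ => gaussianReal 0 1) j
    have e : ∫⁻ ξ, ENNReal.ofReal (h j ξ) ∂gaussProd =
        ∫⁻ x, ENNReal.ofReal (α j / A * Real.exp (c * A * |x|)) ∂(gaussianReal 0 1) := by
      rw [← hmp.lintegral_comp (by fun_prop)]
      rfl
    rw [e, ← ofReal_integral_eq_lintegral_ofReal ((integrable_exp_mul_abs _).const_mul _)
      (ae_of_all _ fun x => mul_nonneg (div_nonneg (hα j) hA0.le) (Real.exp_pos _).le),
      integral_const_mul]
  have hI0 : 0 ≤ I := integral_nonneg fun x => (Real.exp_pos _).le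
  have htot : ∫⁻ ξ, ∑' j, ENNReal.ofReal (h j ξ) ∂gaussProd ≠ ⊤ := by
    rw [lintegral_tsum fun j => (hhm j).ennreal_ofReal.aemeasurable]
    simp only [hint]
    rw [← ENNReal.ofReal_tsum_of_nonneg (fun j => mul_nonneg (div_nonneg (hα j) hA0.le) hI0)
      ((hs.div_const _).mul_right _)]
    exact ENNReal.ofReal_ne_top
  have hmeas : AEMeasurable (fun ξ => ∑' j, ENNReal.ofReal (h j ξ)) gaussProd :=
    (Measurable.tsum fun j => (hhm j).ennreal_ofReal).aemeasurable
  refine ⟨fun ξ => 1 + (∑' j, ENNReal.ofReal (h j ξ)).toReal,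
    (integrable_const 1).add (integrable_toReal_of_lintegral_ne_top hmeas htot), ?_⟩
  filter_upwards [ae_lt_top' hmeas htot] with ξ hξ
  have hle : ∀ n : ℕ, Real.exp (c * ∑ j ∈ range n, α j * |ξ j|) ≤
      1 + (∑' j, ENNReal.ofReal (h j ξ)).toReal := fun n => by
    have hw : ∑ j ∈ range n, α j / A ≤ 1 := by
      rw [← Finset.sum_div, div_le_one hA0, hA]
      have := hs.sum_le_tsum (range n) (fun j _ => hα j)
      linarith
    have hj := convexOn_exp.map_add_sum_le (t := range n) (w := fun j => α j / A)
      (p := fun j => c * A * |ξ j|) (v := 1 - ∑ j ∈ range n, α j / A) (q := 0)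
      (fun j _ => div_nonneg (hα j) hA0.le) (by ring) (fun _ _ => Set.mem_univ _) (by linarith)
      (Set.mem_univ _)
    simp only [smul_eq_mul, mul_zero, zero_add, Real.exp_zero, mul_one] at hj
    have e : c * ∑ j ∈ range n, α j * |ξ j| = ∑ j ∈ range n, α j / A * (c * A * |ξ j|) := by
      rw [Finset.mul_sum]
      refine Finset.sum_congr rfl fun j _ => ?_
      field_simp
    rw [e]
    refine hj.trans (add_le_add ?_ ?_)
    · have : 0 ≤ ∑ j ∈ range n, α j / A :=
        Finset.sum_nonneg fun j _ => div_nonneg (hα j) hA0.le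
      linarith
    · change ∑ j ∈ range n, h j ξ ≤ _
      rw [← ENNReal.toReal_ofReal (Finset.sum_nonneg fun j _ => hh0 j ξ)]
      refine ENNReal.toReal_mono hξ.ne ?_
      rw [ENNReal.ofReal_sum_of_nonneg fun j _ => hh0 j ξ]
      exact ENNReal.sum_le_tsum _
  have hsum : Summable fun j => α j * |ξ j| := by
    refine summable_of_sum_range_le (c := 1 + (∑' j, ENNReal.ofReal (h j ξ)).toReal)
      (fun j => mul_nonneg (hα j) (abs_nonneg _)) fun n => ?_
    refine le_trans ?_ (hle n)
    have h0 : 0 ≤ ∑ j ∈ range n, α j * |ξ j| :=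
      Finset.sum_nonneg fun j _ => mul_nonneg (hα j) (abs_nonneg _)
    have := Real.add_one_le_exp (c * ∑ j ∈ range n, α j * |ξ j|)
    nlinarith
  refine ⟨hsum, ?_⟩
  have ht : Tendsto (fun n => Real.exp (c * ∑ j ∈ range n, α j * |ξ j|)) atTop
      (𝓝 (Real.exp (c * ∑' j, α j * |ξ j|))) :=
    (Real.continuous_exp.tendsto _).comp ((hsum.hasSum.tendsto_sum_nat).const_mul c)
  exact le_of_tendsto' ht hle

/-- The restriction of `ξ ∈ ℝ^ℕ` to its first `m` coordinates. -/
def restr (m : ℕ) (ξ : ℕ → ℝ) : Fin m → ℝ := fun j => ξ j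

/-- The standard Gaussian measure on `ℝ^m`. -/
def gaussFin (m : ℕ) : Measure (Fin m → ℝ) := Measure.pi fun _ => gaussianReal 0 1

theorem measurable_restr (m : ℕ) : Measurable (restr m) :=
  measurable_pi_lambda _ fun _ => measurable_pi_apply _

theorem measurePreserving_restr (m : ℕ) : MeasurePreserving (restr m) gaussProd (gaussFin m) := by
  refine ⟨measurable_restr m, ?_⟩
  refine (Measure.pi_eq fun t ht => ?_).symm
  rw [Measure.map_apply (measurable_restr m) (MeasurableSet.univ_pi ht)]
  set t' : ℕ → Set ℝ := fun j => if h : j < m then t ⟨j, h⟩ else Set.univ with ht'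
  have e : restr m ⁻¹' (Set.univ.pi t) = Set.pi (↑(range m)) t' := by
    ext ξ
    simp only [Set.mem_preimage, Set.mem_pi, Set.mem_univ, true_imp_iff, coe_range, Set.mem_Iio,
      restr, ht']
    constructor
    · intro h j hj
      rw [dif_pos hj]; exact h ⟨j, hj⟩
    · intro h j
      have := h j j.2
      rwa [dif_pos j.2] at this
  rw [e, gaussProd, Measure.infinitePi_pi]
  · rw [← Fin.prod_univ_eq_prod_range (fun j => gaussianReal 0 1 (t' j)) m]
    refine Finset.prod_congr rfl fun j _ => ?_
    simp only [ht', j.2, dif_pos]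
  · intro j hj
    simp only [ht']
    split_ifs with h
    · exact ht _
    · exact MeasurableSet.univ

variable {L : ℝ} [hL : Fact (0 < L)]

local notation "haar" => (AddCircle.haarAddCircle (T := L))

/-! ### Pathwise error of the observable -/

set_option maxHeartbeats 1000000 in
/-- The pathwise error of the observable is of first order in the time step and in the
truncation of the potential, with a constant growing exponentially in the potential. -/
theorem obs_error (G : StrongDual ℂ (SobolevSpace L 1)) (a : SeqL2) {T : ℝ} (hT : 0 < T) :
    ∃ C c : ℝ, 0 ≤ C ∧ 1 ≤ c ∧ ∀ (z : ℝ → SeqL2) (w W : SeqL2), z 0 = inclS L a →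
    (∀ t, 0 ≤ t → HasDerivAt z
        (-Complex.I • flowS L (-t) (mulS L 0 w (flowS L t (z t)))) t) →
    ∀ ρ : ℝ, ‖w‖ ≤ ρ → ‖W‖ ≤ ρ → ∀ (τ : ℝ) (n : ℕ), 0 ≤ τ → n * τ ≤ T →
      ‖obsS G (inclS L ((stepS L 2 τ W)^[n] a))‖ ≤ C * Real.exp (c * ρ) ∧
      ‖obsS G (flowS L (n * τ) (z (n * τ))) - obsS G (inclS L ((stepS L 2 τ W)^[n] a))‖ ≤
        C * Real.exp (c * ρ) * (‖inclS L W - w‖ + τ) := by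
  have hc0 := algConst_nonneg (L := L) 0
  have hc2 := algConst_nonneg (L := L) 2
  have hwc := wtConst_nonneg (L := L)
  set c₁ := T * algConst L 2 + algConst L 0 * T + 1 with hc₁
  set K₁ := T * ‖a‖ * (algConst L 0 + 4 * wtConst L) with hK₁
  set Kd := ‖dualS G‖ * algConst L 0 with hKd
  have hKd0 : 0 ≤ Kd := by positivity
  have hK₁0 : 0 ≤ K₁ := by positivity
  have hc₁1 : 1 ≤ c₁ := by
    have : 0 ≤ T * algConst L 2 + algConst L 0 * T := by positivity
    linarith
  refine ⟨Kd * (2 * ‖a‖ + K₁ * (2 + T)) * K₁ + Kd * ‖a‖ ^ 2, 2 * c₁ + 1, by positivity, by linarith,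
    fun z w W hz0 hz ρ hwρ hWρ τ n hτ hn => ?_⟩
  have hρ0 : 0 ≤ ρ := (norm_nonneg _).trans hwρ
  set ψ := inclS L ((stepS L 2 τ W)^[n] a) with hψ
  set M := Real.exp (T * (algConst L 2 * ‖W‖)) * ‖a‖ with hM
  set E := Real.exp (c₁ * ρ) with hE
  have hE1 : 1 ≤ E := Real.one_le_exp (by positivity)
  have hρE : ρ ≤ Real.exp ρ := by have := Real.add_one_le_exp ρ; linarith
  have hME : M ≤ E * ‖a‖ := by
    refine mul_le_mul_of_nonneg_right (Real.exp_le_exp.2 ?_) (norm_nonneg _)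
    calc T * (algConst L 2 * ‖W‖) ≤ T * (algConst L 2 * ρ) := by gcongr
      _ ≤ _ := by rw [hc₁]; nlinarith [mul_nonneg hc0 hT.le]
  have hψM : ‖ψ‖ ≤ M := by
    refine (norm_inclS_le _).trans ((norm_iterate_step_le τ hτ 2 W a n).trans ?_)
    rw [hM]
    gcongr
  have hψE : ‖ψ‖ ≤ E * ‖a‖ := hψM.trans hME
  have hEE : Real.exp ((2 * c₁ + 1) * ρ) = E * E * Real.exp ρ := by
    rw [hE, ← Real.exp_add, ← Real.exp_add]; congr 1; ring
  have hexp1 : 1 ≤ Real.exp ρ := Real.one_le_exp hρ0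
  rw [hEE]
  constructor
  · refine (norm_obsS_le G ψ).trans ?_
    calc Kd * ‖ψ‖ ^ 2 ≤ Kd * (E * ‖a‖) ^ 2 := by gcongr
      _ = Kd * ‖a‖ ^ 2 * (E * E * 1) := by ring
      _ ≤ (Kd * (2 * ‖a‖ + K₁ * (2 + T)) * K₁ + Kd * ‖a‖ ^ 2) * (E * E * Real.exp ρ) := by
        gcongr
        have : 0 ≤ Kd * (2 * ‖a‖ + K₁ * (2 + T)) * K₁ := by positivity
        linarith
  -- for `n ≥ 1` the step `τ` is at most `T`; for `n = 0` it is arbitrary, but there is no error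
  rcases Nat.eq_zero_or_pos n with hn0 | hn0
  · have e : flowS L (n * τ) (z (n * τ)) = ψ := by
      rw [hψ, hn0]; simp [flowS_zero, hz0]
    rw [e, sub_self, norm_zero]
    positivity
  have hτT : τ ≤ T := le_trans (le_mul_of_one_le_left hτ (by exact_mod_cast hn0)) hn
  set D := ‖inclS L W - w‖ with hD
  have hD2 : D ≤ 2 * ρ := by
    refine (norm_sub_le _ _).trans ?_
    have := norm_inclS_le (L := L) W
    linarith
  set φ := flowS L (n * τ) (z (n * τ)) with hφ
  have herr : ‖φ - ψ‖ ≤ K₁ * (D + τ) * E := by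
    have h := splitting_error hz0 hz hτ hM.ge n hn
    have hE2 : Real.exp (T * (algConst L 2 * ρ)) * Real.exp (algConst L 0 * ρ * T) * Real.exp ρ = E := by
      rw [← Real.exp_add, ← Real.exp_add, hE, hc₁]; congr 1; ring
    have hMρ : M ≤ Real.exp (T * (algConst L 2 * ρ)) * ‖a‖ := by rw [hM]; gcongr
    have hX : algConst L 0 * D * M + 4 * τ * wtConst L * M * ‖W‖ ≤
        (algConst L 0 + 4 * wtConst L) * (D + τ) * M * Real.exp ρ := by
      have hM0 : 0 ≤ M := by positivity
      have hD0 : 0 ≤ D := norm_nonneg _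
      calc algConst L 0 * D * M + 4 * τ * wtConst L * M * ‖W‖
          ≤ algConst L 0 * D * M * Real.exp ρ + 4 * τ * wtConst L * M * Real.exp ρ := by
            refine add_le_add (le_mul_of_one_le_right (by positivity) hexp1) ?_
            gcongr
            exact hWρ.trans hρE
        _ = (algConst L 0 * D + 4 * wtConst L * τ) * M * Real.exp ρ := by ring
        _ ≤ _ := by
          gcongr
          nlinarith [mul_nonneg hc0 hτ, mul_nonneg hwc hD0]
    have hD0 : 0 ≤ D := norm_nonneg _
    calc _ ≤ _ := h
      _ ≤ T * ((algConst L 0 + 4 * wtConst L) * (D + τ) *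
          (Real.exp (T * (algConst L 2 * ρ)) * ‖a‖) * Real.exp ρ) *
          Real.exp (algConst L 0 * ρ * T) := by
        gcongr
        exact hX.trans (by gcongr)
      _ = K₁ * (D + τ) * (Real.exp (T * (algConst L 2 * ρ)) * Real.exp (algConst L 0 * ρ * T) *
          Real.exp ρ) := by rw [hK₁]; ring
      _ = _ := by rw [hE2]
  -- the observable is quadratic, so its increment costs a factor `‖φ‖ + ‖ψ‖`
  have hsum : ‖φ‖ + ‖ψ‖ ≤ (2 * ‖a‖ + K₁ * (2 + T)) * (E * Real.exp ρ) := by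
    have h1 : ‖φ‖ ≤ ‖φ - ψ‖ + ‖ψ‖ := norm_le_norm_sub_add _ _
    have h2 : K₁ * (D + τ) * E ≤ K₁ * (2 + T) * (E * Real.exp ρ) := by
      have : D + τ ≤ (2 + T) * Real.exp ρ := by nlinarith
      calc K₁ * (D + τ) * E ≤ K₁ * ((2 + T) * Real.exp ρ) * E := by gcongr
        _ = _ := by ring
    have h3 : E * ‖a‖ ≤ ‖a‖ * (E * Real.exp ρ) := by
      rw [mul_comm]
      gcongr
      exact le_mul_of_one_le_right (by positivity) hexp1
    linarith
  refine (norm_obsS_sub_le G φ ψ).trans ?_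
  have hD0 : 0 ≤ D := norm_nonneg _
  calc _ ≤ Kd * ((2 * ‖a‖ + K₁ * (2 + T)) * (E * Real.exp ρ)) * (K₁ * (D + τ) * E) := by gcongr
    _ = Kd * (2 * ‖a‖ + K₁ * (2 + T)) * K₁ * (E * E * Real.exp ρ) * (D + τ) := by ring
    _ ≤ _ := by
      gcongr
      have : 0 ≤ Kd * ‖a‖ ^ 2 := by positivity
      linarith

/-! ### Continuity of the semi-discrete observable in the random parameters -/

theorem continuous_truncS (V0 : SeqL2) (lam : ℕ → ℝ) (V : ℕ → SeqL2) (m : ℕ) :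
    Continuous (truncS V0 lam V m) := by
  unfold truncS
  fun_prop

theorem Continuous.kickS {X : Type*} [TopologicalSpace X] {w a : X → SeqL2} (r : ℕ) (τ : ℝ)
    (hw : Continuous w) (ha : Continuous a) : Continuous fun x => kickS L r τ (w x) (a x) := by
  let _ : NormedAlgebra ℚ (SeqL2 →L[ℂ] SeqL2) := NormedAlgebra.restrictScalars ℚ ℂ _
  have h0 : Continuous fun x => (-Complex.I * (τ : ℂ)) • mulS L r (w x) :=
    (continuous_const_smul (-Complex.I * (τ : ℂ))).comp ((mulS L r).continuous.comp hw)
  have h1 : Continuous fun x => QMCTS.kickS L r τ (w x) := NormedSpace.exp_continuous.comp h0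
  exact h1.clm_apply ha

theorem continuous_iterate_step (V0 : SeqL2) (lam : ℕ → ℝ) (V : ℕ → SeqL2) (a : SeqL2) (m r : ℕ)
    (τ : ℝ) (n : ℕ) :
    Continuous fun ξ => (stepS L r τ (truncS V0 lam V m ξ))^[n] a := by
  induction n with
  | zero => exact continuous_const
  | succ n ih =>
    simp only [Function.iterate_succ_apply', stepS]
    exact (flowS L τ).continuous.comp (Continuous.kickS r τ (continuous_truncS V0 lam V m) ih)

theorem continuous_obsS (G : StrongDual ℂ (SobolevSpace L 1)) : Continuous (obsS G) := by
  unfold obsS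
  exact (dualS G).continuous.comp ((mulS L 0).continuous.clm_apply conjS.continuous)

/-- The semi-discrete observable as a function of the random parameters. -/
def semiObs (G : StrongDual ℂ (SobolevSpace L 1)) (V0 : SeqL2) (lam : ℕ → ℝ) (V : ℕ → SeqL2)
    (a : SeqL2) (m : ℕ) (τ : ℝ) (n : ℕ) (ξ : Fin m → ℝ) : ℂ :=
  obsS G (inclS L ((stepS L 2 τ (truncS V0 lam V m ξ))^[n] a))

theorem continuous_semiObs (G : StrongDual ℂ (SobolevSpace L 1)) (V0 : SeqL2) (lam : ℕ → ℝ)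
    (V : ℕ → SeqL2) (a : SeqL2) (m : ℕ) (τ : ℝ) (n : ℕ) :
    Continuous (semiObs G V0 lam V a m τ n) :=
  (continuous_obsS G).comp ((inclS L).continuous.comp (continuous_iterate_step V0 lam V a m 2 τ n))

theorem observable_semiDiscrete (G : StrongDual ℂ (SobolevSpace L 1)) {v₀ : AddCircle L → ℝ}
    {lam : ℕ → ℝ} {v : ℕ → AddCircle L → ℝ} {V0 : SeqL2} {V : ℕ → SeqL2}
    {ψin : AddCircle L → ℂ} {a : SeqL2}
    (h0 : cplx v₀ =ᵐ[haar] ev L 2 V0)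
    (hV : ∀ j, cplx (v j) =ᵐ[haar] ev L 2 (V j)) (hψ : ψin =ᵐ[haar] ev L 2 a)
    (m : ℕ) (τ : ℝ) (n : ℕ) (ξ : Fin m → ℝ) :
    observable G (semiDiscrete v₀ lam v ψin m τ n ξ) = semiObs G V0 lam V a m τ n ξ := by
  refine observable_eq G ?_
  rw [ev_inclS]
  exact iterate_lieStep hψ (truncPotential_ae h0 hV m ξ) τ n

end

section
variable {L : ℝ} [hL : Fact (0 < L)]

local notation "haar" => (AddCircle.haarAddCircle (T := L))

/-! ### The error of the expectation -/

/-- The random potential as a sequence. -/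
def potS (V0 : SeqL2) (lam : ℕ → ℝ) (V : ℕ → SeqL2) (ξ : ℕ → ℝ) : SeqL2 :=
  V0 + ∑' j, ((lam j * ξ j : ℝ) : ℂ) • V j

theorem norm_term {lam : ℕ → ℝ} (hlam : ∀ j, 0 ≤ lam j) (V : ℕ → SeqL2) (ξ : ℕ → ℝ) (j : ℕ) :
    ‖((lam j * ξ j : ℝ) : ℂ) • V j‖ = lam j * ‖V j‖ * |ξ j| := by
  rw [norm_smul, Complex.norm_real, Real.norm_eq_abs, abs_mul, abs_of_nonneg (hlam j)]; ring

section
variable (V0 : SeqL2) {lam : ℕ → ℝ} (hlam : ∀ j, 0 ≤ lam j) {V : ℕ → SeqL2} {ξ : ℕ → ℝ}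
  (hξ : Summable fun j => lam j * ‖V j‖ * |ξ j|)
include hlam hξ

theorem summable_term : Summable fun j => ((lam j * ξ j : ℝ) : ℂ) • V j :=
  Summable.of_norm (hξ.congr fun j => (norm_term hlam V ξ j).symm)

theorem norm_potS_le : ‖potS V0 lam V ξ‖ ≤ ‖V0‖ + ∑' j, lam j * ‖V j‖ * |ξ j| := by
  refine (norm_add_le _ _).trans (add_le_add le_rfl ?_)
  refine (norm_tsum_le_tsum_norm (hξ.congr fun j => (norm_term hlam V ξ j).symm)).trans ?_
  simp only [norm_term hlam, le_refl]

theorem norm_truncS_restr_le (m : ℕ) :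
    ‖truncS V0 lam V m (restr m ξ)‖ ≤ ‖V0‖ + ∑' j, lam j * ‖V j‖ * |ξ j| := by
  refine (norm_add_le _ _).trans (add_le_add le_rfl ?_)
  refine (norm_sum_le _ _).trans ?_
  simp only [restr, norm_term hlam]
  rw [Fin.sum_univ_eq_sum_range (fun j => lam j * ‖V j‖ * |ξ j|) m]
  exact hξ.sum_le_tsum _ fun j _ => mul_nonneg (mul_nonneg (hlam j) (norm_nonneg _)) (abs_nonneg _)

theorem tendsto_truncS :
    Tendsto (fun m => truncS V0 lam V m (restr m ξ)) atTop (𝓝 (potS V0 lam V ξ)) := by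
  have h := (summable_term hlam hξ).hasSum.tendsto_sum_nat.const_add V0
  refine h.congr fun m => ?_
  rw [truncS]
  simp only [restr]
  rw [Fin.sum_univ_eq_sum_range (fun j => ((lam j * ξ j : ℝ) : ℂ) • V j) m]

end

/-- The `H¹` distance between the truncated and the full potential. -/
def truncDist (L : ℝ) (V0 : SeqL2) (lam : ℕ → ℝ) (V : ℕ → SeqL2) (m : ℕ) (ξ : ℕ → ℝ) : ℝ :=
  ‖inclS L (truncS V0 lam V m (restr m ξ)) - inclS L (potS V0 lam V ξ)‖

theorem continuous_truncS_restr (V0 : SeqL2) (lam : ℕ → ℝ) (V : ℕ → SeqL2) (m : ℕ) :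
    Continuous fun ξ : ℕ → ℝ => truncS V0 lam V m (restr m ξ) :=
  (continuous_truncS V0 lam V m).comp (continuous_pi fun _ => continuous_apply _)

omit hL in
theorem aestronglyMeasurable_truncDist (V0 : SeqL2) {lam : ℕ → ℝ} (hlam : ∀ j, 0 ≤ lam j)
    {V : ℕ → SeqL2} (hs : Summable fun j => lam j * ‖V j‖) (m : ℕ) :
    AEStronglyMeasurable (truncDist L V0 lam V m) gaussProd := by
  refine aestronglyMeasurable_of_tendsto_ae atTop
    (f := fun N ξ => ‖inclS L (truncS V0 lam V m (restr m ξ))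
      - inclS L (truncS V0 lam V N (restr N ξ))‖) (fun N => ?_) ?_
  · have h1 := (inclS L).continuous.comp (continuous_truncS_restr V0 lam V m)
    have h2 := (inclS L).continuous.comp (continuous_truncS_restr V0 lam V N)
    exact ((h1.sub h2).norm).measurable.aestronglyMeasurable
  · obtain ⟨H, -, hH⟩ := exists_exp_dominating
      (fun j => mul_nonneg (hlam j) (norm_nonneg (V j))) hs le_rfl
    filter_upwards [hH] with ξ hξ
    have h := ((inclS L).continuous.tendsto _).comp (tendsto_truncS V0 hlam hξ.1)
    exact (h.const_sub _).norm

set_option maxHeartbeats 1000000 in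
/-- Integrability of the observable of the exact solution, and the error of its expectation
caused by truncation and time discretization. The exact solution enters through its
interaction picture `Z`. -/
theorem expectation_error (G : StrongDual ℂ (SobolevSpace L 1)) (a V0 : SeqL2) {lam : ℕ → ℝ}
    (hlam : ∀ j, 0 ≤ lam j) {V : ℕ → SeqL2} (hs : Summable fun j => lam j * ‖V j‖)
    {T K χ : ℝ} (hT : 0 < T) (hK : 0 ≤ K)
    (hrate : ∀ m : ℕ, 1 ≤ m → eLpNorm (truncDist L V0 lam V m) 2 gaussProd
      ≤ ENNReal.ofReal (K * (m : ℝ) ^ (-χ)))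
    {Z : (ℕ → ℝ) → ℝ → SeqL2}
    (hZ : ∀ᵐ ξ ∂gaussProd, Z ξ 0 = inclS L a ∧ ∀ t, 0 ≤ t → HasDerivAt (Z ξ)
        (-Complex.I • flowS L (-t) (mulS L 0 (inclS L (potS V0 lam V ξ)) (flowS L t (Z ξ t)))) t) :
    (∀ t, 0 ≤ t → t ≤ T → Integrable (fun ξ => obsS G (flowS L t (Z ξ t))) gaussProd) ∧
    ∃ C : ℝ, 0 ≤ C ∧ ∀ (m : ℕ) (τ : ℝ) (n : ℕ), 1 ≤ m → 0 ≤ τ → n * τ ≤ T →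
      ‖(∫ ξ, obsS G (flowS L (n * τ) (Z ξ (n * τ))) ∂gaussProd)
        - ∫ ξ, semiObs G V0 lam V a m τ n ξ ∂(gaussFin m)‖ ≤ C * ((m : ℝ) ^ (-χ) + τ) := by
  obtain ⟨C, c, hC, hc, hE⟩ := obs_error G a hT
  obtain ⟨H, hHint, hH⟩ := exists_exp_dominating
      (fun j => mul_nonneg (hlam j) (norm_nonneg (V j))) hs (c := 2 * c) (by linarith)
  -- all pathwise constants are bounded by a multiple of `√H`
  have hpath : ∀ᵐ ξ ∂gaussProd, (Summable fun j => lam j * ‖V j‖ * |ξ j|) ∧ 0 ≤ H ξ ∧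
      ∀ (m : ℕ) (τ : ℝ) (n : ℕ), 0 ≤ τ → n * τ ≤ T →
        ‖semiObs G V0 lam V a m τ n (restr m ξ)‖ ≤
          C * Real.exp (c * ‖V0‖) * Real.sqrt (H ξ) ∧
        ‖obsS G (flowS L (n * τ) (Z ξ (n * τ))) - semiObs G V0 lam V a m τ n (restr m ξ)‖ ≤
          C * Real.exp (c * ‖V0‖) * Real.sqrt (H ξ) * (truncDist L V0 lam V m ξ + τ) := by
    filter_upwards [hH, hZ] with ξ hξ hZξ
    refine ⟨hξ.1, (Real.exp_pos _).le.trans hξ.2, fun m τ n hτ hn => ?_⟩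
    have hb : Real.exp (c * (‖V0‖ + ∑' j, lam j * ‖V j‖ * |ξ j|)) ≤
        Real.exp (c * ‖V0‖) * Real.sqrt (H ξ) := by
      rw [mul_add, Real.exp_add]
      gcongr
      refine Real.le_sqrt_of_sq_le ((le_of_eq ?_).trans hξ.2)
      rw [← Real.exp_nat_mul]; congr 1; push_cast; ring
    obtain ⟨h1, h2⟩ := hE (Z ξ) (inclS L (potS V0 lam V ξ)) (truncS V0 lam V m (restr m ξ))
      hZξ.1 hZξ.2 (‖V0‖ + ∑' j, lam j * ‖V j‖ * |ξ j|)
      ((norm_inclS_le _).trans (norm_potS_le V0 hlam hξ.1)) (norm_truncS_restr_le V0 hlam hξ.1 m)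
      τ n hτ hn
    refine ⟨h1.trans (by rw [mul_assoc]; gcongr), h2.trans ?_⟩
    have hD : 0 ≤ truncDist L V0 lam V m ξ + τ := add_nonneg (norm_nonneg _) hτ
    rw [mul_assoc C (Real.exp (c * ‖V0‖))]
    change C * _ * (truncDist L V0 lam V m ξ + τ) ≤ _
    gcongr
  -- `√H` is square integrable
  have hsH : MemLp (fun ξ => Real.sqrt (H ξ)) 2 gaussProd := by
    refine (memLp_two_iff_integrable_sq
      (Real.continuous_sqrt.comp_aestronglyMeasurable hHint.1)).2 ?_
    refine hHint.congr ?_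
    filter_upwards [hpath] with ξ hξ
    rw [Real.sq_sqrt hξ.2.1]
  have hsH1 : Integrable (fun ξ => Real.sqrt (H ξ)) gaussProd := hsH.integrable (by norm_num)
  have hsemi : ∀ (m : ℕ) (τ : ℝ) (n : ℕ), 0 ≤ τ → n * τ ≤ T →
      Integrable (fun ξ => semiObs G V0 lam V a m τ n (restr m ξ)) gaussProd := by
    intro m τ n hτ hn
    refine Integrable.mono' (hsH1.const_mul (C * Real.exp (c * ‖V0‖)))
      (((continuous_semiObs G V0 lam V a m τ n).comp
        (continuous_pi fun _ => continuous_apply _)).measurable.aestronglyMeasurable) ?_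
    filter_upwards [hpath] with ξ hξ
    exact (hξ.2.2 m τ n hτ hn).1
  -- for integrability, in particular measurability, the observable of the exact solution is the
  -- limit of the semi-discrete ones with `m = k` and `τ = t / (k + 1)`
  have hint : ∀ t, 0 ≤ t → t ≤ T →
      Integrable (fun ξ => obsS G (flowS L t (Z ξ t))) gaussProd := by
    intro t ht0 htT
    have hk : ∀ k : ℕ, ((k + 1 : ℕ) : ℝ) * (t / (k + 1 : ℕ)) = t := fun k => by
      field_simp
    have htend : ∀ᵐ ξ ∂gaussProd, Tendsto
        (fun k : ℕ => semiObs G V0 lam V a k (t / (k + 1 : ℕ)) (k + 1) (restr k ξ)) atTop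
        (𝓝 (obsS G (flowS L t (Z ξ t)))) := by
      filter_upwards [hpath] with ξ hξ
      rw [tendsto_iff_norm_sub_tendsto_zero]
      have hD : Tendsto (fun k : ℕ => C * Real.exp (c * ‖V0‖) * Real.sqrt (H ξ) *
          (truncDist L V0 lam V k ξ + t / (k + 1 : ℕ))) atTop (𝓝 0) := by
        have h := ((inclS L).continuous.tendsto _).comp (tendsto_truncS V0 hlam hξ.1)
        have h1 : Tendsto (fun k => truncDist L V0 lam V k ξ) atTop (𝓝 0) :=
          tendsto_iff_norm_sub_tendsto_zero.1 h
        have h2 : Tendsto (fun k : ℕ => t / ((k + 1 : ℕ) : ℝ)) atTop (𝓝 0) :=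
          (tendsto_const_div_atTop_nhds_zero_nat t).comp (tendsto_add_atTop_nat 1)
        have := (h1.add h2).const_mul (C * Real.exp (c * ‖V0‖) * Real.sqrt (H ξ))
        simpa using this
      refine squeeze_zero (fun _ => norm_nonneg _) (fun k => ?_) hD
      have h := (hξ.2.2 k (t / (k + 1 : ℕ)) (k + 1) (by positivity) (by rw [hk]; exact htT)).2
      rw [hk] at h
      rw [norm_sub_rev]; exact h
    refine Integrable.mono' (hsH1.const_mul (C * Real.exp (c * ‖V0‖)))
      (aestronglyMeasurable_of_tendsto_ae atTop (fun k =>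
        (hsemi k (t / (k + 1 : ℕ)) (k + 1) (by positivity) (by rw [hk]; exact htT)).1) htend) ?_
    filter_upwards [hpath, htend] with ξ hξ hξt
    refine le_of_tendsto' hξt.norm fun k => ?_
    exact (hξ.2.2 k (t / (k + 1 : ℕ)) (k + 1) (by positivity) (by rw [hk]; exact htT)).1
  refine ⟨hint, ?_⟩
  set S := (∫ ξ, Real.sqrt (H ξ) ^ (2:ℝ) ∂gaussProd) ^ (1 / (2:ℝ)) with hS
  have hS0 : 0 ≤ S := by positivity
  set I := ∫ ξ, Real.sqrt (H ξ) ∂gaussProd with hI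
  have hI0 : 0 ≤ I := integral_nonneg fun _ => Real.sqrt_nonneg _
  set B := C * Real.exp (c * ‖V0‖) with hB
  refine ⟨B * (S * K + I), by positivity, fun m τ n hm hτ hn => ?_⟩
  have hDm : MemLp (truncDist L V0 lam V m) 2 gaussProd :=
    ⟨aestronglyMeasurable_truncDist V0 hlam hs m, (hrate m hm).trans_lt ENNReal.ofReal_lt_top⟩
  have hDint : Integrable (fun ξ => Real.sqrt (H ξ) * truncDist L V0 lam V m ξ) gaussProd :=
    hsH.integrable_mul hDm
  have hbint : Integrable (fun ξ => B * (Real.sqrt (H ξ) * truncDist L V0 lam V m ξ) +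
      B * τ * Real.sqrt (H ξ)) gaussProd := (hDint.const_mul _).add (hsH1.const_mul _)
  have hmap : ∫ ξ, semiObs G V0 lam V a m τ n ξ ∂(gaussFin m) =
      ∫ ξ, semiObs G V0 lam V a m τ n (restr m ξ) ∂gaussProd := by
    rw [← (measurePreserving_restr m).map_eq, integral_map (measurable_restr m).aemeasurable]
    exact (continuous_semiObs G V0 lam V a m τ n).measurable.aestronglyMeasurable
  have hD2 : (∫ ξ, truncDist L V0 lam V m ξ ^ (2:ℝ) ∂gaussProd) ^ (1 / (2:ℝ)) ≤
      K * (m : ℝ) ^ (-χ) := by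
    have h := hrate m hm
    rw [hDm.eLpNorm_eq_integral_rpow_norm (by norm_num) (by norm_num)] at h
    have h2 := (ENNReal.ofReal_le_ofReal_iff (by positivity)).1 h
    simp only [ENNReal.toReal_ofNat] at h2
    rw [one_div]
    refine le_trans (le_of_eq ?_) h2
    congr 1
    refine integral_congr_ae (ae_of_all _ fun ξ => ?_)
    simp only [truncDist, norm_norm]
  have hCS : ∫ ξ, Real.sqrt (H ξ) * truncDist L V0 lam V m ξ ∂gaussProd ≤ S * (K * (m:ℝ) ^ (-χ)) := by
    refine (integral_mul_le_Lp_mul_Lq_of_nonneg (p := 2) (q := 2)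
      (f := fun ξ => Real.sqrt (H ξ)) (g := truncDist L V0 lam V m) (by constructor <;> norm_num)
      (ae_of_all _ fun ξ => Real.sqrt_nonneg _) (ae_of_all _ fun ξ => norm_nonneg _)
      (by simpa using hsH) (by simpa using hDm)).trans ?_
    gcongr
  rw [hmap, ← integral_sub (hint _ (by positivity) hn) (hsemi m τ n hτ hn)]
  refine (norm_integral_le_of_norm_le hbint ?_).trans ?_
  · filter_upwards [hpath] with ξ hξ
    refine (hξ.2.2 m τ n hτ hn).2.trans (le_of_eq ?_)
    ring
  · rw [integral_add (hDint.const_mul _) (hsH1.const_mul _), integral_const_mul, integral_const_mul]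
    have hm0 : 0 ≤ (m:ℝ) ^ (-χ) := by positivity
    have hB0 : 0 ≤ B := by positivity
    calc _ ≤ B * (S * (K * (m:ℝ) ^ (-χ))) + B * τ * I := by gcongr
      _ ≤ B * (S * K + I) * ((m:ℝ) ^ (-χ) + τ) := by
        have h1 : 0 ≤ B * (S * K) * τ := by positivity
        have h2 : 0 ≤ B * I * (m:ℝ) ^ (-χ) := by positivity
        nlinarith

end

section
variable {L : ℝ} [hL : Fact (0 < L)]

local notation "haar" => (AddCircle.haarAddCircle (T := L))

/-! ### Spatial derivatives and `L²` norms -/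

/-- The spatial derivative, from `H³` to `H²`. -/
def derivS (L : ℝ) : SeqL2 →L[ℂ] SeqL2 :=
  diagS (fun n => (2 * Real.pi * n / L : ℝ) * Complex.I / (wt L n : ℂ)) (fun n => by
    rw [norm_div, norm_mul, Complex.norm_I, mul_one, Complex.norm_real, Complex.norm_real,
      Real.norm_eq_abs, Real.norm_of_nonneg (wt_pos n).le, div_le_one (wt_pos n)]
    exact abs_le_wt n)

omit hL in
theorem cf_derivS (a : SeqL2) (n : ℤ) :
    cf L 1 (derivS L a) n = (2 * Real.pi * n / L : ℝ) * Complex.I * cf L 2 a n := by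
  rw [cf, cf, derivS, diagS_apply]
  have := wt_ne (L := L) n
  field_simp
  ring

theorem hasDerivAt_ev (a : SeqL2) (x : ℝ) :
    HasDerivAt (fun y : ℝ => ev L 2 a (y : AddCircle L)) (ev L 1 (derivS L a) (x : AddCircle L)) x := by
  have h1 : ∀ y : ℝ, HasSum (fun n => cf L 2 a n * fourier n (y : AddCircle L)) (ev L 2 a y) :=
    fun y => (hasSum_ev 2 a).mapL (ContinuousMap.evalCLM ℂ (y : AddCircle L))
  have h2 : HasSum (fun n => cf L 1 (derivS L a) n * fourier n (x : AddCircle L))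
      (ev L 1 (derivS L a) x) :=
    (hasSum_ev 1 (derivS L a)).mapL (ContinuousMap.evalCLM ℂ (x : AddCircle L))
  have hd : ∀ n (y : ℝ), HasDerivAt (fun y : ℝ => cf L 2 a n * fourier n (y : AddCircle L))
      (cf L 1 (derivS L a) n * fourier n (y : AddCircle L)) y := fun n y => by
    have := (hasDerivAt_fourier L n y).const_mul (cf L 2 a n)
    have e : cf L 1 (derivS L a) n * fourier n (y : AddCircle L) = cf L 2 a n *
        (2 * Real.pi * Complex.I * n / L * fourier n (y : AddCircle L)) := by
      rw [cf_derivS]; push_cast; ring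
    rw [e]
    exact this
  have hb : ∀ n (y : ℝ), ‖cf L 1 (derivS L a) n * fourier n (y : AddCircle L)‖ ≤
      ‖cf L 1 (derivS L a) n‖ := fun n y => by
    rw [norm_mul]
    refine mul_le_of_le_one_right (norm_nonneg _) ?_
    rw [← fourier_norm (T := L) n]
    exact ContinuousMap.norm_coe_le_norm _ _
  have h := hasDerivAt_tsum (summable_cf (L := L) 1 (derivS L a)) hd hb (h1 x).summable x
  rw [h2.tsum_eq] at h
  have e : (fun y : ℝ => ∑' n, cf L 2 a n * fourier n (y : AddCircle L)) =
      fun y : ℝ => ev L 2 a (y : AddCircle L) := funext fun y => (h1 y).tsum_eq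
  rwa [e] at h

theorem ev_derivS_mulS (v a : SeqL2) (x : AddCircle L) :
    ev L 1 (derivS L (mulS L 2 v a)) x =
      ev L 1 (derivS L v) x * ev L 2 a x + ev L 2 v x * ev L 1 (derivS L a) x := by
  induction x using QuotientAddGroup.induction_on with
  | H x =>
    have h1 := hasDerivAt_ev (L := L) (mulS L 2 v a) x
    have h2 := (hasDerivAt_ev (L := L) v x).mul (hasDerivAt_ev (L := L) a x)
    refine h1.unique (h2.congr_of_eventuallyEq (Eventually.of_forall fun y => ?_))
    simp only [ev_mulS, ContinuousMap.mul_apply]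
    rfl

theorem ev_derivS_kickS (τ : ℝ) (w a : SeqL2) (x : AddCircle L) :
    ev L 1 (derivS L (kickS L 2 τ w a)) x = Complex.exp (-Complex.I * τ * ev L 2 w x) *
      (ev L 1 (derivS L a) x - Complex.I * τ * ev L 1 (derivS L w) x * ev L 2 a x) := by
  induction x using QuotientAddGroup.induction_on with
  | H x =>
    have h1 := hasDerivAt_ev (L := L) (kickS L 2 τ w a) x
    have h2 := (((hasDerivAt_ev (L := L) w x).const_mul (-Complex.I * τ)).cexp).mul
      (hasDerivAt_ev (L := L) a x)
    have h3 := h1.unique (h2.congr_of_eventuallyEq (Eventually.of_forall fun y => by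
      simp only [ev_kickS]
      rfl))
    refine h3.trans ?_
    change Complex.exp (-Complex.I * τ * ev L 2 w (x : AddCircle L)) *
      (-Complex.I * τ * ev L 1 (derivS L w) (x : AddCircle L)) * ev L 2 a (x : AddCircle L) +
      Complex.exp (-Complex.I * τ * ev L 2 w (x : AddCircle L)) *
        ev L 1 (derivS L a) (x : AddCircle L) =
      Complex.exp (-Complex.I * τ * ev L 2 w (x : AddCircle L)) *
      (ev L 1 (derivS L a) (x : AddCircle L) - Complex.I * τ *
        ev L 1 (derivS L w) (x : AddCircle L) * ev L 2 a (x : AddCircle L))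
    ring

/-- The `L²` norm of a continuous function on the torus. -/
def nrmL2 (f : C(AddCircle L, ℂ)) : ℝ := ‖ContinuousMap.toLp (E := ℂ) 2 haar ℂ f‖

theorem nrmL2_add_le (f g : C(AddCircle L, ℂ)) : nrmL2 (f + g) ≤ nrmL2 f + nrmL2 g := by
  rw [nrmL2, map_add]; exact norm_add_le _ _

theorem nrmL2_nonneg (f : C(AddCircle L, ℂ)) : 0 ≤ nrmL2 f := norm_nonneg _

theorem nrmL2_le_of_le {f g : C(AddCircle L, ℂ)} {c : ℝ} (h : ∀ x, ‖f x‖ ≤ c * ‖g x‖) :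
    nrmL2 f ≤ c * nrmL2 g := by
  refine Lp.norm_le_mul_norm_of_ae_le_mul ?_
  filter_upwards [ContinuousMap.coeFn_toLp (E := ℂ) (p := 2) haar (𝕜 := ℂ) f,
    ContinuousMap.coeFn_toLp (E := ℂ) (p := 2) haar (𝕜 := ℂ) g] with x hf hg
  rw [hf, hg]; exact h x

theorem nrmL2_sq (f : C(AddCircle L, ℂ)) : nrmL2 f ^ 2 = ∑' n, ‖fcoeff L n f‖ ^ 2 := by
  rw [nrmL2, ← (fourierBasis (T := L)).repr.norm_map, SeqL2.norm_sq]
  refine tsum_congr fun n => ?_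
  rw [fourierBasis_repr, fourierCoeff_toLp]
  rfl

theorem norm_inclS_le_nrmL2 (a : SeqL2) :
    ‖inclS L a‖ ≤ nrmL2 (ev L 2 a) + nrmL2 (ev L 1 (derivS L a)) := by
  have h0 := nrmL2_nonneg (L := L) (ev L 2 a)
  have h1 := nrmL2_nonneg (L := L) (ev L 1 (derivS L a))
  refine le_of_sq_le_sq ?_ (add_nonneg h0 h1)
  have e : ‖inclS L a‖ ^ 2 = nrmL2 (ev L 2 a) ^ 2 + nrmL2 (ev L 1 (derivS L a)) ^ 2 := by
    have s0 := (parseval (ev L 2 a)).summable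
    have s1 := (parseval (ev L 1 (derivS L a))).summable
    rw [nrmL2_sq, nrmL2_sq, ← s0.tsum_add s1, SeqL2.norm_sq]
    refine tsum_congr fun n => ?_
    rw [fcoeff_ev, fcoeff_ev, cf_derivS, ← norm_cf_mul (L := L) 0, cf_inclS, norm_mul, norm_mul,
      Complex.norm_I, mul_one, Complex.norm_real, Real.norm_eq_abs, zero_add, pow_one, mul_pow,
      mul_pow, sq_abs, wt_sq]
    ring
  rw [e]; nlinarith

/-- Multiplication by a function of class `W^{1,∞}`. -/
theorem nrmL2_mulS_le {v : SeqL2} {b : ℝ} (h0 : ∀ x, ‖ev L 2 v x‖ ≤ b)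
    (h1 : ∀ x, ‖ev L 1 (derivS L v) x‖ ≤ b) (a : SeqL2) :
    nrmL2 (ev L 2 (mulS L 2 v a)) ≤ b * nrmL2 (ev L 2 a) ∧
    nrmL2 (ev L 1 (derivS L (mulS L 2 v a))) ≤
      b * (nrmL2 (ev L 1 (derivS L a)) + nrmL2 (ev L 2 a)) := by
  constructor
  · refine nrmL2_le_of_le fun x => ?_
    rw [ev_mulS, ContinuousMap.mul_apply, norm_mul]
    gcongr
    exact h0 x
  · have e : ev L 1 (derivS L (mulS L 2 v a)) =
        ev L 2 v * ev L 1 (derivS L a) + ev L 1 (derivS L v) * ev L 2 a := by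
      ext x
      rw [ev_derivS_mulS]
      simp only [ContinuousMap.add_apply, ContinuousMap.mul_apply]; ring
    rw [e, mul_add]
    refine (nrmL2_add_le _ _).trans (add_le_add ?_ ?_)
    · refine nrmL2_le_of_le fun x => ?_
      rw [ContinuousMap.mul_apply, norm_mul]
      gcongr
      exact h0 x
    · refine nrmL2_le_of_le fun x => ?_
      rw [ContinuousMap.mul_apply, norm_mul]
      gcongr
      exact h1 x

/-- The kick by a real potential is an isometry of `L²`, and increases the norm of the derivative
at most linearly. -/
theorem nrmL2_kickS_le {w : SeqL2} {b τ : ℝ} (hτ : 0 ≤ τ) (hre : ∀ x, (ev L 2 w x).im = 0)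
    (h1 : ∀ x, ‖ev L 1 (derivS L w) x‖ ≤ b) (a : SeqL2) :
    nrmL2 (ev L 2 (kickS L 2 τ w a)) ≤ nrmL2 (ev L 2 a) ∧
    nrmL2 (ev L 1 (derivS L (kickS L 2 τ w a))) ≤
      nrmL2 (ev L 1 (derivS L a)) + τ * b * nrmL2 (ev L 2 a) := by
  have hn : ∀ x, ‖Complex.exp (-Complex.I * τ * ev L 2 w x)‖ = 1 := fun x => by
    have : ev L 2 w x = (((ev L 2 w x).re : ℝ) : ℂ) := by
      apply Complex.ext <;> simp [hre x]
    rw [this, mul_assoc, ← Complex.ofReal_mul, norm_exp_neg_I_mul]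
  constructor
  · rw [← one_mul (nrmL2 (ev L 2 a))]
    refine nrmL2_le_of_le fun x => ?_
    rw [ev_kickS, norm_mul, hn]
  · have e1 : nrmL2 (ev L 1 (derivS L (kickS L 2 τ w a))) ≤
        1 * nrmL2 (ev L 1 (derivS L a) +
          (-(Complex.I * τ)) • (ev L 1 (derivS L w) * ev L 2 a)) := by
      refine nrmL2_le_of_le fun x => ?_
      rw [ev_derivS_kickS, norm_mul, hn]
      refine le_of_eq ?_
      congr 2
      simp only [ContinuousMap.add_apply, ContinuousMap.smul_apply, ContinuousMap.mul_apply,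
        smul_eq_mul]; ring
    rw [one_mul] at e1
    refine e1.trans ((nrmL2_add_le _ _).trans (add_le_add le_rfl ?_))
    refine nrmL2_le_of_le fun x => ?_
    rw [ContinuousMap.smul_apply, ContinuousMap.mul_apply, norm_smul, norm_neg, norm_mul,
      Complex.norm_I, one_mul, Complex.norm_real, Real.norm_of_nonneg hτ, norm_mul, mul_assoc τ]
    gcongr
    exact h1 x

/-- The free flow commutes with the derivative and preserves both norms. -/
theorem nrmL2_flowS (t : ℝ) (a : SeqL2) :
    nrmL2 (ev L 2 (flowS L t a)) = nrmL2 (ev L 2 a) ∧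
    nrmL2 (ev L 1 (derivS L (flowS L t a))) = nrmL2 (ev L 1 (derivS L a)) := by
  have h : ∀ (r : ℕ) (a : SeqL2) (n : ℤ), ‖cf L r (flowS L t a) n‖ = ‖cf L r a n‖ :=
    fun r a n => by
      rw [norm_cf, norm_cf, flowS_apply, norm_mul, norm_exp_neg_I_mul, one_mul]
  have key : ∀ f g : C(AddCircle L, ℂ), (∀ n, ‖fcoeff L n f‖ = ‖fcoeff L n g‖) →
      nrmL2 f = nrmL2 g := fun f g hfg => by
    rw [← Real.sqrt_sq (nrmL2_nonneg f), ← Real.sqrt_sq (nrmL2_nonneg g), nrmL2_sq, nrmL2_sq]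
    simp only [hfg]
  constructor
  · refine key _ _ fun n => ?_
    rw [fcoeff_ev, fcoeff_ev, h]
  · refine key _ _ fun n => ?_
    rw [fcoeff_ev, fcoeff_ev, cf_derivS, cf_derivS, norm_mul, h, ← norm_mul]

/-! ### The functions `vⱼ` -/

/-- An almost everywhere bound for a continuous function holds everywhere. -/
theorem norm_le_of_ae {f : C(AddCircle L, ℂ)} {c : ℝ} (h : ∀ᵐ x ∂haar, ‖f x‖ ≤ c)
    (x : AddCircle L) : ‖f x‖ ≤ c := by
  by_contra hx
  have ho : IsOpen {x | c < ‖f x‖} := isOpen_lt continuous_const f.continuous.norm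
  have h0 : haar {x | c < ‖f x‖} = 0 := by
    rw [ae_iff] at h
    simpa only [not_le] using h
  have := (ho.measure_eq_zero_iff haar).1 h0
  have hm : x ∈ {x | c < ‖f x‖} := not_le.1 hx
  rw [this] at hm
  exact hm

theorem im_eq_zero_of_ae {f : C(AddCircle L, ℂ)} {v : AddCircle L → ℝ} (h : cplx v =ᵐ[haar] f)
    (x : AddCircle L) : (f x).im = 0 := by
  let g : C(AddCircle L, ℂ) := ⟨fun x => ((f x).im : ℂ), by fun_prop⟩
  have : ‖g x‖ ≤ 0 := norm_le_of_ae (by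
    filter_upwards [h] with y hy
    change ‖((f y).im : ℂ)‖ ≤ 0
    rw [← hy]; simp [cplx]) x
  have h2 : ((f x).im : ℂ) = 0 := norm_le_zero_iff.1 this
  exact_mod_cast h2

/-- The definition of the weak derivative, tested with the Fourier characters. -/
theorem fourierCoeff_weakDeriv {f g : AddCircle L → ℂ} (h : IsWeakDeriv f g) (n : ℤ) :
    fourierCoeff g n = (2 * Real.pi * n / L : ℝ) * Complex.I * fourierCoeff f n := by
  have hd := h.2.2 (fun x => fourier (-n) (x : AddCircle L)) (by
    have e : (fun x : ℝ => (fourier (-n) (x : AddCircle L) : ℂ)) =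
        fun x : ℝ => Complex.exp (2 * Real.pi * Complex.I * (-n : ℤ) * x / L) := by
      funext x; rw [fourier_coe_apply]
    rw [e]
    exact ((contDiff_const.mul Complex.ofRealCLM.contDiff).div_const _).cexp) (fun x => by simp)
  have e1 : ∀ x : ℝ, deriv (fun x : ℝ => (fourier (-n) (x : AddCircle L) : ℂ)) x =
      -2 * Real.pi * Complex.I * n / L * fourier (-n) (x : AddCircle L) := fun x =>
    (hasDerivAt_fourier_neg L n x).deriv
  simp only [e1] at hd
  rw [fourierCoeff_eq_intervalIntegral g n 0, fourierCoeff_eq_intervalIntegral f n 0, zero_add]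
  have h2 : ∫ x in (0:ℝ)..L, fourier (-n) (x : AddCircle L) • g x =
      ∫ x in (0:ℝ)..L, g x * fourier (-n) (x : AddCircle L) := by
    simp only [smul_eq_mul, mul_comm]
  have h3 : ∫ x in (0:ℝ)..L, f x * (-2 * Real.pi * Complex.I * n / L * fourier (-n) (x : AddCircle L)) =
      (-2 * Real.pi * Complex.I * n / L) * ∫ x in (0:ℝ)..L, fourier (-n) (x : AddCircle L) • f x := by
    rw [← intervalIntegral.integral_const_mul]
    refine intervalIntegral.integral_congr fun x _ => ?_
    simp only [smul_eq_mul]; ring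
  rw [h3] at hd
  rw [h2, ← neg_eq_iff_eq_neg.2 hd.symm.symm]
  simp only [Complex.real_smul, smul_eq_mul]
  push_cast; ring

/-- For `f ∈ H³ ∩ W^{1,∞}`, the `W^{1,∞}` norm bounds the continuous representatives of `f` and
of its derivative everywhere. -/
theorem norm_le_w1InfNorm {f : AddCircle L → ℂ} {a : SeqL2} (hf : f =ᵐ[haar] ev L 2 a)
    (hW : MemW1Inf f) (x : AddCircle L) :
    ‖ev L 2 a x‖ ≤ w1InfNorm f ∧ ‖ev L 1 (derivS L a) x‖ ≤ w1InfNorm f := by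
  have hwd : IsWeakDeriv f (weakDeriv f) := by
    rw [weakDeriv, dif_pos hW.1]; exact hW.1.choose_spec
  have h2 : weakDeriv f =ᵐ[haar] ev L 1 (derivS L a) := by
    refine ae_eq_of_fourierCoeff (hW.2.2.mono_exponent le_top) (memLp_continuousMap _) fun n => ?_
    rw [fourierCoeff_weakDeriv hwd, fourierCoeff_ev, cf_derivS, fourierCoeff_congr_ae hf,
      fourierCoeff_ev]
  have key : ∀ (g : AddCircle L → ℂ) (c : C(AddCircle L, ℂ)), MemLp g ∞ haar → g =ᵐ[haar] c →
      ∀ x, ‖c x‖ ≤ (eLpNorm g ∞ haar).toReal := fun g c hg hgc x => by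
    refine norm_le_of_ae ?_ x
    have := ae_le_eLpNormEssSup (f := g) (μ := haar)
    filter_upwards [this, hgc] with y hy hy2
    rw [← hy2, ← toReal_enorm]
    rw [← eLpNorm_exponent_top] at hy
    exact ENNReal.toReal_mono hg.2.ne hy
  exact ⟨(key _ _ hW.2.1 hf x).trans (le_max_left _ _), (key _ _ hW.2.2 h2 x).trans (le_max_right _ _)⟩

end

section
variable {L : ℝ} [hL : Fact (0 < L)]

/-! ### Mixed derivatives in the random parameters -/

/-- `f u` is the mixed first derivative of `f ∅` in the coordinates `j ∈ u`. -/
def IsDerivFamily {m : ℕ} {E : Type*} [NormedAddCommGroup E] [NormedSpace ℝ E]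
    (f : Finset (Fin m) → (Fin m → ℝ) → E) : Prop :=
  (∀ u, Continuous (f u)) ∧ ∀ u j, j ∉ u → ∀ ξ : Fin m → ℝ,
    HasDerivAt (fun s => f u (Function.update ξ j s)) (f (insert j u) ξ) (ξ j)

section
variable {m : ℕ} {E F H : Type*} [NormedAddCommGroup E] [NormedSpace ℝ E]
  [NormedAddCommGroup F] [NormedSpace ℝ F] [NormedAddCommGroup H] [NormedSpace ℝ H]

theorem isDerivFamily_const (a : E) :
    IsDerivFamily fun (u : Finset (Fin m)) (_ : Fin m → ℝ) => if u = ∅ then a else 0 := by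
  refine ⟨fun u => continuous_const, fun u j _ ξ => ?_⟩
  beta_reduce
  rw [if_neg (insert_ne_empty j u)]
  exact hasDerivAt_const _ _

theorem IsDerivFamily.clm {f : Finset (Fin m) → (Fin m → ℝ) → E} (hf : IsDerivFamily f)
    (A : E →L[ℝ] F) : IsDerivFamily fun u ξ => A (f u ξ) :=
  ⟨fun u => A.continuous.comp (hf.1 u), fun u j hj ξ =>
    A.hasFDerivAt.comp_hasDerivAt _ (hf.2 u j hj ξ)⟩

/-- The Leibniz rule. -/
theorem IsDerivFamily.bilin {f : Finset (Fin m) → (Fin m → ℝ) → E}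
    {g : Finset (Fin m) → (Fin m → ℝ) → F} (hf : IsDerivFamily f) (hg : IsDerivFamily g)
    (B : E →L[ℝ] F →L[ℝ] H) :
    IsDerivFamily fun u ξ => ∑ w ∈ u.powerset, B (f w ξ) (g (u \ w) ξ) := by
  refine ⟨fun u => continuous_finsetSum _ fun w _ =>
    (B.continuous.comp (hf.1 w)).clm_apply (hg.1 _), fun u j hj ξ => ?_⟩
  have key : ∀ w ∈ u.powerset, HasDerivAt
      (fun s => B (f w (Function.update ξ j s)) (g (u \ w) (Function.update ξ j s)))
      (B (f w ξ) (g (insert j u \ w) ξ) + B (f (insert j w) ξ) (g (insert j u \ insert j w) ξ))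
      (ξ j) := fun w hw => by
    have hjw : j ∉ w := fun h => hj (mem_powerset.1 hw h)
    have h := (B.hasFDerivAt.comp_hasDerivAt (ξ j) (hf.2 w j hjw ξ)).clm_apply
      (hg.2 (u \ w) j (fun h => hj (mem_sdiff.1 h).1) ξ)
    have e : insert j u \ insert j w = u \ w := by
      rw [insert_sdiff_insert, sdiff_insert_of_notMem hj]
    rw [insert_sdiff_of_notMem u hjw, e, add_comm]
    simpa only [Function.comp_apply, Function.update_eq_self] using h
  have h := HasDerivAt.fun_sum key
  rw [sum_add_distrib] at h
  beta_reduce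
  rw [sum_powerset_insert hj]
  exact h

end

/-! ### The mixed derivatives of the semi-discrete solution -/

section
variable (V0 : SeqL2) (lam : ℕ → ℝ) (V : ℕ → SeqL2) (m : ℕ) (τ : ℝ)

/-- The operator `-iτ λⱼ vⱼ`. -/
def dirS (L : ℝ) [Fact (0 < L)] (lam : ℕ → ℝ) (V : ℕ → SeqL2) (τ : ℝ) (j : ℕ) :
    SeqL2 →L[ℂ] SeqL2 := (-Complex.I * τ * lam j) • mulS L 2 (V j)

theorem commute_dirS (i j : ℕ) : Commute (dirS L lam V τ i) (dirS L lam V τ j) :=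
  ((commute_mulS (L := L) 2 (V i) (V j)).smul_left _).smul_right _

/-- The product of the operators `-iτ λⱼ vⱼ`, `j ∈ u`. -/
def dirProd (L : ℝ) [Fact (0 < L)] (lam : ℕ → ℝ) (V : ℕ → SeqL2) {m : ℕ} (τ : ℝ)
    (u : Finset (Fin m)) : SeqL2 →L[ℂ] SeqL2 :=
  u.noncommProd (fun j => dirS L lam V τ j) fun i _ j _ _ => commute_dirS lam V τ i j

theorem dirProd_empty {m : ℕ} : dirProd L lam V τ (∅ : Finset (Fin m)) = 1 :=
  noncommProd_empty _ _

theorem dirProd_insert {m : ℕ} {u : Finset (Fin m)} {j : Fin m} (hj : j ∉ u) :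
    dirProd L lam V τ (insert j u) = dirS L lam V τ j * dirProd L lam V τ u :=
  noncommProd_insert_of_notMem _ _ _ _ hj

/-- The mixed derivatives of the kick operator. -/
def kickFam (L : ℝ) [Fact (0 < L)] (V0 : SeqL2) (lam : ℕ → ℝ) (V : ℕ → SeqL2) (m : ℕ) (τ : ℝ)
    (u : Finset (Fin m)) (ξ : Fin m → ℝ) : SeqL2 →L[ℂ] SeqL2 :=
  kickS L 2 τ (truncS V0 lam V m ξ) * dirProd L lam V τ u

theorem truncS_update (ξ : Fin m → ℝ) (j : Fin m) (s : ℝ) :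
    truncS V0 lam V m (Function.update ξ j s) =
      truncS V0 lam V m ξ + ((lam j * (s - ξ j) : ℝ) : ℂ) • V j := by
  have h : ∀ i : Fin m, ((lam i * Function.update ξ j s i : ℝ) : ℂ) • V i =
      ((lam i * ξ i : ℝ) : ℂ) • V i +
        if i = j then ((lam j * (s - ξ j) : ℝ) : ℂ) • V j else 0 := fun i => by
    by_cases h : i = j
    · subst h
      rw [Function.update_self, if_pos rfl, ← add_smul, ← Complex.ofReal_add]
      congr 2; ring
    · rw [Function.update_of_ne h, if_neg h, add_zero]
  rw [truncS, truncS, sum_congr rfl fun i _ => h i, sum_add_distrib, sum_ite_eq' univ j]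
  simp only [mem_univ, if_true]
  abel

theorem hasDerivAt_exp_smul_zero {A : Type*} [NormedRing A] [NormedAlgebra ℝ A] [CompleteSpace A]
    (b : A) : HasDerivAt (fun s : ℝ => NormedSpace.exp (s • b)) b 0 := by
  have h := hasDerivAt_exp_smul_const (𝕂 := ℝ) b 0
  rwa [zero_smul, NormedSpace.exp_zero, one_mul] at h

theorem isDerivFamily_kickFam : IsDerivFamily (kickFam L V0 lam V m τ) := by
  let _ : NormedAlgebra ℚ (SeqL2 →L[ℂ] SeqL2) := NormedAlgebra.restrictScalars ℚ ℂ _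
  constructor
  · intro u
    have h0 : Continuous fun ξ => (-Complex.I * (τ : ℂ)) • mulS L 2 (truncS V0 lam V m ξ) :=
      (continuous_const_smul (-Complex.I * (τ : ℂ))).comp
        ((mulS L 2).continuous.comp (continuous_truncS V0 lam V m))
    exact (NormedSpace.exp_continuous.comp h0).mul continuous_const
  · intro u j hj ξ
    have e : ∀ s, kickS L 2 τ (truncS V0 lam V m (Function.update ξ j s)) =
        kickS L 2 τ (truncS V0 lam V m ξ) *
          NormedSpace.exp ((s - ξ j) • dirS L lam V τ j) := fun s => by
      have e1 : (-Complex.I * (τ : ℂ)) • mulS L 2 (((lam j * (s - ξ j) : ℝ) : ℂ) • V j) =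
          (s - ξ j) • dirS L lam V τ j := by
        have e2 : ∀ (r : ℝ) (c : ℂ) (A : SeqL2 →L[ℂ] SeqL2), r • c • A = ((r : ℂ) * c) • A :=
          fun r c A => by rw [mul_smul]; rfl
        rw [dirS, map_smul, smul_smul, e2]
        congr 1; push_cast; ring
      rw [truncS_update, kickS, map_add, smul_add, e1, NormedSpace.exp_add_of_commute, kickS]
      rw [← e1]
      exact ((commute_mulS (L := L) 2 _ _).smul_left _).smul_right _
    have h1 : HasDerivAt (fun s : ℝ => NormedSpace.exp (s • dirS L lam V τ j)) (dirS L lam V τ j)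
        (ξ j - ξ j) := by
      rw [sub_self]
      exact hasDerivAt_exp_smul_zero (dirS L lam V τ j)
    have h2 := (h1.comp_sub_const (ξ j) (ξ j)).const_mul (kickS L 2 τ (truncS V0 lam V m ξ))
    have h3 := h2.mul_const (dirProd L lam V τ u)
    rw [mul_assoc, ← dirProd_insert _ _ _ hj] at h3
    simp only [kickFam, e]
    exact h3

/-- The mixed derivatives of the splitting approximation. -/
def stepFam (L : ℝ) [Fact (0 < L)] (V0 : SeqL2) (lam : ℕ → ℝ) (V : ℕ → SeqL2) (a : SeqL2) (m : ℕ)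
    (τ : ℝ) : ℕ → Finset (Fin m) → (Fin m → ℝ) → SeqL2
  | 0 => fun u _ => if u = ∅ then a else 0
  | n + 1 => fun u ξ => flowS L τ (∑ w ∈ u.powerset,
      kickFam L V0 lam V m τ w ξ (stepFam L V0 lam V a m τ n (u \ w) ξ))

theorem isDerivFamily_stepFam (a : SeqL2) (n : ℕ) :
    IsDerivFamily (stepFam L V0 lam V a m τ n) := by
  induction n with
  | zero => exact isDerivFamily_const a
  | succ n ih =>
    exact ((isDerivFamily_kickFam (L := L) V0 lam V m τ).bilin ih
      (ContinuousLinearMap.restrictScalarsL ℂ SeqL2 SeqL2 ℝ ℝ)).clm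
        ((flowS L τ).restrictScalars ℝ)

theorem stepFam_empty (a : SeqL2) (n : ℕ) (ξ : Fin m → ℝ) :
    stepFam L V0 lam V a m τ n ∅ ξ = (stepS L 2 τ (truncS V0 lam V m ξ))^[n] a := by
  induction n with
  | zero => simp [stepFam]
  | succ n ih =>
    rw [Function.iterate_succ_apply', ← ih]
    simp [stepFam, stepS, kickFam, dirProd_empty]

end

/-! ### Bounds for the mixed derivatives -/

/-- The `L²` norm. -/
def nrm0 (L : ℝ) [Fact (0 < L)] (a : SeqL2) : ℝ := nrmL2 (ev L 2 a)

/-- The `L²` norm of the derivative. -/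
def nrm1 (L : ℝ) [Fact (0 < L)] (a : SeqL2) : ℝ := nrmL2 (ev L 1 (derivS L a))

theorem nrm0_nonneg (a : SeqL2) : 0 ≤ nrm0 L a := nrmL2_nonneg _
theorem nrm1_nonneg (a : SeqL2) : 0 ≤ nrm1 L a := nrmL2_nonneg _

theorem nrmL2_zero : nrmL2 (0 : C(AddCircle L, ℂ)) = 0 := by rw [nrmL2, map_zero, norm_zero]

theorem nrm0_zero : nrm0 L 0 = 0 := by rw [nrm0, map_zero, nrmL2_zero]
theorem nrm1_zero : nrm1 L 0 = 0 := by rw [nrm1, map_zero, map_zero, nrmL2_zero]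

theorem nrm0_sum_le {ι : Type*} (s : Finset ι) (f : ι → SeqL2) :
    nrm0 L (∑ i ∈ s, f i) ≤ ∑ i ∈ s, nrm0 L (f i) :=
  le_sum_of_subadditive _ nrm0_zero.le (fun a b => by
    rw [nrm0, map_add]; exact nrmL2_add_le _ _) s f

theorem nrm1_sum_le {ι : Type*} (s : Finset ι) (f : ι → SeqL2) :
    nrm1 L (∑ i ∈ s, f i) ≤ ∑ i ∈ s, nrm1 L (f i) :=
  le_sum_of_subadditive _ nrm1_zero.le (fun a b => by
    rw [nrm1, map_add, map_add]; exact nrmL2_add_le _ _) s f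

theorem nrmL2_smul (c : ℂ) (f : C(AddCircle L, ℂ)) : nrmL2 (c • f) = ‖c‖ * nrmL2 f := by
  rw [nrmL2, map_smul, norm_smul, nrmL2]

section
variable {V0 : SeqL2} {lam : ℕ → ℝ} {V : ℕ → SeqL2} {τ b₀ : ℝ} {β : ℕ → ℝ} {m : ℕ}
  (hτ : 0 ≤ τ) (hlam : ∀ j, 0 ≤ lam j)
  (h0 : ∀ j x, ‖ev L 2 (V j) x‖ ≤ β j) (h1 : ∀ j x, ‖ev L 1 (derivS L (V j)) x‖ ≤ β j)

include hτ hlam h0 h1 in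
theorem nrm_dirS_le (j : ℕ) (a : SeqL2) :
    nrm0 L (dirS L lam V τ j a) ≤ τ * (lam j * β j) * nrm0 L a ∧
    nrm1 L (dirS L lam V τ j a) ≤ τ * (lam j * β j) * (nrm1 L a + nrm0 L a) := by
  have h := nrmL2_mulS_le (L := L) (h0 j) (h1 j) a
  have hn : ‖-Complex.I * (τ : ℂ) * (lam j : ℂ)‖ = τ * lam j := by
    rw [norm_mul, norm_mul, norm_neg, Complex.norm_I, one_mul, Complex.norm_real,
      Complex.norm_real, Real.norm_of_nonneg hτ, Real.norm_of_nonneg (hlam j)]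
  have hnn := mul_nonneg hτ (hlam j)
  constructor
  · rw [nrm0, dirS, _root_.smul_apply, map_smul, nrmL2_smul, hn]
    exact (mul_le_mul_of_nonneg_left h.1 hnn).trans (le_of_eq (by rw [nrm0]; ring))
  · rw [nrm1, dirS, _root_.smul_apply, map_smul, map_smul, nrmL2_smul, hn]
    exact (mul_le_mul_of_nonneg_left h.2 hnn).trans (le_of_eq (by rw [nrm0, nrm1]; ring))

include hτ hlam h0 h1 in
theorem nrm_dirProd_le (u : Finset (Fin m)) (a : SeqL2) :
    nrm0 L (dirProd L lam V τ u a) ≤ (∏ j ∈ u, τ * (lam j * β j)) * nrm0 L a ∧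
    nrm1 L (dirProd L lam V τ u a) ≤
      (∏ j ∈ u, τ * (lam j * β j)) * (nrm1 L a + u.card * nrm0 L a) := by
  have hβ : ∀ j, 0 ≤ β j := fun j => (norm_nonneg _).trans (h0 j 0)
  have hP : ∀ j, 0 ≤ τ * (lam j * β j) := fun j => mul_nonneg hτ (mul_nonneg (hlam j) (hβ j))
  induction u using Finset.induction_on with
  | empty => simp [dirProd_empty]
  | insert j u hj ih =>
    rw [dirProd_insert _ _ _ hj, prod_insert hj, card_insert_of_notMem hj]
    have h := nrm_dirS_le hτ hlam h0 h1 j (dirProd L lam V τ u a)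
    change nrm0 L (dirS L lam V τ j (dirProd L lam V τ u a)) ≤ _ ∧
      nrm1 L (dirS L lam V τ j (dirProd L lam V τ u a)) ≤ _
    constructor
    · refine h.1.trans ?_
      rw [mul_assoc _ (∏ i ∈ u, _)]
      exact mul_le_mul_of_nonneg_left ih.1 (hP j)
    · refine h.2.trans ?_
      rw [mul_assoc _ (∏ i ∈ u, _)]
      refine mul_le_mul_of_nonneg_left ((add_le_add ih.2 ih.1).trans (le_of_eq ?_)) (hP j)
      push_cast; ring

include hτ hlam h0 h1 in
/-- Each derivative in `ξⱼ` of the kicks costs a factor `τ bⱼ`. The derivative in space of the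
result grows only additively, with the number of parameter derivatives and the size of the
potential. -/
theorem nrm_kickFam_le (him0 : ∀ x, (ev L 2 V0 x).im = 0) (him : ∀ j x, (ev L 2 (V j) x).im = 0)
    (hb0 : ∀ x, ‖ev L 1 (derivS L V0) x‖ ≤ b₀) (u : Finset (Fin m)) (ξ : Fin m → ℝ) (a : SeqL2) :
    nrm0 L (kickFam L V0 lam V m τ u ξ a) ≤ (∏ j ∈ u, τ * (lam j * β j)) * nrm0 L a ∧
    nrm1 L (kickFam L V0 lam V m τ u ξ a) ≤ (∏ j ∈ u, τ * (lam j * β j)) *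
      (nrm1 L a + (u.card + τ * (b₀ + ∑ j : Fin m, lam j * β j * |ξ j|)) * nrm0 L a) := by
  set Y := b₀ + ∑ j : Fin m, lam j * β j * |ξ j| with hY
  have hβ : ∀ j, 0 ≤ β j := fun j => (norm_nonneg _).trans (h0 j 0)
  have hY0 : 0 ≤ Y := add_nonneg ((norm_nonneg _).trans (hb0 0)) (sum_nonneg fun j _ =>
    mul_nonneg (mul_nonneg (hlam j) (hβ j)) (abs_nonneg _))
  have hre : ∀ x, (ev L 2 (truncS V0 lam V m ξ) x).im = 0 := fun x => by
    simp only [truncS, map_add, map_sum, map_smul, ContinuousMap.add_apply,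
      ContinuousMap.sum_apply, ContinuousMap.smul_apply, smul_eq_mul, Complex.add_im,
      Complex.im_sum, Complex.mul_im, him0, him, Complex.ofReal_im, mul_zero, zero_mul, add_zero,
      sum_const_zero]
  have hd : ∀ x, ‖ev L 1 (derivS L (truncS V0 lam V m ξ)) x‖ ≤ Y := fun x => by
    simp only [truncS, map_add, map_sum, map_smul, ContinuousMap.add_apply,
      ContinuousMap.sum_apply, ContinuousMap.smul_apply]
    refine (norm_add_le _ _).trans (add_le_add (hb0 x) ((norm_sum_le _ _).trans
      (sum_le_sum fun j _ => ?_)))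
    rw [norm_smul, Complex.norm_real, Real.norm_eq_abs, abs_mul, abs_of_nonneg (hlam j)]
    calc _ ≤ lam j * |ξ j| * β j :=
          mul_le_mul_of_nonneg_left (h1 j x) (mul_nonneg (hlam j) (abs_nonneg _))
      _ = _ := by ring
  have hk := nrmL2_kickS_le (L := L) hτ hre hd (dirProd L lam V τ u a)
  have hp := nrm_dirProd_le hτ hlam h0 h1 u a
  refine ⟨hk.1.trans hp.1, hk.2.trans ?_⟩
  calc _ ≤ (∏ j ∈ u, τ * (lam j * β j)) * (nrm1 L a + u.card * nrm0 L a) +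
        τ * Y * ((∏ j ∈ u, τ * (lam j * β j)) * nrm0 L a) :=
        add_le_add hp.2 (mul_le_mul_of_nonneg_left hp.1 (mul_nonneg hτ hY0))
    _ = _ := by ring

include hτ hlam h0 h1 in
/-- The product rule distributes the parameter derivatives over the steps, and by
`∏ (xⱼ + yⱼ) = ∑_w ∏_{j ∈ w} xⱼ ∏_{j ∉ w} yⱼ` the factors `τ bⱼ` of the single steps add up to
`n τ bⱼ`. The `H¹` norm grows linearly, not exponentially, in the potential, since the kicks are
unitary in `L²`. -/
theorem nrm_stepFam_le (him0 : ∀ x, (ev L 2 V0 x).im = 0) (him : ∀ j x, (ev L 2 (V j) x).im = 0)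
    (hb0 : ∀ x, ‖ev L 1 (derivS L V0) x‖ ≤ b₀) (a : SeqL2) (n : ℕ) (u : Finset (Fin m))
    (ξ : Fin m → ℝ) :
    nrm0 L (stepFam L V0 lam V a m τ n u ξ) ≤ (∏ j ∈ u, n * τ * (lam j * β j)) * nrm0 L a ∧
    nrm1 L (stepFam L V0 lam V a m τ n u ξ) ≤ (∏ j ∈ u, n * τ * (lam j * β j)) *
      (nrm1 L a + (u.card + n * τ * (b₀ + ∑ j : Fin m, lam j * β j * |ξ j|)) * nrm0 L a) := by
  set Y := b₀ + ∑ j : Fin m, lam j * β j * |ξ j| with hY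
  have hβ : ∀ j, 0 ≤ β j := fun j => (norm_nonneg _).trans (h0 j 0)
  have hY0 : 0 ≤ Y := add_nonneg ((norm_nonneg _).trans (hb0 0)) (sum_nonneg fun j _ =>
    mul_nonneg (mul_nonneg (hlam j) (hβ j)) (abs_nonneg _))
  have hn0 := nrm0_nonneg (L := L) a
  have hn1 := nrm1_nonneg (L := L) a
  have hP : ∀ (k : ℕ) (j : ℕ), 0 ≤ k * τ * (lam j * β j) := fun k j =>
    mul_nonneg (mul_nonneg k.cast_nonneg hτ) (mul_nonneg (hlam j) (hβ j))
  have hP1 : ∀ (j : ℕ), 0 ≤ τ * (lam j * β j) := fun j =>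
    mul_nonneg hτ (mul_nonneg (hlam j) (hβ j))
  induction n generalizing u with
  | zero =>
    rcases eq_or_ne u ∅ with rfl | hu
    · simp [stepFam]
    · simp only [stepFam, if_neg hu, nrm0_zero, nrm1_zero]
      have hp : 0 ≤ ∏ j ∈ u, ((0 : ℕ) : ℝ) * τ * (lam j * β j) := prod_nonneg fun j _ => hP 0 j
      exact ⟨mul_nonneg hp hn0, mul_nonneg hp (by positivity)⟩
  | succ n ih =>
    have e : ∏ j ∈ u, ((n + 1 : ℕ) : ℝ) * τ * (lam j * β j) =
        ∑ w ∈ u.powerset, (∏ j ∈ w, τ * (lam j * β j)) *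
          ∏ j ∈ u \ w, n * τ * (lam j * β j) := by
      rw [← prod_add]
      refine prod_congr rfl fun j _ => ?_
      push_cast; ring
    have hw0 : ∀ w : Finset (Fin m), 0 ≤ ∏ j ∈ w, τ * (lam j * β j) := fun w =>
      prod_nonneg fun j _ => hP1 j
    have hw1 : ∀ w : Finset (Fin m), 0 ≤ ∏ j ∈ w, n * τ * (lam j * β j) := fun w =>
      prod_nonneg fun j _ => hP n j
    have hf := nrmL2_flowS (L := L) τ (∑ w ∈ u.powerset,
      kickFam L V0 lam V m τ w ξ (stepFam L V0 lam V a m τ n (u \ w) ξ))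
    constructor
    · refine (hf.1.le.trans (nrm0_sum_le _ _)).trans ?_
      rw [e, sum_mul]
      refine sum_le_sum fun w _ => ?_
      refine (nrm_kickFam_le hτ hlam h0 h1 him0 him hb0 w ξ _).1.trans ?_
      rw [mul_assoc]
      exact mul_le_mul_of_nonneg_left (ih (u \ w)).1 (hw0 w)
    · refine (hf.2.le.trans (nrm1_sum_le _ _)).trans ?_
      rw [e, sum_mul]
      refine sum_le_sum fun w hw => ?_
      refine (nrm_kickFam_le hτ hlam h0 h1 him0 him hb0 w ξ _).2.trans ?_
      rw [mul_assoc]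
      refine mul_le_mul_of_nonneg_left ?_ (hw0 w)
      have hc : (u.card : ℝ) = w.card + (u \ w).card := by
        rw [← Nat.cast_add, add_comm, card_sdiff_add_card_eq_card (mem_powerset.1 hw)]
      have ih1 := ih (u \ w)
      have hq : 0 ≤ w.card + τ * Y := by positivity
      calc _ ≤ (∏ j ∈ u \ w, n * τ * (lam j * β j)) *
              (nrm1 L a + ((u \ w).card + n * τ * Y) * nrm0 L a) +
            (w.card + τ * Y) * ((∏ j ∈ u \ w, n * τ * (lam j * β j)) * nrm0 L a) :=
            add_le_add ih1.2 (mul_le_mul_of_nonneg_left ih1.1 hq)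
        _ = _ := by rw [hc]; push_cast; ring

end

/-! ### The mixed derivatives of the observable -/

/-- The mixed derivatives of the semi-discrete observable. -/
def obsFam (G : StrongDual ℂ (SobolevSpace L 1)) (V0 : SeqL2) (lam : ℕ → ℝ) (V : ℕ → SeqL2)
    (a : SeqL2) (m : ℕ) (τ : ℝ) (n : ℕ) (u : Finset (Fin m)) (ξ : Fin m → ℝ) : ℂ :=
  dualS G (∑ w ∈ u.powerset, mulS L 0 (inclS L (stepFam L V0 lam V a m τ n w ξ))
    (conjS (inclS L (stepFam L V0 lam V a m τ n (u \ w) ξ))))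

theorem isDerivFamily_obsFam (G : StrongDual ℂ (SobolevSpace L 1)) (V0 : SeqL2) (lam : ℕ → ℝ)
    (V : ℕ → SeqL2) (a : SeqL2) (m : ℕ) (τ : ℝ) (n : ℕ) :
    IsDerivFamily (obsFam G V0 lam V a m τ n) := by
  have h := (isDerivFamily_stepFam (L := L) V0 lam V m τ a n).clm ((inclS L).restrictScalars ℝ)
  exact (h.bilin (h.clm conjS) ((ContinuousLinearMap.restrictScalarsL ℂ SeqL2 SeqL2 ℝ ℝ).comp
    ((mulS L 0).restrictScalars ℝ))).clm ((dualS G).restrictScalars ℝ)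

theorem obsFam_empty (G : StrongDual ℂ (SobolevSpace L 1)) (V0 : SeqL2) (lam : ℕ → ℝ)
    (V : ℕ → SeqL2) (a : SeqL2) (m : ℕ) (τ : ℝ) (n : ℕ) (ξ : Fin m → ℝ) :
    obsFam G V0 lam V a m τ n ∅ ξ = semiObs G V0 lam V a m τ n ξ := by
  simp [obsFam, semiObs, obsS, stepFam_empty]

set_option maxHeartbeats 1000000 in
/-- The mixed derivatives of the semi-discrete observable are bounded by products of the `bⱼ`,
uniformly in the discretization parameters. -/
theorem norm_obsFam_le (G : StrongDual ℂ (SobolevSpace L 1)) {V0 : SeqL2} {lam : ℕ → ℝ}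
    {V : ℕ → SeqL2} {β : ℕ → ℝ} (a : SeqL2) {T : ℝ} (hT : 0 ≤ T) (hlam : ∀ j, 0 ≤ lam j)
    (h0 : ∀ j x, ‖ev L 2 (V j) x‖ ≤ β j) (h1 : ∀ j x, ‖ev L 1 (derivS L (V j)) x‖ ≤ β j)
    (him0 : ∀ x, (ev L 2 V0 x).im = 0) (him : ∀ j x, (ev L 2 (V j) x).im = 0) :
    ∃ C : ℝ, 0 ≤ C ∧ ∀ (m n : ℕ) (τ : ℝ), 0 ≤ τ → n * τ ≤ T →
      ∀ (u : Finset (Fin m)) (ξ : Fin m → ℝ), ‖obsFam G V0 lam V a m τ n u ξ‖ ≤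
        C * ((2 * max 1 T) ^ u.card * ((u.card : ℝ) + 1) ^ 2 * ∏ j ∈ u, lam j * β j) *
          Real.exp (∑ j : Fin m, lam j * β j * |ξ j|) := by
  set b₀ := ‖ev L 1 (derivS L V0)‖ with hb₀
  have hb0 : ∀ x, ‖ev L 1 (derivS L V0) x‖ ≤ b₀ := fun x => ContinuousMap.norm_coe_le_norm _ x
  have hb00 : 0 ≤ b₀ := norm_nonneg _
  have hβ : ∀ j, 0 ≤ β j := fun j => (norm_nonneg _).trans (h0 j 0)
  have hn0 := nrm0_nonneg (L := L) a
  have hn1 := nrm1_nonneg (L := L) a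
  have hc0 := algConst_nonneg (L := L) 0
  set A := nrm0 L a + nrm1 L a + (1 + T * (b₀ + 2)) * nrm0 L a with hA
  have hA0 : 0 ≤ A := by positivity
  refine ⟨‖dualS G‖ * algConst L 0 * A ^ 2, by positivity, fun m n τ hτ hn u ξ => ?_⟩
  set S := ∑ j : Fin m, lam j * β j * |ξ j| with hS
  have hS0 : 0 ≤ S := sum_nonneg fun j _ =>
    mul_nonneg (mul_nonneg (hlam j) (hβ j)) (abs_nonneg _)
  -- `e ^ 2 = exp S`: each of the two factors of the density takes one `e`
  set e := Real.exp (S / 2) with he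
  have he1 : 1 ≤ e := Real.one_le_exp (by positivity)
  have heS : S ≤ 2 * e := by have := Real.add_one_le_exp (S / 2); linarith
  have hee : Real.exp S = e ^ 2 := by rw [he, ← Real.exp_nat_mul]; congr 1; push_cast; ring
  set M := max 1 T with hM
  have hM1 : 1 ≤ M := le_max_left _ _
  have hM0 : 0 ≤ M := zero_le_one.trans hM1
  have key : ∀ w : Finset (Fin m), w ⊆ u →
      ‖inclS L (stepFam L V0 lam V a m τ n w ξ)‖ ≤
        (∏ j ∈ w, M * (lam j * β j)) * (A * ((u.card : ℝ) + 1) * e) := fun w hw => by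
    have h := nrm_stepFam_le hτ hlam h0 h1 him0 him hb0 a n w ξ
    have hcw : (w.card : ℝ) ≤ u.card := by exact_mod_cast card_le_card hw
    have hk : (0 : ℝ) ≤ u.card := Nat.cast_nonneg _
    have hp : ∏ j ∈ w, n * τ * (lam j * β j) ≤ ∏ j ∈ w, M * (lam j * β j) :=
      prod_le_prod (fun j _ => mul_nonneg (by positivity) (mul_nonneg (hlam j) (hβ j)))
        fun j _ => mul_le_mul_of_nonneg_right (hn.trans (le_max_right _ _))
          (mul_nonneg (hlam j) (hβ j))
    have hp0 : 0 ≤ ∏ j ∈ w, M * (lam j * β j) :=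
      prod_nonneg fun j _ => mul_nonneg hM0 (mul_nonneg (hlam j) (hβ j))
    refine ((norm_inclS_le_nrmL2 _).trans (add_le_add h.1 h.2)).trans ?_
    rw [← mul_add]
    refine (mul_le_mul_of_nonneg_right hp (by positivity)).trans
      (mul_le_mul_of_nonneg_left ?_ hp0)
    have hke : (1 : ℝ) ≤ (u.card + 1) * e := by nlinarith
    have hq : (w.card : ℝ) + n * τ * (b₀ + S) ≤ (1 + T * (b₀ + 2)) * ((u.card + 1) * e) := by
      have q1 : (u.card : ℝ) ≤ (u.card + 1) * e := by nlinarith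
      have q2 : b₀ + S ≤ (b₀ + 2) * ((u.card + 1) * e) := by
        have : e ≤ (u.card + 1) * e := by nlinarith
        nlinarith
      calc (w.card : ℝ) + n * τ * (b₀ + S) ≤ u.card + T * (b₀ + S) := by gcongr
        _ ≤ (u.card + 1) * e + T * ((b₀ + 2) * ((u.card + 1) * e)) := by gcongr
        _ = _ := by ring
    calc _ ≤ nrm0 L a * ((u.card + 1) * e) + (nrm1 L a * ((u.card + 1) * e) +
          (1 + T * (b₀ + 2)) * ((u.card + 1) * e) * nrm0 L a) := by
          refine add_le_add (le_mul_of_one_le_right hn0 hke)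
            (add_le_add (le_mul_of_one_le_right hn1 hke) (mul_le_mul_of_nonneg_right hq hn0))
      _ = _ := by rw [hA]; ring
  rw [obsFam]
  refine ((dualS G).le_opNorm _).trans ?_
  have hsum : ‖∑ w ∈ u.powerset, mulS L 0 (inclS L (stepFam L V0 lam V a m τ n w ξ))
      (conjS (inclS L (stepFam L V0 lam V a m τ n (u \ w) ξ)))‖ ≤
      ∑ w ∈ u.powerset, algConst L 0 *
        ((∏ j ∈ w, M * (lam j * β j)) * (A * ((u.card : ℝ) + 1) * e)) *
        ((∏ j ∈ u \ w, M * (lam j * β j)) * (A * ((u.card : ℝ) + 1) * e)) := by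
    refine (norm_sum_le _ _).trans (sum_le_sum fun w hw => ?_)
    refine (norm_mulS_le _ _ _).trans ?_
    rw [norm_conjS]
    have hwu := mem_powerset.1 hw
    have k1 := key w hwu
    have k2 := key (u \ w) sdiff_subset
    exact mul_le_mul (mul_le_mul_of_nonneg_left k1 hc0) k2 (norm_nonneg _)
      (mul_nonneg hc0 ((norm_nonneg _).trans k1))
  refine (mul_le_mul_of_nonneg_left hsum (norm_nonneg _)).trans (le_of_eq ?_)
  have hpp : ∏ j ∈ u, (M * (lam j * β j) + M * (lam j * β j)) =
      (2 * M) ^ u.card * ∏ j ∈ u, lam j * β j := by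
    rw [← prod_const, ← prod_mul_distrib]
    exact prod_congr rfl fun j _ => by ring
  rw [prod_add] at hpp
  rw [hee]
  calc _ = ‖dualS G‖ * algConst L 0 * A ^ 2 * ((u.card : ℝ) + 1) ^ 2 * e ^ 2 *
        ∑ w ∈ u.powerset, (∏ j ∈ w, M * (lam j * β j)) * ∏ j ∈ u \ w, M * (lam j * β j) := by
        rw [mul_sum, mul_sum]
        exact sum_congr rfl fun w _ => by ring
    _ = _ := by rw [hpp]; ring

end

section

/-! ### The normal distribution function and its inverse -/

local notation "μG" => gaussianReal 0 1

theorem continuous_stdNormalCDF : Continuous stdNormalCDF := by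
  rw [continuous_iff_continuousAt]
  intro x
  have hl : ContinuousWithinAt (cdf μG) (Set.Iio x) x := by
    have _ := nullSingletonClass_gaussianReal (μ := 0) (v := 1) one_ne_zero
    have h := (cdf μG).measure_singleton x
    rw [measure_cdf, measure_singleton] at h
    have h2 : cdf μG x ≤ Function.leftLim (cdf μG) x := by
      have := ENNReal.ofReal_eq_zero.1 h.symm
      linarith
    have h3 := (monotone_cdf μG).tendsto_leftLim x
    have h4 : Function.leftLim (cdf μG) x = cdf μG x :=
      le_antisymm ((monotone_cdf μG).leftLim_le le_rfl) h2
    rw [h4] at h3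
    exact h3
  have hr := (cdf μG).right_continuous x
  exact continuousAt_iff_continuous_left'_right'.2
    ⟨hl, hr.mono_left (nhdsWithin_mono _ Set.Ioi_subset_Ici_self)⟩

theorem monotone_stdNormalCDF : Monotone stdNormalCDF := monotone_cdf _
theorem stdNormalCDF_nonneg (t : ℝ) : 0 ≤ stdNormalCDF t := cdf_nonneg _ t
theorem stdNormalCDF_le_one (t : ℝ) : stdNormalCDF t ≤ 1 := cdf_le_one _ t

theorem integral_lt_indicator (t : ℝ) :
    ∫ s, (if t < s then (1 : ℝ) else 0) ∂μG = 1 - stdNormalCDF t := by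
  have e : (fun s => if t < s then (1 : ℝ) else 0) = (Set.Iic t)ᶜ.indicator 1 := by
    funext s
    simp [Set.indicator_apply]
  rw [e, integral_indicator_one measurableSet_Iic.compl, measureReal_compl measurableSet_Iic,
    probReal_univ, stdNormalCDF, cdf_eq_real]

/-- On `(0,1)`, the quantile function is inverse to the distribution function. -/
theorem lt_stdNormalQuantile_iff {y t : ℝ} (hy0 : 0 < y) (hy1 : y < 1) :
    t < stdNormalQuantile y ↔ stdNormalCDF t < y := by
  have hbdd : BddBelow {s : ℝ | y ≤ stdNormalCDF s} := by
    obtain ⟨s, hs⟩ := ((tendsto_cdf_atBot μG).eventually (gt_mem_nhds hy0)).exists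
    refine ⟨s, fun r hr => ?_⟩
    by_contra h
    exact absurd (hr.trans (monotone_stdNormalCDF (not_le.1 h).le)) (not_le.2 hs)
  constructor
  · intro h
    by_contra h2
    exact absurd (csInf_le hbdd (not_lt.1 h2)) (not_le.2 h)
  · intro h
    obtain ⟨r, hr⟩ := ((tendsto_cdf_atTop μG).eventually (lt_mem_nhds hy1)).exists
    have hn : ({s : ℝ | y ≤ stdNormalCDF s}).Nonempty := ⟨r, hr.le⟩
    have hev : ∀ᶠ s in 𝓝[>] t, stdNormalCDF s < y :=
      (continuous_stdNormalCDF.continuousAt.eventually (gt_mem_nhds h)).filter_mono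
        nhdsWithin_le_nhds
    obtain ⟨s, hs, hts⟩ := (hev.and self_mem_nhdsWithin).exists
    refine lt_of_lt_of_le (b := s) hts (le_csInf hn fun r hr => ?_)
    by_contra h3
    exact absurd (hr.trans (monotone_stdNormalCDF (not_le.1 h3).le)) (not_le.2 hs)

/-- Outside `[0,1]` the infimum defining the quantile is over `∅` or `ℝ`, where it is `0`. -/
theorem measurable_stdNormalQuantile : Measurable stdNormalQuantile := by
  have hle : ∀ y : ℝ, y ≤ 0 → stdNormalQuantile y = 0 := fun y hy => by
    have : {t : ℝ | y ≤ stdNormalCDF t} = Set.univ :=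
      Set.eq_univ_of_forall fun t => hy.trans (stdNormalCDF_nonneg t)
    rw [stdNormalQuantile, this, Real.sInf_univ]
  have hge : ∀ y : ℝ, 1 < y → stdNormalQuantile y = 0 := fun y hy => by
    have : {t : ℝ | y ≤ stdNormalCDF t} = ∅ :=
      Set.eq_empty_of_forall_notMem fun t ht => absurd (hy.trans_le ht)
        (not_lt.2 (stdNormalCDF_le_one t))
    rw [stdNormalQuantile, this, Real.sInf_empty]
  refine measurable_of_Ioi fun t => ?_
  have e : stdNormalQuantile ⁻¹' Set.Ioi t =
      (Set.Ioo 0 1 ∩ Set.Ioi (stdNormalCDF t)) ∪ (Set.Iic 0 ∩ {_y | t < 0}) ∪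
        (Set.Ioi 1 ∩ {_y | t < 0}) ∪ ({1} ∩ {_y | t < stdNormalQuantile 1}) := by
    ext y
    simp only [Set.mem_preimage, Set.mem_Ioi, Set.mem_union, Set.mem_inter_iff, Set.mem_Ioo,
      Set.mem_Iic, Set.mem_ofPred_eq, Set.mem_singleton_iff]
    rcases le_or_gt y 0 with h0 | h0
    · rw [hle y h0]
      have h1 : ¬ 0 < y := not_lt.2 h0
      have h2 : ¬ 1 < y := by linarith
      have h3 : y ≠ 1 := by linarith
      simp [h0, h1, h2, h3]
    · rcases lt_trichotomy y 1 with h1 | rfl | h1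
      · rw [lt_stdNormalQuantile_iff h0 h1]
        simp [h0, h1, not_le.2 h0, not_lt.2 h1.le, h1.ne]
      · simp
      · rw [hge y h1]
        simp [h1, not_le.2 h0, not_lt.2 h1.le, h1.ne']
  rw [e]
  exact (((measurableSet_Ioo.inter measurableSet_Ioi).union
    (measurableSet_Iic.inter (MeasurableSet.const _))).union
    (measurableSet_Ioi.inter (MeasurableSet.const _))).union
    ((measurableSet_singleton _).inter (MeasurableSet.const _))

/-! ### The representation of a function by its mean and its derivative -/

/-- The kernel `1_{t<x} - (1 - Φ(t))`, which recovers a function from its derivative and its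
Gaussian mean. -/
def gaussKer (x t : ℝ) : ℝ := (if t < x then 1 else 0) - (1 - stdNormalCDF t)

theorem measurable_gaussKer_prod : Measurable fun q : ℝ × ℝ => gaussKer q.1 q.2 :=
  (Measurable.ite (measurableSet_lt measurable_snd measurable_fst) measurable_const
    measurable_const).sub
    (measurable_const.sub (continuous_stdNormalCDF.measurable.comp measurable_snd))

theorem abs_gaussKer_le (x t : ℝ) : |gaussKer x t| ≤ 1 := by
  have h0 := stdNormalCDF_nonneg t
  have h1 := stdNormalCDF_le_one t
  rw [gaussKer, abs_le]
  split_ifs <;> constructor <;> linarith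

theorem measurable_gaussKer (x : ℝ) : Measurable (gaussKer x) :=
  (Measurable.ite measurableSet_Iio measurable_const measurable_const).sub
    (measurable_const.sub continuous_stdNormalCDF.measurable)

section
variable {E : Type*} [NormedAddCommGroup E] [NormedSpace ℝ E]

theorem ite_lt_sub_ite_lt (x s t : ℝ) (a : E) :
    ((if t < x then (1 : ℝ) else 0) - if t < s then 1 else 0) • a =
      (Set.Ico s x).indicator (fun _ => a) t - (Set.Ico x s).indicator (fun _ => a) t := by
  simp only [Set.indicator_apply, Set.mem_Ico]
  by_cases h1 : t < x <;> by_cases h2 : t < s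
  · simp [h1, h2, not_le.2 h1, not_le.2 h2]
  · simp [h1, h2, not_le.2 h1, not_lt.1 h2]
  · simp [h1, h2, not_lt.1 h1, not_le.2 h2]
  · simp [h1, h2]

theorem integral_ite_lt_sub [CompleteSpace E] {g g' : ℝ → E} (hg : ∀ t, HasDerivAt g (g' t) t)
    (hc : Continuous g') (x s : ℝ) :
    ∫ t, ((if t < x then (1 : ℝ) else 0) - if t < s then 1 else 0) • g' t = g x - g s := by
  have hi : ∀ a b, IntegrableOn g' (Set.Ico a b) := fun a b =>
    (hc.integrableOn_Icc (a := a) (b := b)).mono_set Set.Ico_subset_Icc_self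
  have key : ∀ a b, a ≤ b → ∫ t in Set.Ico a b, g' t = g b - g a := fun a b hab => by
    rw [integral_Ico_eq_integral_Ioo, ← integral_Ioc_eq_integral_Ioo,
      ← intervalIntegral.integral_of_le hab]
    exact intervalIntegral.integral_eq_sub_of_hasDerivAt (fun t _ => hg t)
      (hc.intervalIntegrable _ _)
  have e : ∀ t, ((if t < x then (1 : ℝ) else 0) - if t < s then 1 else 0) • g' t =
      (Set.Ico s x).indicator g' t - (Set.Ico x s).indicator g' t := fun t => by
    rw [ite_lt_sub_ite_lt]; rfl
  simp only [e]
  rw [integral_sub ((hi _ _).integrable_indicator measurableSet_Ico)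
    ((hi _ _).integrable_indicator measurableSet_Ico), integral_indicator measurableSet_Ico,
    integral_indicator measurableSet_Ico]
  rcases le_total s x with h | h
  · rw [key s x h, Set.Ico_eq_empty (not_lt.2 h), setIntegral_empty, sub_zero]
  · rw [key x s h, Set.Ico_eq_empty (not_lt.2 h), setIntegral_empty, zero_sub, neg_sub]

variable {g' : ℝ → E} {M b : ℝ}

theorem norm_ite_lt_le (hb : 0 ≤ b) (hM : ∀ t, ‖g' t‖ ≤ M * Real.exp (b * |t|)) (x s t : ℝ) :
    ‖((if t < x then (1 : ℝ) else 0) - if t < s then 1 else 0) • g' t‖ ≤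
      (Set.Ico (min x s) (max x s)).indicator (fun _ => M * Real.exp (b * (|x| + |s|))) t := by
  have hM0 : 0 ≤ M := by
    have := (norm_nonneg _).trans (hM 0)
    simpa using this
  have hbd : t ∈ Set.Ico (min x s) (max x s) → ‖g' t‖ ≤ M * Real.exp (b * (|x| + |s|)) :=
    fun ht => by
      refine (hM t).trans ?_
      gcongr
      rw [abs_le]
      rcases le_total x s with h | h
      · rw [min_eq_left h, max_eq_right h] at ht
        have := neg_abs_le x; have := le_abs_self s
        have := abs_nonneg x; have := abs_nonneg s
        exact ⟨by linarith [ht.1], by linarith [ht.2]⟩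
      · rw [min_eq_right h, max_eq_left h] at ht
        have := neg_abs_le s; have := le_abs_self x
        have := abs_nonneg x; have := abs_nonneg s
        exact ⟨by linarith [ht.1], by linarith [ht.2]⟩
  by_cases h1 : t < x <;> by_cases h2 : t < s
  · simp only [h1, h2, if_true, sub_self, zero_smul, norm_zero]
    exact Set.indicator_nonneg (fun _ _ => by positivity) _
  · have ht : t ∈ Set.Ico (min x s) (max x s) :=
      ⟨(min_le_right _ _).trans (not_lt.1 h2), h1.trans_le (le_max_left _ _)⟩
    rw [Set.indicator_of_mem ht, if_pos h1, if_neg h2, sub_zero, one_smul]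
    exact hbd ht
  · have ht : t ∈ Set.Ico (min x s) (max x s) :=
      ⟨(min_le_left _ _).trans (not_lt.1 h1), h2.trans_le (le_max_right _ _)⟩
    rw [Set.indicator_of_mem ht, if_neg h1, if_pos h2, zero_sub, neg_smul, one_smul, norm_neg]
    exact hbd ht
  · simp only [h1, h2, if_false, sub_self, zero_smul, norm_zero]
    exact Set.indicator_nonneg (fun _ _ => by positivity) _

theorem integrable_ite_lt_prod (hc : Continuous g') (hb : 0 ≤ b)
    (hM : ∀ t, ‖g' t‖ ≤ M * Real.exp (b * |t|)) (x : ℝ) :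
    Integrable (fun q : ℝ × ℝ =>
      ((if q.2 < x then (1 : ℝ) else 0) - if q.2 < q.1 then 1 else 0) • g' q.2)
      ((μG).prod volume) := by
  have hM0 : 0 ≤ M := by
    have := (norm_nonneg _).trans (hM 0)
    simpa using this
  have hmeas : AEStronglyMeasurable (fun q : ℝ × ℝ =>
      ((if q.2 < x then (1 : ℝ) else 0) - if q.2 < q.1 then 1 else 0) • g' q.2)
      ((μG).prod volume) := by
    have m1 : Measurable fun q : ℝ × ℝ =>
        ((if q.2 < x then (1 : ℝ) else 0) - if q.2 < q.1 then 1 else 0) :=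
      (Measurable.ite (measurableSet_lt measurable_snd measurable_const) measurable_const
        measurable_const).sub (Measurable.ite (measurableSet_lt measurable_snd measurable_fst)
          measurable_const measurable_const)
    exact m1.aestronglyMeasurable.smul (hc.comp continuous_snd).aestronglyMeasurable
  have hind : ∀ s, Integrable ((Set.Ico (min x s) (max x s)).indicator
      fun _ : ℝ => M * Real.exp (b * (|x| + |s|))) := fun s =>
    (integrableOn_const (by simp)).integrable_indicator measurableSet_Ico
  have hint : ∀ s, Integrable (fun t =>
      ((if t < x then (1 : ℝ) else 0) - if t < s then 1 else 0) • g' t) := fun s => by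
    refine (hind s).mono' ?_ (ae_of_all _ fun t => norm_ite_lt_le hb hM x s t)
    have m1 : Measurable fun t : ℝ =>
        ((if t < x then (1 : ℝ) else 0) - if t < s then 1 else 0) :=
      (Measurable.ite measurableSet_Iio measurable_const
        measurable_const).sub (Measurable.ite measurableSet_Iio measurable_const measurable_const)
    exact m1.aestronglyMeasurable.smul hc.aestronglyMeasurable
  rw [integrable_prod_iff hmeas]
  refine ⟨ae_of_all _ hint, ?_⟩
  refine Integrable.mono' (((integrable_exp_mul_abs (b + 1)).const_mul
    (M * Real.exp ((b + 1) * |x|)))) hmeas.norm.integral_prod_right' (ae_of_all _ fun s => ?_)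
  rw [Real.norm_of_nonneg (integral_nonneg fun t => norm_nonneg _)]
  refine (integral_mono (hint s).norm (hind s) fun t => norm_ite_lt_le hb hM x s t).trans ?_
  rw [integral_indicator measurableSet_Ico, setIntegral_const, smul_eq_mul, Real.volume_real_Ico_of_le
    (min_le_max)]
  have h1 : max x s - min x s ≤ Real.exp (|x| + |s|) := by
    rw [max_sub_min_eq_abs]
    have := Real.add_one_le_exp (|x| + |s|)
    have := abs_sub s x
    linarith
  calc _ ≤ Real.exp (|x| + |s|) * (M * Real.exp (b * (|x| + |s|))) := by gcongr
    _ = M * (Real.exp (|x| + |s|) * Real.exp (b * (|x| + |s|))) := by ring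
    _ = M * (Real.exp ((b + 1) * |x|) * Real.exp ((b + 1) * |s|)) := by
      rw [← Real.exp_add, ← Real.exp_add]; congr 2; ring
    _ = _ := by ring

theorem integral_ite_lt_smul [CompleteSpace E] (x t : ℝ) :
    ∫ s, ((if t < x then (1 : ℝ) else 0) - if t < s then 1 else 0) • g' t ∂μG =
      gaussKer x t • g' t := by
  have hi : Integrable (fun s => if t < s then (1 : ℝ) else 0) μG := by
    refine Integrable.mono' (integrable_const (1 : ℝ)) ?_ (ae_of_all _ fun s => ?_)
    · exact (Measurable.ite measurableSet_Ioi measurable_const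
        measurable_const).aestronglyMeasurable
    · split_ifs <;> simp
  rw [integral_smul_const, integral_sub (integrable_const _) hi, integral_lt_indicator,
    integral_const, probReal_univ, one_smul]
  rfl

theorem integrable_gaussKer_smul [CompleteSpace E] (hc : Continuous g') (hb : 0 ≤ b)
    (hM : ∀ t, ‖g' t‖ ≤ M * Real.exp (b * |t|)) (x : ℝ) :
    Integrable fun t => gaussKer x t • g' t := by
  have h := (integrable_ite_lt_prod hc hb hM x).integral_prod_right
  simpa only [integral_ite_lt_smul] using h

/-- The one-dimensional ANOVA decomposition: average the fundamental theorem of calculus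
`g x - g s = ∫ (1_{t<x} - 1_{t<s}) g' t` over the Gaussian variable `s`. -/
theorem eq_integral_add_integral_gaussKer [CompleteSpace E] {g : ℝ → E}
    (hg : ∀ t, HasDerivAt g (g' t) t) (hc : Continuous g') (hb : 0 ≤ b)
    (hM : ∀ t, ‖g' t‖ ≤ M * Real.exp (b * |t|)) (hgi : Integrable g μG) (x : ℝ) :
    g x = ∫ s, g s ∂μG + ∫ t, gaussKer x t • g' t := by
  have h := integral_integral_swap (f := fun s t =>
    ((if t < x then (1 : ℝ) else 0) - if t < s then 1 else 0) • g' t)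
    (integrable_ite_lt_prod hc hb hM x)
  simp only [integral_ite_lt_sub hg hc, integral_ite_lt_smul] at h
  rw [integral_sub (integrable_const _) hgi, integral_const, probReal_univ, one_smul] at h
  rw [← h]; abel

end

theorem integrable_gaussKer_mul_exp (x b : ℝ) (hb : 0 ≤ b) :
    Integrable fun t => gaussKer x t * Real.exp (b * |t|) :=
  integrable_gaussKer_smul (g' := fun t => Real.exp (b * |t|)) (M := 1) (by fun_prop) hb
    (fun t => by rw [Real.norm_of_nonneg (Real.exp_pos _).le, one_mul]) x

theorem integrable_cdf_mul_exp (b : ℝ) (hb : 0 ≤ b) :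
    Integrable fun t => stdNormalCDF t * (1 - stdNormalCDF t) * Real.exp (b * |t|) := by
  refine (integrable_gaussKer_mul_exp 0 b hb).norm.mono' ?_ (ae_of_all _ fun t => ?_)
  · have := continuous_stdNormalCDF
    exact Continuous.aestronglyMeasurable (by fun_prop)
  · have h0 := stdNormalCDF_nonneg t
    have h1 := stdNormalCDF_le_one t
    rw [norm_mul, norm_mul _ (Real.exp _)]
    gcongr
    rw [Real.norm_of_nonneg (mul_nonneg h0 (by linarith)), gaussKer, Real.norm_eq_abs]
    split_ifs
    · rw [sub_sub_cancel, abs_of_nonneg h0]; nlinarith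
    · rw [zero_sub, abs_neg, abs_of_nonneg (by linarith)]; nlinarith

theorem integrable_exp_neg_mul_abs {c : ℝ} (hc : 0 < c) :
    Integrable (fun t : ℝ => Real.exp (-c * |t|)) ∧ ∫ t : ℝ, Real.exp (-c * |t|) = 2 / c := by
  have h := integrableOn_exp_mul_Ioi (neg_lt_zero.2 hc) 0
  constructor
  · have h2 : Integrable fun t : ℝ => (fun y => Real.exp (-c * y)) |t| := by
      rw [← integrableOn_univ, ← Set.Iic_union_Ioi (a := (0 : ℝ))]
      refine IntegrableOn.union ?_ ?_
      · have h3 := integrableOn_exp_mul_Iic hc 0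
        refine h3.congr_fun (fun t ht => ?_) measurableSet_Iic
        simp only [abs_of_nonpos (Set.mem_Iic.1 ht)]
        congr 1; ring
      · refine h.congr_fun (fun t ht => ?_) measurableSet_Ioi
        simp only [abs_of_pos (Set.mem_Ioi.1 ht)]
    exact h2
  · have h2 := integral_comp_abs (f := fun y => Real.exp (-c * y))
    beta_reduce at h2
    rw [h2, integral_exp_mul_Ioi (neg_lt_zero.2 hc), mul_zero, Real.exp_zero]
    field_simp

/-! ### The covariance of two shifted points -/

/-- The covariance of the indicators of `U ≤ a` and `frac(U + f) ≤ a`, with `U` uniform. -/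
def shiftCov (a f : ℝ) : ℝ := max (a - f) 0 + max (a - 1 + f) 0 - a ^ 2

theorem continuous_shiftCov_left (f : ℝ) : Continuous fun a => shiftCov a f := by
  unfold shiftCov
  fun_prop

theorem abs_shiftCov_le {a f : ℝ} (ha0 : 0 ≤ a) (ha1 : a ≤ 1) (hf0 : 0 ≤ f) (hf1 : f ≤ 1) :
    |shiftCov a f| ≤ a * (1 - a) := by
  rw [shiftCov, abs_le]
  rcases max_cases (a - f) 0 with ⟨h1, h2⟩ | ⟨h1, h2⟩ <;>
    rcases max_cases (a - 1 + f) 0 with ⟨h3, h4⟩ | ⟨h3, h4⟩ <;> rw [h1, h3] <;>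
    constructor <;> nlinarith

theorem integral_le_indicator {c₀ c₁ d : ℝ} (h : c₀ ≤ c₁) :
    IntervalIntegrable (fun u => if u ≤ d then (1 : ℝ) else 0) volume c₀ c₁ ∧
    ∫ u in c₀..c₁, (if u ≤ d then (1 : ℝ) else 0) = max (min c₁ d - c₀) 0 := by
  have e : (fun u => if u ≤ d then (1 : ℝ) else 0) = (Set.Iic d).indicator 1 := by
    funext u
    simp [Set.indicator_apply]
  rw [e]
  constructor
  · rw [intervalIntegrable_iff_integrableOn_Ioc_of_le h]
    exact (integrableOn_const (by simp)).indicator measurableSet_Iic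
  · rw [intervalIntegral.integral_of_le h, integral_indicator_one measurableSet_Iic,
      measureReal_restrict_apply measurableSet_Iic, Set.inter_comm, Set.Ioc_inter_Iic,
      Real.volume_real_Ioc]

theorem integral_piece {c₀ c₁ a d e : ℝ} (h : c₀ ≤ c₁) (hde : d ≤ e) :
    ∫ u in c₀..c₁, ((if u ≤ d then (1 : ℝ) else 0) - a) * ((if u ≤ e then 1 else 0) - a) =
      max (min c₁ d - c₀) 0 - a * (max (min c₁ d - c₀) 0 + max (min c₁ e - c₀) 0)
        + a ^ 2 * (c₁ - c₀) := by
  obtain ⟨i1, j1⟩ := integral_le_indicator (d := d) h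
  obtain ⟨i2, j2⟩ := integral_le_indicator (d := e) h
  have e1 : ∀ u, ((if u ≤ d then (1 : ℝ) else 0) - a) * ((if u ≤ e then 1 else 0) - a) =
      ((if u ≤ d then (1 : ℝ) else 0) - a * ((if u ≤ d then (1 : ℝ) else 0) +
        if u ≤ e then (1 : ℝ) else 0)) + a ^ 2 := fun u => by
    by_cases h1 : u ≤ d
    · have h2 : u ≤ e := h1.trans hde
      simp only [h1, h2, if_true]; ring
    · simp only [h1, if_false]; ring
  simp only [e1]
  rw [intervalIntegral.integral_add (i1.sub ((i1.add i2).const_mul a))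
    intervalIntegrable_const, intervalIntegral.integral_sub i1 ((i1.add i2).const_mul a),
    intervalIntegral.integral_const_mul, intervalIntegral.integral_add i1 i2, j1, j2,
    intervalIntegral.integral_const, smul_eq_mul]
  ring

/-- The covariance of the indicators of `[0, a]` at a uniform point of the circle and at its
translate by `f`. -/
theorem integral_fract_cov {a f : ℝ} (ha0 : 0 ≤ a) (ha1 : a ≤ 1) (hf0 : 0 ≤ f) (hf1 : f < 1) :
    ∫ u in (0 : ℝ)..1, ((if Int.fract u ≤ a then (1 : ℝ) else 0) - a) *
      ((if Int.fract (u + f) ≤ a then 1 else 0) - a) = shiftCov a f := by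
  have e1 : ∫ u in (0 : ℝ)..(1 - f), ((if Int.fract u ≤ a then (1 : ℝ) else 0) - a) *
      ((if Int.fract (u + f) ≤ a then 1 else 0) - a) =
      ∫ u in (0 : ℝ)..(1 - f), ((if u ≤ a - f then (1 : ℝ) else 0) - a) *
        ((if u ≤ a then 1 else 0) - a) := by
    refine intervalIntegral.integral_congr_Ioo_of_le (by linarith) fun u hu => ?_
    have h1 : Int.fract u = u := Int.fract_eq_self.2 ⟨hu.1.le, by linarith [hu.2]⟩
    have h2 : Int.fract (u + f) = u + f :=
      Int.fract_eq_self.2 ⟨by linarith [hu.1], by linarith [hu.2]⟩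
    simp only [h1, h2, ← le_sub_iff_add_le]
    ring
  have e2 : ∫ u in (1 - f)..1, ((if Int.fract u ≤ a then (1 : ℝ) else 0) - a) *
      ((if Int.fract (u + f) ≤ a then 1 else 0) - a) =
      ∫ u in (1 - f)..1, ((if u ≤ a then (1 : ℝ) else 0) - a) *
        ((if u ≤ a + 1 - f then 1 else 0) - a) := by
    refine intervalIntegral.integral_congr_Ioo_of_le (by linarith) fun u hu => ?_
    have h1 : Int.fract u = u := Int.fract_eq_self.2 ⟨by linarith [hu.1], hu.2⟩
    have h2 : Int.fract (u + f) = u + f - 1 := by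
      rw [← Int.fract_sub_one]
      exact Int.fract_eq_self.2 ⟨by linarith [hu.1], by linarith [hu.2]⟩
    have h3 : u + f - 1 ≤ a ↔ u ≤ a + 1 - f := by constructor <;> intro h <;> linarith
    simp only [h1, h2, h3]
  have hm : ∀ c d : ℝ, IntervalIntegrable (fun u =>
      ((if Int.fract u ≤ a then (1 : ℝ) else 0) - a) *
      ((if Int.fract (u + f) ≤ a then 1 else 0) - a)) volume c d := fun c d => by
    refine (intervalIntegrable_const (c := (4 : ℝ))).mono_fun ?_ (ae_of_all _ fun u => ?_)
    · have m1 : Measurable fun u : ℝ => if Int.fract u ≤ a then (1 : ℝ) else 0 :=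
        Measurable.ite (measurable_fract measurableSet_Iic) measurable_const measurable_const
      exact ((m1.sub_const a).mul ((m1.comp (measurable_add_const f)).sub_const a)).aestronglyMeasurable
    · have hq : ∀ p : Prop, [Decidable p] → |(if p then (1 : ℝ) else 0) - a| ≤ 2 := fun p _ => by
        rw [abs_le]; split_ifs <;> constructor <;> linarith
      beta_reduce
      rw [Real.norm_eq_abs, abs_mul, Real.norm_of_nonneg (by norm_num : (0:ℝ) ≤ 4)]
      have := hq (Int.fract u ≤ a)
      have := hq (Int.fract (u + f) ≤ a)
      nlinarith [abs_nonneg ((if Int.fract u ≤ a then (1 : ℝ) else 0) - a),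
        abs_nonneg ((if Int.fract (u + f) ≤ a then (1 : ℝ) else 0) - a)]
  rw [← intervalIntegral.integral_add_adjacent_intervals (hm 0 (1 - f)) (hm (1 - f) 1), e1, e2,
    integral_piece (by linarith) (by linarith), integral_piece (by linarith) (by linarith),
    min_eq_right (by linarith : a - f ≤ 1 - f), min_eq_right ha1, sub_zero, sub_zero, shiftCov]
  have h1 : a - (1 - f) = a - 1 + f := by ring
  rw [h1]
  rcases le_total a f with h | h <;> rcases le_total a (1 - f) with h' | h'
  · rw [min_eq_right h', min_eq_right (by linarith : a + 1 - f ≤ 1), max_eq_right (by linarith),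
      max_eq_left ha0, max_eq_right (by linarith : a - 1 + f ≤ 0),
      max_eq_left (by linarith : 0 ≤ a + 1 - f - (1 - f))]; ring
  · rw [min_eq_left h', min_eq_right (by linarith : a + 1 - f ≤ 1), max_eq_right (by linarith),
      max_eq_left (by linarith : 0 ≤ 1 - f), max_eq_left (by linarith : 0 ≤ a - 1 + f),
      max_eq_left (by linarith : 0 ≤ a + 1 - f - (1 - f))]; ring
  · rw [min_eq_right h', min_eq_left (by linarith : 1 ≤ a + 1 - f), max_eq_left (by linarith),
      max_eq_left ha0, max_eq_right (by linarith : a - 1 + f ≤ 0),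
      max_eq_left (by linarith : 0 ≤ 1 - (1 - f))]; ring
  · rw [min_eq_left h', min_eq_left (by linarith : 1 ≤ a + 1 - f), max_eq_left (by linarith),
      max_eq_left (by linarith : 0 ≤ 1 - f), max_eq_left (by linarith : 0 ≤ a - 1 + f),
      max_eq_left (by linarith : 0 ≤ 1 - (1 - f))]; ring

theorem ae_fract_mem (c : ℝ) : ∀ᵐ Δ : ℝ, Int.fract (c + Δ) ∈ Set.Ioo (0 : ℝ) 1 := by
  have hc : (Set.range fun n : ℤ => (n : ℝ) - c).Countable := Set.countable_range _
  filter_upwards [hc.ae_notMem volume] with Δ hΔ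
  refine ⟨lt_of_le_of_ne (Int.fract_nonneg _) fun h => hΔ ?_, Int.fract_lt_one _⟩
  obtain ⟨n, hn⟩ := Int.fract_eq_zero_iff.1 h.symm
  exact ⟨n, by simp only [hn]; ring⟩

/-- At a quantile, the kernel is a centred indicator function. -/
theorem gaussKer_quantile {y t : ℝ} (hy : y ∈ Set.Ioo (0 : ℝ) 1) :
    gaussKer (stdNormalQuantile y) t =
      -((if y ≤ stdNormalCDF t then (1 : ℝ) else 0) - stdNormalCDF t) := by
  rw [gaussKer]
  by_cases h : stdNormalCDF t < y
  · rw [if_pos ((lt_stdNormalQuantile_iff hy.1 hy.2).2 h), if_neg (not_le.2 h)]; ring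
  · rw [if_neg (fun h2 => h ((lt_stdNormalQuantile_iff hy.1 hy.2).1 h2)), if_pos (not_lt.1 h)]; ring

/-- The average over a random shift of the product of the kernels at two points. -/
theorem integral_gaussKer_shift (c c' t : ℝ) :
    ∫ Δ in Set.Icc (0 : ℝ) 1, gaussKer (stdNormalQuantile (Int.fract (c + Δ))) t *
      gaussKer (stdNormalQuantile (Int.fract (c' + Δ))) t =
      shiftCov (stdNormalCDF t) (Int.fract (c' - c)) := by
  set a := stdNormalCDF t with ha
  rw [integral_Icc_eq_integral_Ioc, ← intervalIntegral.integral_of_le zero_le_one]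
  set h : ℝ → ℝ := fun u => ((if Int.fract u ≤ a then (1 : ℝ) else 0) - a) *
      ((if Int.fract (u + Int.fract (c' - c)) ≤ a then 1 else 0) - a) with hh
  have e : ∫ Δ in (0:ℝ)..1, gaussKer (stdNormalQuantile (Int.fract (c + Δ))) t *
      gaussKer (stdNormalQuantile (Int.fract (c' + Δ))) t = ∫ Δ in (0:ℝ)..1, h (c + Δ) := by
    refine intervalIntegral.integral_congr_ae ?_
    filter_upwards [ae_fract_mem c, ae_fract_mem c'] with Δ h1 h2 _
    have e3 : Int.fract (c + Δ + Int.fract (c' - c)) = Int.fract (c' + Δ) := by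
      rw [show c + Δ + Int.fract (c' - c) = (c' + Δ) - ⌊c' - c⌋ by rw [Int.fract]; ring,
        Int.fract_sub_intCast]
    rw [gaussKer_quantile h1, gaussKer_quantile h2, hh]
    simp only [e3]
    ring
  have hper : Function.Periodic h 1 := fun u => by
    simp only [hh, Int.fract_add_one, add_right_comm u 1]
  rw [e, intervalIntegral.integral_comp_add_left, add_zero, hper.intervalIntegral_add_eq c 0,
    zero_add]
  exact integral_fract_cov (stdNormalCDF_nonneg t) (stdNormalCDF_le_one t) (Int.fract_nonneg _)
    (Int.fract_lt_one _)

theorem integrable_shiftCov (θ : ℝ) (hθ : 0 ≤ θ) {f : ℝ} (hf0 : 0 ≤ f) (hf1 : f ≤ 1) :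
    Integrable fun t => shiftCov (stdNormalCDF t) f / weightFun θ t ^ 2 := by
  refine (integrable_cdf_mul_exp (2 * θ) (by positivity)).mono' ?_ (ae_of_all _ fun t => ?_)
  · have h1 := (continuous_shiftCov_left f).comp continuous_stdNormalCDF
    have h2 : Continuous fun t => weightFun θ t ^ 2 := by unfold weightFun; fun_prop
    exact (h1.div h2 fun t => (pow_pos (Real.exp_pos _) 2).ne').aestronglyMeasurable
  · have e : (weightFun θ t ^ 2)⁻¹ = Real.exp (2 * θ * |t|) := by
      rw [weightFun, ← Real.exp_nat_mul, ← Real.exp_neg]; congr 1; push_cast; ring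
    rw [div_eq_mul_inv, e, norm_mul, Real.norm_of_nonneg (Real.exp_pos _).le]
    gcongr
    exact abs_shiftCov_le (stdNormalCDF_nonneg t) (stdNormalCDF_le_one t) hf0 hf1

end

section

/-! ### The ANOVA decomposition in several variables -/

section
variable {m : ℕ}

theorem sigmaFinite_update {ν : Fin m → Measure ℝ} [∀ i, SigmaFinite (ν i)] (j : Fin m)
    (ρ : Measure ℝ) [SigmaFinite ρ] (i : Fin m) : SigmaFinite (Function.update ν j ρ i) := by
  rcases eq_or_ne i j with rfl | h
  · rw [Function.update_self]; infer_instance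
  · rw [Function.update_of_ne h]; infer_instance

/-- A factor of a product measure that is a Dirac measure can be replaced by any other measure. -/
theorem measurePreserving_update {ν : Fin m → Measure ℝ} [∀ i, SigmaFinite (ν i)] {j : Fin m}
    {c : ℝ} (hν : ν j = Measure.dirac c) (ρ : Measure ℝ) [SigmaFinite ρ] :
    MeasurePreserving (fun q : (Fin m → ℝ) × ℝ => Function.update q.1 j q.2)
      ((Measure.pi ν).prod ρ) (Measure.pi (Function.update ν j ρ)) := by
  have hm : Measurable fun q : (Fin m → ℝ) × ℝ => Function.update q.1 j q.2 := by
    refine measurable_pi_lambda _ fun i => ?_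
    rcases eq_or_ne i j with rfl | h
    · simpa only [Function.update_self] using measurable_snd
    · simp only [Function.update_of_ne h]
      exact (measurable_pi_apply i).comp measurable_fst
  have := sigmaFinite_update (ν := ν) j ρ
  refine ⟨hm, (Measure.pi_eq fun s hs => ?_).symm⟩
  rw [Measure.map_apply hm (MeasurableSet.univ_pi hs)]
  have e : (fun q : (Fin m → ℝ) × ℝ => Function.update q.1 j q.2) ⁻¹' Set.univ.pi s =
      (Set.univ.pi (Function.update s j Set.univ)) ×ˢ s j := by
    ext q
    simp only [Set.mem_preimage, Set.mem_pi, Set.mem_univ, true_imp_iff, Set.mem_prod]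
    constructor
    · intro h
      refine ⟨fun i => ?_, by simpa using h j⟩
      rcases eq_or_ne i j with rfl | hij
      · simp
      · simpa only [Function.update_of_ne hij] using h i
    · rintro ⟨h1, h2⟩ i
      rcases eq_or_ne i j with rfl | hij
      · simpa using h2
      · simpa only [Function.update_of_ne hij] using h1 i
  rw [e, Measure.prod_prod, Measure.pi_pi, ← mul_prod_erase univ _ (mem_univ j),
    ← mul_prod_erase univ (fun i => Function.update ν j ρ i (s i)) (mem_univ j)]
  simp only [Function.update_self, hν, measure_univ, one_mul]
  rw [mul_comm]
  congr 1
  refine prod_congr rfl fun i hi => ?_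
  rw [Function.update_of_ne (ne_of_mem_erase hi), Function.update_of_ne (ne_of_mem_erase hi)]

/-- The measures of the ANOVA decomposition, when only the coordinates in `A` have been
decomposed. -/
def anovaMeas (A u : Finset (Fin m)) (x : Fin m → ℝ) (j : Fin m) : Measure ℝ :=
  if j ∈ u then volume else if j ∈ A then gaussianReal 0 1 else Measure.dirac (x j)

instance (A u : Finset (Fin m)) (x : Fin m → ℝ) (j : Fin m) : SigmaFinite (anovaMeas A u x j) := by
  unfold anovaMeas
  split_ifs <;> infer_instance

/-- The integrand of the ANOVA decomposition. -/
def anovaTerm (D : Finset (Fin m) → (Fin m → ℝ) → ℂ) (u : Finset (Fin m)) (x t : Fin m → ℝ) : ℂ :=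
  (∏ j ∈ u, gaussKer (x j) (t j)) • D u t

/-- Exponential growth of a family of functions. -/
def ExpGrowth (D : Finset (Fin m) → (Fin m → ℝ) → ℂ) (M : Finset (Fin m) → ℝ) (b : Fin m → ℝ) :
    Prop := ∀ u ξ, ‖D u ξ‖ ≤ M u * Real.exp (∑ j, b j * |ξ j|)

theorem ExpGrowth.nonneg {D : Finset (Fin m) → (Fin m → ℝ) → ℂ} {M : Finset (Fin m) → ℝ}
    {b : Fin m → ℝ} (hM : ExpGrowth D M b) (u : Finset (Fin m)) : 0 ≤ M u := by
  have h := (norm_nonneg _).trans (hM u 0)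
  simpa using h

variable {D : Finset (Fin m) → (Fin m → ℝ) → ℂ} (hD : IsDerivFamily D)
  {M : Finset (Fin m) → ℝ} {b : Fin m → ℝ} (hb : ∀ j, 0 ≤ b j) (hM : ExpGrowth D M b)

include hD hb hM in
theorem integrable_anovaTerm (A u : Finset (Fin m)) (x : Fin m → ℝ) :
    Integrable (anovaTerm D u x) (Measure.pi (anovaMeas A u x)) := by
  have h : Measurable fun t : Fin m → ℝ => ∏ j ∈ u, gaussKer (x j) (t j) :=
    Finset.measurable_prod _ fun j _ => (measurable_gaussKer (x j)).comp (measurable_pi_apply j)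
  set f : Fin m → ℝ → ℝ := fun j t =>
    (if j ∈ u then gaussKer (x j) t else 1) * Real.exp (b j * |t|) with hf
  have hfi : ∀ j, Integrable (f j) (anovaMeas A u x j) := fun j => by
    simp only [hf, anovaMeas]
    split_ifs
    · exact integrable_gaussKer_mul_exp _ _ (hb j)
    · simpa only [one_mul] using integrable_exp_mul_abs (b j)
    · exact integrable_dirac (by simp [enorm_lt_top])
  refine ((Integrable.fintype_prod hfi).norm.const_mul (M u)).mono'
    ((h.aestronglyMeasurable).smul (hD.1 u).aestronglyMeasurable) (ae_of_all _ fun t => ?_)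
  have e : ‖∏ j, f j (t j)‖ = ‖∏ j ∈ u, gaussKer (x j) (t j)‖ *
      Real.exp (∑ j, b j * |t j|) := by
    simp only [hf]
    rw [prod_mul_distrib, ← Real.exp_sum, norm_mul, Real.norm_of_nonneg (Real.exp_pos _).le,
      prod_ite_mem, univ_inter]
  rw [e, anovaTerm, norm_smul]
  calc _ ≤ ‖∏ j ∈ u, gaussKer (x j) (t j)‖ * (M u * Real.exp (∑ j, b j * |t j|)) := by
        gcongr; exact hM u t
    _ = _ := by ring

theorem anovaMeas_insert_left {A u : Finset (Fin m)} {j : Fin m} (hju : j ∉ u) (x : Fin m → ℝ) :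
    anovaMeas (insert j A) u x = Function.update (anovaMeas A u x) j (gaussianReal 0 1) := by
  funext i
  rcases eq_or_ne i j with rfl | h
  · simp [anovaMeas, hju]
  · simp [anovaMeas, h]

theorem anovaMeas_insert_both {A u : Finset (Fin m)} {j : Fin m} (x : Fin m → ℝ) :
    anovaMeas (insert j A) (insert j u) x = Function.update (anovaMeas A u x) j volume := by
  funext i
  rcases eq_or_ne i j with rfl | h
  · simp [anovaMeas]
  · simp [anovaMeas, h]

include hb hM in
theorem norm_update_le (u : Finset (Fin m)) (j : Fin m) (t : Fin m → ℝ) (s : ℝ) :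
    ‖D u (Function.update t j s)‖ ≤
      (M u * Real.exp (∑ i, b i * |t i|)) * Real.exp (b j * |s|) := by
  refine (hM u _).trans ?_
  rw [mul_assoc, ← Real.exp_add]
  refine mul_le_mul_of_nonneg_left (Real.exp_le_exp.2 ?_) (hM.nonneg u)
  have h : ∀ i, b i * |Function.update t j s i| ≤ b i * |t i| + if i = j then b j * |s| else 0 :=
    fun i => by
      rcases eq_or_ne i j with rfl | h
      · rw [Function.update_self, if_pos rfl]
        exact le_add_of_nonneg_left (mul_nonneg (hb _) (abs_nonneg _))
      · rw [Function.update_of_ne h, if_neg h, add_zero]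
  refine (sum_le_sum fun i _ => h i).trans (le_of_eq ?_)
  rw [sum_add_distrib, sum_ite_eq' univ j]
  simp

include hD hb hM in
/-- One step of the ANOVA decomposition: the one-dimensional decomposition in the variable `j`, in
which the measure on the left is the Dirac measure at `x j`. -/
theorem integral_anovaTerm_insert {A u : Finset (Fin m)} {j : Fin m} (hjA : j ∉ A) (hju : j ∉ u)
    (x : Fin m → ℝ) :
    ∫ t, anovaTerm D u x t ∂(Measure.pi (anovaMeas A u x)) =
      ∫ t, anovaTerm D u x t ∂(Measure.pi (anovaMeas (insert j A) u x)) +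
      ∫ t, anovaTerm D (insert j u) x t
        ∂(Measure.pi (anovaMeas (insert j A) (insert j u) x)) := by
  have hν : anovaMeas A u x j = Measure.dirac (x j) := by simp [anovaMeas, hju, hjA]
  have hp1 := measurePreserving_update (ν := anovaMeas A u x) hν (gaussianReal 0 1)
  have hp2 := measurePreserving_update (ν := anovaMeas A u x) hν volume
  have i1 := integrable_anovaTerm hD hb hM (insert j A) u x
  have i2 := integrable_anovaTerm hD hb hM (insert j A) (insert j u) x
  rw [anovaMeas_insert_left hju] at i1 ⊢
  rw [anovaMeas_insert_both] at i2 ⊢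
  have j1 := hp1.integrable_comp_of_integrable i1
  have j2 := hp2.integrable_comp_of_integrable i2
  have k1 : ∫ t, anovaTerm D u x t
      ∂(Measure.pi (Function.update (anovaMeas A u x) j (gaussianReal 0 1))) =
      ∫ t, ∫ s, anovaTerm D u x (Function.update t j s) ∂(gaussianReal 0 1)
        ∂(Measure.pi (anovaMeas A u x)) := by
    rw [← hp1.map_eq] at i1 ⊢
    rw [integral_map hp1.measurable.aemeasurable i1.aestronglyMeasurable]
    exact integral_prod _ j1
  have k2 : ∫ t, anovaTerm D (insert j u) x t
      ∂(Measure.pi (Function.update (anovaMeas A u x) j volume)) =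
      ∫ t, (∫ s, anovaTerm D (insert j u) x (Function.update t j s))
        ∂(Measure.pi (anovaMeas A u x)) := by
    rw [← hp2.map_eq] at i2 ⊢
    rw [integral_map hp2.measurable.aemeasurable i2.aestronglyMeasurable]
    exact integral_prod _ j2
  rw [k1, k2]
  refine Eq.trans ?_ (integral_add j1.integral_prod_left j2.integral_prod_left)
  refine integral_congr_ae ?_
  have hae : ∀ᵐ t ∂(Measure.pi (anovaMeas A u x)), t j = x j := by
    have h := Measure.tendsto_eval_ae_ae (μ := anovaMeas A u x) (i := j)
    rw [hν] at h
    exact h.eventually (p := fun y => y = x j) (by rw [ae_dirac_eq]; exact eventually_pure.2 rfl)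
  filter_upwards [hae] with t ht
  have hpr : ∀ s, ∏ i ∈ u, gaussKer (x i) (Function.update t j s i) =
      ∏ i ∈ u, gaussKer (x i) (t i) := fun s =>
    prod_congr rfl fun i hi => by rw [Function.update_of_ne (ne_of_mem_of_not_mem hi hju)]
  have hder : ∀ s, HasDerivAt (fun r => D u (Function.update t j r))
      (D (insert j u) (Function.update t j s)) s := fun s => by
    have := hD.2 u j hju (Function.update t j s)
    simpa only [Function.update_idem, Function.update_self] using this
  have hcont : ∀ v, Continuous fun s => D v (Function.update t j s) := fun v =>
    (hD.1 v).comp (continuous_const.update j continuous_id)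
  have h1d := eq_integral_add_integral_gaussKer hder (hcont _) (hb j)
    (norm_update_le hb hM (insert j u) j t)
    (((integrable_exp_mul_abs (b j)).const_mul _).mono' (hcont u).aestronglyMeasurable
      (ae_of_all _ (norm_update_le hb hM u j t))) (x j)
  have e1 : ∀ s, anovaTerm D u x (Function.update t j s) =
      (∏ i ∈ u, gaussKer (x i) (t i)) • D u (Function.update t j s) := fun s => by
    rw [anovaTerm, hpr]
  have e2 : ∀ s, anovaTerm D (insert j u) x (Function.update t j s) =
      (∏ i ∈ u, gaussKer (x i) (t i)) •
        (gaussKer (x j) s • D (insert j u) (Function.update t j s)) := fun s => by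
    rw [anovaTerm, prod_insert hju, hpr, Function.update_self, mul_comm, mul_smul]
  change _ = ∫ s, anovaTerm D u x (Function.update t j s) ∂(gaussianReal 0 1) +
    ∫ s, anovaTerm D (insert j u) x (Function.update t j s)
  simp only [e1, e2]
  rw [integral_smul, integral_smul, ← smul_add, ← h1d, anovaTerm]
  congr 2
  rw [← ht, Function.update_eq_self]

include hD hb hM in
/-- The ANOVA decomposition in the variables of `A`; the remaining ones are frozen at `x`. -/
theorem anova_partial (A : Finset (Fin m)) (x : Fin m → ℝ) :
    D ∅ x = ∑ u ∈ A.powerset, ∫ t, anovaTerm D u x t ∂(Measure.pi (anovaMeas A u x)) := by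
  induction A using Finset.induction_on with
  | empty =>
    rw [powerset_empty, sum_singleton]
    have hae : ∀ᵐ t ∂(Measure.pi (anovaMeas ∅ ∅ x)), t = x := by
      have h : ∀ j, ∀ᵐ t ∂(Measure.pi (anovaMeas ∅ ∅ x)), t j = x j := fun j => by
        have h := Measure.tendsto_eval_ae_ae (μ := anovaMeas ∅ ∅ x) (i := j)
        have hν : anovaMeas ∅ ∅ x j = Measure.dirac (x j) := by simp [anovaMeas]
        rw [hν] at h
        exact h.eventually (p := fun y => y = x j) (by rw [ae_dirac_eq]; exact eventually_pure.2 rfl)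
      filter_upwards [ae_all_iff.2 h] with t ht
      exact funext ht
    have : IsProbabilityMeasure (Measure.pi (anovaMeas ∅ ∅ x)) := by
      have : ∀ j, IsProbabilityMeasure (anovaMeas ∅ ∅ x j) := fun j => by
        simp only [anovaMeas, notMem_empty, if_false]; infer_instance
      infer_instance
    rw [integral_congr_ae (g := fun _ => D ∅ x)]
    · simp
    · filter_upwards [hae] with t ht
      rw [ht, anovaTerm, prod_empty, one_smul]
  | insert j A hj ih =>
    rw [sum_powerset_insert hj, ← sum_add_distrib, ih]
    exact sum_congr rfl fun u hu =>
      integral_anovaTerm_insert hD hb hM hj (fun h => hj (mem_powerset.1 hu h)) x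

/-- Lebesgue measure in the coordinates `j ∈ u`, the Gaussian measure in the others. -/
def anovaVol (u : Finset (Fin m)) (j : Fin m) : Measure ℝ :=
  if j ∈ u then volume else gaussianReal 0 1

instance (u : Finset (Fin m)) (j : Fin m) : SigmaFinite (anovaVol u j) := by
  unfold anovaVol
  split_ifs <;> infer_instance

theorem anovaMeas_univ (u : Finset (Fin m)) (x : Fin m → ℝ) :
    anovaMeas univ u x = anovaVol u := by
  funext j
  simp [anovaMeas, anovaVol]

include hD hb hM in
/-- The value of a function at a point, in terms of its mixed first derivatives. The term `u = ∅`
is the Gaussian mean. -/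
theorem anova (x : Fin m → ℝ) :
    D ∅ x = ∑ u, ∫ t, anovaTerm D u x t ∂(Measure.pi (anovaVol u)) := by
  have h := anova_partial hD hb hM univ x
  simpa only [anovaMeas_univ, powerset_univ] using h

/-- The average of the product of the kernels over the points of a quadrature rule. -/
def kerAvg {ι : Type*} (s : Finset ι) (N : ℕ) (X : ι → Fin m → ℝ) (u : Finset (Fin m))
    (t : Fin m → ℝ) : ℝ := (N : ℝ)⁻¹ * ∑ k ∈ s, ∏ j ∈ u, gaussKer (X k j) (t j)

include hD hb hM in
/-- The error of a quadrature rule, in terms of the mixed derivatives of the integrand. -/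
theorem quadrature_error {ι : Type*} (s : Finset ι) {N : ℕ} (hN : 1 ≤ N) (hs : s.card = N)
    (X : ι → Fin m → ℝ) :
    (N : ℂ)⁻¹ * ∑ k ∈ s, D ∅ (X k) - ∫ t, D ∅ t ∂gaussFin m =
      ∑ u ∈ univ.erase ∅, ∫ t, kerAvg s N X u t • D u t ∂(Measure.pi (anovaVol u)) := by
  have hN0 : (N : ℂ) ≠ 0 := by exact_mod_cast (by omega : N ≠ 0)
  have i1 : ∀ u x, Integrable (anovaTerm D u x) (Measure.pi (anovaVol u)) := fun u x => by
    rw [← anovaMeas_univ u x]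
    exact integrable_anovaTerm hD hb hM univ u x
  have hk : ∀ u, (N : ℂ)⁻¹ * ∑ k ∈ s, ∫ t, anovaTerm D u (X k) t ∂(Measure.pi (anovaVol u)) =
      ∫ t, kerAvg s N X u t • D u t ∂(Measure.pi (anovaVol u)) := fun u => by
    rw [← integral_finsetSum _ fun k _ => i1 u (X k), ← integral_const_mul]
    refine integral_congr_ae (ae_of_all _ fun t => ?_)
    simp only [anovaTerm, kerAvg]
    rw [← sum_smul, mul_smul, Complex.real_smul, Complex.real_smul]
    push_cast; rfl
  have h0 : ∫ t, D ∅ t ∂gaussFin m = ∫ t, kerAvg s N X ∅ t • D ∅ t ∂(Measure.pi (anovaVol ∅)) := by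
    have e : (fun _ : Fin m => gaussianReal 0 1) = anovaVol (∅ : Finset (Fin m)) := by
      funext j; simp [anovaVol]
    have e2 : ∀ t, kerAvg s N X ∅ t = 1 := fun t => by
      have : (N : ℝ) ≠ 0 := by exact_mod_cast (by omega : N ≠ 0)
      simp [kerAvg, hs, this]
    rw [gaussFin, e]
    simp only [e2, one_smul]
  have hsum : (N : ℂ)⁻¹ * ∑ k ∈ s, D ∅ (X k) =
      ∑ u, ∫ t, kerAvg s N X u t • D u t ∂(Measure.pi (anovaVol u)) := by
    rw [sum_congr rfl fun k _ => anova hD hb hM (X k), sum_comm, mul_sum]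
    exact sum_congr rfl fun u _ => hk u
  rw [hsum, h0, ← add_sum_erase univ _ (mem_univ ∅), add_sub_cancel_left]

end

end

section

/-! ### The mean square error of the lattice rule -/

theorem sum_range_zmod {M : Type*} [AddCommMonoid M] {N : ℕ} [NeZero N] (g : ZMod N → M) :
    ∑ k ∈ range N, g k = ∑ r, g r := by
  refine sum_nbij' (fun k => (k : ZMod N)) (fun r => r.val) (fun _ _ => mem_univ _)
    (fun r _ => mem_range.2 (ZMod.val_lt r)) (fun k hk => ?_) (fun r _ => ?_) fun _ _ => rfl
  · rw [ZMod.val_natCast, Nat.mod_eq_of_lt (mem_range.1 hk)]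
  · exact ZMod.natCast_zmod_val r

theorem sum_Icc_periodic {N : ℕ} (hN : 1 ≤ N) {G : ℤ → ℝ} (hG : Function.Periodic G N) (c : ℤ) :
    ∑ k ∈ Icc 1 N, G (k - c) = ∑ k ∈ range N, G k := by
  have : NeZero N := ⟨by omega⟩
  set g : ZMod N → ℝ := fun r => G (r.val : ℤ) with hg
  have hgG : ∀ k : ℤ, G k = g (k : ZMod N) := fun k => by
    simp only [hg]
    rw [ZMod.val_intCast]
    conv_lhs => rw [← Int.emod_add_mul_ediv k N, mul_comm]
    exact hG.int_mul _ _
  have e1 : ∑ k ∈ Icc 1 N, G (k - c) = ∑ k ∈ range N, g ((k : ZMod N) + (1 - (c : ZMod N))) := by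
    rw [← Finset.Ico_add_one_right_eq_Icc, sum_Ico_eq_sum_range]
    refine sum_congr (by simp) fun k _ => ?_
    rw [hgG]; congr 1; push_cast; ring
  have e2 : ∑ k ∈ range N, G k = ∑ k ∈ range N, g (k : ZMod N) :=
    sum_congr rfl fun k _ => by rw [hgG, Int.cast_natCast]
  rw [e1, sum_range_zmod fun r => g (r + (1 - (c : ZMod N))), e2, sum_range_zmod g]
  exact Equiv.sum_comp (Equiv.addRight ((1 : ZMod N) - c)) g

/-- The points of the shifted lattice rule. -/
def latPt {m : ℕ} (N : ℕ) (z : ℕ → ℕ) (Δ : Fin m → ℝ) (k : ℕ) (j : Fin m) : ℝ :=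
  stdNormalQuantile (Int.fract ((k : ℝ) * (z j : ℝ) / N + Δ j))

theorem measurable_latPt {m : ℕ} (N : ℕ) (z : ℕ → ℕ) (k : ℕ) :
    Measurable fun Δ : Fin m → ℝ => latPt N z Δ k :=
  measurable_pi_lambda _ fun j => measurable_stdNormalQuantile.comp
    (measurable_fract.comp ((measurable_pi_apply j).const_add _))

theorem restrict_Icc_eq_pi (m : ℕ) : (volume : Measure (Fin m → ℝ)).restrict (Set.Icc 0 1) =
    Measure.pi fun _ : Fin m => (volume : Measure ℝ).restrict (Set.Icc 0 1) := by
  rw [← Set.pi_univ_Icc, volume_pi, Measure.restrict_pi_pi]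
  rfl

instance (m : ℕ) : IsProbabilityMeasure ((volume : Measure (Fin m → ℝ)).restrict (Set.Icc 0 1)) := by
  have : IsProbabilityMeasure ((volume : Measure ℝ).restrict (Set.Icc 0 1)) := ⟨by simp⟩
  rw [restrict_Icc_eq_pi]
  infer_instance

section
variable {m : ℕ}

theorem abs_prod_gaussKer_le (u : Finset (Fin m)) (x t : Fin m → ℝ) :
    |∏ j ∈ u, gaussKer (x j) (t j)| ≤ 1 := by
  rw [abs_prod]
  exact prod_le_one (fun _ _ => abs_nonneg _) fun _ _ => abs_gaussKer_le _ _

theorem measurable_prod_gaussKer (N : ℕ) (z : ℕ → ℕ) (u : Finset (Fin m)) (k : ℕ) :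
    Measurable fun q : (Fin m → ℝ) × (Fin m → ℝ) =>
      ∏ j ∈ u, gaussKer (latPt N z q.1 k j) (q.2 j) := by
  refine Finset.measurable_prod _ fun j _ => measurable_gaussKer_prod.comp
    (Measurable.prodMk ?_ ?_)
  · exact (measurable_pi_apply j).comp ((measurable_latPt N z k).comp measurable_fst)
  · exact (measurable_pi_apply j).comp measurable_snd

theorem measurable_kerAvg (N : ℕ) (z : ℕ → ℕ) (u : Finset (Fin m)) :
    Measurable fun q : (Fin m → ℝ) × (Fin m → ℝ) =>
      kerAvg (Icc 1 N) N (latPt N z q.1) u q.2 :=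
  (Finset.measurable_sum _ fun k _ => measurable_prod_gaussKer N z u k).const_mul _

/-- The shift average of the product of the kernels at two lattice points. -/
theorem integral_prod_gaussKer (N : ℕ) (z : ℕ → ℕ) (u : Finset (Fin m)) (k l : ℕ)
    (t : Fin m → ℝ) :
    ∫ Δ in Set.Icc (0 : Fin m → ℝ) 1, (∏ j ∈ u, gaussKer (latPt N z Δ k j) (t j)) *
      ∏ j ∈ u, gaussKer (latPt N z Δ l j) (t j) =
      ∏ j ∈ u, shiftCov (stdNormalCDF (t j))
        (Int.fract ((l : ℝ) * (z j : ℝ) / N - (k : ℝ) * (z j : ℝ) / N)) := by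
  set f : Fin m → ℝ → ℝ := fun j y => if j ∈ u then
    gaussKer (stdNormalQuantile (Int.fract ((k : ℝ) * (z j : ℝ) / N + y))) (t j) *
    gaussKer (stdNormalQuantile (Int.fract ((l : ℝ) * (z j : ℝ) / N + y))) (t j) else 1 with hf
  have e : ∀ Δ : Fin m → ℝ, (∏ j ∈ u, gaussKer (latPt N z Δ k j) (t j)) *
      ∏ j ∈ u, gaussKer (latPt N z Δ l j) (t j) = ∏ j, f j (Δ j) := fun Δ => by
    simp only [hf]
    rw [prod_ite_mem, univ_inter, ← prod_mul_distrib]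
    rfl
  have hp : IsProbabilityMeasure ((volume : Measure ℝ).restrict (Set.Icc 0 1)) := ⟨by simp⟩
  have e2 : ∀ j : Fin m, ∫ y in Set.Icc (0 : ℝ) 1, f j y =
      if j ∈ u then shiftCov (stdNormalCDF (t j))
        (Int.fract ((l : ℝ) * (z j : ℝ) / N - (k : ℝ) * (z j : ℝ) / N)) else 1 := fun j => by
    by_cases hj : j ∈ u
    · simp only [hf, hj, if_true]
      exact integral_gaussKer_shift _ _ _
    · simp only [hf, hj, if_false]
      rw [integral_const, probReal_univ, one_smul]
  simp only [e]
  rw [restrict_Icc_eq_pi, integral_fintype_prod_eq_prod (𝕜 := ℝ) f]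
  simp only [e2]
  rw [prod_ite_mem, univ_inter]

theorem integral_kerAvg_sq {N : ℕ} (hN : 1 ≤ N) (z : ℕ → ℕ) (u : Finset (Fin m)) (t : Fin m → ℝ) :
    ∫ Δ in Set.Icc (0 : Fin m → ℝ) 1, kerAvg (Icc 1 N) N (latPt N z Δ) u t ^ 2 =
      (N : ℝ)⁻¹ * ∑ k ∈ range N, ∏ j ∈ u, shiftCov (stdNormalCDF (t j))
        (Int.fract ((k : ℝ) * (z j : ℝ) / N)) := by
  have hN0 : (N : ℝ) ≠ 0 := by exact_mod_cast (by omega : N ≠ 0)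
  have hi : ∀ k l : ℕ, Integrable (fun Δ : Fin m → ℝ =>
      (∏ j ∈ u, gaussKer (latPt N z Δ k j) (t j)) * ∏ j ∈ u, gaussKer (latPt N z Δ l j) (t j))
      (volume.restrict (Set.Icc 0 1)) := fun k l => by
    have hm : ∀ k, Measurable fun Δ : Fin m → ℝ => ∏ j ∈ u, gaussKer (latPt N z Δ k j) (t j) :=
      fun k => Finset.measurable_prod _ fun j _ => measurable_gaussKer_prod.comp
        (((measurable_pi_apply j).comp (measurable_latPt N z k)).prodMk measurable_const)
    refine Integrable.mono' (integrable_const (1 : ℝ)) ((hm k).mul (hm l)).aestronglyMeasurable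
      (ae_of_all _ fun Δ => ?_)
    rw [Real.norm_eq_abs, abs_mul]
    exact mul_le_one₀ (abs_prod_gaussKer_le u (latPt N z Δ k) t) (abs_nonneg _)
      (abs_prod_gaussKer_le u (latPt N z Δ l) t)
  have e : ∀ Δ : Fin m → ℝ, kerAvg (Icc 1 N) N (latPt N z Δ) u t ^ 2 =
      (N : ℝ)⁻¹ ^ 2 * ∑ k ∈ Icc 1 N, ∑ l ∈ Icc 1 N,
        (∏ j ∈ u, gaussKer (latPt N z Δ k j) (t j)) *
          ∏ j ∈ u, gaussKer (latPt N z Δ l j) (t j) := fun Δ => by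
    rw [kerAvg, mul_pow, sq (∑ k ∈ Icc 1 N, _), sum_mul_sum]
  simp only [e]
  rw [integral_const_mul, integral_finsetSum _ fun k _ => integrable_finsetSum _ fun l _ => hi k l]
  set G : ℤ → ℝ := fun k => ∏ j ∈ u, shiftCov (stdNormalCDF (t j))
        (Int.fract ((k : ℝ) * (z j : ℝ) / N)) with hG
  have hper : Function.Periodic G N := fun k => by
    simp only [hG]
    refine prod_congr rfl fun j _ => ?_
    congr 1
    have : (((k + N : ℤ) : ℝ) * (z j : ℝ) / N) = (k : ℝ) * (z j : ℝ) / N + ((z j : ℤ) : ℝ) := by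
      push_cast
      field_simp
    rw [this, Int.fract_add_intCast]
  have e2 : ∀ k ∈ Icc 1 N, ∫ Δ in Set.Icc (0 : Fin m → ℝ) 1, (∑ l ∈ Icc 1 N,
        (∏ j ∈ u, gaussKer (latPt N z Δ k j) (t j)) *
          ∏ j ∈ u, gaussKer (latPt N z Δ l j) (t j)) = ∑ l ∈ range N, G l := fun k _ => by
    rw [integral_finsetSum _ fun l _ => hi k l, ← sum_Icc_periodic hN hper k]
    refine sum_congr rfl fun l _ => ?_
    rw [integral_prod_gaussKer]
    simp only [hG]
    refine prod_congr rfl fun j _ => ?_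
    congr 2
    push_cast; ring
  rw [sum_congr rfl e2, sum_const, Nat.card_Icc, add_tsub_cancel_right, nsmul_eq_mul]
  simp only [hG, Int.cast_natCast]
  field_simp

/-- The shift average of the squared weighted norm of the averaged kernel is the part of the
squared worst-case error that belongs to `u`. -/
theorem lintegral_kerAvg_sq {N : ℕ} (hN : 1 ≤ N) (z : ℕ → ℕ) {θ : ℕ → ℝ} (hθ : ∀ j, 0 ≤ θ j)
    (u : Finset (Fin m)) :
    0 ≤ (N : ℝ)⁻¹ * ∑ k ∈ range N, ∏ j ∈ u,
      shiftKernel (θ j) (Int.fract ((k : ℝ) * (z j : ℝ) / N)) ∧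
    ∫⁻ Δ in Set.Icc (0 : Fin m → ℝ) 1, ∫⁻ t, ENNReal.ofReal
      (kerAvg (Icc 1 N) N (latPt N z Δ) u t ^ 2 * ∏ j ∈ u, (weightFun (θ j) (t j) ^ 2)⁻¹)
        ∂(Measure.pi (anovaVol u)) =
      ENNReal.ofReal ((N : ℝ)⁻¹ * ∑ k ∈ range N, ∏ j ∈ u,
        shiftKernel (θ j) (Int.fract ((k : ℝ) * (z j : ℝ) / N))) := by
  have hw0 : ∀ t : Fin m → ℝ, 0 ≤ ∏ j ∈ u, (weightFun (θ j) (t j) ^ 2)⁻¹ := fun t =>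
    prod_nonneg fun j _ => inv_nonneg.2 (sq_nonneg _)
  have hwm : Measurable fun t : Fin m → ℝ => ∏ j ∈ u, (weightFun (θ j) (t j) ^ 2)⁻¹ := by
    refine Finset.measurable_prod _ fun j _ => ?_
    have : Measurable fun y : ℝ => (weightFun (θ j) y ^ 2)⁻¹ := by unfold weightFun; fun_prop
    exact this.comp (measurable_pi_apply j)
  set H : (Fin m → ℝ) → ℝ := fun t => (N : ℝ)⁻¹ * ∑ k ∈ range N, ∏ j ∈ u,
    (shiftCov (stdNormalCDF (t j)) (Int.fract ((k : ℝ) * (z j : ℝ) / N)) /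
      weightFun (θ j) (t j) ^ 2) with hH
  have hH1 : ∀ t, ∫ Δ in Set.Icc (0 : Fin m → ℝ) 1, kerAvg (Icc 1 N) N (latPt N z Δ) u t ^ 2 *
      ∏ j ∈ u, (weightFun (θ j) (t j) ^ 2)⁻¹ = H t := fun t => by
    rw [integral_mul_const, integral_kerAvg_sq hN, mul_assoc, sum_mul]
    simp only [hH, div_eq_mul_inv, prod_mul_distrib]
  have hH0 : ∀ t, 0 ≤ H t := fun t => by
    rw [← hH1]
    exact integral_nonneg fun Δ => mul_nonneg (sq_nonneg _) (hw0 t)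
  have hHi : ∀ k : ℕ, Integrable (fun t : Fin m → ℝ => ∏ j ∈ u,
      (shiftCov (stdNormalCDF (t j)) (Int.fract ((k : ℝ) * (z j : ℝ) / N)) /
      weightFun (θ j) (t j) ^ 2)) (Measure.pi (anovaVol u)) ∧
      ∫ t : Fin m → ℝ, ∏ j ∈ u,
      (shiftCov (stdNormalCDF (t j)) (Int.fract ((k : ℝ) * (z j : ℝ) / N)) /
      weightFun (θ j) (t j) ^ 2) ∂(Measure.pi (anovaVol u)) =
      ∏ j ∈ u, shiftKernel (θ j) (Int.fract ((k : ℝ) * (z j : ℝ) / N)) := fun k => by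
    set f : Fin m → ℝ → ℝ := fun j y => if j ∈ u then
        shiftCov (stdNormalCDF y) (Int.fract ((k : ℝ) * (z j : ℝ) / N)) /
          weightFun (θ j) y ^ 2 else 1 with hf
    have e : ∀ t : Fin m → ℝ, ∏ j ∈ u,
      (shiftCov (stdNormalCDF (t j)) (Int.fract ((k : ℝ) * (z j : ℝ) / N)) /
      weightFun (θ j) (t j) ^ 2) = ∏ j, f j (t j) := fun t => by
      simp only [hf]
      rw [prod_ite_mem, univ_inter]
    have hi : ∀ j : Fin m, Integrable (f j) (anovaVol u j) ∧ ∫ y : ℝ, f j y ∂(anovaVol u j) =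
        if j ∈ u then shiftKernel (θ j) (Int.fract ((k : ℝ) * (z j : ℝ) / N)) else 1 := fun j => by
      by_cases hj : j ∈ u
      · simp only [hf, hj, if_true, anovaVol]
        exact ⟨integrable_shiftCov _ (hθ j) (Int.fract_nonneg _) (Int.fract_lt_one _).le, rfl⟩
      · simp only [hf, hj, if_false, anovaVol]
        exact ⟨integrable_const _, by rw [integral_const, probReal_univ, one_smul]⟩
    simp only [e]
    refine ⟨Integrable.fintype_prod fun j => (hi j).1, ?_⟩
    rw [integral_fintype_prod_eq_prod (𝕜 := ℝ) f]
    simp only [fun j => (hi j).2]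
    rw [prod_ite_mem, univ_inter]
  have hHint : Integrable H (Measure.pi (anovaVol u)) :=
    (integrable_finsetSum _ fun k _ => (hHi k).1).const_mul _
  have hHval : ∫ t, H t ∂(Measure.pi (anovaVol u)) = (N : ℝ)⁻¹ * ∑ k ∈ range N, ∏ j ∈ u,
      shiftKernel (θ j) (Int.fract ((k : ℝ) * (z j : ℝ) / N)) := by
    simp only [hH]
    rw [integral_const_mul, integral_finsetSum _ fun k _ => (hHi k).1]
    simp only [fun k => (hHi k).2]
  have hmeas : Measurable fun q : (Fin m → ℝ) × (Fin m → ℝ) =>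
      kerAvg (Icc 1 N) N (latPt N z q.1) u q.2 ^ 2 *
        ∏ j ∈ u, (weightFun (θ j) (q.2 j) ^ 2)⁻¹ :=
    ((measurable_kerAvg N z u).pow_const 2).mul (hwm.comp measurable_snd)
  refine ⟨by rw [← hHval]; exact integral_nonneg hH0, ?_⟩
  rw [lintegral_lintegral_swap hmeas.ennreal_ofReal.aemeasurable, ← hHval,
    ofReal_integral_eq_lintegral_ofReal hHint (ae_of_all _ hH0)]
  refine lintegral_congr fun t => ?_
  rw [← hH1, ofReal_integral_eq_lintegral_ofReal ?_
    (ae_of_all _ fun Δ => mul_nonneg (sq_nonneg _) (hw0 t))]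
  refine Integrable.mul_const ?_ _
  refine Integrable.mono' (integrable_const (1 : ℝ))
    (((measurable_kerAvg N z u).comp measurable_prodMk_right).pow_const 2).aestronglyMeasurable
    (ae_of_all _ fun Δ => ?_)
  rw [Real.norm_of_nonneg (sq_nonneg _), sq_le_one_iff_abs_le_one, kerAvg, abs_mul,
    abs_of_nonneg (by positivity)]
  have hs : |∑ k ∈ Icc 1 N, ∏ j ∈ u, gaussKer (latPt N z Δ k j) (t j)| ≤ N := by
    refine (abs_sum_le_sum_abs _ _).trans ((sum_le_sum fun k _ =>
      abs_prod_gaussKer_le u (latPt N z Δ k) t).trans (le_of_eq ?_))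
    simp
  calc (N : ℝ)⁻¹ * _ ≤ (N : ℝ)⁻¹ * N := by gcongr
    _ ≤ 1 := inv_mul_le_one

/-- The weighted `L²` norm of a mixed derivative. -/
theorem lintegral_weighted_le {D : Finset (Fin m) → (Fin m → ℝ) → ℂ}
    {M : Finset (Fin m) → ℝ} {b : ℕ → ℝ} (hM : ExpGrowth D M fun j => b j)
    {θ : ℕ → ℝ} (hθ : ∀ j, b j < θ j) (u : Finset (Fin m)) :
    ∫⁻ t, (‖D u t‖ₑ * ENNReal.ofReal (∏ j ∈ u, weightFun (θ j) (t j))) ^ (2 : ℝ)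
      ∂(Measure.pi (anovaVol u)) ≤
      ENNReal.ofReal (M u ^ 2 * ((∏ j ∈ u, 1 / (θ j - b j)) *
        ∏ j ∈ univ \ u, ∫ y, Real.exp (2 * b j * |y|) ∂(gaussianReal 0 1))) := by
  set h : Fin m → ℝ → ℝ := fun j y => if j ∈ u then Real.exp (-(2 * (θ j - b j)) * |y|) else
    Real.exp (2 * b j * |y|) with hh
  have hi : ∀ j, Integrable (h j) (anovaVol u j) ∧ ∫ y, h j y ∂(anovaVol u j) =
      if j ∈ u then 1 / (θ j - b j) else ∫ y, Real.exp (2 * b j * |y|) ∂(gaussianReal 0 1) :=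
    fun j => by
      by_cases hj : j ∈ u
      · simp only [hh, hj, if_true, anovaVol]
        have hc : 0 < 2 * (θ j - b j) := by linarith [hθ j]
        refine ⟨(integrable_exp_neg_mul_abs hc).1, ?_⟩
        rw [(integrable_exp_neg_mul_abs hc).2]
        have : θ j - b j ≠ 0 := by linarith [hθ j]
        field_simp
      · simp only [hh, hj, if_false, anovaVol]
        exact ⟨integrable_exp_mul_abs _, trivial⟩
  have hint := (Integrable.fintype_prod fun j => (hi j).1).const_mul (M u ^ 2)
  have hval : ∫ t : Fin m → ℝ, M u ^ 2 * ∏ j, h j (t j) ∂(Measure.pi (anovaVol u)) =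
      M u ^ 2 * ((∏ j ∈ u, 1 / (θ j - b j)) *
        ∏ j ∈ univ \ u, ∫ y, Real.exp (2 * b j * |y|) ∂(gaussianReal 0 1)) := by
    rw [integral_const_mul, integral_fintype_prod_eq_prod (𝕜 := ℝ)]
    simp only [fun j => (hi j).2]
    rw [prod_ite, filter_mem_eq_inter, univ_inter, filter_notMem_eq_sdiff]
  have hpos : ∀ t : Fin m → ℝ, 0 ≤ M u ^ 2 * ∏ j, h j (t j) := fun t =>
    mul_nonneg (sq_nonneg _) (prod_nonneg fun j _ => by
      simp only [hh]; split_ifs <;> exact (Real.exp_pos _).le)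
  rw [← hval, ofReal_integral_eq_lintegral_ofReal hint (ae_of_all _ hpos)]
  refine lintegral_mono fun t => ?_
  have hM0 := hM.nonneg u
  have hprod0 : 0 ≤ ∏ j ∈ u, weightFun (θ j) (t j) := prod_nonneg fun j _ => (Real.exp_pos _).le
  rw [← ofReal_norm, ← ENNReal.ofReal_mul (norm_nonneg _),
    ENNReal.ofReal_rpow_of_nonneg (mul_nonneg (norm_nonneg _) hprod0) (by norm_num), Real.rpow_two]
  refine ENNReal.ofReal_le_ofReal ?_
  have e : (∏ j ∈ u, weightFun (θ j) (t j)) ^ 2 * Real.exp (∑ j : Fin m, b j * |t j|) ^ 2 =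
      ∏ j, h j (t j) := by
    have e1 : ∏ j ∈ u, weightFun (θ j) (t j) =
        ∏ j, if j ∈ u then weightFun (θ j) (t j) else 1 := by rw [prod_ite_mem, univ_inter]
    rw [e1, Real.exp_sum, ← mul_pow, ← prod_mul_distrib, ← prod_pow]
    refine prod_congr rfl fun j _ => ?_
    simp only [hh]
    split_ifs
    · rw [weightFun, ← Real.exp_add, ← Real.exp_nat_mul]; congr 1; push_cast; ring
    · rw [one_mul, ← Real.exp_nat_mul]; congr 1; push_cast; ring
  calc (‖D u t‖ * ∏ j ∈ u, weightFun (θ j) (t j)) ^ 2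
      ≤ ((M u * Real.exp (∑ j : Fin m, b j * |t j|)) * ∏ j ∈ u, weightFun (θ j) (t j)) ^ 2 := by
        gcongr
        exact hM u t
    _ = M u ^ 2 * ((∏ j ∈ u, weightFun (θ j) (t j)) ^ 2 *
        Real.exp (∑ j : Fin m, b j * |t j|) ^ 2) := by ring
    _ = _ := by rw [e]

/-- The Cauchy–Schwarz inequality with the weight functions. -/
theorem sq_enorm_integral_le {D : Finset (Fin m) → (Fin m → ℝ) → ℂ} (hD : IsDerivFamily D)
    {M : Finset (Fin m) → ℝ} {b : ℕ → ℝ} (hM : ExpGrowth D M fun j => b j)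
    {θ : ℕ → ℝ} (hθ : ∀ j, b j < θ j) (u : Finset (Fin m)) (N : ℕ) (z : ℕ → ℕ)
    (Δ : Fin m → ℝ) :
    ‖∫ t, kerAvg (Icc 1 N) N (latPt N z Δ) u t • D u t ∂(Measure.pi (anovaVol u))‖ₑ ≤
      (∫⁻ t, ENNReal.ofReal (kerAvg (Icc 1 N) N (latPt N z Δ) u t ^ 2 *
        ∏ j ∈ u, (weightFun (θ j) (t j) ^ 2)⁻¹) ∂(Measure.pi (anovaVol u))) ^ (1 / (2 : ℝ)) *
      (ENNReal.ofReal (M u ^ 2 * ((∏ j ∈ u, 1 / (θ j - b j)) *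
        ∏ j ∈ univ \ u, ∫ y, Real.exp (2 * b j * |y|) ∂(gaussianReal 0 1)))) ^ (1 / (2 : ℝ)) := by
  refine (enorm_integral_le_lintegral_enorm _).trans ?_
  have hk : Measurable fun t => kerAvg (Icc 1 N) N (latPt N z Δ) u t :=
    (Finset.measurable_sum _ fun k _ => Finset.measurable_prod _ fun j _ =>
      (measurable_gaussKer _).comp (measurable_pi_apply j)).const_mul _
  have hw : Measurable fun t : Fin m → ℝ => ∏ j ∈ u, weightFun (θ j) (t j) := by
    unfold weightFun
    fun_prop
  have hwpos : ∀ t : Fin m → ℝ, 0 < ∏ j ∈ u, weightFun (θ j) (t j) := fun t =>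
    prod_pos fun j _ => Real.exp_pos _
  have hf : Measurable fun t => ENNReal.ofReal (|kerAvg (Icc 1 N) N (latPt N z Δ) u t| *
      (∏ j ∈ u, weightFun (θ j) (t j))⁻¹) :=
    ((continuous_abs.measurable.comp hk).mul hw.inv).ennreal_ofReal
  have hg : Measurable fun t => ‖D u t‖ₑ * ENNReal.ofReal (∏ j ∈ u, weightFun (θ j) (t j)) :=
    (hD.1 u).measurable.enorm.mul hw.ennreal_ofReal
  have h := ENNReal.lintegral_mul_le_Lp_mul_Lq (Measure.pi (anovaVol u))
    Real.HolderConjugate.two_two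
    hf.aemeasurable hg.aemeasurable
  have e1 : ∀ t, ‖kerAvg (Icc 1 N) N (latPt N z Δ) u t • D u t‖ₑ =
      ((fun t => ENNReal.ofReal (|kerAvg (Icc 1 N) N (latPt N z Δ) u t| *
      (∏ j ∈ u, weightFun (θ j) (t j))⁻¹)) * fun t => ‖D u t‖ₑ *
        ENNReal.ofReal (∏ j ∈ u, weightFun (θ j) (t j))) t := fun t => by
    have hne := (hwpos t).ne'
    rw [Pi.mul_apply, mul_comm ‖D u t‖ₑ, ← mul_assoc, ← ENNReal.ofReal_mul (by
      have := hwpos t; positivity), mul_assoc, inv_mul_cancel₀ hne, mul_one, enorm_smul,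
      ← Real.norm_eq_abs, ofReal_norm]
  have e2 : ∀ t, ENNReal.ofReal (|kerAvg (Icc 1 N) N (latPt N z Δ) u t| *
      (∏ j ∈ u, weightFun (θ j) (t j))⁻¹) ^ (2 : ℝ) =
      ENNReal.ofReal (kerAvg (Icc 1 N) N (latPt N z Δ) u t ^ 2 *
        ∏ j ∈ u, (weightFun (θ j) (t j) ^ 2)⁻¹) := fun t => by
    have := hwpos t
    rw [ENNReal.ofReal_rpow_of_nonneg (by positivity) (by norm_num), Real.rpow_two, mul_pow,
      sq_abs, inv_pow, ← prod_pow, prod_inv_distrib]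
  simp only [e2] at h
  rw [lintegral_congr e1]
  refine h.trans (mul_le_mul_right ?_ _)
  exact ENNReal.rpow_le_rpow (lintegral_weighted_le hM hθ u) (by norm_num)

/-- The mean square error of the randomly shifted lattice rule is at most `∑ R u` times the squared
shift-averaged worst-case error for the weights `γ`, if `γ u * R u` dominates the squared weighted
norm of the mixed derivative in the variables of `u`: the error is a sum over `u` of products, to
each of which the Cauchy–Schwarz inequality applies, and then once more to the sum. -/
theorem lattice_error {D : Finset (Fin m) → (Fin m → ℝ) → ℂ} (hD : IsDerivFamily D)
    {M : Finset (Fin m) → ℝ} {b : ℕ → ℝ} (hb : ∀ j, 0 ≤ b j) (hM : ExpGrowth D M fun j => b j)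
    {θ : ℕ → ℝ} (hθ : ∀ j, b j < θ j) {γ R : Finset (Fin m) → ℝ} (hγ : ∀ u, 0 ≤ γ u)
    (hR : ∀ u, 0 ≤ R u)
    (hP : ∀ u, M u ^ 2 * ((∏ j ∈ u, 1 / (θ j - b j)) *
        ∏ j ∈ univ \ u, ∫ y, Real.exp (2 * b j * |y|) ∂(gaussianReal 0 1)) ≤ γ u * R u)
    {N : ℕ} (hN : 1 ≤ N) (z : ℕ → ℕ) :
    ∫⁻ Δ in Set.Icc (0 : Fin m → ℝ) 1,
      ‖latticeRule m N z (D ∅) Δ - ∫ t, D ∅ t ∂gaussFin m‖ₑ ^ (2 : ℝ) ≤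
      ENNReal.ofReal (∑ u, R u) * ENNReal.ofReal (∑ u ∈ univ.erase ∅, γ u *
        ((N : ℝ)⁻¹ * ∑ k ∈ range N, ∏ j ∈ u,
          shiftKernel (θ j) (Int.fract ((k : ℝ) * (z j : ℝ) / N)))) := by
  have hθ0 : ∀ j, 0 ≤ θ j := fun j => (hb j).trans (hθ j).le
  set S : Finset (Fin m) → (Fin m → ℝ) → ℝ≥0∞ := fun u Δ =>
    ∫⁻ t, ENNReal.ofReal (kerAvg (Icc 1 N) N (latPt N z Δ) u t ^ 2 *
        ∏ j ∈ u, (weightFun (θ j) (t j) ^ 2)⁻¹) ∂(Measure.pi (anovaVol u)) with hS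
  have hpt : ∀ Δ : Fin m → ℝ,
      ‖latticeRule m N z (D ∅) Δ - ∫ t, D ∅ t ∂gaussFin m‖ₑ ^ (2 : ℝ) ≤
      ENNReal.ofReal (∑ u, R u) * ∑ u ∈ univ.erase ∅, ENNReal.ofReal (γ u) * S u Δ := fun Δ => by
    have hq := quadrature_error hD (fun j => hb j) hM (Icc 1 N) hN (by simp) (latPt N z Δ)
    have e : latticeRule m N z (D ∅) Δ = (N : ℂ)⁻¹ * ∑ k ∈ Icc 1 N, D ∅ (latPt N z Δ k) := rfl
    rw [e, hq]
    have h1 : ‖∑ u ∈ univ.erase ∅, ∫ t, kerAvg (Icc 1 N) N (latPt N z Δ) u t • D u t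
        ∂(Measure.pi (anovaVol u))‖ₑ ≤ ∑ u ∈ univ.erase (∅ : Finset (Fin m)),
        (ENNReal.ofReal (R u)) ^ (1 / (2 : ℝ)) *
          (ENNReal.ofReal (γ u) * S u Δ) ^ (1 / (2 : ℝ)) := by
      refine (enorm_sum_le _ _).trans (sum_le_sum fun u _ => ?_)
      refine (sq_enorm_integral_le hD hM hθ u N z Δ).trans ?_
      refine (mul_le_mul_right (ENNReal.rpow_le_rpow (ENNReal.ofReal_le_ofReal (hP u))
        (by norm_num)) _).trans (le_of_eq ?_)
      rw [← ENNReal.mul_rpow_of_nonneg _ _ (by norm_num),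
        ← ENNReal.mul_rpow_of_nonneg _ _ (by norm_num), ENNReal.ofReal_mul (hγ u)]
      congr 1; ring
    have h2 := ENNReal.inner_le_Lp_mul_Lq (univ.erase (∅ : Finset (Fin m)))
      (fun u => (ENNReal.ofReal (R u)) ^ (1 / (2 : ℝ)))
      (fun u => (ENNReal.ofReal (γ u) * S u Δ) ^ (1 / (2 : ℝ))) Real.HolderConjugate.two_two
    have e3 : ∀ x : ℝ≥0∞, (x ^ (1 / (2 : ℝ))) ^ (2 : ℝ) = x := fun x => by
      rw [← ENNReal.rpow_mul]; norm_num
    simp only [e3] at h2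
    refine (ENNReal.rpow_le_rpow (h1.trans h2) (by norm_num)).trans ?_
    rw [ENNReal.mul_rpow_of_nonneg _ _ (by norm_num), e3, e3]
    refine mul_le_mul_left ?_ _
    rw [ENNReal.ofReal_sum_of_nonneg fun u _ => hR u]
    exact sum_le_sum_of_subset (erase_subset _ _)
  refine (lintegral_mono hpt).trans ?_
  have hSm : ∀ u, Measurable (S u) := fun u => by
    have hwm : Measurable fun t : Fin m → ℝ => ∏ j ∈ u, (weightFun (θ j) (t j) ^ 2)⁻¹ := by
      unfold weightFun
      fun_prop
    exact (((measurable_kerAvg N z u).pow_const 2).mul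
      (hwm.comp measurable_snd)).ennreal_ofReal.lintegral_prod_right'
  rw [lintegral_const_mul _ (Finset.measurable_sum _ fun u _ => (hSm u).const_mul _),
    lintegral_finsetSum _ fun u _ => (hSm u).const_mul _]
  refine mul_le_mul_right (le_of_eq ?_) _
  rw [ENNReal.ofReal_sum_of_nonneg fun u _ =>
    mul_nonneg (hγ u) (lintegral_kerAvg_sq hN z hθ0 u).1]
  refine sum_congr rfl fun u _ => ?_
  rw [lintegral_const_mul _ (hSm u), (lintegral_kerAvg_sq hN z hθ0 u).2,
    ← ENNReal.ofReal_mul (hγ u)]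

end

end

section

/-! ### The Fourier coefficients of the shift-averaged kernel -/

theorem hasSum_cos_bernoulli {x : ℝ} (h0 : 0 ≤ x) (h1 : x ≤ 1) :
    HasSum (fun n : ℕ => 1 / (Real.pi ^ 2 * (n : ℝ) ^ 2) * Real.cos (2 * Real.pi * n * x))
      (x ^ 2 - x + 1 / 6) := by
  have h := (hasSum_one_div_nat_pow_mul_cos one_ne_zero ⟨h0, h1⟩).mul_left (1 / Real.pi ^ 2)
  have hb : (Polynomial.map (algebraMap ℚ ℝ) (Polynomial.bernoulli 2)).eval x =
      x ^ 2 - x + 1 / 6 := by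
    simp [Polynomial.bernoulli_def, Finset.sum_range_succ, bernoulli_two, bernoulli_one]
    ring
  have hpi := Real.pi_ne_zero
  convert! h using 1
  · funext n
    simp only [mul_one, one_div, mul_inv]
    ring
  · rw [mul_one, hb]
    simp
    field_simp

/-- The Fourier expansion of the covariance of two shifted points. -/
theorem hasSum_shiftCov {a f : ℝ} (ha0 : 0 ≤ a) (ha1 : a ≤ 1) (hf0 : 0 ≤ f) (hf1 : f ≤ 1) :
    HasSum (fun n : ℕ => 2 * (1 / (Real.pi ^ 2 * (n : ℝ) ^ 2)) * Real.sin (Real.pi * n * a) ^ 2 *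
      Real.cos (2 * Real.pi * n * f)) (shiftCov a f) := by
  have key : ∀ {x y : ℝ}, 0 ≤ x → x ≤ 1 → 0 ≤ y → y ≤ 1 →
      (∀ n : ℕ, Real.cos (2 * Real.pi * n * x) = Real.cos (2 * Real.pi * n * (f + a))) →
      (∀ n : ℕ, Real.cos (2 * Real.pi * n * y) = Real.cos (2 * Real.pi * n * (f - a))) →
      HasSum (fun n : ℕ => 2 * (1 / (Real.pi ^ 2 * (n : ℝ) ^ 2)) *
        Real.sin (Real.pi * n * a) ^ 2 * Real.cos (2 * Real.pi * n * f))
        ((f ^ 2 - f + 1 / 6) - ((x ^ 2 - x + 1 / 6) / 2 + (y ^ 2 - y + 1 / 6) / 2)) := by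
    intro x y hx0 hx1 hy0 hy1 hx hy
    convert! (hasSum_cos_bernoulli hf0 hf1).sub (((hasSum_cos_bernoulli hx0 hx1).div_const 2).add
      ((hasSum_cos_bernoulli hy0 hy1).div_const 2)) using 1
    funext n
    rw [hx, hy, show 2 * Real.pi * n * (f + a) = 2 * Real.pi * n * f + 2 * (Real.pi * n * a) by ring,
      show 2 * Real.pi * n * (f - a) = 2 * Real.pi * n * f - 2 * (Real.pi * n * a) by ring,
      Real.cos_add, Real.cos_sub, Real.cos_two_mul, ← Real.sin_sq_add_cos_sq (Real.pi * n * a)]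
    have := Real.sin_sq_add_cos_sq (Real.pi * n * a)
    rw [show Real.cos (Real.pi * n * a) ^ 2 = 1 - Real.sin (Real.pi * n * a) ^ 2 by linarith]
    ring
  have hy : ∀ n : ℕ, Real.cos (2 * Real.pi * n * |f - a|) =
      Real.cos (2 * Real.pi * n * (f - a)) := fun n => by
    rcases abs_choice (f - a) with h | h <;> rw [h]
    rw [mul_neg, Real.cos_neg]
  have hy1 : |f - a| ≤ 1 := abs_le.2 ⟨by linarith, by linarith⟩
  have hsq := sq_abs (f - a)
  have hm : |f - a| = 2 * max (a - f) 0 - (a - f) := by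
    rcases le_total f a with h | h
    · rw [abs_of_nonpos (by linarith), max_eq_left (by linarith)]; ring
    · rw [abs_of_nonneg (by linarith), max_eq_right (by linarith)]; ring
  rcases le_total (f + a) 1 with h | h
  · have := key (x := f + a) (by linarith) h (abs_nonneg (f - a)) hy1 (fun _ => rfl) hy
    rw [shiftCov, max_eq_right (by linarith : a - 1 + f ≤ 0)]
    convert! this using 1
    rw [hsq, hm]; ring
  · have := key (x := f + a - 1) (by linarith) (by linarith) (abs_nonneg (f - a)) hy1 (fun n => by
      rw [show 2 * Real.pi * n * (f + a - 1) = 2 * Real.pi * n * (f + a) - n * (2 * Real.pi) by ring,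
        Real.cos_sub_nat_mul_two_pi]) hy
    rw [shiftCov, max_eq_left (by linarith : 0 ≤ a - 1 + f)]
    convert! this using 1
    rw [hsq, hm]; ring

/-- Half the `n`-th cosine coefficient of the shift-averaged kernel. -/
def kerCoeff (θ : ℝ) (n : ℕ) : ℝ :=
  1 / (Real.pi ^ 2 * (n : ℝ) ^ 2) *
    ∫ t, Real.sin (Real.pi * n * stdNormalCDF t) ^ 2 / weightFun θ t ^ 2

theorem kerCoeff_nonneg (θ : ℝ) (n : ℕ) : 0 ≤ kerCoeff θ n :=
  mul_nonneg (by positivity) (integral_nonneg fun t => by positivity)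

theorem kerCoeff_zero (θ : ℝ) : kerCoeff θ 0 = 0 := by simp [kerCoeff]

/-- Gaussian tail bounds for the distribution function. -/
theorem stdNormalCDF_tail (t : ℝ) :
    (t ≤ 0 → stdNormalCDF t ≤ Real.exp (-t ^ 2 / 2)) ∧
      (0 ≤ t → 1 - stdNormalCDF t ≤ Real.exp (-t ^ 2 / 2)) := by
  have hm : mgf id (gaussianReal 0 1) t = Real.exp (t ^ 2 / 2) := by
    rw [mgf_id_gaussianReal]; simp
  have hexp : Real.exp (-t * t) * Real.exp (t ^ 2 / 2) = Real.exp (-t ^ 2 / 2) := by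
    rw [← Real.exp_add]; congr 1; ring
  have hcdf : stdNormalCDF t = (gaussianReal 0 1).real (Set.Iic t) := cdf_eq_real _ _
  constructor
  · intro ht
    have h := measure_le_le_exp_mul_mgf (μ := gaussianReal 0 1) (X := id) t ht
      (integrable_exp_mul_gaussianReal t)
    rw [hm, hexp] at h
    rw [hcdf]
    exact h
  · intro ht
    have h := measure_ge_le_exp_mul_mgf (μ := gaussianReal 0 1) (X := id) t ht
      (integrable_exp_mul_gaussianReal t)
    rw [hm, hexp] at h
    refine le_trans ?_ h
    rw [hcdf, ← probReal_compl_eq_one_sub measurableSet_Iic]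
    exact measureReal_mono fun x hx => (not_le.1 (show ¬ x ≤ t from hx)).le

theorem abs_sin_cdf_le (n : ℕ) (t : ℝ) :
    |Real.sin (Real.pi * n * stdNormalCDF t)| ≤ Real.pi * n * Real.exp (-t ^ 2 / 2) := by
  have hpn : 0 ≤ Real.pi * n := by positivity
  rcases le_total t 0 with ht | ht
  · refine (Real.abs_sin_le_abs).trans ?_
    rw [abs_of_nonneg (mul_nonneg hpn (stdNormalCDF_nonneg t))]
    exact mul_le_mul_of_nonneg_left ((stdNormalCDF_tail t).1 ht) hpn
  · have e : |Real.sin (Real.pi * n * stdNormalCDF t)| =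
        |Real.sin (Real.pi * n * (1 - stdNormalCDF t))| := by
      rw [show Real.pi * n * (1 - stdNormalCDF t) =
        n * Real.pi - Real.pi * n * stdNormalCDF t by ring, Real.sin_nat_mul_pi_sub, abs_neg,
        abs_mul, abs_pow, abs_neg, abs_one, one_pow, one_mul]
    rw [e]
    refine (Real.abs_sin_le_abs).trans ?_
    rw [abs_of_nonneg (mul_nonneg hpn (by linarith [stdNormalCDF_le_one t]))]
    exact mul_le_mul_of_nonneg_left ((stdNormalCDF_tail t).2 ht) hpn

theorem integral_exp_quadratic {η : ℝ} (hη : 0 < η) (θ : ℝ) :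
    Integrable (fun t : ℝ => Real.exp (-η * t ^ 2) * Real.exp (2 * θ * t)) ∧
      ∫ t : ℝ, Real.exp (-η * t ^ 2) * Real.exp (2 * θ * t) =
        Real.sqrt (Real.pi / η) * Real.exp (θ ^ 2 / η) := by
  have e : (fun t : ℝ => Real.exp (-η * t ^ 2) * Real.exp (2 * θ * t)) = fun t =>
      Real.exp (-η * (t - θ / η) ^ 2) * Real.exp (θ ^ 2 / η) := by
    funext t
    rw [← Real.exp_add, ← Real.exp_add]
    congr 1
    field_simp
    ring
  rw [e]
  refine ⟨((integrable_exp_neg_mul_sq hη).comp_sub_right _).mul_const _, ?_⟩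
  rw [integral_mul_const, integral_sub_right_eq_self (fun t => Real.exp (-η * t ^ 2)),
    integral_gaussian]

/-- `sin²` is at most its `η`-th power, which is bounded by the Gaussian tail: this trades decay in
`n` for integrability against the weight function. -/
theorem sin_sq_div_weight_le {η : ℝ} (hη0 : 0 < η) (hη1 : η ≤ 1) (θ : ℝ) (n : ℕ) (t : ℝ) :
    Real.sin (Real.pi * n * stdNormalCDF t) ^ 2 / weightFun θ t ^ 2 ≤
      (Real.pi * n) ^ (2 * η) * (Real.exp (-η * t ^ 2) * Real.exp (2 * θ * t) +
        Real.exp (-η * t ^ 2) * Real.exp (2 * (-θ) * t)) := by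
  have e : (weightFun θ t ^ 2)⁻¹ = Real.exp (2 * θ * |t|) := by
    rw [weightFun, ← Real.exp_nat_mul, ← Real.exp_neg]; congr 1; push_cast; ring
  have h1 : Real.exp (2 * θ * |t|) ≤ Real.exp (2 * θ * t) + Real.exp (2 * (-θ) * t) := by
    rcases abs_choice t with h | h <;> rw [h]
    · exact le_add_of_nonneg_right (Real.exp_pos _).le
    · rw [show 2 * θ * -t = 2 * (-θ) * t by ring]
      exact le_add_of_nonneg_left (Real.exp_pos _).le
  have h2 : Real.sin (Real.pi * n * stdNormalCDF t) ^ 2 ≤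
      (Real.pi * n) ^ (2 * η) * Real.exp (-η * t ^ 2) := by
    set y := |Real.sin (Real.pi * n * stdNormalCDF t)| with hy
    have hy0 : 0 ≤ y := abs_nonneg _
    have hy1 : y ≤ 1 := Real.abs_sin_le_one _
    calc Real.sin (Real.pi * n * stdNormalCDF t) ^ 2 = y ^ (2 : ℝ) := by
          rw [Real.rpow_two, hy, sq_abs]
      _ ≤ y ^ (2 * η) := by
          rcases hy0.eq_or_lt with h | h
          · rw [← h, Real.zero_rpow (by norm_num), Real.zero_rpow (by positivity)]
          · exact Real.rpow_le_rpow_of_exponent_ge h hy1 (by linarith)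
      _ ≤ (Real.pi * n * Real.exp (-t ^ 2 / 2)) ^ (2 * η) :=
          Real.rpow_le_rpow hy0 (abs_sin_cdf_le n t) (by positivity)
      _ = _ := by
          rw [Real.mul_rpow (by positivity) (Real.exp_pos _).le, ← Real.exp_mul]
          congr 2; ring
  rw [div_eq_mul_inv, e, ← mul_add, ← mul_assoc]
  exact mul_le_mul h2 h1 (Real.exp_pos _).le (by positivity)

theorem integrable_sin_sq_div_weight (θ : ℝ) (n : ℕ) :
    Integrable fun t => Real.sin (Real.pi * n * stdNormalCDF t) ^ 2 / weightFun θ t ^ 2 := by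
  refine Integrable.mono' (((integral_exp_quadratic one_pos θ).1.add
    (integral_exp_quadratic one_pos (-θ)).1).const_mul ((Real.pi * n) ^ (2 * (1 : ℝ)))) ?_
    (ae_of_all _ fun t => ?_)
  · have h1 := continuous_stdNormalCDF
    have h2 : Continuous fun t => weightFun θ t ^ 2 := by unfold weightFun; fun_prop
    exact (Continuous.div (by fun_prop) h2
      fun t => (pow_pos (Real.exp_pos _) 2).ne').aestronglyMeasurable
  · rw [Real.norm_of_nonneg (by positivity)]
    exact sin_sq_div_weight_le one_pos le_rfl θ n t

/-- The decay of the Fourier coefficients; the constant is the one in `rhoConst`. -/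
theorem kerCoeff_le {η : ℝ} (hη0 : 0 < η) (hη1 : η ≤ 1 / 4) (θ : ℝ) (n : ℕ) :
    kerCoeff θ n ≤ Real.sqrt (2 * Real.pi) * Real.exp (θ ^ 2 / η)
      / (Real.pi ^ (2 - 2 * η) * (1 - η) * η) * (n : ℝ) ^ (-(2 - 2 * η)) := by
  rcases Nat.eq_zero_or_pos n with rfl | hn
  · rw [kerCoeff_zero]
    have : 0 < 1 - η := by linarith
    positivity
  have hn' : (0 : ℝ) < n := by exact_mod_cast hn
  have hpi := Real.pi_pos
  have hη' : 0 < 1 - η := by linarith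
  have h1 : ∫ t, Real.sin (Real.pi * n * stdNormalCDF t) ^ 2 / weightFun θ t ^ 2 ≤
      (Real.pi * n) ^ (2 * η) * (2 * (Real.sqrt (Real.pi / η) * Real.exp (θ ^ 2 / η))) := by
    have h := integral_mono (integrable_sin_sq_div_weight θ n)
      (((integral_exp_quadratic hη0 θ).1.add
        (integral_exp_quadratic hη0 (-θ)).1).const_mul ((Real.pi * n) ^ (2 * η)))
      (fun t => sin_sq_div_weight_le hη0 (by linarith) θ n t)
    refine h.trans (le_of_eq ?_)
    rw [integral_const_mul]
    simp only [Pi.add_apply]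
    rw [integral_add (integral_exp_quadratic hη0 θ).1 (integral_exp_quadratic hη0 (-θ)).1,
      (integral_exp_quadratic hη0 θ).2, (integral_exp_quadratic hη0 (-θ)).2, neg_sq]
    ring
  have h2 : Real.sqrt (Real.pi / η) * 2 ≤ Real.sqrt (2 * Real.pi) / ((1 - η) * η) := by
    rw [le_div_iff₀ (by positivity)]
    refine Real.le_sqrt_of_sq_le ?_
    rw [mul_pow, mul_pow, Real.sq_sqrt (by positivity)]
    rw [show Real.pi / η * 2 ^ 2 * ((1 - η) * η) ^ 2 = 4 * (1 - η) ^ 2 * η * Real.pi by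
      field_simp; norm_num]
    have : 4 * (1 - η) ^ 2 * η ≤ 2 := by nlinarith [mul_pos hη0 hη']
    exact mul_le_mul_of_nonneg_right this hpi.le
  rw [kerCoeff]
  calc _ ≤ 1 / (Real.pi ^ 2 * (n : ℝ) ^ 2) * ((Real.pi * n) ^ (2 * η) *
        (2 * (Real.sqrt (Real.pi / η) * Real.exp (θ ^ 2 / η)))) := by gcongr
    _ = (Real.pi * n) ^ (-(2 - 2 * η)) * (Real.exp (θ ^ 2 / η) *
        (Real.sqrt (Real.pi / η) * 2)) := by
        rw [show -(2 - 2 * η) = 2 * η - 2 by ring, Real.rpow_sub (by positivity), Real.rpow_two]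
        field_simp
    _ ≤ (Real.pi * n) ^ (-(2 - 2 * η)) * (Real.exp (θ ^ 2 / η) *
        (Real.sqrt (2 * Real.pi) / ((1 - η) * η))) := by gcongr
    _ = _ := by
        rw [Real.mul_rpow hpi.le hn'.le, Real.rpow_neg hpi.le]
        have := Real.rpow_pos_of_pos hpi (2 - 2 * η)
        field_simp

theorem summable_kerCoeff (θ : ℝ) : Summable (kerCoeff θ) := by
  refine Summable.of_nonneg_of_le (kerCoeff_nonneg θ)
    (kerCoeff_le (η := 1 / 4) (by norm_num) le_rfl θ) (Summable.mul_left _ ?_)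
  exact Real.summable_nat_rpow.2 (by norm_num)

/-- The cosine expansion of the shift-averaged kernel. -/
theorem hasSum_shiftKernel (θ : ℝ) {f : ℝ} (hf0 : 0 ≤ f) (hf1 : f ≤ 1) :
    HasSum (fun n : ℕ => 2 * kerCoeff θ n * Real.cos (2 * Real.pi * n * f)) (shiftKernel θ f) := by
  set F : ℕ → ℝ → ℝ := fun n t => (2 * (1 / (Real.pi ^ 2 * (n : ℝ) ^ 2)) *
    Real.cos (2 * Real.pi * n * f)) *
      (Real.sin (Real.pi * n * stdNormalCDF t) ^ 2 / weightFun θ t ^ 2) with hF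
  have hFi : ∀ n, Integrable (F n) := fun n => (integrable_sin_sq_div_weight θ n).const_mul _
  have hFv : ∀ n, ∫ t, F n t = 2 * kerCoeff θ n * Real.cos (2 * Real.pi * n * f) := fun n => by
    rw [integral_const_mul, kerCoeff]; ring
  have hFn : ∀ n, ∫ t, ‖F n t‖ ≤ 2 * kerCoeff θ n := fun n => by
    have e : ∀ t, ‖F n t‖ = |2 * (1 / (Real.pi ^ 2 * (n : ℝ) ^ 2)) *
        Real.cos (2 * Real.pi * n * f)| *
        (Real.sin (Real.pi * n * stdNormalCDF t) ^ 2 / weightFun θ t ^ 2) := fun t => by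
      rw [Real.norm_eq_abs, abs_mul, abs_of_nonneg (by positivity :
        0 ≤ Real.sin (Real.pi * n * stdNormalCDF t) ^ 2 / weightFun θ t ^ 2)]
    simp only [e]
    rw [integral_const_mul, kerCoeff, ← mul_assoc]
    refine mul_le_mul_of_nonneg_right ?_ (integral_nonneg fun t => by positivity)
    rw [abs_mul, abs_of_nonneg (by positivity)]
    exact mul_le_of_le_one_right (by positivity) (Real.abs_cos_le_one _)
  have h := hasSum_integral_of_summable_integral_norm hFi
    (Summable.of_nonneg_of_le (fun n => integral_nonneg fun t => norm_nonneg _) hFn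
      ((summable_kerCoeff θ).mul_left 2))
  simp only [hFv] at h
  convert! h using 1
  refine integral_congr_ae (ae_of_all _ fun t => ?_)
  have h2 := (hasSum_shiftCov (stdNormalCDF_nonneg t) (stdNormalCDF_le_one t) hf0
    hf1).div_const (weightFun θ t ^ 2)
  change shiftCov (stdNormalCDF t) f / weightFun θ t ^ 2 = _
  rw [← h2.tsum_eq]
  refine tsum_congr fun n => ?_
  simp only [hF]; ring

end

section

/-! ### Functions on `ℤ/N` with a nonnegative spectrum -/

/-- Subadditivity of `x ↦ x ^ l` for `l ≤ 1`; in the theory of lattice rules it is called Jensen's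
inequality. -/
theorem rpow_sum_le_sum_rpow {ι : Type*} (s : Finset ι) {f : ι → ℝ} (hf : ∀ i, 0 ≤ f i) {l : ℝ}
    (hl0 : 0 < l) (hl1 : l ≤ 1) : (∑ i ∈ s, f i) ^ l ≤ ∑ i ∈ s, f i ^ l := by
  classical
  induction s using Finset.induction_on with
  | empty => simp [Real.zero_rpow hl0.ne']
  | insert a s ha ih =>
    rw [sum_insert ha, sum_insert ha]
    refine (Real.rpow_add_le_add_rpow (hf a) (sum_nonneg fun i _ => hf i) hl0.le hl1).trans ?_
    gcongr

theorem rpow_tsum_le_tsum_rpow {f : ℕ → ℝ} (hf : ∀ i, 0 ≤ f i) {l : ℝ}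
    (hl0 : 0 < l) (hl1 : l ≤ 1) (hs : Summable f) (hs' : Summable fun i => f i ^ l) :
    (∑' i, f i) ^ l ≤ ∑' i, f i ^ l := by
  have h1 := (Real.continuous_rpow_const hl0.le).continuousAt.tendsto.comp
    hs.hasSum.tendsto_sum_nat
  refine le_of_tendsto_of_tendsto' h1 hs'.hasSum.tendsto_sum_nat fun n => ?_
  exact rpow_sum_le_sum_rpow _ hf hl0 hl1

section
variable {N : ℕ} [NeZero N]

/-- `c` is the Fourier transform of `q` on `ℤ/N`. -/
def HasSpectrum (c q : ZMod N → ℝ) : Prop :=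
  ∀ k, (c k : ℂ) = ∑ r, (q r : ℂ) * ZMod.stdAddChar (r * k)

theorem HasSpectrum.mean {c q : ZMod N → ℝ} (h : HasSpectrum c q) :
    (N : ℝ)⁻¹ * ∑ k, c k = q 0 := by
  have hN : (N : ℂ) ≠ 0 := by exact_mod_cast NeZero.ne N
  have e : ((∑ k, c k : ℝ) : ℂ) = N * q 0 := by
    rw [Complex.ofReal_sum]
    rw [sum_congr rfl fun k _ => h k, sum_comm]
    have h1 : ∀ r : ZMod N, ∑ k, (q r : ℂ) * ZMod.stdAddChar (r * k) =
        if r = 0 then (N : ℂ) * q 0 else 0 := fun r => by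
      rw [← mul_sum]
      have h2 := AddChar.sum_mulShift r (ZMod.isPrimitive_stdAddChar N)
      rw [ZMod.card] at h2
      simp only [mul_comm r, h2]
      split_ifs with h3
      · rw [h3, mul_comm]
      · simp
    simp only [h1]
    simp
  have h3 : (((N : ℝ)⁻¹ * ∑ k, c k : ℝ) : ℂ) = (q 0 : ℂ) := by
    rw [Complex.ofReal_mul, e, Complex.ofReal_inv, Complex.ofReal_natCast, inv_mul_cancel_left₀ hN]
  exact_mod_cast h3

/-- A product of functions on `ℤ/N`, the second one dilated by `y`, has as its spectrum the
convolution of the spectra, the second one dilated by `y`. -/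
theorem HasSpectrum.mul_dilate {c c' A q : ZMod N → ℝ} (h : HasSpectrum c A)
    (h' : HasSpectrum c' q) (y : ZMod N) :
    HasSpectrum (fun k => c k * c' (k * y)) fun t => ∑ r, A (t - r * y) * q r := by
  intro k
  have e : ∀ r : ZMod N, ∑ t : ZMod N, ((A (t - r * y) * q r : ℝ) : ℂ) * ZMod.stdAddChar (t * k) =
      (∑ t, (A t : ℂ) * ZMod.stdAddChar (t * k)) * (q r * ZMod.stdAddChar (r * (k * y))) :=
    fun r => by
      rw [← Equiv.sum_comp (Equiv.addRight (r * y)), sum_mul]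
      refine sum_congr rfl fun t _ => ?_
      rw [Equiv.coe_addRight, add_sub_cancel_right, add_mul, AddChar.map_add_eq_mul,
        show r * y * k = r * (k * y) by ring]
      push_cast
      ring
  push_cast
  rw [h k, h' (k * y), mul_sum]
  simp only [sum_mul _ _ (ZMod.stdAddChar _)]
  rw [sum_comm]
  refine sum_congr rfl fun r _ => ?_
  rw [← e r]
  push_cast
  rfl

/-- The sum of the Fourier coefficients of the shift-averaged kernel over a residue class. -/
def foldCoeff (θ : ℝ) (r : ZMod N) : ℝ :=
  ∑' n : ℕ, kerCoeff θ n *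
    ((if (n : ZMod N) = r then 1 else 0) + if -(n : ZMod N) = r then 1 else 0)

theorem ite_add_ite_nonneg (p p' : Prop) [Decidable p] [Decidable p'] :
    0 ≤ (if p then (1 : ℝ) else 0) + if p' then 1 else 0 := by
  split_ifs <;> norm_num

theorem ite_add_ite_le (p p' : Prop) [Decidable p] [Decidable p'] :
    (if p then (1 : ℝ) else 0) + (if p' then 1 else 0) ≤ 2 := by
  split_ifs <;> norm_num

omit [NeZero N] in
theorem summable_foldCoeff (θ : ℝ) (r : ZMod N) : Summable fun n : ℕ => kerCoeff θ n *
    ((if (n : ZMod N) = r then 1 else 0) + if -(n : ZMod N) = r then 1 else 0) :=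
  Summable.of_nonneg_of_le (fun n => mul_nonneg (kerCoeff_nonneg θ n) (ite_add_ite_nonneg _ _))
    (fun n => mul_le_mul_of_nonneg_left (ite_add_ite_le _ _) (kerCoeff_nonneg θ n))
    ((summable_kerCoeff θ).mul_right 2)

omit [NeZero N] in
theorem foldCoeff_nonneg (θ : ℝ) (r : ZMod N) : 0 ≤ foldCoeff θ r :=
  tsum_nonneg fun n => mul_nonneg (kerCoeff_nonneg θ n) (ite_add_ite_nonneg _ _)

theorem hasSpectrum_shiftKernel (θ : ℝ) :
    HasSpectrum (fun k : ZMod N => shiftKernel θ (k.val / N)) (foldCoeff θ) := by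
  intro k
  have hN : (0 : ℝ) < N := by exact_mod_cast Nat.pos_of_ne_zero (NeZero.ne N)
  have hf1 : (k.val : ℝ) / N ≤ 1 := by
    rw [div_le_one hN]
    exact_mod_cast (ZMod.val_lt k).le
  have h1 := (hasSum_shiftKernel θ (by positivity) hf1).mapL Complex.ofRealCLM
  have h2 : HasSum (fun n : ℕ => ∑ r : ZMod N, ((kerCoeff θ n *
      ((if (n : ZMod N) = r then 1 else 0) + if -(n : ZMod N) = r then 1 else 0) : ℝ) : ℂ) *
      ZMod.stdAddChar (r * k)) (∑ r : ZMod N, (foldCoeff θ r : ℂ) * ZMod.stdAddChar (r * k)) := by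
    refine hasSum_sum fun r _ => HasSum.mul_right _ ?_
    exact (summable_foldCoeff θ r).hasSum.mapL Complex.ofRealCLM
  refine h1.unique ?_
  convert! h2 using 1
  funext n
  have e1 : ZMod.stdAddChar ((n : ZMod N) * k) =
      Complex.exp ((2 * Real.pi * n * (k.val / N) : ℝ) * Complex.I) := by
    have := ZMod.stdAddChar_coe (N := N) ((n * k.val : ℕ) : ℤ)
    rw [Int.cast_natCast, Nat.cast_mul, ZMod.natCast_zmod_val] at this
    rw [this]
    congr 1
    push_cast
    ring
  have e2 : ZMod.stdAddChar (-(n : ZMod N) * k) =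
      Complex.exp (-(2 * Real.pi * n * (k.val / N) : ℝ) * Complex.I) := by
    have := ZMod.stdAddChar_coe (N := N) (-((n * k.val : ℕ) : ℤ))
    rw [Int.cast_neg, Int.cast_natCast, Nat.cast_mul, ZMod.natCast_zmod_val, ← neg_mul] at this
    rw [this]
    congr 1
    push_cast
    ring
  simp only [Complex.ofRealCLM_apply, mul_add, Complex.ofReal_add, add_mul, sum_add_distrib]
  have e3 : ∀ x : ZMod N, ∑ r : ZMod N, ((kerCoeff θ n * (if x = r then 1 else 0) : ℝ) : ℂ) *
      ZMod.stdAddChar (r * k) = kerCoeff θ n * ZMod.stdAddChar (x * k) := fun x => by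
    rw [sum_eq_single x (fun r _ hr => by rw [if_neg hr.symm]; simp) (by simp)]
    simp
  rw [e3, e3, e1, e2, ← mul_add, Complex.ofReal_mul (2 * _), Complex.ofReal_cos, Complex.cos]
  push_cast
  ring

/-- The equation `s y = ± n` in `ℤ/N` has at most `gcd (s, N)` solutions, and none unless this
number divides `n`. -/
theorem card_mul_eq_le (s : ZMod N) {x : ZMod N} {n : ℕ} (hx : x = n ∨ x = -n) :
    #{y : ZMod N | x = s * y} ≤ if s.val.gcd N ∣ n then s.val.gcd N else 0 := by
  set g := s.val.gcd N with hg
  have hg0 : 0 < g := Nat.gcd_pos_of_pos_right _ (Nat.pos_of_ne_zero (NeZero.ne N))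
  rcases ({y : ZMod N | x = s * y} : Finset (ZMod N)).eq_empty_or_nonempty with h | ⟨y₀, hy₀⟩
  · rw [h]; simp
  have hy₀ := (mem_filter.1 hy₀).2
  have hdvd : g ∣ n := by
    set f := ZMod.castHom (Nat.gcd_dvd_right s.val N) (ZMod g) with hf
    have hs : f s = 0 := by
      rw [← ZMod.natCast_zmod_val s, map_natCast]
      exact (ZMod.natCast_eq_zero_iff _ _).2 (Nat.gcd_dvd_left _ _)
    have hfx : f x = 0 := by rw [hy₀, map_mul, hs, zero_mul]
    rw [← ZMod.natCast_eq_zero_iff]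
    rcases hx with h | h <;> rw [h] at hfx
    · rwa [map_natCast] at hfx
    · rwa [map_neg, map_natCast, neg_eq_zero] at hfx
  rw [if_pos hdvd]
  refine le_trans ?_ (IsAddCyclic.card_nsmul_eq_zero_le (α := ZMod N) hg0)
  refine card_le_card_of_injOn (fun y => y - y₀) (fun y hy => ?_) fun a _ b _ h => by simpa using h
  have hy : x = s * y := by simpa using hy
  have h0 : s * (y - y₀) = 0 := by rw [mul_sub, ← hy, ← hy₀, sub_self]
  have hbez : (g : ZMod N) = s * ((s.val.gcdA N : ℤ) : ZMod N) := by
    have := congrArg (Int.cast : ℤ → ZMod N) (Nat.gcd_eq_gcd_ab s.val N)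
    push_cast at this
    rw [ZMod.natCast_zmod_val, ZMod.natCast_self, zero_mul, add_zero] at this
    exact_mod_cast this
  have : g • (y - y₀) = 0 := by
    rw [nsmul_eq_mul, hbez, mul_right_comm, h0, zero_mul]
  simpa using this

theorem re_riemannZeta {x : ℝ} (hx : 1 < x) :
    (riemannZeta (x : ℂ)).re = ∑' n : ℕ, (n : ℝ) ^ (-x) := by
  rw [zeta_eq_tsum_one_div_nat_cpow (by simpa using hx)]
  have e : ∀ n : ℕ, 1 / (n : ℂ) ^ (x : ℂ) = (((n : ℝ) ^ (-x) : ℝ) : ℂ) := fun n => by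
    rw [Real.rpow_neg (by positivity), Complex.ofReal_inv, Complex.ofReal_cpow (by positivity),
      one_div, Complex.ofReal_natCast]
  simp only [e]
  rw [← Complex.ofReal_tsum, Complex.ofReal_re]

theorem tsum_dvd_rpow {g : ℕ} (hg : 0 < g) (x : ℝ) :
    ∑' n : ℕ, (if g ∣ n then (n : ℝ) ^ (-x) else 0) = (g : ℝ) ^ (-x) * ∑' n : ℕ, (n : ℝ) ^ (-x) := by
  have hinj : Function.Injective fun n : ℕ => g * n := fun a b h => Nat.eq_of_mul_eq_mul_left hg h
  rw [← tsum_mul_left, ← hinj.tsum_eq]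
  · refine tsum_congr fun n => ?_
    rw [if_pos (Dvd.intro _ rfl), Nat.cast_mul, Real.mul_rpow (by positivity) (by positivity)]
  · intro n hn
    by_contra h
    refine hn (if_neg fun ⟨k, hk⟩ => h ⟨k, hk.symm⟩)

/-- The key estimate of the component-by-component construction: the `l`-th powers of the folded
coefficients along the multiples of any residue `s`. For `s = 1` it bounds the sum over all
residues. With `g = gcd (s, N)`, only the frequencies divisible by `g` occur, each at most `g` times
for either sign; since the coefficients decay faster than `1 / n`, this is worst for `g = 1`. -/
theorem sum_foldCoeff_rpow_le {l : ℝ} (hl0 : 1 / 2 < l) (hl1 : l ≤ 1) (θ : ℝ) (s : ZMod N) :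
    ∑ y : ZMod N, foldCoeff θ (s * y) ^ l ≤ rhoConst θ l := by
  have hl : 0 < l := by linarith
  set η : ℝ := (2 * l - 1) / (4 * l) with hη
  have hη0 : 0 < η := div_pos (by linarith) (by linarith)
  have hη1 : η ≤ 1 / 4 := by rw [hη, div_le_iff₀ (by linarith)]; linarith
  set c : ℝ := Real.sqrt (2 * Real.pi) * Real.exp (θ ^ 2 / η)
      / (Real.pi ^ (2 - 2 * η) * (1 - η) * η) with hc
  have hc0 : 0 ≤ c := by
    have : 0 < 1 - η := by linarith
    positivity
  set x : ℝ := l + 1 / 2 with hx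
  have hx1 : 1 < x := by linarith
  have hexp : (2 - 2 * η) * l = x := by rw [hη, hx]; field_simp; ring
  have hk : ∀ n, kerCoeff θ n ^ l ≤ c ^ l * (n : ℝ) ^ (-x) := fun n => by
    refine (Real.rpow_le_rpow (kerCoeff_nonneg θ n) (kerCoeff_le hη0 hη1 θ n) hl.le).trans ?_
    rw [Real.mul_rpow hc0 (by positivity), ← Real.rpow_mul (by positivity), neg_mul, hexp]
  have hsx : Summable fun n : ℕ => (n : ℝ) ^ (-x) := Real.summable_nat_rpow.2 (by linarith)
  set I : ZMod N → ℕ → ℝ := fun r n =>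
    (if (n : ZMod N) = r then 1 else 0) + if -(n : ZMod N) = r then 1 else 0 with hI
  have hIl : ∀ r n, I r n ^ l ≤ I r n := fun r n => by
    have h2 : (1 + 1 : ℝ) ^ l ≤ 1 + 1 := by
      conv_rhs => rw [← Real.rpow_one (1 + 1)]
      exact Real.rpow_le_rpow_of_exponent_le (by norm_num) hl1
    simp only [hI]
    split_ifs <;> simp [Real.zero_rpow hl.ne'] at h2 ⊢
    exact h2
  have hsI : ∀ r, Summable fun n : ℕ => c ^ l * (n : ℝ) ^ (-x) * I r n := fun r =>
    Summable.of_nonneg_of_le (fun n => mul_nonneg (by positivity) (ite_add_ite_nonneg _ _))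
      (fun n => mul_le_mul_of_nonneg_left (ite_add_ite_le _ _) (by positivity))
      ((hsx.mul_left (c ^ l)).mul_right 2)
  have hterm : ∀ r n, (kerCoeff θ n * I r n) ^ l ≤ c ^ l * (n : ℝ) ^ (-x) * I r n := fun r n => by
    rw [Real.mul_rpow (kerCoeff_nonneg θ n) (ite_add_ite_nonneg _ _)]
    exact mul_le_mul (hk n) (hIl r n) (Real.rpow_nonneg (ite_add_ite_nonneg _ _) _) (by positivity)
  have hfold : ∀ r, foldCoeff θ r ^ l ≤ ∑' n : ℕ, c ^ l * (n : ℝ) ^ (-x) * I r n := fun r => by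
    have hs' : Summable fun n => (kerCoeff θ n * I r n) ^ l :=
      Summable.of_nonneg_of_le (fun n => Real.rpow_nonneg
        (mul_nonneg (kerCoeff_nonneg θ n) (ite_add_ite_nonneg _ _)) _) (hterm r) (hsI r)
    refine (rpow_tsum_le_tsum_rpow (fun n => mul_nonneg (kerCoeff_nonneg θ n)
      (ite_add_ite_nonneg _ _)) hl hl1 (summable_foldCoeff θ r) hs').trans ?_
    exact hs'.tsum_le_tsum (hterm r) (hsI r)
  set g := s.val.gcd N with hg
  have hg0 : 0 < g := Nat.gcd_pos_of_pos_right _ (Nat.pos_of_ne_zero (NeZero.ne N))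
  have hcount : ∀ n : ℕ, ∑ y, I (s * y) n ≤ if g ∣ n then 2 * (g : ℝ) else 0 := fun n => by
    simp only [hI, sum_add_distrib, sum_boole]
    have h1 := card_mul_eq_le s (x := (n : ZMod N)) (Or.inl rfl)
    have h2 := card_mul_eq_le s (x := -(n : ZMod N)) (Or.inr rfl)
    rw [← hg] at h1 h2
    split_ifs at h1 h2 ⊢
    · have h1 := (Nat.cast_le (α := ℝ)).2 h1
      have h2 := (Nat.cast_le (α := ℝ)).2 h2
      linarith
    · have h1 := (Nat.cast_le (α := ℝ)).2 h1
      have h2 := (Nat.cast_le (α := ℝ)).2 h2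
      simp only [Nat.cast_zero] at h1 h2
      linarith
  have hdv : Summable fun n : ℕ => if g ∣ n then (n : ℝ) ^ (-x) else 0 :=
    Summable.of_nonneg_of_le (fun n => by split_ifs <;> positivity)
      (fun n => by split_ifs; exacts [le_rfl, by positivity]) hsx
  calc ∑ y : ZMod N, foldCoeff θ (s * y) ^ l
      ≤ ∑ y : ZMod N, ∑' n : ℕ, c ^ l * (n : ℝ) ^ (-x) * I (s * y) n :=
        sum_le_sum fun y _ => hfold _
    _ = ∑' n : ℕ, c ^ l * (n : ℝ) ^ (-x) * ∑ y, I (s * y) n := by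
        rw [← Summable.tsum_finsetSum fun y _ => hsI _]
        simp only [mul_sum]
    _ ≤ ∑' n : ℕ, (2 * c ^ l * g) * (if g ∣ n then (n : ℝ) ^ (-x) else 0) := by
        refine Summable.tsum_le_tsum (fun n => ?_) ?_ (hdv.mul_left _)
        · refine (mul_le_mul_of_nonneg_left (hcount n) (by positivity)).trans (le_of_eq ?_)
          split_ifs <;> ring
        · simp only [mul_sum]
          exact summable_sum fun y _ => hsI _
    _ = 2 * c ^ l * ((g : ℝ) ^ (1 - x) * ∑' n : ℕ, (n : ℝ) ^ (-x)) := by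
        have hgr : (0 : ℝ) < g := by exact_mod_cast hg0
        rw [tsum_mul_left, tsum_dvd_rpow hg0, sub_eq_add_neg, Real.rpow_add hgr, Real.rpow_one]
        ring
    _ ≤ 2 * c ^ l * (1 * ∑' n : ℕ, (n : ℝ) ^ (-x)) := by
        have : (g : ℝ) ^ (1 - x) ≤ 1 :=
          Real.rpow_le_one_of_one_le_of_nonpos (by exact_mod_cast hg0) (by linarith)
        have h0 : 0 ≤ ∑' n : ℕ, (n : ℝ) ^ (-x) := tsum_nonneg fun n => by positivity
        gcongr
    _ = rhoConst θ l := by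
        rw [one_mul, ← re_riemannZeta hx1]
        rfl

end

theorem rhoConst_pos {l : ℝ} (hl0 : 1 / 2 < l) (θ : ℝ) : 0 < rhoConst θ l := by
  have hl : 0 < l := by linarith
  have hη0 : 0 < (2 * l - 1) / (4 * l) := div_pos (by linarith) (by linarith)
  have hη1 : 0 < 1 - (2 * l - 1) / (4 * l) := by
    rw [sub_pos, div_lt_one (by linarith)]; linarith
  have hz : 0 < (riemannZeta ((l + 1 / 2 : ℝ) : ℂ)).re := by
    rw [re_riemannZeta (by linarith)]
    have hs : Summable fun n : ℕ => (n : ℝ) ^ (-(l + 1 / 2)) :=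
      Real.summable_nat_rpow.2 (by linarith)
    exact hs.tsum_pos (fun n => by positivity) 1 (by simp)
  unfold rhoConst
  have hpi := Real.pi_pos
  positivity

end

section

/-! ### The component-by-component construction -/

section
variable {N : ℕ} [NeZero N]

/-- The part of the squared worst-case error that belongs to `u`, for a generating vector of
residues. -/
def kerMean (θ : ℕ → ℝ) (w : ℕ → ZMod N) (u : Finset ℕ) : ℝ :=
  (N : ℝ)⁻¹ * ∑ k : ZMod N, ∏ j ∈ u, shiftKernel (θ j) ((k * w j).val / N)

/-- The product of the shift-averaged kernels over `u` has a nonnegative spectrum, and the sum of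
its `l`-th powers is bounded independently of `N` and of the generating vector. -/
theorem exists_spectrum_prod {l : ℝ} (hl0 : 1 / 2 < l) (hl1 : l ≤ 1) (θ : ℕ → ℝ)
    (w : ℕ → ZMod N) (u : Finset ℕ) :
    ∃ A : ZMod N → ℝ, (∀ r, 0 ≤ A r) ∧
      HasSpectrum (fun k => ∏ j ∈ u, shiftKernel (θ j) ((k * w j).val / N)) A ∧
      ∑ r, A r ^ l ≤ ∏ j ∈ u, rhoConst (θ j) l := by
  have hl : 0 < l := by linarith
  induction u using Finset.induction_on with
  | empty =>
    refine ⟨fun r => if r = 0 then 1 else 0, fun r => by beta_reduce; split_ifs <;> norm_num, fun k => ?_, ?_⟩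
    · rw [sum_eq_single 0 (fun r _ hr => by simp only [if_neg hr]; simp) (by simp)]
      simp
    · rw [sum_eq_single 0 (fun r _ hr => by simp only [if_neg hr, Real.zero_rpow hl.ne']) (by simp)]
      simp
  | insert d u hd ih =>
    obtain ⟨A, hA0, hA, hAs⟩ := ih
    refine ⟨fun t => ∑ r, A (t - r * w d) * foldCoeff (θ d) r, fun t =>
      sum_nonneg fun r _ => mul_nonneg (hA0 _) (foldCoeff_nonneg _ _), ?_, ?_⟩
    · convert! hA.mul_dilate (hasSpectrum_shiftKernel (θ d)) (w d) using 1
      funext k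
      rw [prod_insert hd, mul_comm]
    · have hq := sum_foldCoeff_rpow_le hl0 hl1 (θ d) (1 : ZMod N)
      simp only [one_mul] at hq
      calc ∑ t, (∑ r, A (t - r * w d) * foldCoeff (θ d) r) ^ l
          ≤ ∑ t, ∑ r, A (t - r * w d) ^ l * foldCoeff (θ d) r ^ l := by
            refine sum_le_sum fun t _ => (rpow_sum_le_sum_rpow _ (fun r =>
              mul_nonneg (hA0 _) (foldCoeff_nonneg _ _)) hl hl1).trans (le_of_eq ?_)
            exact sum_congr rfl fun r _ => Real.mul_rpow (hA0 _) (foldCoeff_nonneg _ _)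
        _ = ∑ r, (∑ t, A t ^ l) * foldCoeff (θ d) r ^ l := by
            rw [sum_comm]
            refine sum_congr rfl fun r _ => ?_
            rw [← sum_mul, ← Equiv.sum_comp (Equiv.subRight (r * w d)) fun t => A t ^ l]
            rfl
        _ = (∑ r, foldCoeff (θ d) r ^ l) * ∑ t, A t ^ l := by rw [← mul_sum, mul_comm]
        _ ≤ rhoConst (θ d) l * ∏ j ∈ u, rhoConst (θ j) l :=
            mul_le_mul hq hAs (sum_nonneg fun r _ => Real.rpow_nonneg (hA0 _) _)
              (rhoConst_pos hl0 _).le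
        _ = _ := (prod_insert (f := fun j => rhoConst (θ j) l) hd).symm

theorem kerMean_nonneg (θ : ℕ → ℝ) (w : ℕ → ZMod N) (u : Finset ℕ) : 0 ≤ kerMean θ w u := by
  obtain ⟨A, hA0, hA, -⟩ := exists_spectrum_prod (l := 1) (by norm_num) le_rfl θ w u
  rw [kerMean, hA.mean]
  exact hA0 0

theorem kerMean_congr (θ : ℕ → ℝ) {w w' : ℕ → ZMod N} {u : Finset ℕ} (h : ∀ j ∈ u, w j = w' j) :
    kerMean θ w u = kerMean θ w' u := by
  simp only [kerMean]
  congr 1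
  refine sum_congr rfl fun k _ => prod_congr rfl fun j hj => by rw [h j hj]

/-- The sum over the choices of one component. The spectrum at `0` is a correlation of the spectrum
of the other components with the dilated one of the new component, and for each frequency `s` of
the former, `sum_foldCoeff_rpow_le` controls the sum over the dilations. -/
theorem sum_units_kerMean_rpow_le {l : ℝ} (hl0 : 1 / 2 < l) (hl1 : l ≤ 1) (θ : ℕ → ℝ)
    (w : ℕ → ZMod N) {d : ℕ} {u : Finset ℕ} (hd : d ∉ u) :
    ∑ y : (ZMod N)ˣ, kerMean θ (Function.update w d y) (insert d u) ^ l ≤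
      ∏ j ∈ insert d u, rhoConst (θ j) l := by
  have hl : 0 < l := by linarith
  obtain ⟨A, hA0, hA, hAs⟩ := exists_spectrum_prod hl0 hl1 θ w u
  have h1 : ∀ y : (ZMod N)ˣ, kerMean θ (Function.update w d y) (insert d u) =
      ∑ r, A (-(r * y)) * foldCoeff (θ d) r := fun y => by
    have h := (hA.mul_dilate (hasSpectrum_shiftKernel (θ d)) (y : ZMod N)).mean
    simp only [zero_sub] at h
    rw [← h, kerMean]
    congr 1
    refine sum_congr rfl fun k _ => ?_
    rw [prod_insert hd, mul_comm, Function.update_self]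
    congr 1
    refine prod_congr rfl fun j hj => ?_
    rw [Function.update_of_ne (by rintro rfl; exact hd hj)]
  have h2 : ∀ y : (ZMod N)ˣ, ∑ r, A (-(r * y)) ^ l * foldCoeff (θ d) r ^ l =
      ∑ s, A s ^ l * foldCoeff (θ d) (s * ((-y⁻¹ : (ZMod N)ˣ) : ZMod N)) ^ l := fun y => by
    rw [← Equiv.sum_comp (Units.mulRight (-y⁻¹))]
    refine sum_congr rfl fun s _ => ?_
    rw [Units.mulRight_apply]
    congr 3
    rw [mul_assoc, ← Units.val_mul, neg_mul, inv_mul_cancel, Units.val_neg, Units.val_one]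
    ring
  calc ∑ y : (ZMod N)ˣ, kerMean θ (Function.update w d y) (insert d u) ^ l
      ≤ ∑ y : (ZMod N)ˣ, ∑ s, A s ^ l *
          foldCoeff (θ d) (s * ((-y⁻¹ : (ZMod N)ˣ) : ZMod N)) ^ l := by
        refine sum_le_sum fun y _ => ?_
        rw [h1, ← h2]
        refine (rpow_sum_le_sum_rpow _ (fun r =>
          mul_nonneg (hA0 _) (foldCoeff_nonneg _ _)) hl hl1).trans (le_of_eq ?_)
        exact sum_congr rfl fun r _ => Real.mul_rpow (hA0 _) (foldCoeff_nonneg _ _)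
    _ = ∑ s, A s ^ l * ∑ y : (ZMod N)ˣ, foldCoeff (θ d) (s * (y : ZMod N)) ^ l := by
        rw [sum_comm]
        refine sum_congr rfl fun s _ => ?_
        rw [← mul_sum, ← Equiv.sum_comp ((Equiv.inv (ZMod N)ˣ).trans (Equiv.neg (ZMod N)ˣ))
          fun y => foldCoeff (θ d) (s * (y : ZMod N)) ^ l]
        rfl
    _ ≤ ∑ s, A s ^ l * rhoConst (θ d) l := by
        refine sum_le_sum fun s _ => mul_le_mul_of_nonneg_left ?_ (Real.rpow_nonneg (hA0 _) _)
        refine le_trans ?_ (sum_foldCoeff_rpow_le hl0 hl1 (θ d) s)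
        refine (sum_map (univ : Finset (ZMod N)ˣ) ⟨fun y => (y : ZMod N), Units.val_injective⟩
          fun y => foldCoeff (θ d) (s * y) ^ l).symm.trans_le ?_
        exact sum_le_sum_of_subset_of_nonneg (subset_univ _) fun y _ _ =>
          Real.rpow_nonneg (foldCoeff_nonneg _ _) _
    _ ≤ (∏ j ∈ u, rhoConst (θ j) l) * rhoConst (θ d) l := by
        rw [← sum_mul]
        exact mul_le_mul_of_nonneg_right hAs (rhoConst_pos hl0 _).le
    _ = _ := by rw [prod_insert hd, mul_comm]

theorem sum_powerset_succ_erase (f : Finset ℕ → ℝ) (d : ℕ) :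
    ∑ u ∈ (range (d + 1)).powerset.erase ∅, f u =
      ∑ u ∈ (range d).powerset.erase ∅, f u + ∑ v ∈ (range d).powerset, f (insert d v) := by
  rw [sum_erase_eq_sub (empty_mem_powerset _), sum_erase_eq_sub (empty_mem_powerset _),
    range_add_one, sum_powerset_insert notMem_range_self]
  ring

/-- The error bound for a vector each of whose components minimizes the error given the preceding
ones: the minimum is at most the average over the `φ(N)` admissible choices. -/
theorem cbc_bound {l : ℝ} (hl0 : 1 / 2 < l) (hl1 : l ≤ 1) (θ : ℕ → ℝ) {γ : Finset ℕ → ℝ}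
    (hγ : ∀ u, 0 ≤ γ u) (w : ℕ → ZMod N) {m : ℕ}
    (hmin : ∀ d < m, ∀ y : (ZMod N)ˣ,
      ∑ v ∈ (range d).powerset, γ (insert d v) * kerMean θ w (insert d v) ≤
      ∑ v ∈ (range d).powerset, γ (insert d v) *
        kerMean θ (Function.update w d y) (insert d v)) :
    ∀ d ≤ m, (∑ u ∈ (range d).powerset.erase ∅, γ u * kerMean θ w u) ^ l ≤
      (N.totient : ℝ)⁻¹ * ∑ u ∈ (range d).powerset.erase ∅,
        γ u ^ l * ∏ j ∈ u, rhoConst (θ j) l := by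
  have hl : 0 < l := by linarith
  have hφ : (0 : ℝ) < N.totient := by
    exact_mod_cast Nat.totient_pos.2 (Nat.pos_of_ne_zero (NeZero.ne N))
  intro d hd
  induction d with
  | zero => simp [Real.zero_rpow hl.ne']
  | succ d ih =>
    rw [sum_powerset_succ_erase, sum_powerset_succ_erase, mul_add]
    have hk0 : ∀ (w : ℕ → ZMod N) u, 0 ≤ γ u * kerMean θ w u := fun w u =>
      mul_nonneg (hγ u) (kerMean_nonneg θ w u)
    refine (Real.rpow_add_le_add_rpow (sum_nonneg fun u _ => hk0 w u)
      (sum_nonneg fun u _ => hk0 w _) hl.le hl1).trans (add_le_add (ih (by omega)) ?_)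
    rw [← div_eq_inv_mul, le_div_iff₀ hφ]
    have hcard : (N.totient : ℝ) = ∑ y : (ZMod N)ˣ, 1 := by
      rw [sum_const, card_univ, ZMod.card_units_eq_totient, nsmul_eq_mul, mul_one]
    rw [hcard, mul_sum]
    calc _ ≤ ∑ y : (ZMod N)ˣ, (∑ v ∈ (range d).powerset, γ (insert d v) *
          kerMean θ (Function.update w d y) (insert d v)) ^ l := by
          refine sum_le_sum fun y _ => ?_
          rw [mul_one]
          exact Real.rpow_le_rpow (sum_nonneg fun u _ => hk0 w _) (hmin d (by omega) y) hl.le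
      _ ≤ ∑ y : (ZMod N)ˣ, ∑ v ∈ (range d).powerset, γ (insert d v) ^ l *
          kerMean θ (Function.update w d y) (insert d v) ^ l := by
          refine sum_le_sum fun y _ => (rpow_sum_le_sum_rpow _ (fun v => hk0 _ _) hl
            hl1).trans (le_of_eq ?_)
          exact sum_congr rfl fun v _ => Real.mul_rpow (hγ _) (kerMean_nonneg _ _ _)
      _ = ∑ v ∈ (range d).powerset, γ (insert d v) ^ l *
          ∑ y : (ZMod N)ˣ, kerMean θ (Function.update w d y) (insert d v) ^ l := by
          rw [sum_comm]
          simp only [mul_sum]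
      _ ≤ _ := by
          refine sum_le_sum fun v hv => mul_le_mul_of_nonneg_left ?_ (Real.rpow_nonneg (hγ _) _)
          refine sum_units_kerMean_rpow_le hl0 hl1 θ w fun h => ?_
          exact notMem_range_self (mem_powerset.1 hv h)

theorem kerMean_natCast (θ : ℕ → ℝ) (z : ℕ → ℕ) (u : Finset ℕ) :
    (N : ℝ)⁻¹ * ∑ k ∈ range N, ∏ j ∈ u,
      shiftKernel (θ j) (Int.fract ((k : ℝ) * (z j : ℝ) / N)) =
      kerMean θ (fun j => (z j : ZMod N)) u := by
  rw [kerMean, ← sum_range_zmod]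
  congr 1
  refine sum_congr rfl fun k _ => prod_congr rfl fun j _ => ?_
  congr 1
  rw [← Nat.cast_mul, Int.fract_div_natCast_eq_div_natCast_mod, ← Nat.cast_mul, ZMod.val_natCast]

theorem shiftAvgError_eq (γ : Finset ℕ → ℝ) (θ : ℕ → ℝ) (d : ℕ) (z : ℕ → ℕ) :
    shiftAvgError γ θ N d z = Real.sqrt (∑ u ∈ (range d).powerset.erase ∅,
      γ u * kerMean θ (fun j => (z j : ZMod N)) u) := by
  rw [shiftAvgError, sum_comm, mul_sum]
  congr 1
  refine sum_congr rfl fun u _ => ?_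
  rw [← kerMean_natCast, ← mul_sum]
  ring

theorem shiftAvgError_congr (γ : Finset ℕ → ℝ) (θ : ℕ → ℝ) {d : ℕ} {z z' : ℕ → ℕ}
    (h : ∀ j < d, z j = z' j) : shiftAvgError γ θ N d z = shiftAvgError γ θ N d z' := by
  rw [shiftAvgError_eq, shiftAvgError_eq]
  congr 1
  refine sum_congr rfl fun u hu => ?_
  rw [kerMean_congr]
  intro j hj
  rw [h j (mem_range.1 (mem_powerset.1 (mem_of_mem_erase hu) hj))]

theorem exists_isCBC (γ : Finset ℕ → ℝ) (θ : ℕ → ℝ) (m : ℕ) : ∃ z, IsCBC γ θ N m z := by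
  have hN : 1 ≤ N := Nat.pos_of_ne_zero (NeZero.ne N)
  induction m with
  | zero => exact ⟨fun _ => 1, rfl, fun d _ h => absurd h (by omega)⟩
  | succ m ih =>
    obtain ⟨z, hz0, hz⟩ := ih
    rcases Nat.eq_zero_or_pos m with rfl | hm
    · exact ⟨z, hz0, fun d h1 h2 => absurd h1 (by omega)⟩
    obtain ⟨y, hy, hymin⟩ := exists_min_image ((Icc 1 N).filter fun y => Nat.Coprime y N)
      (fun y => shiftAvgError γ θ N (m + 1) (Function.update z m y))
      ⟨1, by simp [hN]⟩
    simp only [mem_filter, mem_Icc, and_imp] at hy hymin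
    refine ⟨Function.update z m y, by rwa [Function.update_of_ne (by omega)], fun d h1 h2 => ?_⟩
    rcases (Nat.lt_succ_iff.1 h2).eq_or_lt with rfl | hdm
    · refine ⟨by rw [Function.update_self]; exact ⟨hy.1.1, hy.1.2, hy.2⟩, fun y' h1 h2 h3 => ?_⟩
      rw [Function.update_idem]
      exact hymin y' h1 h2 h3
    · have hzd := hz d h1 hdm
      rw [Function.update_of_ne (by omega)]
      refine ⟨hzd.1, fun y' h1 h2 h3 => ?_⟩
      convert! hzd.2 y' h1 h2 h3 using 1
      · exact shiftAvgError_congr γ θ fun j hj => Function.update_of_ne (by omega) _ _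
      · refine shiftAvgError_congr γ θ fun j hj => ?_
        rw [Function.update_comm (by omega), Function.update_of_ne (by omega)]

theorem exists_natCast_eq_unit (y : (ZMod N)ˣ) :
    ∃ n : ℕ, 1 ≤ n ∧ n ≤ N ∧ Nat.Coprime n N ∧ (n : ZMod N) = y := by
  rcases Nat.eq_zero_or_pos (y : ZMod N).val with h | h
  · have hc := ZMod.val_coe_unit_coprime y
    rw [h, Nat.coprime_zero_left] at hc
    -- a unit is represented by `0` only if `N = 1`, and `0` is outside of the range `1, …, N`
    refine ⟨1, le_rfl, hc.ge, Nat.coprime_one_left N, ?_⟩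
    subst hc
    exact Subsingleton.elim _ _
  · exact ⟨(y : ZMod N).val, h, (ZMod.val_lt _).le, ZMod.val_coe_unit_coprime y,
      ZMod.natCast_zmod_val _⟩

/-- The error bound for the component-by-component construction. -/
theorem IsCBC.bound {l : ℝ} (hl0 : 1 / 2 < l) (hl1 : l ≤ 1) {θ : ℕ → ℝ} {γ : Finset ℕ → ℝ}
    (hγ : ∀ u, 0 ≤ γ u) {m : ℕ} {z : ℕ → ℕ} (hz : IsCBC γ θ N m z) :
    ∑ u ∈ (range m).powerset.erase ∅, γ u * kerMean θ (fun j => (z j : ZMod N)) u ≤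
      ((N.totient : ℝ)⁻¹ * ∑ u ∈ (range m).powerset.erase ∅,
        γ u ^ l * ∏ j ∈ u, rhoConst (θ j) l) ^ (1 / l) := by
  have hl : 0 < l := by linarith
  have hk0 : ∀ (w : ℕ → ZMod N) u, 0 ≤ γ u * kerMean θ w u := fun w u =>
    mul_nonneg (hγ u) (kerMean_nonneg θ w u)
  rw [one_div, Real.le_rpow_inv_iff_of_pos (sum_nonneg fun u _ => hk0 _ u)
    (mul_nonneg (by positivity) (sum_nonneg fun u _ => mul_nonneg (Real.rpow_nonneg (hγ u) _)
      (prod_nonneg fun j _ => (rhoConst_pos hl0 _).le))) hl]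
  refine cbc_bound hl0 hl1 θ hγ _ (m := m) (fun d hd y => ?_) m le_rfl
  rcases Nat.eq_zero_or_pos d with rfl | hd0
  -- the first component is not chosen by minimization, but all units give the same error
  · rw [range_zero, powerset_empty, sum_singleton, sum_singleton]
    refine le_of_eq ?_
    congr 1
    simp only [kerMean, insert_empty_eq, prod_singleton, Function.update_self, hz.1,
      Nat.cast_one, mul_one]
    congr 1
    exact (Equiv.sum_comp (Units.mulRight y) fun k : ZMod N =>
      shiftKernel (θ 0) (k.val / N)).symm
  · obtain ⟨n, h1, h2, h3, h4⟩ := exists_natCast_eq_unit y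
    have h := (hz.2 d hd0 hd).2 n h1 h2 h3
    rw [shiftAvgError_eq, shiftAvgError_eq, Real.sqrt_le_sqrt_iff (sum_nonneg fun u _ => hk0 _ u),
      sum_powerset_succ_erase, sum_powerset_succ_erase] at h
    have e : (fun j => ((Function.update z d n j : ℕ) : ZMod N)) =
        Function.update (fun j => (z j : ZMod N)) d y := by
      funext j
      rcases eq_or_ne j d with rfl | hj
      · rw [Function.update_self, Function.update_self, h4]
      · rw [Function.update_of_ne hj, Function.update_of_ne hj]
    rw [e] at h
    have e2 : ∑ u ∈ (range d).powerset.erase ∅, γ u *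
        kerMean θ (Function.update (fun j => (z j : ZMod N)) d y) u =
        ∑ u ∈ (range d).powerset.erase ∅, γ u * kerMean θ (fun j => (z j : ZMod N)) u := by
      refine sum_congr rfl fun u hu => ?_
      rw [kerMean_congr]
      intro j hj
      have := mem_range.1 (mem_powerset.1 (mem_of_mem_erase hu) hj)
      rw [Function.update_of_ne (by omega)]
    rw [e2] at h
    linarith

end

end

section

/-! ### Elementary symmetric sums and product and order dependent weights -/

theorem add_pow_ge {S x : ℝ} (hS : 0 ≤ S) (hx : 0 ≤ x) (k : ℕ) :
    S ^ (k + 1) + (k + 1) * S ^ k * x ≤ (S + x) ^ (k + 1) := by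
  induction k with
  | zero => simp
  | succ k ih =>
    have h := mul_le_mul_of_nonneg_right ih (add_nonneg hS hx)
    rw [← pow_succ] at h
    refine le_trans ?_ h
    have : 0 ≤ (k + 1 : ℝ) * S ^ k * x * x := by positivity
    have e : (S ^ (k + 1) + (k + 1) * S ^ k * x) * (S + x) =
        S ^ (k + 1 + 1) + (k + 1 + 1) * S ^ (k + 1) * x + (k + 1) * S ^ k * x * x := by ring
    push_cast
    linarith

/-- Maclaurin's inequality for elementary symmetric sums. -/
theorem sum_powersetCard_prod_le (s : Finset ℕ) {x : ℕ → ℝ} (hx : ∀ j, 0 ≤ x j) (k : ℕ) :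
    ∑ u ∈ s.powersetCard k, ∏ j ∈ u, x j ≤ (∑ j ∈ s, x j) ^ k / k.factorial := by
  induction s using Finset.induction_on generalizing k with
  | empty =>
    rcases k with _ | k
    · simp
    · rw [powersetCard_eq_empty.2 (by simp)]; simp
  | insert a s ha ih =>
    rcases k with _ | k
    · simp
    have hdisj : Disjoint (s.powersetCard (k + 1)) ((s.powersetCard k).image (insert a)) := by
      rw [Finset.disjoint_left]
      intro u hu hu'
      obtain ⟨v, -, rfl⟩ := mem_image.1 hu'
      exact ha ((mem_powersetCard.1 hu).1 (mem_insert_self _ _))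
    have hinj : Set.InjOn (insert a) (s.powersetCard k : Set (Finset ℕ)) := by
      intro u hu v hv h
      have hu' : a ∉ u := fun h => ha ((mem_powersetCard.1 (mem_coe.1 hu)).1 h)
      have hv' : a ∉ v := fun h => ha ((mem_powersetCard.1 (mem_coe.1 hv)).1 h)
      rw [← erase_insert hu', ← erase_insert hv']
      exact congrArg (fun w => w.erase a) h
    rw [powersetCard_succ_insert ha, sum_union hdisj, sum_image hinj, sum_insert ha]
    have e : ∑ v ∈ s.powersetCard k, ∏ j ∈ insert a v, x j =
        x a * ∑ v ∈ s.powersetCard k, ∏ j ∈ v, x j := by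
      rw [mul_sum]
      refine sum_congr rfl fun v hv => prod_insert fun h => ha ((mem_powersetCard.1 hv).1 h)
    have hS : 0 ≤ ∑ j ∈ s, x j := sum_nonneg fun j _ => hx j
    have h1 := ih (k + 1)
    have h2 := mul_le_mul_of_nonneg_left (ih k) (hx a)
    have h3 := add_pow_ge hS (hx a) k
    have hk : (0 : ℝ) < k.factorial := by exact_mod_cast k.factorial_pos
    rw [e, add_comm (x a)]
    refine (add_le_add h1 h2).trans ?_
    rw [Nat.factorial_succ, Nat.cast_mul, Nat.cast_succ, le_div_iff₀ (by positivity)]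
    refine le_trans (le_of_eq ?_) h3
    field_simp

theorem sum_rpow_le_rpow_sum {ι : Type*} (s : Finset ι) {f : ι → ℝ} (hf : ∀ i, 0 ≤ f i) {r : ℝ}
    (hr : 1 ≤ r) : ∑ i ∈ s, f i ^ r ≤ (∑ i ∈ s, f i) ^ r := by
  have hr0 : 0 < r := by linarith
  have h := rpow_sum_le_sum_rpow s (f := fun i => f i ^ r) (fun i => Real.rpow_nonneg (hf i) _)
    (inv_pos.2 hr0) (inv_le_one_of_one_le₀ hr)
  simp only [fun i => Real.rpow_rpow_inv (hf i) hr0.ne'] at h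
  rwa [Real.rpow_inv_le_iff_of_pos (sum_nonneg fun i _ => Real.rpow_nonneg (hf i) _)
    (sum_nonneg fun i _ => hf i) hr0] at h

/-- The bound for the sum over all sets of cardinality `k`. -/
def orderBound (p q S : ℝ) (k : ℕ) : ℝ :=
  (((k + 1).factorial : ℝ) * (S ^ k / k.factorial) ^ (1 / p)) ^ q

/-- Sums of product and order dependent terms over all finite sets, bounded through `ℓ^p ⊆ ℓ^q` and
the elementary symmetric sums of the `c j ^ p`. -/
theorem sum_powerset_factorial_le {p q : ℝ} (hp : 0 < p) (hpq : p ≤ q) {c : ℕ → ℝ}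
    (hc : ∀ j, 0 ≤ c j) (hs : Summable fun j => c j ^ p)
    (ho : Summable (orderBound p q (∑' j, c j ^ p))) (m : ℕ) :
    ∑ u ∈ (range m).powerset, (((u.card + 1).factorial : ℝ) * ∏ j ∈ u, c j) ^ q ≤
      ∑' k, orderBound p q (∑' j, c j ^ p) k := by
  have hq : 0 < q := hp.trans_le hpq
  have hcp : ∀ j, 0 ≤ c j ^ p := fun j => Real.rpow_nonneg (hc j) _
  have hS0 : 0 ≤ ∑' j, c j ^ p := tsum_nonneg hcp
  have ho0 : ∀ k, 0 ≤ orderBound p q (∑' j, c j ^ p) k := fun k => by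
    unfold orderBound; positivity
  rw [sum_powerset, card_range]
  refine le_trans (sum_le_sum fun k _ => ?_) (ho.sum_le_tsum _ fun k _ => ho0 k)
  have hprod : ∀ u : Finset ℕ, 0 ≤ ∏ j ∈ u, c j ^ p := fun u => prod_nonneg fun j _ => hcp j
  have e : ∀ u ∈ (range m).powersetCard k, (((u.card + 1).factorial : ℝ) * ∏ j ∈ u, c j) ^ q =
      ((k + 1).factorial : ℝ) ^ q * (∏ j ∈ u, c j ^ p) ^ (q / p) := fun u hu => by
    rw [(mem_powersetCard.1 hu).2, Real.mul_rpow (by positivity) (prod_nonneg fun j _ => hc j),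
      Real.finsetProd_rpow _ _ fun j _ => hc j, ← Real.rpow_mul (prod_nonneg fun j _ => hc j),
      mul_div_cancel₀ _ hp.ne']
  rw [sum_congr rfl e, ← mul_sum, orderBound, Real.mul_rpow (by positivity) (by positivity),
    ← Real.rpow_mul (by positivity), one_div_mul_eq_div]
  refine mul_le_mul_of_nonneg_left ?_ (by positivity)
  refine (sum_rpow_le_rpow_sum _ hprod ((one_le_div hp).2 hpq)).trans ?_
  refine Real.rpow_le_rpow (sum_nonneg fun u _ => hprod u) ?_ (by positivity)
  refine (sum_powersetCard_prod_le _ hcp k).trans ?_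
  have : ∑ j ∈ range m, c j ^ p ≤ ∑' j, c j ^ p := hs.sum_le_tsum _ fun j _ => hcp j
  have h0 : 0 ≤ ∑ j ∈ range m, c j ^ p := sum_nonneg fun j _ => hcp j
  gcongr

/-- For `p < 1` the factorials in the denominator win. -/
theorem summable_orderBound_of_lt_one {p q S : ℝ} (hp : 0 < p) (hp1 : p < 1) (hq : 0 < q)
    (hS : 0 ≤ S) : Summable (orderBound p q S) := by
  suffices h : Summable (orderBound p q (S + 1)) by
    refine Summable.of_nonneg_of_le (fun k => by unfold orderBound; positivity) (fun k => ?_) h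
    unfold orderBound
    have : S ≤ S + 1 := by linarith
    gcongr
  have hS1 : 0 < S + 1 := by linarith
  have hpos : ∀ k, 0 < orderBound p q (S + 1) k := fun k => by
    unfold orderBound
    have := k.factorial_pos
    have := (k + 1).factorial_pos
    positivity
  have hr : ∀ k : ℕ, orderBound p q (S + 1) (k + 1) / orderBound p q (S + 1) k =
      ((1 + 1 / ((k : ℝ) + 1)) * ((S + 1) ^ (1 / p) * ((k : ℝ) + 1) ^ (-(1 / p - 1)))) ^ q :=
    fun k => by
      have hk : (0 : ℝ) < k.factorial := by exact_mod_cast k.factorial_pos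
      have hk1 : (0 : ℝ) < (k : ℝ) + 1 := by positivity
      have hsc : 0 < (S + 1) ^ k / (k.factorial : ℝ) := by positivity
      unfold orderBound
      rw [← Real.div_rpow (by positivity) (by positivity)]
      congr 1
      have e1 : (S + 1) ^ (k + 1) / ((k + 1).factorial : ℝ) =
          ((S + 1) ^ k / k.factorial) * ((S + 1) / (k + 1)) := by
        rw [Nat.factorial_succ]; push_cast; field_simp; ring
      rw [e1, Real.mul_rpow hsc.le (by positivity), Real.div_rpow hS1.le hk1.le,
        neg_sub, Real.rpow_sub hk1, Real.rpow_one, Nat.factorial_succ (k + 1),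
        Nat.factorial_succ k]
      have h1 := Real.rpow_pos_of_pos hsc (1 / p)
      have h2 := Real.rpow_pos_of_pos hk1 (1 / p)
      push_cast
      field_simp
  refine summable_of_ratio_test_tendsto_lt_one (l := 0) one_pos
    (Eventually.of_forall fun k => (hpos k).ne') ?_
  have hn : ∀ k, ‖orderBound p q (S + 1) (k + 1)‖ / ‖orderBound p q (S + 1) k‖ =
      ((1 + 1 / ((k : ℝ) + 1)) * ((S + 1) ^ (1 / p) * ((k : ℝ) + 1) ^ (-(1 / p - 1)))) ^ q :=
    fun k => by
      rw [Real.norm_of_nonneg (hpos _).le, Real.norm_of_nonneg (hpos _).le, hr]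
  simp only [hn]
  have hgap : 0 < 1 / p - 1 := by rw [sub_pos, lt_div_iff₀ hp]; linarith
  have t1 : Tendsto (fun k : ℕ => ((k : ℝ) + 1) ^ (-(1 / p - 1))) atTop (𝓝 0) :=
    (tendsto_rpow_neg_atTop hgap).comp
      (tendsto_atTop_add_const_right _ _ tendsto_natCast_atTop_atTop)
  have t2 : Tendsto (fun k : ℕ => 1 + 1 / ((k : ℝ) + 1)) atTop (𝓝 (1 + 0)) :=
    tendsto_const_nhds.add tendsto_one_div_add_atTop_nhds_zero_nat
  have t3 := (t2.mul (t1.const_mul ((S + 1) ^ (1 / p)))).rpow_const (p := q) (Or.inr hq.le)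
  simpa [Real.zero_rpow hq.ne'] using t3

theorem summable_orderBound_one {S : ℝ} (hS0 : 0 ≤ S) (hS1 : S < 1) :
    Summable (orderBound 1 1 S) := by
  have h := (summable_pow_mul_geometric_of_norm_lt_one 1
    (by rwa [Real.norm_of_nonneg hS0] : ‖S‖ < 1)).add (summable_geometric_of_lt_one hS0 hS1)
  refine h.congr fun k => ?_
  have hk : (k.factorial : ℝ) ≠ 0 := by exact_mod_cast k.factorial_ne_zero
  rw [orderBound, div_one, Real.rpow_one, Real.rpow_one, Nat.factorial_succ]
  push_cast
  field_simp

/-! ### The parameters -/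

theorem lamStar_mem {p δ : ℝ} (hp1 : p ≤ 1) (hδ0 : 0 < δ) (hδ1 : δ ≤ 1 / 2) :
    1 / 2 < lamStar p δ ∧ lamStar p δ ≤ 1 := by
  unfold lamStar
  split_ifs with h
  · exact ⟨one_div_lt_one_div_of_lt (by linarith) (by linarith),
      (div_le_one (by linarith)).2 (by linarith)⟩
  · have : 2 / 3 < p := not_le.1 h
    exact ⟨(div_lt_div_iff₀ (by norm_num) (by linarith)).2 (by linarith),
      (div_le_one (by linarith)).2 (by linarith)⟩

theorem one_div_two_mul_lamStar {p δ : ℝ} (hp1 : p ≤ 1) :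
    1 / (2 * lamStar p δ) = kappa p δ := by
  unfold lamStar kappa
  split_ifs with h
  · field_simp
  · have : 2 / 3 < p := not_le.1 h
    have h2 : (2 - p) ≠ 0 := by linarith
    have h3 : p ≠ 0 := by linarith
    field_simp

theorem le_two_mul_lamStar_div {p δ : ℝ} (hp1 : p ≤ 1) (hδ0 : 0 < δ) (hδ1 : δ ≤ 1 / 2) :
    p ≤ 2 * lamStar p δ / (1 + lamStar p δ) := by
  have h1 := (lamStar_mem hp1 hδ0 hδ1).1
  rw [le_div_iff₀ (by linarith)]
  revert h1
  unfold lamStar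
  split_ifs with h
  · intro h1
    nlinarith
  · intro _
    have : 2 / 3 < p := not_le.1 h
    have h2 : (2 - p) ≠ 0 := by linarith
    refine le_of_eq ?_
    field_simp
    ring

section
variable {b : ℕ → ℝ} {l : ℝ}

theorem thetaSeq_sub (b : ℕ → ℝ) (l : ℝ) (j : ℕ) :
    thetaSeq b l j - b j = (Real.sqrt (b j ^ 2 + 1 - 1 / (2 * l)) - b j) / 2 := by
  rw [thetaSeq]; ring

theorem gap_pos (hl : 1 / 2 < l) : 0 < 1 - 1 / (2 * l) := by
  rw [sub_pos, div_lt_one (by linarith)]; linarith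

theorem lt_thetaSeq (hl : 1 / 2 < l) (j : ℕ) : b j < thetaSeq b l j := by
  rw [← sub_pos, thetaSeq_sub]
  have h := gap_pos hl
  have : b j < Real.sqrt (b j ^ 2 + 1 - 1 / (2 * l)) :=
    lt_of_le_of_lt (le_abs_self _) (by
      rw [← Real.sqrt_sq_eq_abs]; exact Real.sqrt_lt_sqrt (sq_nonneg _) (by linarith))
  linarith

/-- The gaps `θⱼ - bⱼ` are bounded below and the `θⱼ` above, since the `bⱼ` are bounded. -/
theorem exists_thetaSeq_bounds (hl : 1 / 2 < l) (hb : ∀ j, 0 ≤ b j) {B : ℝ} (hB : ∀ j, b j ≤ B) :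
    ∃ D Θ : ℝ, 0 < D ∧ ∀ j, D ≤ thetaSeq b l j - b j ∧ thetaSeq b l j ≤ Θ := by
  have h := gap_pos hl
  set g := 1 - 1 / (2 * l) with hg
  have hB0 : 0 ≤ B := (hb 0).trans (hB 0)
  have hD : 0 < Real.sqrt (B ^ 2 + g) - B := by
    rw [sub_pos]
    exact Real.lt_sqrt_of_sq_lt (by linarith)
  refine ⟨(Real.sqrt (B ^ 2 + g) - B) / 2, (B + Real.sqrt (B ^ 2 + g)) / 2, by linarith,
    fun j => ?_⟩
  have e : b j ^ 2 + 1 - 1 / (2 * l) = b j ^ 2 + g := by rw [hg]; ring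
  have h2 : Real.sqrt (b j ^ 2 + g) ≤ Real.sqrt (B ^ 2 + g) := by
    refine Real.sqrt_le_sqrt ?_
    have := pow_le_pow_left₀ (hb j) (hB j) 2
    linarith
  rw [thetaSeq_sub, thetaSeq, e]
  constructor
  · have s1 := Real.sq_sqrt (by positivity : 0 ≤ b j ^ 2 + g)
    have s2 := Real.sq_sqrt (by positivity : 0 ≤ B ^ 2 + g)
    have p1 : b j ≤ Real.sqrt (b j ^ 2 + g) := Real.le_sqrt_of_sq_le (by linarith)
    have p2 := Real.sqrt_nonneg (B ^ 2 + g)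
    by_contra hcon
    have hcon : Real.sqrt (b j ^ 2 + g) - b j < Real.sqrt (B ^ 2 + g) - B := by linarith
    nlinarith [hB j, hb j, Real.sqrt_nonneg (b j ^ 2 + g)]
  · linarith [hB j]

theorem rhoConst_mono (hl : 1 / 2 < l) {θ θ' : ℝ} (h0 : 0 ≤ θ) (h : θ ≤ θ') :
    rhoConst θ l ≤ rhoConst θ' l := by
  have hl' : 0 < l := by linarith
  have hη0 : 0 < (2 * l - 1) / (4 * l) := div_pos (by linarith) (by linarith)
  have hη1 : 0 < 1 - (2 * l - 1) / (4 * l) := by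
    rw [sub_pos, div_lt_one (by linarith)]; linarith
  have hz : 0 ≤ (riemannZeta ((l + 1 / 2 : ℝ) : ℂ)).re := by
    rw [re_riemannZeta (by linarith)]
    exact tsum_nonneg fun n => by positivity
  unfold rhoConst
  have hpi := Real.pi_pos
  dsimp only
  gcongr

/-- The quantity inside the outer power in the definition of the weights. -/
def podBase (b : ℕ → ℝ) (l T : ℝ) (u : Finset ℕ) : ℝ :=
  (((u.card + 1).factorial : ℝ)) ^ 2 * (4 * max 1 T) ^ (2 * u.card)
    * ∏ j ∈ u, b j ^ 2 / ((thetaSeq b l j - b j) * rhoConst (thetaSeq b l j) l)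

theorem podBase_nonneg (hl : 1 / 2 < l) (T : ℝ) (u : Finset ℕ) : 0 ≤ podBase b l T u := by
  refine mul_nonneg (by positivity) (prod_nonneg fun j _ => div_nonneg (sq_nonneg _) ?_)
  exact mul_nonneg (sub_nonneg.2 (lt_thetaSeq hl j).le) (rhoConst_pos hl _).le

theorem podWeight_eq (b : ℕ → ℝ) (l T : ℝ) (u : Finset ℕ) :
    podWeight b l T u = podBase b l T u ^ (1 / (1 + l)) := rfl

theorem podWeight_nonneg (hl : 1 / 2 < l) (T : ℝ) (u : Finset ℕ) : 0 ≤ podWeight b l T u :=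
  Real.rpow_nonneg (podBase_nonneg hl T u) _

theorem podWeight_mul_rpow (hl : 1 / 2 < l) (T : ℝ) (u : Finset ℕ) :
    podWeight b l T u * podWeight b l T u ^ l = podBase b l T u := by
  rw [podWeight_eq, ← Real.rpow_mul (podBase_nonneg hl T u),
    ← Real.rpow_add_of_nonneg (podBase_nonneg hl T u) (by positivity) (by positivity)]
  rw [show 1 / (1 + l) + 1 / (1 + l) * l = 1 by field_simp, Real.rpow_one]

theorem sq_le_factorial_mul_two_pow (k : ℕ) : (k + 1) ^ 2 ≤ (k + 1).factorial * 2 ^ k := by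
  induction k with
  | zero => simp
  | succ k ih =>
    rw [Nat.factorial_succ (k + 1), pow_succ 2 k]
    calc (k + 1 + 1) ^ 2 ≤ 2 * (k + 1 + 1) * (k + 1) ^ 2 := by nlinarith
      _ ≤ 2 * (k + 1 + 1) * ((k + 1).factorial * 2 ^ k) := by gcongr
      _ = _ := by ring

/-- The weights are matched to the bounds for the mixed derivatives: the factors of `podWeight` are
the ones that make `γ u * γ u ^ l * ∏ ϱ(θⱼ)` dominate the squared derivative bounds. -/
theorem derivBound_le_podWeight (hl : 1 / 2 < l) (T : ℝ) (u : Finset ℕ) :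
    ((2 * max 1 T) ^ u.card * ((u.card : ℝ) + 1) ^ 2 * ∏ j ∈ u, b j) ^ 2 *
        ∏ j ∈ u, 1 / (thetaSeq b l j - b j) ≤
      podWeight b l T u * (podWeight b l T u ^ l * ∏ j ∈ u, rhoConst (thetaSeq b l j) l) := by
  rw [← mul_assoc, podWeight_mul_rpow hl, podBase, mul_assoc _ (∏ j ∈ u, _ / _), ← prod_mul_distrib]
  have e : ∏ j ∈ u, b j ^ 2 / ((thetaSeq b l j - b j) * rhoConst (thetaSeq b l j) l) *
      rhoConst (thetaSeq b l j) l = (∏ j ∈ u, b j) ^ 2 * ∏ j ∈ u, 1 / (thetaSeq b l j - b j) := by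
    rw [← prod_pow, ← prod_mul_distrib]
    refine prod_congr rfl fun j _ => ?_
    have := (rhoConst_pos hl (thetaSeq b l j)).ne'
    have := (sub_pos.2 (lt_thetaSeq (b := b) hl j)).ne'
    field_simp
  rw [e, mul_pow, mul_assoc]
  have h0 : 0 ≤ (∏ j ∈ u, b j) ^ 2 * ∏ j ∈ u, 1 / (thetaSeq b l j - b j) :=
    mul_nonneg (sq_nonneg _) (prod_nonneg fun j _ =>
      one_div_nonneg.2 (sub_nonneg.2 (lt_thetaSeq hl j).le))
  refine mul_le_mul_of_nonneg_right ?_ h0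
  have hk : ((u.card : ℝ) + 1) ^ 2 ≤ (u.card + 1).factorial * 2 ^ u.card := by
    exact_mod_cast sq_le_factorial_mul_two_pow u.card
  calc ((2 * max 1 T) ^ u.card * ((u.card : ℝ) + 1) ^ 2) ^ 2
      ≤ ((2 * max 1 T) ^ u.card * ((u.card + 1).factorial * 2 ^ u.card)) ^ 2 := by
        have : 0 ≤ max 1 T := zero_le_one.trans (le_max_left _ _)
        gcongr
    _ = (((u.card + 1).factorial : ℝ)) ^ 2 * (4 * max 1 T) ^ (2 * u.card) := by
        rw [show (4 : ℝ) * max 1 T = 2 * (2 * max 1 T) by ring]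
        generalize 2 * max 1 T = x
        ring

/-- The weights, raised to the power `l`, in terms of a multiple of the sequence `b`. -/
theorem podWeight_rpow_mul_le (hl : 1 / 2 < l) (hb : ∀ j, 0 ≤ b j) {D ρ : ℝ} (hD : 0 < D)
    (hD' : ∀ j, D ≤ thetaSeq b l j - b j) (hρ : ∀ j, rhoConst (thetaSeq b l j) l ≤ ρ) (T : ℝ)
    (u : Finset ℕ) :
    podWeight b l T u ^ l * ∏ j ∈ u, rhoConst (thetaSeq b l j) l ≤
      (((u.card + 1).factorial : ℝ) * ∏ j ∈ u,
        (4 * max 1 T * (Real.sqrt D)⁻¹ * ρ ^ (1 / (2 * l)) * b j)) ^ (2 * l / (1 + l)) := by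
  have hl0 : 0 < l := by linarith
  have hT0 : 0 ≤ max 1 T := zero_le_one.trans (le_max_left _ _)
  have hρ0 : 0 < ρ := (rhoConst_pos hl _).trans_le (hρ 0)
  set A := 4 * max 1 T * (Real.sqrt D)⁻¹ * ρ ^ (1 / (2 * l)) with hA
  have hA0 : 0 ≤ A := by positivity
  have hfac : ∀ j, 0 ≤ b j ^ 2 / ((thetaSeq b l j - b j) * rhoConst (thetaSeq b l j) l) := fun j =>
    div_nonneg (sq_nonneg _)
      (mul_nonneg (sub_nonneg.2 (lt_thetaSeq hl j).le) (rhoConst_pos hl _).le)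
  rw [podWeight_eq, ← Real.rpow_mul (podBase_nonneg hl T u), podBase,
    Real.mul_rpow (by positivity) (prod_nonneg fun j _ => hfac j),
    ← Real.finsetProd_rpow _ _ fun j _ => hfac j, mul_assoc, ← prod_mul_distrib,
    Real.mul_rpow (by positivity) (prod_nonneg fun j _ => mul_nonneg hA0 (hb j)),
    ← Real.finsetProd_rpow _ _ fun j _ => mul_nonneg hA0 (hb j)]
  have e1 : ((((u.card + 1).factorial : ℝ)) ^ 2 * (4 * max 1 T) ^ (2 * u.card)) ^ (1 / (1 + l) * l) =
      ((u.card + 1).factorial : ℝ) ^ (2 * l / (1 + l)) *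
        ∏ _j ∈ u, (4 * max 1 T) ^ (2 * l / (1 + l)) := by
    rw [prod_const, pow_mul, ← Real.rpow_natCast _ u.card, ← Real.rpow_natCast (_ ^ _) u.card,
      Real.mul_rpow (by positivity) (by positivity), ← Real.rpow_two, ← Real.rpow_two,
      ← Real.rpow_mul (by positivity), ← Real.rpow_mul (by positivity),
      ← Real.rpow_mul (by positivity), ← Real.rpow_mul (by positivity)]
    congr 2 <;> ring
  rw [e1, mul_assoc, ← prod_mul_distrib]
  refine mul_le_mul_of_nonneg_left (prod_le_prod (fun j _ => ?_) fun j _ => ?_) (by positivity)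
  · have := hfac j
    have := (rhoConst_pos hl (thetaSeq b l j)).le
    positivity
  · set r := rhoConst (thetaSeq b l j) l with hr
    have hr0 : 0 < r := rhoConst_pos hl _
    set d := thetaSeq b l j - b j with hd
    have hd0 : 0 < d := hD.trans_le (hD' j)
    have hexp : 0 ≤ 2 * l / (1 + l) := by positivity
    have e2 : (b j ^ 2 / (d * r)) ^ (1 / (1 + l) * l) * r =
        b j ^ (2 * l / (1 + l)) * (d⁻¹ ^ (l / (1 + l)) * r ^ (1 / (1 + l))) := by
      rw [show b j ^ 2 / (d * r) = b j ^ 2 * (d⁻¹ * r⁻¹) by field_simp,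
        Real.mul_rpow (by positivity) (by positivity), Real.mul_rpow (by positivity) (by positivity),
        Real.inv_rpow hr0.le, ← Real.rpow_neg hr0.le, ← Real.rpow_two, ← Real.rpow_mul (hb j)]
      have e3 : r ^ (-(1 / (1 + l) * l)) * r = r ^ (1 / (1 + l)) := by
        conv_lhs => rw [← Real.rpow_one r, ← Real.rpow_mul hr0.le, ← Real.rpow_add hr0]
        congr 1
        field_simp
        ring
      rw [show (2 : ℝ) * (1 / (1 + l) * l) = 2 * l / (1 + l) by ring,
        show 1 / (1 + l) * l = l / (1 + l) by ring] at *
      rw [mul_assoc, mul_assoc, e3]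
    have e4 : (A * b j) ^ (2 * l / (1 + l)) = (4 * max 1 T) ^ (2 * l / (1 + l)) *
        (b j ^ (2 * l / (1 + l)) * (D⁻¹ ^ (l / (1 + l)) * ρ ^ (1 / (1 + l)))) := by
      rw [hA, Real.mul_rpow (by positivity) (hb j), Real.mul_rpow (by positivity) (by positivity),
        Real.mul_rpow (by positivity) (by positivity), ← Real.rpow_mul hρ0.le,
        ← Real.sqrt_inv, Real.sqrt_eq_rpow, ← Real.rpow_mul (by positivity)]
      rw [show 1 / (2 * l) * (2 * l / (1 + l)) = 1 / (1 + l) by field_simp,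
        show (1 / 2 : ℝ) * (2 * l / (1 + l)) = l / (1 + l) by ring]
      ring
    rw [e2, e4]
    have h1 : d⁻¹ ≤ D⁻¹ := inv_anti₀ hD (hD' j)
    have h2 : r ≤ ρ := hρ j
    have := hb j
    gcongr

end

end

section

/-! ### Uniform bounds for the weights and the exponential moments -/

section
variable {b : ℕ → ℝ}

theorem exists_le_of_summable_rpow {p : ℝ} (hp : 0 < p) (hb : ∀ j, 0 ≤ b j)
    (hs : Summable fun j => b j ^ p) : ∃ B : ℝ, 0 < B ∧ ∀ j, b j ≤ B := by
  refine ⟨(∑' j, b j ^ p) ^ p⁻¹ + 1, add_pos_of_nonneg_of_pos (Real.rpow_nonneg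
    (tsum_nonneg fun j => Real.rpow_nonneg (hb j) _) _) one_pos, fun j => ?_⟩
  have h := hs.le_tsum j fun i _ => Real.rpow_nonneg (hb i) _
  have h2 := Real.rpow_le_rpow (Real.rpow_nonneg (hb j) _) h (inv_pos.2 hp).le
  rw [Real.rpow_rpow_inv (hb j) hp.ne'] at h2
  linarith

theorem summable_of_summable_rpow {p : ℝ} (hp : 0 < p) (hp1 : p ≤ 1) (hb : ∀ j, 0 ≤ b j)
    (hs : Summable fun j => b j ^ p) : Summable b := by
  obtain ⟨B, hB0, hB⟩ := exists_le_of_summable_rpow hp hb hs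
  refine Summable.of_nonneg_of_le hb (fun j => ?_) (hs.mul_left (B ^ (1 - p)))
  calc b j = b j ^ (1 - p) * b j ^ p := by
        rw [← Real.rpow_add_of_nonneg (hb j) (by linarith) hp.le, sub_add_cancel, Real.rpow_one]
    _ ≤ _ := mul_le_mul_of_nonneg_right (Real.rpow_le_rpow (hb j) (hB j) (by linarith))
        (Real.rpow_nonneg (hb j) _)

/-- The sums over the weights that enter the error bound are bounded, uniformly in the
dimension. For `p < 1` the factorials in the weights are outweighed by those of the elementary
symmetric sums. For `p = 1` they balance, and what remains is a geometric series, whose ratio is less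
than `1` by the smallness condition. -/
theorem exists_sum_podWeight_le {p δ T : ℝ} (hp0 : 0 < p) (hp1 : p ≤ 1) (hδ0 : 0 < δ)
    (hδ1 : δ ≤ 1 / 2) (hb : ∀ j, 0 ≤ b j) (hs : Summable fun j => b j ^ p)
    (hsmall : p = 1 → SmallnessCondition b T) :
    ∃ S : ℝ, 0 ≤ S ∧ ∀ m : ℕ, ∑ u ∈ (range m).powerset,
      podWeight b (lamStar p δ) T u ^ lamStar p δ *
        ∏ j ∈ u, rhoConst (thetaSeq b (lamStar p δ) j) (lamStar p δ) ≤ S := by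
  obtain ⟨B, hB0, hB⟩ := exists_le_of_summable_rpow hp0 hb hs
  have hl := (lamStar_mem hp1 hδ0 hδ1).1
  have hpq := le_two_mul_lamStar_div hp1 hδ0 hδ1
  obtain ⟨D, Θ, hD, hDΘ⟩ := exists_thetaSeq_bounds hl hb hB
  set l := lamStar p δ with hldef
  have hl0 : 0 < l := by linarith
  have hT0 : 0 < max 1 T := zero_lt_one.trans_le (le_max_left _ _)
  suffices h : ∃ D' ρ : ℝ, 0 < D' ∧ (∀ j, D' ≤ thetaSeq b l j - b j) ∧
      (∀ j, rhoConst (thetaSeq b l j) l ≤ ρ) ∧ Summable (orderBound p (2 * l / (1 + l))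
        (∑' j, (4 * max 1 T * (Real.sqrt D')⁻¹ * ρ ^ (1 / (2 * l)) * b j) ^ p)) by
    obtain ⟨D', ρ, hD', hDj, hρ, ho⟩ := h
    have hρ0 : 0 < ρ := (rhoConst_pos hl _).trans_le (hρ 0)
    set A := 4 * max 1 T * (Real.sqrt D')⁻¹ * ρ ^ (1 / (2 * l)) with hA
    have hA0 : 0 ≤ A := by positivity
    refine ⟨∑' k, orderBound p (2 * l / (1 + l)) (∑' j, (A * b j) ^ p) k, tsum_nonneg fun k => ?_,
      fun m => ?_⟩
    · have : 0 ≤ ∑' j, (A * b j) ^ p := tsum_nonneg fun j =>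
        Real.rpow_nonneg (mul_nonneg hA0 (hb j)) _
      unfold orderBound
      positivity
    · refine (sum_le_sum fun u _ => podWeight_rpow_mul_le hl hb hD' hDj hρ T u).trans ?_
      refine sum_powerset_factorial_le hp0 hpq (fun j => mul_nonneg hA0 (hb j)) ?_ ho m
      simp only [fun j => Real.mul_rpow (z := p) hA0 (hb j)]
      exact hs.mul_left _
  rcases hp1.lt_or_eq with hlt | rfl
  · refine ⟨D, rhoConst Θ l, hD, fun j => (hDΘ j).1, fun j => rhoConst_mono hl
      ((hb j).trans (lt_thetaSeq hl j).le) (hDΘ j).2, ?_⟩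
    have hρ0 : 0 < rhoConst Θ l := rhoConst_pos hl _
    refine summable_orderBound_of_lt_one hp0 hlt (by positivity) (tsum_nonneg fun j => ?_)
    have := hb j
    positivity
  · have hl1 : l = 1 := by rw [hldef, lamStar, if_neg (by norm_num)]; norm_num
    obtain ⟨θm, hθm, hlt⟩ := hsmall rfl
    rw [hl1] at hDΘ hl ⊢
    have hbdd : BddBelow (Set.range fun j => thetaSeq b 1 j - b j) :=
      ⟨D, by rintro _ ⟨j, rfl⟩; exact (hDΘ j).1⟩
    set I := ⨅ j, (thetaSeq b 1 j - b j) with hI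
    have hI0 : 0 < I := hD.trans_le (le_ciInf fun j => (hDΘ j).1)
    have hρ0 : 0 < rhoConst θm 1 := rhoConst_pos hl _
    refine ⟨I, rhoConst θm 1, hI0, fun j => ciInf_le hbdd j, fun j => rhoConst_mono hl
      ((hb j).trans (lt_thetaSeq hl j).le) (hθm j).le, ?_⟩
    rw [show (2 : ℝ) * 1 / (1 + 1) = 1 by norm_num, show (1 : ℝ) / (2 * 1) = 1 / 2 by norm_num,
      ← Real.sqrt_eq_rpow]
    simp only [Real.rpow_one]
    rw [tsum_mul_left]
    have h0 : 0 ≤ ∑' j, b j := tsum_nonneg hb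
    refine summable_orderBound_one (by positivity) ?_
    rw [lt_div_iff₀ (by positivity)] at hlt
    have hsI := Real.sqrt_pos.2 hI0
    calc 4 * max 1 T * (Real.sqrt I)⁻¹ * Real.sqrt (rhoConst θm 1) * ∑' j, b j
        = (∑' j, b j) * (4 * max 1 T * Real.sqrt (rhoConst θm 1)) / Real.sqrt I := by
          field_simp
      _ < 1 := (div_lt_one hsI).2 hlt

/-- Exponential moments of the Gaussian, with the correct behaviour for small exponents. -/
theorem exists_integral_exp_le (B : ℝ) (hB : 0 < B) : ∃ c : ℝ, 0 ≤ c ∧ ∀ x : ℝ, 0 ≤ x → x ≤ B →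
    1 ≤ ∫ y, Real.exp (2 * x * |y|) ∂(gaussianReal 0 1) ∧
      ∫ y, Real.exp (2 * x * |y|) ∂(gaussianReal 0 1) ≤ Real.exp (c * x) := by
  have h1 : ∀ x : ℝ, 0 ≤ x → 1 ≤ ∫ y, Real.exp (2 * x * |y|) ∂(gaussianReal 0 1) := fun x hx => by
    have : ∫ _y, (1 : ℝ) ∂(gaussianReal 0 1) = 1 := by simp
    rw [← this]
    refine integral_mono (integrable_const _) (integrable_exp_mul_abs _) fun y => ?_
    exact Real.one_le_exp (by positivity)
  set E := ∫ y, Real.exp (2 * B * |y|) ∂(gaussianReal 0 1) with hE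
  have hE1 : 1 ≤ E := h1 B hB.le
  refine ⟨(E - 1) / B, div_nonneg (by linarith) hB.le, fun x hx0 hxB => ⟨h1 x hx0, ?_⟩⟩
  have ht0 : 0 ≤ x / B := by positivity
  have ht1 : x / B ≤ 1 := (div_le_one hB).2 hxB
  have hpt : ∀ y : ℝ, Real.exp (2 * x * |y|) ≤ (1 - x / B) + x / B * Real.exp (2 * B * |y|) :=
    fun y => by
      have h := convexOn_exp.2 (Set.mem_univ 0) (Set.mem_univ (2 * B * |y|))
        (by linarith : 0 ≤ 1 - x / B) ht0 (by ring)
      simp only [smul_eq_mul, mul_zero, zero_add, Real.exp_zero, mul_one] at h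
      refine le_trans (le_of_eq ?_) h
      congr 1
      field_simp
  calc ∫ y, Real.exp (2 * x * |y|) ∂(gaussianReal 0 1)
      ≤ ∫ y, ((1 - x / B) + x / B * Real.exp (2 * B * |y|)) ∂(gaussianReal 0 1) :=
        integral_mono (integrable_exp_mul_abs _)
          ((integrable_const _).add ((integrable_exp_mul_abs _).const_mul _)) hpt
    _ = (E - 1) / B * x + 1 := by
        rw [integral_add (integrable_const _) ((integrable_exp_mul_abs _).const_mul _),
          integral_const_mul, integral_const, probReal_univ, one_smul, ← hE]
        field_simp
        ring
    _ ≤ _ := Real.add_one_le_exp _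

theorem exists_prod_integral_exp_le (hb : ∀ j, 0 ≤ b j) (hs : Summable b) {B : ℝ} (hB0 : 0 < B)
    (hB : ∀ j, b j ≤ B) : ∃ E : ℝ, 0 ≤ E ∧ ∀ (m : ℕ) (u : Finset (Fin m)),
      ∏ j ∈ u, ∫ y, Real.exp (2 * b j * |y|) ∂(gaussianReal 0 1) ≤ E := by
  obtain ⟨c, hc, h⟩ := exists_integral_exp_le B hB0
  refine ⟨Real.exp (c * ∑' j, b j), (Real.exp_pos _).le, fun m u => ?_⟩
  calc ∏ j ∈ u, ∫ y, Real.exp (2 * b j * |y|) ∂(gaussianReal 0 1)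
      ≤ ∏ j ∈ u, Real.exp (c * b j) := prod_le_prod
        (fun j _ => zero_le_one.trans (h _ (hb j) (hB j)).1) fun j _ => (h _ (hb j) (hB j)).2
    _ = Real.exp (c * ∑ j ∈ u.map Fin.valEmbedding, b j) := by
        rw [← Real.exp_sum, ← mul_sum, sum_map]; rfl
    _ ≤ _ := Real.exp_le_exp.2 (mul_le_mul_of_nonneg_left (hs.sum_le_tsum _ fun j _ => hb j) hc)

end

/-! ### The size of Euler's totient function -/

/-- The product is smallest for `s = {2, …, k + 1}`, where it telescopes. -/
theorem one_le_card_mul_prod_one_sub_inv (s : Finset ℕ) (hs : ∀ p ∈ s, 2 ≤ p) :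
    1 ≤ (s.card + 1 : ℚ) * ∏ p ∈ s, (1 - (p : ℚ)⁻¹) := by
  induction s using Finset.induction_on_max with
  | empty => simp
  | insert a s ha ih =>
    have hmem : a ∉ s := fun h => lt_irrefl _ (ha a h)
    have ih := ih fun p hp => hs p (mem_insert_of_mem hp)
    have hcard : s.card + 2 ≤ a := by
      have h2 := hs a (mem_insert_self _ _)
      have : s ⊆ Ico 2 a := fun p hp => mem_Ico.2 ⟨hs p (mem_insert_of_mem hp), ha p hp⟩
      have := card_le_card this
      rw [Nat.card_Ico] at this
      omega
    have ha0 : (s.card + 2 : ℚ) ≤ a := by exact_mod_cast hcard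
    have hapos : (0 : ℚ) < a := by have : (0 : ℚ) ≤ s.card := by positivity
                                   linarith
    rw [prod_insert hmem, card_insert_of_notMem hmem]
    have hP : 0 ≤ ∏ p ∈ s, (1 - (p : ℚ)⁻¹) := prod_nonneg fun p hp => by
      have : (2 : ℚ) ≤ p := by exact_mod_cast hs p (mem_insert_of_mem hp)
      exact sub_nonneg.2 (inv_le_one_of_one_le₀ (by linarith))
    have h1 : (s.card + 1 : ℚ) ≤ (s.card + 1 + 1) * (1 - (a : ℚ)⁻¹) := by
      rw [mul_sub, mul_one]
      have : (s.card + 1 + 1 : ℚ) * (a : ℚ)⁻¹ ≤ 1 := by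
        rw [← div_eq_mul_inv, div_le_one hapos]; linarith
      linarith
    push_cast
    calc (1 : ℚ) ≤ (s.card + 1) * ∏ p ∈ s, (1 - (p : ℚ)⁻¹) := ih
      _ ≤ ((s.card + 1 + 1) * (1 - (a : ℚ)⁻¹)) * ∏ p ∈ s, (1 - (p : ℚ)⁻¹) := by gcongr
      _ = _ := by ring

/-- A lower bound for the totient: the `i`-th smallest prime factor is at least `i + 1`. -/
theorem le_card_primeFactors_mul_totient (N : ℕ) :
    N ≤ (N.primeFactors.card + 1) * N.totient := by
  have h := one_le_card_mul_prod_one_sub_inv N.primeFactors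
    fun p hp => (Nat.prime_of_mem_primeFactors hp).two_le
  have h2 := Nat.totient_eq_mul_prod_factors N
  have : (N : ℚ) ≤ (N.primeFactors.card + 1) * N.totient := by
    rw [h2]
    have h3 := mul_le_mul_of_nonneg_left h (Nat.cast_nonneg (α := ℚ) N)
    linarith
  exact_mod_cast this

/-- A number up to `10 ^ 30 < 2 ^ 100` has fewer than `100` prime factors. -/
theorem le_hundred_mul_totient {N : ℕ} (hN : 1 ≤ N) (hN' : N ≤ 10 ^ 30) :
    N ≤ 100 * N.totient := by
  refine (le_card_primeFactors_mul_totient N).trans (Nat.mul_le_mul_right _ ?_)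
  have h1 : 2 ^ N.primeFactors.card ≤ ∏ p ∈ N.primeFactors, p := by
    refine Finset.pow_card_le_prod _ _ _ fun p hp => (Nat.prime_of_mem_primeFactors hp).two_le
  have h2 := Nat.le_of_dvd hN (Nat.prod_primeFactors_dvd N)
  have h3 : 2 ^ N.primeFactors.card < 2 ^ 100 :=
    (h1.trans (h2.trans hN')).trans_lt (by norm_num)
  have := (Nat.pow_lt_pow_iff_right (by norm_num)).1 h3
  omega

/-! ### The error of the lattice rule with the chosen parameters -/

theorem sum_finset_fin {M : Type*} [AddCommMonoid M] (m : ℕ) (f : Finset ℕ → M) :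
    ∑ u : Finset (Fin m), f (u.map Fin.valEmbedding) = ∑ v ∈ (range m).powerset, f v := by
  refine sum_bij (fun u _ => u.map Fin.valEmbedding) (fun u _ => ?_)
    (fun u _ u' _ h => map_injective _ h) (fun v hv => ?_) fun _ _ => rfl
  · rw [mem_powerset]
    intro j hj
    obtain ⟨i, -, rfl⟩ := mem_map.1 hj
    exact mem_range.2 i.2
  · have hv := mem_powerset.1 hv
    exact ⟨v.attachFin fun j hj => mem_range.1 (hv hj), mem_univ _, map_valEmbedding_attachFin _⟩

theorem sum_finset_fin_erase (m : ℕ) (f : Finset ℕ → ℝ) :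
    ∑ u ∈ (univ : Finset (Finset (Fin m))).erase ∅, f (u.map Fin.valEmbedding) =
      ∑ v ∈ (range m).powerset.erase ∅, f v := by
  rw [sum_erase_eq_sub (mem_univ _), sum_erase_eq_sub (empty_mem_powerset _), sum_finset_fin,
    map_empty]

/-- The root mean square error of the lattice rules found by the component-by-component
construction, for integrands whose mixed derivatives satisfy the bounds of the semi-discrete
observable. The vector does not depend on the integrand. -/
theorem lattice_cbc_error {b : ℕ → ℝ} {p δ T : ℝ} (hp0 : 0 < p) (hp1 : p ≤ 1) (hδ0 : 0 < δ)
    (hδ1 : δ ≤ 1 / 2) (hb : ∀ j, 0 ≤ b j) (hs : Summable fun j => b j ^ p)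
    (hsmall : p = 1 → SmallnessCondition b T) (C₁ : ℝ) :
    ∃ C : ℝ, 0 ≤ C ∧ ∀ m N : ℕ, 1 ≤ N → N ≤ 10 ^ 30 → ∃ z : ℕ → ℕ,
      IsCBC (podWeight b (lamStar p δ) T) (thetaSeq b (lamStar p δ)) N m z ∧
      ∀ D : Finset (Fin m) → (Fin m → ℝ) → ℂ, IsDerivFamily D →
        (∀ u ξ, ‖D u ξ‖ ≤ C₁ * ((2 * max 1 T) ^ u.card * ((u.card : ℝ) + 1) ^ 2 * ∏ j ∈ u, b j) *
          Real.exp (∑ j : Fin m, b j * |ξ j|)) →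
        ∫⁻ Δ in Set.Icc (0 : Fin m → ℝ) 1,
          ‖latticeRule m N z (D ∅) Δ - ∫ t, D ∅ t ∂gaussFin m‖ₑ ^ (2 : ℝ) ≤
          ENNReal.ofReal ((C * (N : ℝ) ^ (-kappa p δ)) ^ 2) := by
  obtain ⟨hl, hl1⟩ := lamStar_mem hp1 hδ0 hδ1
  obtain ⟨S, hS0, hS⟩ := exists_sum_podWeight_le hp0 hp1 hδ0 hδ1 hb hs hsmall
  obtain ⟨B, hB0, hB⟩ := exists_le_of_summable_rpow hp0 hb hs
  obtain ⟨E, hE0, hE⟩ := exists_prod_integral_exp_le hb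
    (summable_of_summable_rpow hp0 hp1 hb hs) hB0 hB
  rw [← one_div_two_mul_lamStar hp1]
  set l := lamStar p δ with hldef
  have hl0 : 0 < l := by linarith
  set θ := thetaSeq b l with hθ
  set γ := podWeight b l T with hγ
  have hγ0 : ∀ u, 0 ≤ γ u := podWeight_nonneg hl T
  set W : Finset ℕ → ℝ := fun u => γ u ^ l * ∏ j ∈ u, rhoConst (θ j) l with hW
  have hW0 : ∀ u, 0 ≤ W u := fun u => mul_nonneg (Real.rpow_nonneg (hγ0 u) _)
    (prod_nonneg fun j _ => (rhoConst_pos hl _).le)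
  set K := C₁ ^ 2 * E * S * (100 * S) ^ (1 / l) with hK
  have hK0 : 0 ≤ K := by positivity
  refine ⟨Real.sqrt K, Real.sqrt_nonneg _, fun m N hN hN' => ?_⟩
  have hNZ : NeZero N := ⟨by omega⟩
  obtain ⟨z, hz⟩ := exists_isCBC (N := N) γ θ m
  refine ⟨z, hz, fun D hD hDb => ?_⟩
  have hprodb : ∀ u : Finset (Fin m), 0 ≤ ∏ j ∈ u, b j := fun u => prod_nonneg fun j _ => hb j
  have hT0 : 0 ≤ max 1 T := zero_le_one.trans (le_max_left _ _)
  refine (lattice_error (b := b) (θ := θ) (M := fun u => C₁ * ((2 * max 1 T) ^ u.card *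
    ((u.card : ℝ) + 1) ^ 2 * ∏ j ∈ u, b j)) (γ := fun u => γ (u.map Fin.valEmbedding))
    (R := fun u => C₁ ^ 2 * E * W (u.map Fin.valEmbedding)) hD hb hDb (fun j => lt_thetaSeq hl j)
    (fun u => hγ0 _) (fun u => mul_nonneg (by positivity) (hW0 _)) (fun u => ?_) hN z).trans ?_
  · have h1 := derivBound_le_podWeight (b := b) hl T (u.map Fin.valEmbedding)
    rw [card_map, prod_map, prod_map] at h1
    have h2 := hE m (univ \ u)
    have h3 : 0 ≤ ∏ j ∈ univ \ u, ∫ y, Real.exp (2 * b j * |y|) ∂(gaussianReal 0 1) :=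
      prod_nonneg fun j _ => integral_nonneg fun y => (Real.exp_pos _).le
    have h4 : 0 ≤ ∏ j ∈ u, 1 / (θ j - b j) := prod_nonneg fun j _ =>
      one_div_nonneg.2 (sub_nonneg.2 (lt_thetaSeq hl j).le)
    calc (C₁ * ((2 * max 1 T) ^ u.card * ((u.card : ℝ) + 1) ^ 2 * ∏ j ∈ u, b j)) ^ 2 *
          ((∏ j ∈ u, 1 / (θ j - b j)) *
            ∏ j ∈ univ \ u, ∫ y, Real.exp (2 * b j * |y|) ∂(gaussianReal 0 1))
        = C₁ ^ 2 * ((((2 * max 1 T) ^ u.card * ((u.card : ℝ) + 1) ^ 2 * ∏ j ∈ u, b j)) ^ 2 *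
          ∏ j ∈ u, 1 / (θ j - b j)) *
            ∏ j ∈ univ \ u, ∫ y, Real.exp (2 * b j * |y|) ∂(gaussianReal 0 1) := by ring
      _ ≤ C₁ ^ 2 * (γ (u.map Fin.valEmbedding) * W (u.map Fin.valEmbedding)) * E := by
          refine mul_le_mul (mul_le_mul_of_nonneg_left h1 (sq_nonneg _)) h2 h3 ?_
          exact mul_nonneg (sq_nonneg _) (mul_nonneg (hγ0 _) (hW0 _))
      _ = _ := by ring
  · have hR : ∑ u : Finset (Fin m), C₁ ^ 2 * E * W (u.map Fin.valEmbedding) ≤ C₁ ^ 2 * E * S := by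
      rw [← mul_sum, sum_finset_fin m W]
      exact mul_le_mul_of_nonneg_left (hS m) (by positivity)
    have hker : ∑ u ∈ (univ : Finset (Finset (Fin m))).erase ∅, γ (u.map Fin.valEmbedding) *
        ((N : ℝ)⁻¹ * ∑ k ∈ range N, ∏ j ∈ u,
          shiftKernel (θ j) (Int.fract ((k : ℝ) * (z j : ℝ) / N))) =
        ∑ v ∈ (range m).powerset.erase ∅, γ v * kerMean θ (fun j => (z j : ZMod N)) v := by
      rw [← sum_finset_fin_erase]
      refine sum_congr rfl fun u _ => ?_
      rw [← kerMean_natCast]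
      simp only [prod_map]
      rfl
    have hN0 : (0 : ℝ) < N := by exact_mod_cast hN
    have hφ : (0 : ℝ) < N.totient := by exact_mod_cast Nat.totient_pos.2 hN
    have hφN : (N.totient : ℝ)⁻¹ ≤ 100 / N := by
      rw [inv_eq_one_div, div_le_div_iff₀ hφ hN0, one_mul]
      exact_mod_cast le_hundred_mul_totient hN hN'
    have hbound := hz.bound hl hl1 hγ0
    have hWsum : ∑ v ∈ (range m).powerset.erase ∅, W v ≤ S :=
      (sum_le_sum_of_subset_of_nonneg (erase_subset _ _) fun v _ _ => hW0 v).trans (hS m)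
    have hW0' : 0 ≤ ∑ v ∈ (range m).powerset.erase ∅, W v := sum_nonneg fun v _ => hW0 v
    rw [hker, ← ENNReal.ofReal_mul (sum_nonneg fun u _ => mul_nonneg (by positivity) (hW0 _))]
    refine ENNReal.ofReal_le_ofReal ?_
    calc _ ≤ (C₁ ^ 2 * E * S) * ((100 / N) * S) ^ (1 / l) := by
          refine mul_le_mul hR (hbound.trans ?_)
            (sum_nonneg fun v _ => mul_nonneg (hγ0 v) (kerMean_nonneg _ _ _)) (by positivity)
          refine Real.rpow_le_rpow (mul_nonneg (by positivity) hW0') ?_ (by positivity)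
          exact mul_le_mul hφN hWsum hW0' (by positivity)
      _ = K * (N : ℝ) ^ (-(1 / l)) := by
          rw [div_mul_eq_mul_div, Real.div_rpow (by positivity) hN0.le, Real.rpow_neg hN0.le, hK]
          ring
      _ = _ := by
          rw [mul_pow, Real.sq_sqrt hK0, ← Real.rpow_natCast, ← Real.rpow_mul hN0.le]
          congr 2
          push_cast
          field_simp

end

section

/-! ### Combination of the error contributions -/

/-- Minkowski's inequality: a deterministic error and a mean square error add up. -/
theorem memLp_const_sub {α : Type*} [MeasurableSpace α] {μ : Measure α} [IsProbabilityMeasure μ]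
    {X : α → ℂ} (hX : AEStronglyMeasurable X μ) (c : ℂ) {A B : ℝ} (hA : ‖c‖ ≤ A) (hB : 0 ≤ B)
    (h : ∫⁻ x, ‖X x‖ₑ ^ (2 : ℝ) ∂μ ≤ ENNReal.ofReal (B ^ 2)) :
    MemLp (fun x => c - X x) 2 μ ∧ Real.sqrt (∫ x, ‖c - X x‖ ^ 2 ∂μ) ≤ A + B := by
  have hA0 : 0 ≤ A := (norm_nonneg c).trans hA
  have h1 : eLpNorm (fun _ : α => c) 2 μ ≤ ENNReal.ofReal A := by
    refine (eLpNorm_le_of_ae_bound (C := A) (ae_of_all _ fun _ => hA)).trans (le_of_eq ?_)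
    simp
  have h2 : eLpNorm X 2 μ ≤ ENNReal.ofReal B := by
    rw [eLpNorm_eq_lintegral_rpow_enorm_toReal (by norm_num) (by norm_num), ENNReal.toReal_ofNat]
    refine (ENNReal.rpow_le_rpow h (by norm_num)).trans (le_of_eq ?_)
    rw [ENNReal.ofReal_rpow_of_nonneg (sq_nonneg B) (by norm_num), ← Real.sqrt_eq_rpow,
      Real.sqrt_sq hB]
  have h3 : eLpNorm (fun x => c - X x) 2 μ ≤ ENNReal.ofReal (A + B) := by
    rw [ENNReal.ofReal_add hA0 hB]
    exact (eLpNorm_sub_le aestronglyMeasurable_const hX (by norm_num)).trans (add_le_add h1 h2)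
  have hm : MemLp (fun x => c - X x) 2 μ :=
    ⟨aestronglyMeasurable_const.sub hX, h3.trans_lt ENNReal.ofReal_lt_top⟩
  refine ⟨hm, ?_⟩
  have h4 := hm.eLpNorm_eq_integral_rpow_norm (by norm_num) (by norm_num)
  rw [h4, ENNReal.toReal_ofNat, ENNReal.ofReal_le_ofReal_iff (by positivity)] at h3
  rw [Real.sqrt_eq_rpow]
  simpa using h3

section
variable {L : ℝ} [hL : Fact (0 < L)]
local notation "haar" => (AddCircle.haarAddCircle (T := L))

theorem measurable_latticeRule {m : ℕ} (N : ℕ) (z : ℕ → ℕ) {F : (Fin m → ℝ) → ℂ}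
    (hF : Continuous F) : Measurable (latticeRule m N z F) :=
  (Finset.measurable_sum _ fun k _ => hF.measurable.comp (measurable_latPt N z k)).const_mul _

/-- The truncation error in terms of sequences. -/
theorem sobolevNorm_truncDiff {v₀ : AddCircle L → ℝ} {lam : ℕ → ℝ} {v : ℕ → AddCircle L → ℝ}
    {V0 : SeqL2} {V : ℕ → SeqL2} (h0 : cplx v₀ =ᵐ[haar] ev L 2 V0)
    (hV : ∀ j, cplx (v j) =ᵐ[haar] ev L 2 (V j)) (hlam : ∀ j, 0 ≤ lam j) {ξ : ℕ → ℝ}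
    (hξ : Summable fun j => lam j * ‖V j‖ * |ξ j|) (m : ℕ) :
    sobolevNorm 1 (truncDiff v₀ lam v m ξ) = truncDist L V0 lam V m ξ := by
  have h : truncDiff v₀ lam v m ξ =ᵐ[haar]
      ev L 0 (inclS L (truncS V0 lam V m (restr m ξ)) - inclS L (potS V0 lam V ξ)) := by
    have h1 := truncPotential_ae (lam := lam) h0 hV m (restr m ξ)
    have h2 := potential_ae h0 hV ξ (summable_term hlam hξ)
    rw [← map_sub, ev_inclS, map_sub]
    filter_upwards [h1, h2] with x hx1 hx2
    rw [ContinuousMap.sub_apply, ← hx1, potS, ← hx2]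
    simp only [truncDiff, cplx]
    push_cast
    rfl
  have h3 := norm_toS (r := 0) (memSobolev_of_ae h)
  rw [toS_eq_of_ae h] at h3
  rw [truncDist, h3]
  norm_num

/-- The convergence of the truncated potentials is needed in mean square only. -/
theorem eLpNorm_truncDist_le {v₀ : AddCircle L → ℝ} {lam : ℕ → ℝ} {v : ℕ → AddCircle L → ℝ}
    {V0 : SeqL2} {V : ℕ → SeqL2} (h0 : cplx v₀ =ᵐ[haar] ev L 2 V0)
    (hV : ∀ j, cplx (v j) =ᵐ[haar] ev L 2 (V j)) (hlam : ∀ j, 0 ≤ lam j)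
    (hs : Summable fun j => lam j * ‖V j‖) {ε χ : ℝ} (hε : 0 < ε)
    (hrate : TruncationRate v₀ lam v (2 + ε) χ) :
    ∃ K : ℝ, 0 ≤ K ∧ ∀ m : ℕ, 1 ≤ m → eLpNorm (truncDist L V0 lam V m) 2 gaussProd
      ≤ ENNReal.ofReal (K * (m : ℝ) ^ (-χ)) := by
  obtain ⟨K, hK⟩ := hrate
  obtain ⟨H, -, hH⟩ := exists_exp_dominating
    (fun j => mul_nonneg (hlam j) (norm_nonneg (V j))) hs le_rfl
  refine ⟨max K 0, le_max_right _ _, fun m hm => ?_⟩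
  have h1 : (fun ξ => sobolevNorm 1 (truncDiff v₀ lam v m ξ)) =ᵐ[gaussProd]
      truncDist L V0 lam V m := by
    filter_upwards [hH] with ξ hξ
    exact sobolevNorm_truncDiff h0 hV hlam hξ.1 m
  have h2 := (hK m hm).2
  rw [eLpNorm_congr_ae h1] at h2
  refine (eLpNorm_le_eLpNorm_of_exponent_le (q := ENNReal.ofReal (2 + ε)) ?_
    (aestronglyMeasurable_truncDist V0 hlam hs m)).trans (h2.trans
    (ENNReal.ofReal_le_ofReal ?_))
  · rw [← ENNReal.ofReal_ofNat]
    exact ENNReal.ofReal_le_ofReal (by linarith)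
  · gcongr
    exact le_max_left _ _

/-- The interaction pictures of the exact solutions, for almost every realization of the
potential. -/
theorem exists_interaction_picture {v₀ : AddCircle L → ℝ} {lam : ℕ → ℝ}
    {v : ℕ → AddCircle L → ℝ} {ψin : AddCircle L → ℂ} {a V0 : SeqL2} {V : ℕ → SeqL2}
    (h0 : cplx v₀ =ᵐ[haar] ev L 2 V0) (hV : ∀ j, cplx (v j) =ᵐ[haar] ev L 2 (V j))
    (ha : ψin =ᵐ[haar] ev L 2 a) (hlam : ∀ j, 0 ≤ lam j)
    (hs : Summable fun j => lam j * ‖V j‖) {ψ : ℝ → (ℕ → ℝ) → SobolevSpace L 1}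
    (hψ : ∀ᵐ ξ ∂gaussProd, IsMildSolution (potential v₀ lam v ξ) ψin fun t => ψ t ξ) :
    ∃ Z : (ℕ → ℝ) → ℝ → SeqL2, ∀ᵐ ξ ∂gaussProd,
      (Z ξ 0 = inclS L a ∧ ∀ t, 0 ≤ t → HasDerivAt (Z ξ)
        (-Complex.I • flowS L (-t) (mulS L 0 (inclS L (potS V0 lam V ξ)) (flowS L t (Z ξ t)))) t) ∧
      ∀ t, 0 ≤ t → (ψ t ξ).toFun =ᵐ[haar] ev L 0 (flowS L t (Z ξ t)) := by
  obtain ⟨H, -, hH⟩ := exists_exp_dominating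
    (fun j => mul_nonneg (hlam j) (norm_nonneg (V j))) hs le_rfl
  have hex : ∀ᵐ ξ ∂gaussProd, ∃ z : ℝ → SeqL2, (z 0 = inclS L a ∧ ∀ t, 0 ≤ t → HasDerivAt z
      (-Complex.I • flowS L (-t) (mulS L 0 (inclS L (potS V0 lam V ξ)) (flowS L t (z t)))) t) ∧
      ∀ t, 0 ≤ t → (ψ t ξ).toFun =ᵐ[haar] ev L 0 (flowS L t (z t)) := by
    filter_upwards [hH, hψ] with ξ hξ hu
    have h2 := potential_ae h0 hV ξ (summable_term hlam hξ.1)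
    obtain ⟨z, hz0, hz1, hz2⟩ := hu.interaction (w := inclS L (potS V0 lam V ξ)) (a := inclS L a)
      (by rw [ev_inclS]; exact h2) (by rw [ev_inclS]; exact ha)
    exact ⟨z, ⟨hz0, hz2⟩, hz1⟩
  exact hex.choice

end

end

end

end QMCTS

theorem theorem2p1
    {L : ℝ} [Fact (0 < L)] (s : ℝ) (hs : 3 ≤ s)
    -- data of the problem
    (ψin : AddCircle L → ℂ) (v₀ : AddCircle L → ℝ) (lam : ℕ → ℝ) (v : ℕ → AddCircle L → ℝ)
    (G : StrongDual ℂ (QMCTS.SobolevSpace L 1))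
    (hlam_anti : Antitone lam) (hlam_pos : ∀ j, 0 < lam j)
    (hψin : QMCTS.MemSobolev s ψin) (hv₀ : QMCTS.MemSobolev s (QMCTS.cplx v₀))
    (hv : ∀ j, QMCTS.MemSobolev s (QMCTS.cplx (v j)))
    (hv' : ∀ j, QMCTS.MemW1Inf (QMCTS.cplx (v j)))
    -- summability
    (ha : Summable (QMCTS.aSeq s lam v))
    (p : ℝ) (hp0 : 0 < p) (hp1 : p ≤ 1)
    (hb : Summable fun j => QMCTS.bSeq lam v j ^ p)
    -- convergence of the truncated potentials
    (ε χ : ℝ) (hε : 0 < ε) (hχ : 0 < χ) (hV : QMCTS.TruncationRate v₀ lam v (2 + ε) χ)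
    -- time horizon, and the smallness condition in the case `p = 1`
    (T : ℝ) (hT : 0 < T)
    (hsmall : p = 1 → QMCTS.SmallnessCondition (QMCTS.bSeq lam v) T)
    (δ : ℝ) (hδ0 : 0 < δ) (hδ1 : δ ≤ 1 / 2)
    -- the exact solution, for almost every realization of the potential
    (ψ : ℝ → (ℕ → ℝ) → QMCTS.SobolevSpace L 1)
    (hψ : ∀ᵐ ξ ∂QMCTS.gaussProd,
      QMCTS.IsMildSolution (QMCTS.potential v₀ lam v ξ) ψin fun t => ψ t ξ) :
    (∀ t, 0 ≤ t → t ≤ T →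
      Integrable (fun ξ => QMCTS.observable G (ψ t ξ).toFun) QMCTS.gaussProd) ∧
    ∃ C : ℝ, 0 < C ∧ ∀ m N : ℕ, 1 ≤ m → 1 ≤ N → N ≤ 10 ^ 30 →
      ∃ z : ℕ → ℕ,
        QMCTS.IsCBC
          (QMCTS.podWeight (QMCTS.bSeq lam v) (QMCTS.lamStar p δ) T)
          (QMCTS.thetaSeq (QMCTS.bSeq lam v) (QMCTS.lamStar p δ)) N m z ∧
        ∀ (τ : ℝ) (n : ℕ), 0 < τ → n * τ ≤ T →
          MemLp (fun Δ : Fin m → ℝ =>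
              (∫ ξ, QMCTS.observable G (ψ (n * τ) ξ).toFun ∂QMCTS.gaussProd)
                - QMCTS.latticeRule m N z
                    (fun ξ => QMCTS.observable G (QMCTS.semiDiscrete v₀ lam v ψin m τ n ξ)) Δ)
            2 (volume.restrict (Set.Icc 0 1)) ∧
          Real.sqrt (∫ Δ in Set.Icc (0 : Fin m → ℝ) 1,
              ‖(∫ ξ, QMCTS.observable G (ψ (n * τ) ξ).toFun ∂QMCTS.gaussProd)
                - QMCTS.latticeRule m N z
                    (fun ξ => QMCTS.observable G (QMCTS.semiDiscrete v₀ lam v ψin m τ n ξ)) Δ‖ ^ 2)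
            ≤ C * ((m : ℝ) ^ (-χ) + τ + (N : ℝ) ^ (-QMCTS.kappa p δ)) := by
  classical
  have hlam : ∀ j, 0 ≤ lam j := fun j => (hlam_pos j).le
  have h3s : (((2 + 1 : ℕ)) : ℝ) ≤ s := by push_cast; linarith
  -- all data are encoded as functions in `H³`
  set V0 := QMCTS.toS 2 (QMCTS.cplx v₀) with hV0
  set V : ℕ → QMCTS.SeqL2 := fun j => QMCTS.toS 2 (QMCTS.cplx (v j)) with hVdef
  set a := QMCTS.toS 2 ψin with hadef
  have e0 := QMCTS.ev_toS_ae (hv₀.mono h3s)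
  have eV : ∀ j, QMCTS.cplx (v j) =ᵐ[AddCircle.haarAddCircle (T := L)] QMCTS.ev L 2 (V j) :=
    fun j => QMCTS.ev_toS_ae ((hv j).mono h3s)
  have ea := QMCTS.ev_toS_ae (hψin.mono h3s)
  have hVs : Summable fun j => lam j * ‖V j‖ := by
    refine Summable.of_nonneg_of_le (fun j => mul_nonneg (hlam j) (norm_nonneg _))
      (fun j => mul_le_mul_of_nonneg_left ?_ (hlam j)) ha
    rw [QMCTS.norm_toS ((hv j).mono h3s)]
    exact QMCTS.sobolevNorm_mono h3s (hv j)
  have hβ := fun j => QMCTS.norm_le_w1InfNorm (eV j) (hv' j)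
  have hb0 : ∀ j, 0 ≤ QMCTS.bSeq lam v j := fun j =>
    mul_nonneg (hlam j) ((norm_nonneg _).trans (hβ j 0).1)
  obtain ⟨K, hK, hrate⟩ := QMCTS.eLpNorm_truncDist_le e0 eV hlam hVs hε hV
  obtain ⟨Z, hZ⟩ := QMCTS.exists_interaction_picture e0 eV ea hlam hVs hψ
  have hobs : ∀ t, 0 ≤ t → (fun ξ => QMCTS.observable G (ψ t ξ).toFun) =ᵐ[QMCTS.gaussProd]
      fun ξ => QMCTS.obsS G (QMCTS.flowS L t (Z ξ t)) := fun t ht => by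
    filter_upwards [hZ] with ξ hξ
    exact QMCTS.observable_eq G (hξ.2 t ht)
  obtain ⟨hint, C₂, hC₂, herr⟩ := QMCTS.expectation_error G a V0 hlam hVs hT hK hrate
    (hZ.mono fun ξ hξ => hξ.1)
  refine ⟨fun t ht hT' => (integrable_congr (hobs t ht)).2 (hint t ht hT'), ?_⟩
  obtain ⟨C₁, -, hfam⟩ := QMCTS.norm_obsFam_le G (V0 := V0) (V := V)
    (β := fun j => QMCTS.w1InfNorm (QMCTS.cplx (v j))) a hT.le hlam (fun j x => (hβ j x).1)
    (fun j x => (hβ j x).2) (QMCTS.im_eq_zero_of_ae e0) fun j => QMCTS.im_eq_zero_of_ae (eV j)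
  obtain ⟨C₃, hC₃, hlat⟩ := QMCTS.lattice_cbc_error hp0 hp1 hδ0 hδ1 hb0 hb hsmall C₁
  refine ⟨C₂ + C₃ + 1, by positivity, fun m N hm hN hN' => ?_⟩
  obtain ⟨z, hz, hzerr⟩ := hlat m N hN hN'
  refine ⟨z, hz, fun τ n hτ hn => ?_⟩
  have hD := hzerr (QMCTS.obsFam G V0 lam V a m τ n)
    (QMCTS.isDerivFamily_obsFam G V0 lam V a m τ n) (hfam m n τ hτ.le hn)
  have hempty : QMCTS.obsFam G V0 lam V a m τ n ∅ = QMCTS.semiObs G V0 lam V a m τ n :=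
    funext (QMCTS.obsFam_empty G V0 lam V a m τ n)
  rw [hempty] at hD
  have hsemi : (fun ξ => QMCTS.observable G (QMCTS.semiDiscrete v₀ lam v ψin m τ n ξ)) =
      QMCTS.semiObs G V0 lam V a m τ n :=
    funext (QMCTS.observable_semiDiscrete G e0 eV ea m τ n)
  have hexp := herr m τ n hm hτ.le hn
  rw [← integral_congr_ae (hobs (n * τ) (by positivity))] at hexp
  -- the total error is the error of the expectation, `E - I`, minus that of the quadrature of `I`
  set E := ∫ ξ, QMCTS.observable G (ψ (n * τ) ξ).toFun ∂QMCTS.gaussProd with hE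
  set I := ∫ ξ, QMCTS.semiObs G V0 lam V a m τ n ξ ∂(QMCTS.gaussFin m) with hI
  have hmeas : Measurable fun Δ : Fin m → ℝ =>
      QMCTS.latticeRule m N z (QMCTS.semiObs G V0 lam V a m τ n) Δ - I :=
    (QMCTS.measurable_latticeRule N z (QMCTS.continuous_semiObs G V0 lam V a m τ n)).sub_const I
  have hfin := QMCTS.memLp_const_sub hmeas.aestronglyMeasurable (E - I) hexp (by positivity) hD
  have hsub : ∀ Δ : Fin m → ℝ, E - I -
      (QMCTS.latticeRule m N z (QMCTS.semiObs G V0 lam V a m τ n) Δ - I) =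
      E - QMCTS.latticeRule m N z (QMCTS.semiObs G V0 lam V a m τ n) Δ := fun Δ => by ring
  simp only [hsub] at hfin
  rw [hsemi]
  refine ⟨hfin.1, hfin.2.trans ?_⟩
  have hm0 : 0 ≤ (m : ℝ) ^ (-χ) := by positivity
  have hN0 : 0 ≤ (N : ℝ) ^ (-QMCTS.kappa p δ) := by positivity
  nlinarith [mul_nonneg hC₃ hm0, mul_nonneg hC₃ hτ.le, mul_nonneg hC₂ hN0]
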